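/- Let $\mathbf k$ be a non-Archimedean local field of characteristic different from $2$, with $|\cdot|$ its normalized absolute value (the module function) and ring of integers $\mathcal O$. Let $\Psi$ be a fixed non-trivial continuous unitary character of $(\mathbf k,+)$ and $\mathcal O^{o}=\{x:\Psi(xy)=1\ \forall y\in\mathcal O\}=\varpi^{n(\Psi)}\mathcal O$ its conductor, where $\varpi$ is a uniformizer and $n(\Psi)\in\mathbb Z$. Let $dx$ be the Haar measure with $\mathrm{Vol}(\mathcal O)\mathrm{Vol}(\mathcal O^o)=1$. Let $d\in\mathbb N$, $\theta\in\mathcal O\setminus\{0\}$, and let $A$ be a $C^*$-algebra faithfully represented on a Hilbert space $\mathcal H$ (we regard $A\subset\mathcal B(\mathcal H)$). *Notation.* For $X=(x,\xi),Y=(y,\eta)\in\mathbf k^{d}\times\mathbf k^d=\mathbf k^{2d}$ put $[X,Y]=\langle y,\xi\rangle-\langle x,\eta\rangle$ and $$\mu_0(X)=\max\{1,|2x|,|2\xi\varpi^{-n(\Psi)}|\}$$ (sup-norms on $\mathbf k^d$). Let $(\mathcal Gf)(X)=|2|^d\int f(Y)\Psi(2[Y,X])\,dY$, and let $I$ be multiplication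 by $\mu_0$, $J=\mathcal GI\mathcal G$, $J_\theta=\mathcal G I_\theta\mathcal G$ with $I_\theta$ multiplication by $\mu_0(\theta\,\cdot)$. Let $\mathcal S(\mathbf k^{2d})=\{\varphi\in L^2:I^nJ^m\varphi\in L^2\ \forall n,m\in\mathbb N\}$, and $\mathcal S'(\mathbf k^{2d},A)$ the space of continuous linear maps $\mathcal S(\mathbf k^{2d})\to A$, on which $I$, $J$, $J_\theta$ act by transposition. Set $$\mathcal B(\mathbf k^{2d},A)=\{F\in\mathcal S'(\mathbf k^{2d},A):J^nF\in L^\infty(\mathbf k^{2d},A)\ \forall n\in\mathbb N\},\qquad \mathfrak P^A_n(F)=\|J^nF\|_\infty,$$ with the topology of the seminorms $\mathfrak P_n^A$, involution $F^*(X)=F(X)^*$ and product $$(F_1\star_\theta F_2)(X)=|2|^{2d}\int_{\mathbf k^{2d}\times\mathbf k^{2d}}\overline{\Psi}(2[Y,Z])\,\mu_0(Y)^{-2d-1}\mu_0(Z)^{-2d-1}(J_\theta^{2d+1}F_1)(X+\theta Y)\,(J^{2d+1}F_2)(X+Z)\,dY\,dZ.$$ Let $\mathcal S(\mathbf k^{2d},A)=\mathcal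 S(\mathbf k^{2d})\widehat\otimes A$, i.e. the $f\in\mathcal B(\mathbf k^{2d},A)$ with $I^nJ^mf$ bounded for all $n,m$. On $L^2(\mathbf k^d)$ let $U_\theta(x,\xi)\varphi(y)=\Psi(\theta^{-1}\langle\xi,y-\frac12x\rangle)\varphi(y-x)$, $\Sigma\varphi(y)=\varphi(-y)$, $\Omega_\theta(X)=U_\theta(X)\Sigma U_\theta(X)^*$. Let $\eta$ be the characteristic function of $\mathcal O^d$ divided by its $L^2$-norm, $\eta_X=U_\theta(X)\eta$, and $$W_{X,Y}(Z)=\int_{\mathbf k^d}\eta_X(t)\,\overline{(\Omega_\theta(Z)\eta_Y)(t)}\,dt,\qquad W_{X,Y}(F)=|2/\theta|^d\int_{\mathbf k^{2d}}W_{X,Y}(Z)F(Z)\,dZ .$$ Write $|\eta_Y\rangle\langle\eta_X|$ for the rank-one operator $\rho\mapsto\big(\int\overline{\eta_X(t)}\rho(t)\,dt\big)\,\eta_Y$. In the weak sense on $L^2(\mathbf k^d)\otimes\mathcal H$ put $$\mathbf W^A_\theta(F)=|\theta|^{-2d}\int_{\mathbf k^{2d}\times\mathbf k^{2d}}|\eta_Y\rangle\langle\eta_X|\otimes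 W_{X,Y}(F)\,dX\,dY,\qquad \mathbf\Omega^A_\theta(f)=|2/\theta|^d\int_{\mathbf k^{2d}}\Omega_\theta(X)\otimes f(X)\,dX,$$ for $F\in\mathcal B(\mathbf k^{2d},A)$ and $f\in L^1(\mathbf k^{2d},A)$. **Theorem.** The function $\mu_0^{-2d-1}$ is integrable. For every $F\in\mathcal B(\mathbf k^{2d},A)$ the weak integral $\mathbf W^A_\theta(F)$ converges absolutely on all pairs of vectors and defines a bounded operator on $L^2(\mathbf k^d)\otimes\mathcal H$, with the bound, uniform in $\theta$, $$\|\mathbf W^A_\theta(F)\|\le\|\mu_0^{-2d-1}\|_1\,\mathfrak P^A_{2d+1}(F).$$ Moreover $F^*\in\mathcal B(\mathbf k^{2d},A)$ and $\mathbf W_\theta^A(F)^*=\mathbf W_\theta^A(F^*)$; for $F_1,F_2\in\mathcal B(\mathbf k^{2d},A)$ one has $F_1\star_\theta F_2\in\mathcal B(\mathbf k^{2d},A)$ and $\mathbf W_\theta^A(F_1)\mathbf W_\theta^A(F_2)=\mathbf W_\theta^A(F_1\star_\theta F_2)$. Thus $\mathbf W_\theta^A$ is a continuous linear $*$-homomorphism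 from $(\mathcal B(\mathbf k^{2d},A),\star_\theta)$ to $\mathcal B(L^2(\mathbf k^d)\otimes\mathcal H)$. It extends $\mathbf\Omega_\theta^A$: each $f\in\mathcal S(\mathbf k^{2d},A)$ is integrable and $\mathbf W_\theta^A(f)=\mathbf\Omega_\theta^A(f)$. -/

import Mathlib

open MeasureTheory
open scoped ComplexConjugate ENNReal

noncomputable section

namespace PadicWeyl

/-- The phase space `k^{2d} = k^d × k^d`, with points `X = (x, ξ)`. -/
abbrev Phase (k : Type*) (d : ℕ) : Type _ := (Fin d → k) × (Fin d → k)

section Kernel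

variable {k : Type*} [NontriviallyNormedField k] {d : ℕ}

/-- The symplectic form `[(x, ξ), (y, η)] = ⟨y, ξ⟩ - ⟨x, η⟩`. -/
def symp (X Y : Phase k d) : k := Y.1 ⬝ᵥ X.2 - X.1 ⬝ᵥ Y.2

/-- The conductor of `Ψ`: the largest fractional ideal on which `Ψ` is trivial. -/
def conductor (Ψ : AddChar k Circle) : Set k := {x | ∀ y : k, ‖y‖ ≤ 1 → Ψ (x * y) = 1}

/-- The absolute value of a generator of the conductor of `Ψ`. -/
def conductorAbs (Ψ : AddChar k Circle) : ℝ := sSup ((fun x : k => ‖x‖) '' conductor Ψ)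

/-- `μ₀(x, ξ) = max {1, |2x|, |2ξ|^∨}`, where `|ξ|^∨` is `|ξ|` divided by the absolute value of
a generator of the conductor. The norm of `Fin d → k` is the sup-norm. -/
def mu0 (Ψ : AddChar k Circle) (X : Phase k d) : ℝ :=
  max 1 (max ‖(2 : k) • X.1‖ (‖(2 : k) • X.2‖ / conductorAbs Ψ))

/-- The Schrödinger representation
`(U_θ(x, ξ) φ)(y) = Ψ(θ⁻¹ ⟨ξ, y - x/2⟩) φ(y - x)`, on functions with values in a vector space
(that is, `U_θ(X) ⊗ id` when the values are in a Hilbert space). -/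
def schrodinger (Ψ : AddChar k Circle) (θ : k) (X : Phase k d) {E : Type*} [SMul ℂ E]
    (φ : (Fin d → k) → E) : (Fin d → k) → E :=
  fun y => (Ψ (θ⁻¹ * (X.2 ⬝ᵥ (y - (2 : k)⁻¹ • X.1))) : ℂ) • φ (y - X.1)

/-- `U_θ(-X)` is the inverse of `U_θ(X)`, hence its adjoint on `L²`. -/
theorem schrodinger_neg_right (h2 : (2 : k) ≠ 0) (Ψ : AddChar k Circle) (θ : k) (X : Phase k d)
    {E : Type*} [AddCommGroup E] [Module ℂ E] (φ : (Fin d → k) → E) :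
    schrodinger Ψ θ X (schrodinger Ψ θ (-X) φ) = φ := by
  funext y
  have hx : X.1 - (2 : k)⁻¹ • X.1 = (2 : k)⁻¹ • X.1 := by
    ext i
    simp only [Pi.sub_apply, Pi.smul_apply, smul_eq_mul]
    field_simp
    ring
  have hz : θ⁻¹ * (X.2 ⬝ᵥ (y - (2 : k)⁻¹ • X.1))
      + θ⁻¹ * ((-X.2) ⬝ᵥ (y - X.1 - (2 : k)⁻¹ • (-X.1))) = 0 := by
    have h1 : y - X.1 - (2 : k)⁻¹ • (-X.1) = y - (2 : k)⁻¹ • X.1 := by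
      rw [smul_neg, sub_neg_eq_add, sub_add, hx]
    rw [h1, neg_dotProduct]
    ring
  simp only [schrodinger, Prod.fst_neg, Prod.snd_neg, smul_smul, sub_neg_eq_add, sub_add_cancel]
  rw [← Circle.coe_mul, ← AddChar.map_add_eq_mul, hz]
  simp

/-- `Ω_θ(X) = U_θ(X) Σ U_θ(X)^*`, where `(Σ φ)(y) = φ(-y)` and `U_θ(X)^* = U_θ(-X)`. -/
def quantizer (Ψ : AddChar k Circle) (θ : k) (X : Phase k d) {E : Type*} [SMul ℂ E]
    (φ : (Fin d → k) → E) : (Fin d → k) → E :=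
  schrodinger Ψ θ X (fun y => schrodinger Ψ θ (-X) φ (-y))

end Kernel

section Analysis

variable {k : Type*} [NontriviallyNormedField k] [MeasureSpace k] {d : ℕ}

/-- The symplectic Fourier transform `(𝒢 f)(X) = |2|^d ∫ f(Y) Ψ(2[Y, X]) dY`. -/
def sympFourier (Ψ : AddChar k Circle) (f : Phase k d → ℂ) (X : Phase k d) : ℂ :=
  ((‖(2 : k)‖ ^ d : ℝ) : ℂ) * ∫ Y : Phase k d, f Y * (Ψ (2 * symp Y X) : ℂ)

/-- The operator `𝒢 m 𝒢` for a weight `m`. It is `J^n` for `m = μ₀^n`, and `J_θ^n` for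
`m = μ₀(θ ·)^n`. -/
def multOp (Ψ : AddChar k Circle) (m : Phase k d → ℝ) (φ : Phase k d → ℂ) : Phase k d → ℂ :=
  sympFourier Ψ (fun X => (m X : ℂ) * sympFourier Ψ φ X)

/-- The Schwartz space `𝒮(k^{2d})`, of the (continuous) functions `φ` such that `I^n J^m φ ∈ L²`
for all `n`, `m`. As some negative power of `μ₀` is in `L²`, all the functions below are then
also integrable; this is recorded, so that each `𝒢` is given by an absolutely convergent integral. -/
structure IsSchwartz (Ψ : AddChar k Circle) (φ : Phase k d → ℂ) : Prop where
  continuous : Continuous φ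
  integrable : Integrable φ
  integrable_fourier : ∀ m : ℕ, Integrable (fun X => ((mu0 Ψ X ^ m : ℝ) : ℂ) * sympFourier Ψ φ X)
  memLp_two : ∀ n m : ℕ, MemLp (fun X => ((mu0 Ψ X ^ n : ℝ) : ℂ)
    * multOp Ψ (fun T => mu0 Ψ T ^ m) φ X) 2
  memLp_one : ∀ n m : ℕ, MemLp (fun X => ((mu0 Ψ X ^ n : ℝ) : ℂ)
    * multOp Ψ (fun T => mu0 Ψ T ^ m) φ X) 1

variable {A : Type*} [NonUnitalCStarAlgebra A]

/-- `L^∞(k^{2d}, A)`. -/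
abbrev LInfty (k : Type*) [NontriviallyNormedField k] [MeasureSpace k] (d : ℕ) (A : Type*)
    [NonUnitalCStarAlgebra A] : Type _ :=
  Lp A ∞ (volume : Measure (Phase k d))

/-- `G = (𝒢 m 𝒢) F` in the space `𝒮'(k^{2d}, A)` of continuous linear maps `𝒮(k^{2d}) → A`, on
which `𝒢 m 𝒢` acts by transposition; `F`, `G` in `L^∞` are seen as the functionals
`φ ↦ ∫ φ(X) F(X) dX` and `φ ↦ ∫ φ(X) G(X) dX`. -/
def IsMultOp (Ψ : AddChar k Circle) (m : Phase k d → ℝ) (F G : LInfty k d A) : Prop :=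
  ∀ φ : Phase k d → ℂ, IsSchwartz Ψ φ →
    ∫ X, multOp Ψ m φ X • F X = ∫ X, φ X • G X

theorem integrable_smul_LInfty {φ : Phase k d → ℂ} (hφ : Integrable φ) (F : LInfty k d A) :
    Integrable (fun X => φ X • F X) := by
  have h := (Lp.memLp F).smul (r := 1) (memLp_one_iff_integrable.2 hφ)
  exact memLp_one_iff_integrable.1 h

theorem IsSchwartz.integrable_multOp {Ψ : AddChar k Circle} {φ : Phase k d → ℂ}
    (h : IsSchwartz Ψ φ) (m : ℕ) : Integrable (multOp Ψ (fun T => mu0 Ψ T ^ m) φ) := by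
  have := memLp_one_iff_integrable.1 (h.memLp_one 0 m)
  simpa using this

/-- The space `𝓑(k^{2d}, A)` of the `F ∈ 𝒮'(k^{2d}, A)` with `J^n F ∈ L^∞(k^{2d}, A)` for all
`n ≥ 0`. The case `n = 0` says that `F` itself is in `L^∞(k^{2d}, A)`. -/
def symbolSpace (d : ℕ) (A : Type*) [NonUnitalCStarAlgebra A] (Ψ : AddChar k Circle) :
    Submodule ℂ (LInfty k d A) where
  carrier := {F | ∀ n : ℕ, ∃ G : LInfty k d A, IsMultOp Ψ (fun T => mu0 Ψ T ^ n) F G}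
  zero_mem' := by
    intro n
    refine ⟨0, fun φ _ => ?_⟩
    have h0 := Lp.coeFn_zero A ∞ (volume : Measure (Phase k d))
    rw [integral_eq_zero_of_ae, integral_eq_zero_of_ae] <;>
    · filter_upwards [h0] with X hX
      rw [hX, Pi.zero_apply, smul_zero]
  add_mem' := by
    intro F F' hF hF' n
    obtain ⟨G, hG⟩ := hF n
    obtain ⟨G', hG'⟩ := hF' n
    refine ⟨G + G', fun φ hφ => ?_⟩
    have e1 : ∫ X, multOp Ψ (fun T => mu0 Ψ T ^ n) φ X • (F + F') X
        = ∫ X, (multOp Ψ (fun T => mu0 Ψ T ^ n) φ X • F X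
          + multOp Ψ (fun T => mu0 Ψ T ^ n) φ X • F' X) := by
      refine integral_congr_ae ?_
      filter_upwards [Lp.coeFn_add F F'] with X hX
      rw [hX, Pi.add_apply, smul_add]
    have e2 : ∫ X, φ X • (G + G') X = ∫ X, (φ X • G X + φ X • G' X) := by
      refine integral_congr_ae ?_
      filter_upwards [Lp.coeFn_add G G'] with X hX
      rw [hX, Pi.add_apply, smul_add]
    rw [e1, e2, integral_add (integrable_smul_LInfty (hφ.integrable_multOp n) F)
      (integrable_smul_LInfty (hφ.integrable_multOp n) F'),
      integral_add (integrable_smul_LInfty hφ.integrable G)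
      (integrable_smul_LInfty hφ.integrable G'), hG φ hφ, hG' φ hφ]
  smul_mem' := by
    intro c F hF n
    obtain ⟨G, hG⟩ := hF n
    refine ⟨c • G, fun φ hφ => ?_⟩
    have e1 : ∫ X, multOp Ψ (fun T => mu0 Ψ T ^ n) φ X • (c • F) X
        = ∫ X, c • (multOp Ψ (fun T => mu0 Ψ T ^ n) φ X • F X) := by
      refine integral_congr_ae ?_
      filter_upwards [Lp.coeFn_smul c F] with X hX
      rw [hX, Pi.smul_apply, smul_comm]
    have e2 : ∫ X, φ X • (c • G) X = ∫ X, c • (φ X • G X) := by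
      refine integral_congr_ae ?_
      filter_upwards [Lp.coeFn_smul c G] with X hX
      rw [hX, Pi.smul_apply, smul_comm]
    rw [e1, e2, integral_smul, integral_smul, hG φ hφ]

open Classical in
/-- The element `(𝒢 m 𝒢) F` of `L^∞(k^{2d}, A)` (zero if there is none). -/
def applyMult (Ψ : AddChar k Circle) (m : Phase k d → ℝ) (F : LInfty k d A) : LInfty k d A :=
  if h : ∃ G : LInfty k d A, IsMultOp Ψ m F G then h.choose else 0

/-- `J^n F`. -/
def powJ (Ψ : AddChar k Circle) (n : ℕ) (F : LInfty k d A) : LInfty k d A :=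
  applyMult Ψ (fun T => mu0 Ψ T ^ n) F

/-- `J_θ^n F`. -/
def powJdil (Ψ : AddChar k Circle) (θ : k) (n : ℕ) (F : LInfty k d A) : LInfty k d A :=
  applyMult Ψ (fun T => mu0 Ψ (θ • T) ^ n) F

/-- The seminorm `𝔓_n^A(F) = ‖J^n F‖_∞`. -/
def seminormP (Ψ : AddChar k Circle) (n : ℕ) (F : LInfty k d A) : ℝ := ‖powJ Ψ n F‖

/-- The topology of `𝓑(k^{2d}, A)` given by the seminorms `𝔓_n^A`, i.e. the coarsest one for which
all the (linear) maps `J^n` into `L^∞(k^{2d}, A)` are continuous. -/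
@[reducible]
def symbolTopology (d : ℕ) (A : Type*) [NonUnitalCStarAlgebra A] (Ψ : AddChar k Circle) :
    TopologicalSpace (symbolSpace d A Ψ) :=
  ⨅ n : ℕ, TopologicalSpace.induced
    (fun F : symbolSpace d A Ψ => powJ Ψ n (F : LInfty k d A)) inferInstance

/-- The Schwartz space `𝒮(k^{2d}, A)`: `I^n J^m f` is bounded for all `n`, `m`. -/
def IsSchwartzSymbol (Ψ : AddChar k Circle) (f : LInfty k d A) : Prop :=
  f ∈ symbolSpace d A Ψ ∧
    ∀ n m : ℕ, MemLp (fun X => ((mu0 Ψ X ^ n : ℝ) : ℂ) • powJ Ψ m f X) ∞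

/-- The deformed product
`|2|^{2d} ∫∫ conj Ψ(2[Y,Z]) μ₀(Y)^{-2d-1} μ₀(Z)^{-2d-1} (J_θ^{2d+1}F₁)(X+θY) (J^{2d+1}F₂)(X+Z) dY dZ`. -/
def starProd (Ψ : AddChar k Circle) (θ : k) (F₁ F₂ : LInfty k d A) (X : Phase k d) : A :=
  ((‖(2 : k)‖ ^ (2 * d) : ℝ) : ℂ) • ∫ P : Phase k d × Phase k d,
    (conj (Ψ (2 * symp P.1 P.2) : ℂ)
        * (((mu0 Ψ P.1 ^ (2 * d + 1))⁻¹ * (mu0 Ψ P.2 ^ (2 * d + 1))⁻¹ : ℝ) : ℂ)) •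
      (powJdil Ψ θ (2 * d + 1) F₁ (X + θ • P.1) * powJ Ψ (2 * d + 1) F₂ (X + P.2))

/-- The characteristic function of the unit ball of `k^d`, divided by its `L²`-norm. -/
def vacuum (k : Type*) [NontriviallyNormedField k] [MeasureSpace k] (d : ℕ) :
    (Fin d → k) → ℂ :=
  (Metric.closedBall (0 : Fin d → k) 1).indicator
    (fun _ => (((√(volume.real (Metric.closedBall (0 : Fin d → k) 1)))⁻¹ : ℝ) : ℂ))

/-- The coherent state `η_X^θ = U_θ(X) η`. -/
def coherent (Ψ : AddChar k Circle) (θ : k) (X : Phase k d) : (Fin d → k) → ℂ :=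
  schrodinger Ψ θ X (vacuum k d)

/-- The Wigner function `W_{X,Y}^θ(Z) = ⟨η_X^θ, Ω_θ(Z) η_Y^θ⟩`, the inner product being linear in
its first argument. -/
def wigner (Ψ : AddChar k Circle) (θ : k) (X Y Z : Phase k d) : ℂ :=
  ∫ t : Fin d → k, coherent Ψ θ X t * conj (quantizer Ψ θ Z (coherent Ψ θ Y) t)

/-- `W_{X,Y}^{θ,A}(F) = |2/θ|^d ∫ W_{X,Y}^θ(Z) F(Z) dZ`. -/
def wignerSymbol (Ψ : AddChar k Circle) (θ : k) (F : LInfty k d A) (X Y : Phase k d) : A :=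
  ((‖2 / θ‖ ^ d : ℝ) : ℂ) • ∫ Z : Phase k d, wigner Ψ θ X Y Z • F Z

variable {H : Type*} [NormedAddCommGroup H] [InnerProductSpace ℂ H]

/-- The Hilbert space `L²(k^d) ⊗ H`, realised as `L²(k^d, H)`. -/
abbrev L2Space (k : Type*) [NontriviallyNormedField k] [MeasureSpace k] (d : ℕ) (H : Type*)
    [NormedAddCommGroup H] [InnerProductSpace ℂ H] : Type _ :=
  Lp H 2 (volume : Measure (Fin d → k))

/-- The operator `|φ⟩⟨ψ| ⊗ a` on `L²(k^d, H)`. -/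
def ketBra (φ ψ : (Fin d → k) → ℂ) (a : H →L[ℂ] H) (Φ : (Fin d → k) → H) : (Fin d → k) → H :=
  fun t => φ t • a (∫ s : Fin d → k, conj (ψ s) • Φ s)

/-- `T` is the weak integral `∫ R_x dx` of a family of operators on `L²(k^d, H)`:
`⟨Φ₁, T Φ₂⟩ = ∫ ⟨Φ₁, R_x Φ₂⟩ dx`, with absolute convergence, for all `Φ₁`, `Φ₂`. -/
def IsWeakIntegral {α : Type*} [MeasureSpace α] (R : α → ((Fin d → k) → H) → (Fin d → k) → H)
    (T : L2Space k d H →L[ℂ] L2Space k d H) : Prop :=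
  ∀ Φ₁ Φ₂ : L2Space k d H,
    Integrable (fun x : α => ∫ t : Fin d → k, inner ℂ (Φ₁ t) (R x Φ₂ t)) ∧
    inner ℂ Φ₁ (T Φ₂) = ∫ x : α, ∫ t : Fin d → k, inner ℂ (Φ₁ t) (R x Φ₂ t)

/-- `T = 𝐖_θ^A(F) = |θ|^{-2d} ∫∫ |η_Y^θ⟩⟨η_X^θ| ⊗ W_{X,Y}^{θ,A}(F) dX dY`, in the weak sense; the
algebra `A` acts on `H` by `π`. -/
def IsWeylOp (Ψ : AddChar k Circle) (θ : k) (π : A → H →L[ℂ] H) (F : LInfty k d A)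
    (T : L2Space k d H →L[ℂ] L2Space k d H) : Prop :=
  IsWeakIntegral (fun (P : Phase k d × Phase k d) Φ t =>
    (((‖θ‖ ^ (2 * d))⁻¹ : ℝ) : ℂ) •
      ketBra (coherent Ψ θ P.2) (coherent Ψ θ P.1) (π (wignerSymbol Ψ θ F P.1 P.2)) Φ t) T

/-- `T = 𝛀_θ^A(f) = |2/θ|^d ∫ Ω_θ(X) ⊗ f(X) dX`. -/
def IsQuantization (Ψ : AddChar k Circle) (θ : k) (π : A → H →L[ℂ] H) (f : LInfty k d A)
    (T : L2Space k d H →L[ℂ] L2Space k d H) : Prop :=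
  IsWeakIntegral (fun (X : Phase k d) Φ t =>
    ((‖2 / θ‖ ^ d : ℝ) : ℂ) • π (f X) (quantizer Ψ θ X Φ t)) T

end Analysis

end PadicWeyl

end

open MeasureTheory
open scoped ComplexConjugate ENNReal

set_option linter.unusedSectionVars false
set_option linter.style.haveILetI false

noncomputable section

namespace PadicWeyl

/-! Write q = |ϖ|⁻¹ and let C be the size of the conductor. The absolute value is discrete, so μ₀
takes only the values qⁿ, and {μ₀ ≤ qⁿ} is a compact open subgroup `dlat n`. For the pairing
Ψ(2[X,Y]) it is dual to `lat n` = {|x| ≤ q⁻ⁿ, |ξ| ≤ q⁻ⁿC}. Truncating a Fourier transform to `dlat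
n` is therefore the same as averaging over `lat n`: the spectral projections of J are conditional
expectations E_n, and `blk n` = E_n − E_{n−1} projects onto the eigenvalue qⁿ. Hence G = JᵐF exactly
when blk n G = q^{nm} blk n F for all n (`IsWeight.isMultOp_iff`), and a bounded F is a symbol
exactly when its blocks decay uniformly faster than every power of q⁻ⁿ. The operator J_θ is diagonal
in the same blocks, with eigenvalue q^{max(n−r,0)} when |θ| = q⁻ʳ.

Norm bound. The Wigner function W_{X,Y}(Z) is a phase times the indicator of X+Y−2Z ∈ Λ, where Λ is
`box 1 θ` (`wigner_eq`), and translating Z by T ∈ Λ multiplies it by Ψ(θ⁻¹[T,Y−X]) (`wigner_add`).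
So if F is invariant under `lat n`, then W_{X,Y}(F) = 0 unless Y−X lies in an explicit box
(`wignerInt_eq_zero`). Let G = J^{2d+1}F and ρ = q^{−2d−1}. Abel summation writes F as the convex
combination (1−ρ)∑ρⁿE_nG, while μ₀^{−2d−1} = (1−ρ)∑ρⁿ1_{dlat n}. Comparing the two series gives
|W_{X,Y}(F)| ≤ |2|^{−d}‖G‖ times μ₀^{−2d−1} evaluated at a rescaling of Y−X
(`norm_wignerSymbol_le`). The coherent states satisfy a Parseval identity with constant |θ|^d
(`parseval`), so Schur's test applies to this convolution kernel. The change of variables removes θ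
and leaves a factor |2|^d ≤ 1, whence the stated constant.

Product. Coherent states are orthogonal or proportional according to classes modulo Λ, so operators
compose through their kernels: the kernel of a product is |θ|^{−d}∫W_{Z,Y}(F₁)W_{X,Z}(F₂)dZ. A Gauss
integral evaluates the same expression for two Wigner functions at points P, Q as an integral of
W_{X,Y}(Z) against conj Ψ(2θ⁻¹[P−Z,Q−Z]) (`integral_wigner_mul_wigner`), which is the kernel of the
deformed product. For single blocks all integrals can be cut off to compact sets. The decisive point
is `starInt_eq_shell`: on blocks of levels n and l, an oscillatory product with radial weights only
sees the values of the weights on the shells n−r and l. Therefore the cutoffs are immaterial, and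
the weights μ₀^{−2d−1} in the definition of the product cancel exactly the eigenvalues of J_θ^{2d+1}
and J^{2d+1} (`starProd_eq_tsum`). Summing over pairs of blocks gives multiplicativity, and the
decay of the block products shows that the product is again a symbol.

Adjoint and extension. Compatibility with adjoints is the symmetry conj W_{X,Y} = W_{Y,X}. For
integrable symbols, Parseval and Fubini turn the coherent-state formula into the integral of Ω_θ(X)
⊗ f(X). -/

/-- Standing facts on the field, a uniformizer `ϖ`, and the character `Ψ`. -/
structure LocalChar {k : Type*} [NontriviallyNormedField k] [MeasureSpace k]
    (Ψ : AddChar k Circle) (ϖ : k) : Prop where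
  two_ne : (2 : k) ≠ 0
  cont : Continuous Ψ
  unif_pos : 0 < ‖ϖ‖
  unif_lt : ‖ϖ‖ < 1
  unif_max : ∀ x : k, ‖x‖ < 1 → ‖x‖ ≤ ‖ϖ‖
  cond_pos : 0 < conductorAbs Ψ
  cond_iff : ∀ x : k, (∀ y : k, ‖y‖ ≤ 1 → Ψ (x * y) = 1) ↔ ‖x‖ ≤ conductorAbs Ψ
  exists_gen : ∃ c : k, ‖c‖ = conductorAbs Ψ
  modulus : ∀ (a : k) (s : Set k),
      volume ((fun x => a * x) '' s) = ENNReal.ofReal ‖a‖ * volume s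
  dual : volume (Metric.closedBall (0 : k) 1) * volume (conductor Ψ) = 1

/-! ### Uniformizer and conductor of the character. -/

section Field

variable {k : Type*} [NontriviallyNormedField k] [IsUltrametricDist k]

/-- In an ultrametric space the open unit ball is closed, hence compact here, so the norm attains
its maximum on it; non-triviality of the absolute value makes this maximum positive. -/
theorem exists_uniformizer [ProperSpace k] :
    ∃ ϖ : k, 0 < ‖ϖ‖ ∧ ‖ϖ‖ < 1 ∧ ∀ x : k, ‖x‖ < 1 → ‖x‖ ≤ ‖ϖ‖ := by
  have hc : IsCompact (Metric.ball (0 : k) 1) :=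
    (Metric.isBounded_ball).isCompact_closure.of_isClosed_subset
      (IsUltrametricDist.isClosed_ball 0 1) subset_closure
  obtain ⟨ϖ, hϖ, hmax⟩ := hc.exists_isMaxOn ⟨0, by simp⟩ continuous_norm.continuousOn
  obtain ⟨x, hx, hx'⟩ := NormedField.exists_norm_lt_one k
  refine ⟨ϖ, lt_of_lt_of_le hx (hmax (by simpa using hx')), by simpa using hϖ, fun y hy => ?_⟩
  exact hmax (by simpa using hy)

variable [ProperSpace k] [MeasureSpace k] [BorelSpace k] [(volume : Measure k).IsAddHaarMeasure]

/-- The conductor is nonzero since points are null and the duality of volumes would fail. It is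
stable under passing to smaller elements, so if it were unbounded it would be all of k and Ψ would
be trivial. Being also closed it is compact, and an element of maximal norm generates it. -/
theorem exists_localChar (hchar : (2 : k) ≠ 0)
    (hmod : ∀ (a : k) (s : Set k),
      volume ((fun x => a * x) '' s) = ENNReal.ofReal ‖a‖ * volume s)
    (Ψ : AddChar k Circle) (hΨcont : Continuous Ψ) (hΨ : Ψ ≠ 1)
    (hdual : volume (Metric.closedBall (0 : k) 1) * volume (conductor Ψ) = 1) :
    ∃ ϖ : k, LocalChar Ψ ϖ := by
  obtain ⟨ϖ, h0, h1, hmax⟩ := exists_uniformizer (k := k)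
  have hball : volume ({0} : Set k) = 0 := by simp
  have hne : ∃ x ∈ conductor Ψ, x ≠ 0 := by
    by_contra! hcon
    have hle : volume (conductor Ψ) ≤ volume ({0} : Set k) := measure_mono fun x hx => hcon x hx
    rw [hball, nonpos_iff_eq_zero] at hle
    simp [hle] at hdual
  have hsub : ∀ x ∈ conductor Ψ, ∀ y : k, ‖y‖ ≤ ‖x‖ → y ∈ conductor Ψ := by
    intro x hx y hy z hz
    by_cases hx0 : x = 0
    · have : y = 0 := by simpa [hx0] using hy
      simp [this]
    · have : y * z = x * (y * z / x) := by field_simp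
      rw [this]
      refine hx _ ?_
      rw [norm_div, norm_mul, div_le_one (norm_pos_iff.2 hx0)]
      calc ‖y‖ * ‖z‖ ≤ ‖x‖ * 1 := by gcongr
        _ = ‖x‖ := mul_one _
  have hclosed : IsClosed (conductor Ψ) := by
    have : conductor Ψ = ⋂ y : {y : k // ‖y‖ ≤ 1}, {x | Ψ (x * y) = 1} := by
      ext x; simp [conductor]
    rw [this]
    exact isClosed_iInter fun y =>
      isClosed_eq (hΨcont.comp (continuous_id.mul continuous_const)) continuous_const
  have hbdd : ∃ R : ℝ, ∀ x ∈ conductor Ψ, ‖x‖ ≤ R := by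
    by_contra! hcon
    refine hΨ (DFunLike.ext _ _ fun t => ?_)
    obtain ⟨x, hx, hxt⟩ := hcon ‖t‖
    have := hsub x hx t hxt.le 1 (by simp)
    simpa using this
  obtain ⟨R, hR⟩ := hbdd
  have hcomp : IsCompact (conductor Ψ) :=
    (Metric.isBounded_closedBall (x := (0 : k)) (r := R)).isCompact_closure.of_isClosed_subset hclosed
      (fun x hx => subset_closure (by simpa using hR x hx))
  obtain ⟨x₀, hx₀, hx₀0⟩ := hne
  obtain ⟨c, hc, hcmax⟩ := hcomp.exists_isMaxOn ⟨x₀, hx₀⟩ continuous_norm.continuousOn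
  have hC : ‖c‖ = conductorAbs Ψ := by
    refine le_antisymm (le_csSup ⟨R, ?_⟩ ⟨c, hc, rfl⟩) (csSup_le ⟨_, c, hc, rfl⟩ ?_)
    · rintro _ ⟨x, hx, rfl⟩; exact hR x hx
    · rintro _ ⟨x, hx, rfl⟩; exact hcmax hx
  refine ⟨ϖ, hchar, hΨcont, h0, h1, hmax, ?_, fun x => ⟨fun hx => ?_, fun hx => ?_⟩, ⟨c, hC⟩,
    hmod, hdual⟩
  · rw [← hC]
    exact lt_of_lt_of_le (norm_pos_iff.2 hx₀0) (hcmax hx₀)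
  · rw [← hC]; exact hcmax (show x ∈ conductor Ψ from hx)
  · exact hsub c hc x (hC ▸ hx)

end Field

/-! ### Boxes in phase space: volume, duality, scaling. -/

/-- The box `{|x| ≤ |a|, |ξ| ≤ |b| C}` in phase space, `C` being the size of the conductor. -/
def box {k : Type*} [NontriviallyNormedField k] [IsUltrametricDist k] {d : ℕ}
    (Ψ : AddChar k Circle) (a b : k) : AddSubgroup (Phase k d) where
  -- The absolute value keeps the radius nonnegative, so that this is a subgroup for every Ψ;
  -- `LocalChar.mem_box` removes it once the conductor is known to be positive.
  carrier := {X | ‖X.1‖ ≤ ‖a‖ ∧ ‖X.2‖ ≤ ‖b‖ * |conductorAbs Ψ|}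
  zero_mem' := by simp; positivity
  add_mem' := fun {X Y} hX hY =>
    ⟨(IsUltrametricDist.norm_add_le_max _ _).trans (max_le hX.1 hY.1),
      (IsUltrametricDist.norm_add_le_max _ _).trans (max_le hX.2 hY.2)⟩
  neg_mem' := fun {X} hX => by simpa using hX

section Box

variable {k : Type*} [NontriviallyNormedField k] [IsUltrametricDist k] [ProperSpace k]
  [MeasureSpace k] [BorelSpace k] [(volume : Measure k).IsAddHaarMeasure]
  {d : ℕ} {Ψ : AddChar k Circle} {ϖ : k}

theorem LocalChar.mem_box (h : LocalChar Ψ ϖ) {a b : k} {X : Phase k d} :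
    X ∈ box Ψ a b ↔ ‖X.1‖ ≤ ‖a‖ ∧ ‖X.2‖ ≤ ‖b‖ * conductorAbs Ψ := by
  rw [← abs_of_pos h.cond_pos]; rfl

theorem box_mono {a b a' b' : k} (ha : ‖a‖ ≤ ‖a'‖) (hb : ‖b‖ ≤ ‖b'‖) :
    box (d := d) Ψ a b ≤ box Ψ a' b' := fun X hX =>
  ⟨hX.1.trans ha, hX.2.trans (by gcongr)⟩

instance : (volume : Measure (Fin d → k)).IsAddHaarMeasure :=
  inferInstanceAs (Measure.pi fun _ : Fin d => (volume : Measure k)).IsAddHaarMeasure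

instance : (volume : Measure (Phase k d)).IsAddHaarMeasure :=
  Measure.prod.instIsAddHaarMeasure (volume : Measure (Fin d → k)) (volume : Measure (Fin d → k))

theorem isOpen_box (h : LocalChar Ψ ϖ) {a b : k} (ha : a ≠ 0) (hb : b ≠ 0) :
    IsOpen (box (d := d) Ψ a b : Set (Phase k d)) := by
  have : (box (d := d) Ψ a b : Set (Phase k d))
      = Metric.closedBall 0 ‖a‖ ×ˢ Metric.closedBall 0 (‖b‖ * conductorAbs Ψ) := by
    ext X
    simp [h.mem_box]
  rw [this]
  have hC := h.cond_pos
  exact (IsUltrametricDist.isOpen_closedBall _ (norm_pos_iff.2 ha).ne').prod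
    (IsUltrametricDist.isOpen_closedBall _ (by positivity))

theorem isCompact_box (h : LocalChar Ψ ϖ) (a b : k) :
    IsCompact (box (d := d) Ψ a b : Set (Phase k d)) := by
  have : (box (d := d) Ψ a b : Set (Phase k d))
      = Metric.closedBall 0 ‖a‖ ×ˢ Metric.closedBall 0 (‖b‖ * conductorAbs Ψ) := by
    ext X
    simp [h.mem_box]
  rw [this]
  exact (isCompact_closedBall _ _).prod (isCompact_closedBall _ _)

theorem measurableSet_box (h : LocalChar Ψ ϖ) (a b : k) :
    MeasurableSet (box (d := d) Ψ a b : Set (Phase k d)) :=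
  (isCompact_box h a b).isClosed.measurableSet

theorem volume_closedBall_mul (h : LocalChar Ψ ϖ) (a b : k) :
    volume (Metric.closedBall (0 : k) (‖a‖ * ‖b‖))
      = ENNReal.ofReal ‖a‖ * volume (Metric.closedBall (0 : k) ‖b‖) := by
  rw [← h.modulus]
  congr 1
  ext x
  simp only [Metric.mem_closedBall, dist_zero_right, Set.mem_image]
  by_cases ha : a = 0
  · subst ha
    simp only [norm_zero, zero_mul, norm_le_zero_iff]
    exact ⟨fun hx => ⟨0, by simp, hx.symm⟩, fun ⟨y, _, hy⟩ => hy.symm⟩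
  · refine ⟨fun hx => ⟨a⁻¹ * x, ?_, by field_simp⟩, ?_⟩
    · rw [norm_mul, norm_inv]
      have := norm_pos_iff.2 ha
      rwa [inv_mul_le_iff₀ this]
    · rintro ⟨y, hy, rfl⟩
      rw [norm_mul]; gcongr

theorem volume_pi_closedBall (h : LocalChar Ψ ϖ) (a : k) :
    volume (Metric.closedBall (0 : Fin d → k) ‖a‖)
      = (ENNReal.ofReal ‖a‖ * volume (Metric.closedBall (0 : k) 1)) ^ d := by
  rw [closedBall_pi _ (norm_nonneg a), volume_pi_pi]
  have := volume_closedBall_mul h a 1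
  rw [norm_one, mul_one] at this
  simp [this]

/-- The momentum ball is scaled by a generator of the conductor, so the self-duality of the measure
makes the unit box have volume one. -/
theorem volume_box (h : LocalChar Ψ ϖ) (a b : k) :
    volume (box (d := d) Ψ a b : Set (Phase k d)) = ENNReal.ofReal ((‖a‖ * ‖b‖) ^ d) := by
  have : (box (d := d) Ψ a b : Set (Phase k d))
      = Metric.closedBall 0 ‖a‖ ×ˢ Metric.closedBall 0 (‖b‖ * conductorAbs Ψ) := by
    ext X
    simp [h.mem_box]
  obtain ⟨c, hc⟩ := h.exists_gen
  rw [this, Measure.volume_eq_prod, Measure.prod_prod, ← hc, ← norm_mul, volume_pi_closedBall h,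
    volume_pi_closedBall h, ← mul_pow, norm_mul, ENNReal.ofReal_mul (norm_nonneg _)]
  have hcond : conductor Ψ = Metric.closedBall (0 : k) (‖c‖ * ‖(1 : k)‖) := by
    ext x
    rw [norm_one, mul_one, hc]
    rw [Metric.mem_closedBall, dist_zero_right]
    exact h.cond_iff x
  have hd := h.dual
  rw [hcond, volume_closedBall_mul h, norm_one] at hd
  rw [ENNReal.ofReal_pow (by positivity), ENNReal.ofReal_mul (norm_nonneg _)]
  congr 1
  calc _ = ENNReal.ofReal ‖a‖ * ENNReal.ofReal ‖b‖ * (volume (Metric.closedBall (0 : k) 1) *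
      (ENNReal.ofReal ‖c‖ * volume (Metric.closedBall (0 : k) 1))) := by ring
    _ = _ := by rw [hd, mul_one]

theorem volume_real_box (h : LocalChar Ψ ϖ) (a b : k) :
    volume.real (box (d := d) Ψ a b : Set (Phase k d)) = (‖a‖ * ‖b‖) ^ d := by
  rw [Measure.real, volume_box h, ENNReal.toReal_ofReal (by positivity)]

theorem norm_sub_le_max' (x y : k) : ‖x - y‖ ≤ max ‖x‖ ‖y‖ := by
  simpa [sub_eq_add_neg] using IsUltrametricDist.norm_add_le_max x (-y)

theorem norm_dotProduct_le (x y : Fin d → k) : ‖x ⬝ᵥ y‖ ≤ ‖x‖ * ‖y‖ := by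
  refine IsUltrametricDist.norm_sum_le_of_forall_le_of_nonneg (by positivity) fun i _ => ?_
  rw [norm_mul]
  gcongr
  exacts [norm_le_pi_norm x i, norm_le_pi_norm y i]

theorem LocalChar.map_eq_one (h : LocalChar Ψ ϖ) {x : k} (hx : ‖x‖ ≤ conductorAbs Ψ) :
    Ψ x = 1 := by
  simpa using (h.cond_iff x).2 hx 1 (by simp)

/-- The dual of a box. -/
theorem mem_box_dual (h : LocalChar Ψ ϖ) {κ a b : k} (hκ : κ ≠ 0) (ha : a ≠ 0) (hb : b ≠ 0)
    {X : Phase k d} :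
    (∀ Y ∈ box Ψ a b, Ψ (κ * symp Y X) = 1) ↔ X ∈ box Ψ (κ * b)⁻¹ (κ * a)⁻¹ := by
  have hC := h.cond_pos
  have hκ' := norm_pos_iff.2 hκ
  have ha' := norm_pos_iff.2 ha
  have hb' := norm_pos_iff.2 hb
  constructor
  · intro hX
    rw [h.mem_box, norm_inv, norm_inv, norm_mul, norm_mul]
    obtain ⟨c, hc⟩ := h.exists_gen
    constructor
    · rw [pi_norm_le_iff_of_nonneg (by positivity)]
      intro i
      -- Testing on vectors with a single nonzero momentum entry b·c·y, |y| ≤ 1, where c generates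
      -- the conductor: `cond_iff` turns triviality of Ψ into a norm bound for one coordinate. The
      -- momentum coordinates of X are treated in the same way with position entries.
      have key : ‖X.1 i * (κ * b * c)‖ ≤ conductorAbs Ψ := by
        rw [← h.cond_iff]
        intro y hy
        have := hX (0, Pi.single i (b * c * y)) ((h.mem_box).2 ⟨by simp, by
          rw [← hc]
          simp only [Pi.norm_single, norm_mul]
          exact mul_le_of_le_one_right (by positivity) hy⟩)
        simp only [symp, dotProduct_single, zero_dotProduct, sub_zero] at this
        rw [← this]
        congr 1; ring
      rw [norm_mul, norm_mul, norm_mul, hc, ← mul_assoc] at key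
      have := le_of_mul_le_mul_right (key.trans_eq (one_mul _).symm) hC
      rwa [← one_div, le_div_iff₀ (by positivity)]
    · rw [pi_norm_le_iff_of_nonneg (by positivity)]
      intro i
      have key : ‖X.2 i * (κ * a)‖ ≤ conductorAbs Ψ := by
        rw [← h.cond_iff]
        intro y hy
        have := hX (Pi.single i (-(a * y)), 0) ((h.mem_box).2 ⟨by
          simp only [Pi.norm_single, norm_mul, norm_neg]
          exact mul_le_of_le_one_right (by positivity) hy, by simp; positivity⟩)
        simp only [symp, single_dotProduct, dotProduct_zero, zero_sub] at this
        rw [← this]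
        congr 1; ring
      rw [norm_mul, norm_mul] at key
      rwa [← div_eq_inv_mul, le_div_iff₀ (by positivity)]
  · intro hX Y hY
    rw [h.mem_box] at hX hY
    rw [norm_inv, norm_inv, norm_mul, norm_mul] at hX
    refine h.map_eq_one ?_
    rw [symp, norm_mul]
    have h1 : ‖X.1 ⬝ᵥ Y.2‖ ≤ ‖κ‖⁻¹ * conductorAbs Ψ := by
      refine (norm_dotProduct_le _ _).trans ?_
      calc _ ≤ (‖κ‖ * ‖b‖)⁻¹ * (‖b‖ * conductorAbs Ψ) :=
            mul_le_mul hX.1 hY.2 (norm_nonneg _) (by positivity)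
        _ = _ := by field_simp
    have h2 : ‖Y.1 ⬝ᵥ X.2‖ ≤ ‖κ‖⁻¹ * conductorAbs Ψ := by
      refine (norm_dotProduct_le _ _).trans ?_
      calc _ ≤ ‖a‖ * ((‖κ‖ * ‖a‖)⁻¹ * conductorAbs Ψ) :=
            mul_le_mul hY.1 hX.2 (norm_nonneg _) (by positivity)
        _ = _ := by field_simp
    have h3 := (norm_sub_le_max' (X.1 ⬝ᵥ Y.2) (Y.1 ⬝ᵥ X.2)).trans (max_le h1 h2)
    calc _ ≤ ‖κ‖ * (‖κ‖⁻¹ * conductorAbs Ψ) := by gcongr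
      _ = _ := by field_simp

theorem symp_add_left (X Y Z : Phase k d) : symp (X + Y) Z = symp X Z + symp Y Z := by
  simp only [symp, Prod.fst_add, Prod.snd_add, add_dotProduct, dotProduct_add]; ring

theorem symp_add_right (X Y Z : Phase k d) : symp X (Y + Z) = symp X Y + symp X Z := by
  simp only [symp, Prod.fst_add, Prod.snd_add, add_dotProduct, dotProduct_add]; ring

theorem symp_neg_right (X Z : Phase k d) : symp X (-Z) = -symp X Z := by
  simp only [symp, Prod.fst_neg, Prod.snd_neg, neg_dotProduct, dotProduct_neg]; ring

theorem symp_sub_right (X Y Z : Phase k d) : symp X (Y - Z) = symp X Y - symp X Z := by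
  rw [sub_eq_add_neg, symp_add_right, symp_neg_right, sub_eq_add_neg]

theorem symp_swap (X Y : Phase k d) : symp X Y = -symp Y X := by
  simp only [symp]; ring

theorem symp_smul_left (a : k) (X Y : Phase k d) : symp (a • X) Y = a * symp X Y := by
  simp only [symp, Prod.smul_fst, Prod.smul_snd, smul_dotProduct, dotProduct_smul, smul_eq_mul]
  ring

theorem continuous_symp : Continuous fun P : Phase k d × Phase k d => symp P.1 P.2 := by
  unfold symp
  exact (Continuous.dotProduct (by fun_prop) (by fun_prop)).sub
    (Continuous.dotProduct (by fun_prop) (by fun_prop))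

theorem continuous_char_symp (h : LocalChar Ψ ϖ) (κ : k) :
    Continuous fun P : Phase k d × Phase k d => (Ψ (κ * symp P.1 P.2) : ℂ) :=
  continuous_subtype_val.comp (h.cont.comp (continuous_const.mul continuous_symp))

@[simp] theorem norm_char (x : k) : ‖(Ψ x : ℂ)‖ = 1 := Circle.norm_coe _

theorem char_add (x y : k) : (Ψ (x + y) : ℂ) = Ψ x * Ψ y := by
  rw [AddChar.map_add_eq_mul, Circle.coe_mul]

theorem conj_char (x : k) : conj (Ψ x : ℂ) = Ψ (-x) := by
  rw [AddChar.map_neg_eq_inv, Circle.coe_inv_eq_conj]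

/-- An integral is zero if a translation multiplies the integrand by a scalar other than one. -/
theorem integral_eq_zero_of_translate {G E : Type*} [AddGroup G] [MeasurableSpace G]
    [MeasurableAdd G] {μ : Measure G} [μ.IsAddRightInvariant] [NormedAddCommGroup E]
    [NormedSpace ℂ E] {f : G → E} (T : G) {χ : ℂ} (hχ : χ ≠ 1) (hf : ∀ Y, f (Y + T) = χ • f Y) :
    ∫ Y, f Y ∂μ = 0 := by
  have h1 : ∫ Y, f Y ∂μ = χ • ∫ Y, f Y ∂μ := by
    rw [← integral_smul, ← integral_add_right_eq_self f T]
    simp_rw [hf]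
  have h2 : (1 - χ) • ∫ Y, f Y ∂μ = 0 := by rw [sub_smul, one_smul, ← h1, sub_self]
  exact (smul_eq_zero.1 h2).resolve_left (sub_ne_zero.2 hχ.symm)

theorem setIntegral_eq_zero_of_translate {G E : Type*} [AddGroup G] [MeasurableSpace G]
    [MeasurableAdd G] {μ : Measure G} [μ.IsAddRightInvariant] [NormedAddCommGroup E]
    [NormedSpace ℂ E] {f : G → E} {s : Set G} (hs : MeasurableSet s) (T : G) {χ : ℂ} (hχ : χ ≠ 1)
    (hT : ∀ Y, Y + T ∈ s ↔ Y ∈ s) (hf : ∀ Y ∈ s, f (Y + T) = χ • f Y) :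
    ∫ Y in s, f Y ∂μ = 0 := by
  rw [← integral_indicator hs]
  refine integral_eq_zero_of_translate T hχ fun Y => ?_
  by_cases hY : Y ∈ s
  · rw [Set.indicator_of_mem ((hT Y).2 hY), Set.indicator_of_mem hY, hf Y hY]
  · rw [Set.indicator_of_notMem (mt (hT Y).1 hY), Set.indicator_of_notMem hY, smul_zero]

/-- Orthogonality of characters on a box. -/
theorem integral_box_char (h : LocalChar Ψ ϖ) {κ a b : k} (hκ : κ ≠ 0) (ha : a ≠ 0) (hb : b ≠ 0)
    (X : Phase k d) [Decidable (X ∈ box Ψ (κ * b)⁻¹ (κ * a)⁻¹)] :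
    ∫ Y in (box (d := d) Ψ a b : Set (Phase k d)), (Ψ (κ * symp Y X) : ℂ)
      = if X ∈ box Ψ (κ * b)⁻¹ (κ * a)⁻¹ then (((‖a‖ * ‖b‖) ^ d : ℝ) : ℂ) else 0 := by
  split_ifs with hX
  · rw [← mem_box_dual h hκ ha hb] at hX
    rw [setIntegral_congr_fun (g := fun _ => (1 : ℂ)) (measurableSet_box h a b)
      (fun Y hY => by simp [hX Y hY]), setIntegral_const, volume_real_box h]
    simp
  · rw [← mem_box_dual h hκ ha hb] at hX
    push Not at hX
    obtain ⟨T, hT, hT1⟩ := hX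
    refine setIntegral_eq_zero_of_translate (measurableSet_box h a b) T
      (χ := Ψ (κ * symp T X)) (fun hc => hT1 (Subtype.ext hc))
      (fun Y => add_mem_cancel_right hT) fun Y _ => ?_
    rw [symp_add_left, mul_add, char_add, smul_eq_mul, mul_comm]

/-- The scaling `(x, ξ) ↦ (a x, b ξ)`. -/
def scale {a b : k} (ha : a ≠ 0) (hb : b ≠ 0) : Phase k d ≃ₜ Phase k d :=
  (Homeomorph.smulOfNeZero a ha).prodCongr (Homeomorph.smulOfNeZero b hb)

theorem scale_apply {a b : k} (ha : a ≠ 0) (hb : b ≠ 0) (X : Phase k d) :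
    scale ha hb X = (a • X.1, b • X.2) := rfl

/-- The image of a Haar measure under a topological automorphism is a multiple of it; the factor is
read off on a box whose preimage is the unit box, of volume one. -/
theorem map_scale (h : LocalChar Ψ ϖ) {a b : k} (ha : a ≠ 0) (hb : b ≠ 0) :
    Measure.map (scale ha hb) (volume : Measure (Phase k d))
      = ENNReal.ofReal (((‖a‖ * ‖b‖) ^ d)⁻¹) • volume := by
  let e : Phase k d ≃+ Phase k d := { (scale ha hb) with
    map_add' := fun X Y => by
      change scale ha hb (X + Y) = scale ha hb X + scale ha hb Y
      simp [scale_apply] }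
  have hH : (Measure.map (scale ha hb) (volume : Measure (Phase k d))).IsAddHaarMeasure :=
    AddEquiv.isAddHaarMeasure_map _ e (scale ha hb).continuous (scale ha hb).symm.continuous
  rw [Measure.isAddLeftInvariant_eq_smul (Measure.map (scale ha hb) volume) volume]
  set c := Measure.addHaarScalarFactor (Measure.map (scale ha hb) volume)
    (volume : Measure (Phase k d)) with hc
  have h1 := congrArg (fun μ => μ (box (d := d) Ψ a b : Set (Phase k d)))
    (Measure.isAddLeftInvariant_eq_smul (Measure.map (scale ha hb) volume)
      (volume : Measure (Phase k d)))
  have hpre : scale ha hb ⁻¹' (box (d := d) Ψ a b : Set (Phase k d))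
      = box (d := d) Ψ (1 : k) (1 : k) := by
    ext X
    simp only [Set.mem_preimage, SetLike.mem_coe, h.mem_box, scale_apply, norm_smul, norm_one]
    rw [mul_le_iff_le_one_right (norm_pos_iff.2 ha), mul_le_mul_iff_right₀ (norm_pos_iff.2 hb),
      one_mul]
  simp only [Measure.smul_apply] at h1
  rw [(scale ha hb).measurableEmbedding.map_apply, hpre, volume_box h, volume_box h, ← hc] at h1
  simp only [norm_one, one_mul, one_pow, ENNReal.ofReal_one] at h1
  have hpos : 0 < (‖a‖ * ‖b‖) ^ d := by
    have := norm_pos_iff.2 ha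
    have := norm_pos_iff.2 hb
    positivity
  rw [ENNReal.ofReal_inv_of_pos hpos]
  have h2 : (c : ℝ≥0∞) = (ENNReal.ofReal ((‖a‖ * ‖b‖) ^ d))⁻¹ :=
    ENNReal.eq_inv_of_mul_eq_one_left h1.symm
  rw [← h2]
  rfl

theorem integral_scale (h : LocalChar Ψ ϖ) {a b : k} (ha : a ≠ 0) (hb : b ≠ 0) {E : Type*}
    [NormedAddCommGroup E] [NormedSpace ℝ E] (f : Phase k d → E) :
    ∫ X : Phase k d, f (a • X.1, b • X.2) = ((‖a‖ * ‖b‖) ^ d)⁻¹ • ∫ X, f X := by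
  have := (scale (d := d) ha hb).measurableEmbedding.integral_map (μ := volume) f
  rw [map_scale h, integral_smul_measure, ENNReal.toReal_ofReal (by positivity)] at this
  exact this.symm

theorem integrable_scale (h : LocalChar Ψ ϖ) {a b : k} (ha : a ≠ 0) (hb : b ≠ 0) {E : Type*}
    [NormedAddCommGroup E] {f : Phase k d → E} (hf : Integrable f) :
    Integrable fun X : Phase k d => f (a • X.1, b • X.2) := by
  have h1 : Integrable f (Measure.map (scale (d := d) ha hb) volume) := by
    rw [map_scale h]
    exact hf.smul_measure ENNReal.ofReal_ne_top
  exact h1.comp_measurable (scale ha hb).continuous.measurable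

theorem quasiMeasurePreserving_scale (h : LocalChar Ψ ϖ) {a b : k} (ha : a ≠ 0) (hb : b ≠ 0) :
    Measure.QuasiMeasurePreserving (fun X : Phase k d => (a • X.1, b • X.2)) := by
  refine ⟨(scale ha hb).continuous.measurable, ?_⟩
  have := map_scale (d := d) h ha hb
  rw [show (fun X : Phase k d => (a • X.1, b • X.2)) = scale ha hb from rfl, this]
  exact Measure.smul_absolutelyContinuous


/-! ### The weight and its level sets -/

theorem mem_box_level (h : LocalChar Ψ ϖ) {n : ℕ} {X : Phase k d} :
    X ∈ box Ψ (2 * ϖ ^ n)⁻¹ (2 * ϖ ^ n)⁻¹ ↔ mu0 Ψ X ≤ ‖ϖ‖⁻¹ ^ n := by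
  have hC := h.cond_pos
  have h2 := norm_pos_iff.2 h.two_ne
  have hϖ := h.unif_pos
  have h1 : (1 : ℝ) ≤ ‖ϖ‖⁻¹ ^ n := one_le_pow₀ (one_le_inv_iff₀.2 ⟨hϖ, h.unif_lt.le⟩)
  rw [h.mem_box, mu0, max_le_iff, max_le_iff, norm_smul, norm_smul, norm_inv, norm_mul, norm_pow]
  simp only [h1, true_and]
  refine and_congr ?_ ?_
  · rw [mul_inv, ← inv_pow, le_inv_mul_iff₀ h2]
  · rw [mul_inv, ← inv_pow, div_le_iff₀ hC, mul_assoc, le_inv_mul_iff₀ h2]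

theorem one_le_mu0 (X : Phase k d) : 1 ≤ mu0 Ψ X := le_max_left _ _

theorem mu0_pos (X : Phase k d) : 0 < mu0 Ψ X := zero_lt_one.trans_le (one_le_mu0 X)

theorem mu0_neg (X : Phase k d) : mu0 Ψ (-X) = mu0 Ψ X := by simp [mu0]

theorem continuous_mu0 : Continuous (mu0 (d := d) Ψ) := by
  unfold mu0
  fun_prop

theorem one_lt_q (h : LocalChar Ψ ϖ) : 1 < ‖ϖ‖⁻¹ := one_lt_inv_iff₀.2 ⟨h.unif_pos, h.unif_lt⟩

/-- Discreteness of the absolute value: the maximality of the uniformizer is applied to the inverse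
of t ϖⁿ, whose norm is less than one. -/
theorem q_pow_le_norm (h : LocalChar Ψ ϖ) {n : ℕ} {t : k} (ht : ‖ϖ‖⁻¹ ^ n < ‖t‖) :
    ‖ϖ‖⁻¹ ^ (n + 1) ≤ ‖t‖ := by
  have hϖ := h.unif_pos
  have ht0 : 0 < ‖t‖ := lt_of_le_of_lt (by positivity) ht
  have := h.unif_max (t * ϖ ^ n)⁻¹ (by
    rw [norm_inv, norm_mul, norm_pow]
    refine inv_lt_one_of_one_lt₀ ?_
    rw [inv_pow, inv_lt_iff_one_lt_mul₀ (by positivity)] at ht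
    linarith)
  rw [norm_inv, norm_mul, norm_pow] at this
  rw [inv_pow, inv_le_iff_one_le_mul₀ (by positivity), pow_succ]
  rw [inv_le_iff_one_le_mul₀ (by positivity)] at this
  linarith

/-- The conductor has a generator, so every quantity in the maximum defining μ₀, apart from 1, is
the norm of a rescaled vector. As soon as one exceeds qⁿ it is at least q^{n+1}, by `q_pow_le_norm`
on a coordinate. -/
theorem exists_mu0_eq (h : LocalChar Ψ ϖ) (X : Phase k d) : ∃ n : ℕ, mu0 Ψ X = ‖ϖ‖⁻¹ ^ n := by
  classical
  have hex : ∃ n : ℕ, mu0 Ψ X ≤ ‖ϖ‖⁻¹ ^ n :=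
    (pow_unbounded_of_one_lt (mu0 Ψ X) (one_lt_q h)).imp fun n hn => hn.le
  refine ⟨Nat.find hex, le_antisymm (Nat.find_spec hex) ?_⟩
  rcases hn : Nat.find hex with _ | n
  · simpa using one_le_mu0 X
  · have hlt : ‖ϖ‖⁻¹ ^ n < mu0 Ψ X := by
      have := Nat.find_min hex (m := n) (by omega)
      exact not_le.1 this
    have h1 : (1 : ℝ) ≤ ‖ϖ‖⁻¹ ^ n := one_le_pow₀ (one_lt_q h).le
    obtain ⟨c, hc⟩ := h.exists_gen
    have hC := h.cond_pos
    have hpi : ∀ (a : k) (x : Fin d → k), ‖ϖ‖⁻¹ ^ n < ‖a‖ * ‖x‖ →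
        ‖ϖ‖⁻¹ ^ (n + 1) ≤ ‖a‖ * ‖x‖ := by
      intro a x hx
      rw [← norm_smul] at hx ⊢
      obtain ⟨i, hi⟩ : ∃ i, ‖ϖ‖⁻¹ ^ n < ‖(a • x) i‖ := by
        by_contra! hcon
        exact absurd ((pi_norm_le_iff_of_nonneg (by positivity)).2 hcon) (not_le.2 hx)
      exact (q_pow_le_norm h hi).trans (norm_le_pi_norm _ i)
    rw [mu0, lt_max_iff, lt_max_iff, norm_smul, norm_smul, mul_div_right_comm, ← hc, ← norm_div]
      at hlt
    rw [mu0, le_max_iff, le_max_iff, norm_smul, norm_smul, mul_div_right_comm, ← hc, ← norm_div]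
    exact Or.inr ((hlt.resolve_left (not_lt.2 h1)).imp (hpi _ _) (hpi _ _))

/-- The `n`-th lattice of translations. -/
abbrev lat (Ψ : AddChar k Circle) (ϖ : k) (d n : ℕ) : AddSubgroup (Phase k d) :=
  box Ψ (ϖ ^ n) (ϖ ^ n)

/-- The lattice `{μ₀ ≤ q^n}`, dual to `lat n`. -/
abbrev dlat (Ψ : AddChar k Circle) (ϖ : k) (d n : ℕ) : AddSubgroup (Phase k d) :=
  box Ψ (2 * ϖ ^ n)⁻¹ (2 * ϖ ^ n)⁻¹

/-- The level sets `{μ₀ = q^n}`. -/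
def shell (Ψ : AddChar k Circle) (ϖ : k) (d n : ℕ) : Set (Phase k d) :=
  {X | mu0 Ψ X = ‖ϖ‖⁻¹ ^ n}

theorem pow_unif_ne (h : LocalChar Ψ ϖ) (n : ℕ) : ϖ ^ n ≠ 0 :=
  pow_ne_zero _ (norm_pos_iff.1 h.unif_pos)

theorem two_mul_unif_ne (h : LocalChar Ψ ϖ) (n : ℕ) : (2 * ϖ ^ n)⁻¹ ≠ 0 :=
  inv_ne_zero (mul_ne_zero h.two_ne (pow_unif_ne h n))

theorem shell_zero (h : LocalChar Ψ ϖ) : shell Ψ ϖ d 0 = dlat Ψ ϖ d 0 := by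
  ext X
  rw [SetLike.mem_coe, mem_box_level h]
  simp only [shell, Set.mem_ofPred_eq, pow_zero]
  exact ⟨fun hX => hX.le, fun hX => le_antisymm hX (one_le_mu0 X)⟩

theorem shell_succ (h : LocalChar Ψ ϖ) (n : ℕ) :
    shell Ψ ϖ d (n + 1) = (dlat Ψ ϖ d (n + 1) : Set (Phase k d)) \ dlat Ψ ϖ d n := by
  ext X
  rw [Set.mem_sdiff, SetLike.mem_coe, SetLike.mem_coe, mem_box_level h, mem_box_level h, not_le]
  simp only [shell, Set.mem_ofPred_eq]
  have hq := one_lt_q h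
  constructor
  · intro hX
    rw [hX]
    exact ⟨le_rfl, pow_lt_pow_right₀ hq (Nat.lt_succ_self n)⟩
  · rintro ⟨h1, h2⟩
    obtain ⟨m, hm⟩ := exists_mu0_eq h X
    rw [hm] at h1 h2 ⊢
    rw [pow_le_pow_iff_right₀ hq] at h1
    rw [pow_lt_pow_iff_right₀ hq] at h2
    congr 1; omega

theorem measurableSet_shell (n : ℕ) : MeasurableSet (shell Ψ ϖ d n) :=
  (continuous_mu0.measurable (measurableSet_singleton _))

theorem lat_anti (h : LocalChar Ψ ϖ) {m n : ℕ} (hmn : m ≤ n) : lat Ψ ϖ d n ≤ lat Ψ ϖ d m := by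
  have : ‖ϖ ^ n‖ ≤ ‖ϖ ^ m‖ := by
    rw [norm_pow, norm_pow]
    exact pow_le_pow_of_le_one h.unif_pos.le h.unif_lt.le hmn
  exact box_mono this this

theorem dlat_mono (h : LocalChar Ψ ϖ) {m n : ℕ} (hmn : m ≤ n) :
    dlat Ψ ϖ d m ≤ dlat Ψ ϖ d n := by
  intro X hX
  rw [mem_box_level h] at hX ⊢
  exact hX.trans (pow_le_pow_right₀ (one_lt_q h).le hmn)

theorem norm_two_le : ‖(2 : k)‖ ≤ 1 := by
  simpa using IsUltrametricDist.norm_natCast_le_one k 2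

theorem lat_le_dlat (h : LocalChar Ψ ϖ) (m n : ℕ) : lat Ψ ϖ d m ≤ dlat Ψ ϖ d n := by
  have h1 : ‖ϖ ^ m‖ ≤ 1 := by
    rw [norm_pow]; exact pow_le_one₀ h.unif_pos.le h.unif_lt.le
  have h2 : 1 ≤ ‖(2 * ϖ ^ n)⁻¹‖ := by
    rw [norm_inv, norm_mul, norm_pow]
    have := norm_pos_iff.2 h.two_ne
    have := h.unif_pos
    refine (one_le_inv₀ (by positivity)).2 (mul_le_one₀ norm_two_le (by positivity)
      (pow_le_one₀ h.unif_pos.le h.unif_lt.le))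
  exact box_mono (h1.trans h2) (h1.trans h2)

/-- All sublevel sets of μ₀ are subgroups containing `dlat 0`, so such a translation cannot change
the level of a point. This is why functions of μ₀ are radial weights in the sense of `IsRadial`. -/
theorem mu0_add_of_mem (h : LocalChar Ψ ϖ) {T : Phase k d} (hT : T ∈ dlat Ψ ϖ d 0)
    (X : Phase k d) : mu0 Ψ (X + T) = mu0 Ψ X := by
  obtain ⟨n, hn⟩ := exists_mu0_eq h X
  obtain ⟨m, hm⟩ := exists_mu0_eq h (X + T)
  have h1 : X ∈ dlat Ψ ϖ d m := by
    have : X + T ∈ dlat Ψ ϖ d m := (mem_box_level h).2 hm.le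
    exact (add_mem_cancel_right (dlat_mono h (Nat.zero_le m) hT)).1 this
  have h2 : X + T ∈ dlat Ψ ϖ d n :=
    add_mem ((mem_box_level h).2 hn.le) (dlat_mono h (Nat.zero_le n) hT)
  exact le_antisymm (by rw [hn]; exact (mem_box_level h).1 h2)
    (by rw [hm]; exact (mem_box_level h).1 h1)

/-- `lat n` and `dlat n` are dual. -/
theorem mem_dlat_iff (h : LocalChar Ψ ϖ) {n : ℕ} {X : Phase k d} :
    (∀ Y ∈ lat Ψ ϖ d n, Ψ (2 * symp Y X) = 1) ↔ X ∈ dlat Ψ ϖ d n :=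
  mem_box_dual h h.two_ne (pow_unif_ne h n) (pow_unif_ne h n)

end Box

/-! ### Continuity of translations. -/

section Translate
open Filter Topology

variable {G : Type*} [AddCommGroup G] [TopologicalSpace G] [IsTopologicalAddGroup G]
  [LocallyCompactSpace G] [SecondCountableTopology G] [T2Space G]
  [MeasurableSpace G] [BorelSpace G] {μ : Measure G} [μ.IsAddHaarMeasure]
  {E : Type*} [NormedAddCommGroup E]

theorem tendsto_translate_Lp {p : ℝ≥0∞} [Fact (1 ≤ p)] [Fact (p ≠ ∞)] (f : Lp E p μ) :
    Tendsto (fun T : G => DomAddAct.mk T +ᵥ f) (𝓝 0) (𝓝 f) := by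
  have h1 : Continuous fun T : G => DomAddAct.mk T +ᵥ f :=
    Continuous.vadd (DomAddAct.continuous_mk) continuous_const
  have := h1.tendsto 0
  simpa using this

theorem tendsto_integral_norm_translate {φ : G → E} (hφ : Integrable φ μ) :
    Tendsto (fun T : G => ∫ X, ‖φ (T + X) - φ X‖ ∂μ) (𝓝 0) (𝓝 0) := by
  haveI : Fact ((1 : ℝ≥0∞) ≠ ∞) := ⟨ENNReal.one_ne_top⟩
  have h := tendsto_translate_Lp (hφ.toL1 φ)
  rw [tendsto_iff_norm_sub_tendsto_zero] at h
  refine h.congr fun T => ?_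
  rw [L1.norm_eq_integral_norm]
  refine integral_congr_ae ?_
  have e1 := DomAddAct.vadd_Lp_ae_eq (DomAddAct.mk T) (hφ.toL1 φ)
  have e2 := hφ.coeFn_toL1
  have e3 := (measurePreserving_add_left μ T).quasiMeasurePreserving.ae_eq_comp hφ.coeFn_toL1
  filter_upwards [Lp.coeFn_sub (DomAddAct.mk T +ᵥ hφ.toL1 φ) (hφ.toL1 φ), e1, e2, e3]
    with X h1 h2 h3 h4
  rw [h1, Pi.sub_apply, h2, h3]
  simp only [Function.comp_apply, Equiv.symm_apply_apply, vadd_eq_add] at h4 ⊢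
  rw [h4]

theorem integrable_shear {φ : G → ℂ} [NormedSpace ℂ E] {g : G → E} (hφ : Integrable φ μ)
    (hg : Integrable g μ) : Integrable (fun p : G × G => φ p.2 • g (p.1 + p.2)) (μ.prod μ) :=
  (measurePreserving_add_prod μ μ).integrable_comp_of_integrable
    (g := fun p : G × G => φ p.2 • g p.1) (hφ.smul_prod hg).swap

theorem integrable_shear_bdd {φ ψ : G → ℂ} [NormedSpace ℂ E] {F : G → E} (hφ : Integrable φ μ)
    (hψ : Integrable ψ μ) (hF : MemLp F ∞ μ) :
    Integrable (fun p : G × G => (φ p.1 * ψ p.2) • F (p.1 + p.2)) (μ.prod μ) := by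
  have hq : Measure.QuasiMeasurePreserving (fun p : G × G => p.1 + p.2) (μ.prod μ) μ :=
    Measure.quasiMeasurePreserving_fst.comp (measurePreserving_add_prod μ μ).quasiMeasurePreserving
  refine (hφ.mul_prod hψ).smul_bdd (eLpNormEssSup F μ).toReal
    (hF.1.comp_quasiMeasurePreserving hq) ?_
  refine hq.ae (p := fun X => ‖F X‖ ≤ (eLpNormEssSup F μ).toReal) ?_
  have hfin : eLpNormEssSup F μ ≠ ∞ := by
    have := hF.2.ne
    rwa [eLpNorm_exponent_top] at this
  filter_upwards [ae_le_eLpNormEssSup (f := F) (μ := μ)] with X hX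
  rw [← toReal_enorm]
  exact (ENNReal.toReal_le_toReal (by simp) hfin).2 hX

/-- F is merely bounded and need not be translation-continuous; the translation is moved to φ, for
which L¹-continuity holds. -/
theorem tendsto_integral_smul_translate {φ : G → ℂ} [NormedSpace ℂ E] {F : G → E}
    (hφ : Integrable φ μ) (hF : MemLp F ∞ μ) :
    Tendsto (fun Y : G => ∫ X, φ X • F (X + Y) ∂μ) (𝓝 0) (𝓝 (∫ X, φ X • F X ∂μ)) := by
  set C := (eLpNormEssSup F μ).toReal
  have hfin : eLpNormEssSup F μ ≠ ∞ := by
    have := hF.2.ne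
    rwa [eLpNorm_exponent_top] at this
  have hC : ∀ᵐ X ∂μ, ‖F X‖ ≤ C := by
    filter_upwards [ae_le_eLpNormEssSup (f := F) (μ := μ)] with X hX
    rw [← toReal_enorm]
    exact (ENNReal.toReal_le_toReal (by simp) hfin).2 hX
  have h0 := (tendsto_integral_norm_translate hφ).comp
    (show Tendsto (fun Y : G => -Y) (𝓝 0) (𝓝 0) by simpa using (continuous_neg (G := G)).tendsto 0)
  rw [tendsto_iff_norm_sub_tendsto_zero]
  refine squeeze_zero (fun _ => norm_nonneg _) (fun Y => ?_)
    (by simpa using h0.mul_const C)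
  have hφY : Integrable (fun X => φ (-Y + X)) μ := hφ.comp_add_left (-Y)
  have e1 : ∫ X, φ X • F (X + Y) ∂μ = ∫ X, φ (-Y + X) • F X ∂μ := by
    rw [← integral_add_right_eq_self (fun X => φ (-Y + X) • F X) Y]
    refine integral_congr_ae (ae_of_all _ fun X => ?_)
    simp [add_comm]
  have i1 : Integrable (fun X => φ (-Y + X) • F X) μ := hφY.smul_of_top_left hF
  have i2 : Integrable (fun X => φ X • F X) μ := hφ.smul_of_top_left hF
  rw [e1, ← integral_sub i1 i2, ← integral_mul_const]
  refine norm_integral_le_of_norm_le ((hφY.sub hφ).norm.mul_const C) ?_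
  filter_upwards [hC] with X hX
  rw [← sub_smul, norm_smul]
  exact mul_le_mul_of_nonneg_left hX (norm_nonneg _)

end Translate

/-! ### Averages over the lattices and the blocks. -/

section Avg
open Filter Topology

variable {k : Type*} [NontriviallyNormedField k] [IsUltrametricDist k] [ProperSpace k]
  [MeasureSpace k] [BorelSpace k] [(volume : Measure k).IsAddHaarMeasure]
  {d : ℕ} {Ψ : AddChar k Circle} {ϖ : k}
  {E : Type*} [NormedAddCommGroup E] [NormedSpace ℂ E] [CompleteSpace E]

/-- Average over the cosets of the `n`-th lattice. -/
def avg (Ψ : AddChar k Circle) (ϖ : k) (n : ℕ) (f : Phase k d → E) (X : Phase k d) : E :=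
  (volume.real (lat Ψ ϖ d n : Set (Phase k d)))⁻¹ • ∫ Y in (lat Ψ ϖ d n : Set (Phase k d)), f (X + Y)

/-- The differences of successive averages. -/
def blk (Ψ : AddChar k Circle) (ϖ : k) : ℕ → (Phase k d → E) → Phase k d → E
  | 0, f => avg Ψ ϖ 0 f
  | n + 1, f => fun X => avg Ψ ϖ (n + 1) f X - avg Ψ ϖ n f X

theorem blk_zero (f : Phase k d → E) : blk Ψ ϖ 0 f = avg Ψ ϖ 0 f := rfl

theorem blk_succ (n : ℕ) (f : Phase k d → E) (X : Phase k d) :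
    blk Ψ ϖ (n + 1) f X = avg Ψ ϖ (n + 1) f X - avg Ψ ϖ n f X := rfl

theorem sum_blk (n : ℕ) (f : Phase k d → E) (X : Phase k d) :
    ∑ j ∈ Finset.range (n + 1), blk Ψ ϖ j f X = avg Ψ ϖ n f X := by
  induction n with
  | zero => simp [blk]
  | succ n ih => rw [Finset.sum_range_succ, ih]; simp [blk]

theorem lat_vol_pos (h : LocalChar Ψ ϖ) (n : ℕ) :
    0 < volume.real (lat Ψ ϖ d n : Set (Phase k d)) := by
  rw [volume_real_box h, norm_pow]
  have := h.unif_pos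
  positivity

theorem lat_vol_ne_top (h : LocalChar Ψ ϖ) (n : ℕ) :
    volume (lat Ψ ϖ d n : Set (Phase k d)) ≠ ∞ := by
  rw [volume_box h]; exact ENNReal.ofReal_ne_top

/-- The lattices are open, so invariant functions are locally constant. -/
theorem continuous_of_invariant (h : LocalChar Ψ ϖ) {F : Type*} [TopologicalSpace F] {n : ℕ}
    {f : Phase k d → F} (hf : ∀ X, ∀ T ∈ lat Ψ ϖ d n, f (X + T) = f X) : Continuous f := by
  refine continuous_iff_continuousAt.2 fun X => ?_
  have hopen := isOpen_box (d := d) h (pow_unif_ne h n) (pow_unif_ne h n)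
  have h1 : ∀ᶠ Y in 𝓝 X, Y - X ∈ lat Ψ ϖ d n := by
    have hc : ContinuousAt (fun Y : Phase k d => Y - X) X := by fun_prop
    refine hc.eventually_mem (hopen.mem_nhds ?_)
    rw [sub_self]; exact zero_mem _
  refine Tendsto.congr' ?_ tendsto_const_nhds
  filter_upwards [h1] with Y hY
  rw [← hf X _ hY, add_sub_cancel]

theorem avg_add (h : LocalChar Ψ ϖ) {n : ℕ} (f : Phase k d → E) (X : Phase k d) {T : Phase k d}
    (hT : T ∈ lat Ψ ϖ d n) : avg Ψ ϖ n f (X + T) = avg Ψ ϖ n f X := by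
  unfold avg
  congr 1
  rw [← integral_indicator (measurableSet_box h _ _), ← integral_indicator (measurableSet_box h _ _),
    ← integral_add_left_eq_self
      (((lat Ψ ϖ d n : Set (Phase k d))).indicator fun Y => f (X + Y)) T]
  congr 1
  ext Y
  by_cases hY : Y ∈ lat Ψ ϖ d n
  · rw [Set.indicator_of_mem (by exact hY), Set.indicator_of_mem (by exact add_mem hT hY), add_assoc]
  · rw [Set.indicator_of_notMem (by exact hY), Set.indicator_of_notMem]
    exact fun hc => hY ((add_mem_cancel_left hT).1 hc)

theorem avg_of_invariant (h : LocalChar Ψ ϖ) {n : ℕ} {f : Phase k d → E}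
    (hf : ∀ X, ∀ T ∈ lat Ψ ϖ d n, f (X + T) = f X) : avg Ψ ϖ n f = f := by
  ext X
  rw [avg, setIntegral_congr_fun (g := fun _ => f X) (measurableSet_box h _ _)
    (fun Y hY => hf X Y hY), setIntegral_const, smul_smul, inv_mul_cancel₀ (lat_vol_pos h n).ne',
    one_smul]

theorem avg_congr {n : ℕ} {f g : Phase k d → E} (hfg : f =ᵐ[volume] g) :
    avg Ψ ϖ n f = avg Ψ ϖ n g := by
  ext X
  unfold avg
  congr 1
  refine integral_congr_ae (ae_restrict_of_ae ?_)
  exact (measurePreserving_add_left volume X).quasiMeasurePreserving.ae_eq_comp hfg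

theorem integrableOn_translate (h : LocalChar Ψ ϖ) {f : Phase k d → E}
    (hf : LocallyIntegrable f) (n : ℕ) (X : Phase k d) :
    IntegrableOn (fun Y => f (X + Y)) (lat Ψ ϖ d n : Set (Phase k d)) := by
  have hc : LocallyIntegrable (fun Y => f (X + Y)) := by
    intro Y
    obtain ⟨s, hs, hfs⟩ := hf (X + Y)
    refine ⟨(fun Y => X + Y) ⁻¹' s, (continuous_const_add X).continuousAt.preimage_mem_nhds hs, ?_⟩
    exact ((measurePreserving_add_left volume X).integrableOn_comp_preimage
      (MeasurableEquiv.addLeft X).measurableEmbedding).2 hfs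
  exact hc.integrableOn_isCompact (isCompact_box h _ _)

theorem norm_avg_le (h : LocalChar Ψ ϖ) {n : ℕ} {f : Phase k d → E} {C : ℝ}
    (hf : ∀ᵐ X, ‖f X‖ ≤ C) (X : Phase k d) : ‖avg Ψ ϖ n f X‖ ≤ C := by
  have hv := lat_vol_pos (d := d) h n
  have h1 : ∀ᵐ Y, ‖f (X + Y)‖ ≤ C :=
    (measurePreserving_add_left volume X).quasiMeasurePreserving.ae hf
  have h2 := norm_setIntegral_le_of_norm_le_const_ae (μ := volume)
    (s := (lat Ψ ϖ d n : Set (Phase k d))) (f := fun Y => f (X + Y)) (C := C)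
    (lat_vol_ne_top h n).lt_top (ae_restrict_of_ae h1)
  rw [avg, norm_smul, norm_inv, Real.norm_of_nonneg hv.le, inv_mul_le_iff₀ hv, mul_comm]
  exact h2

theorem avg_add_fun (h : LocalChar Ψ ϖ) {f g : Phase k d → E} (hf : LocallyIntegrable f)
    (hg : LocallyIntegrable g) (n : ℕ) (X : Phase k d) :
    avg Ψ ϖ n (fun Y => f Y + g Y) X = avg Ψ ϖ n f X + avg Ψ ϖ n g X := by
  unfold avg
  rw [integral_add (integrableOn_translate h hf n X) (integrableOn_translate h hg n X), smul_add]

theorem avg_smul (n : ℕ) (c : ℂ) (f : Phase k d → E) (X : Phase k d) :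
    avg Ψ ϖ n (fun Y => c • f Y) X = c • avg Ψ ϖ n f X := by
  unfold avg
  rw [integral_smul, smul_comm]

/-- The tower property of conditional expectations: the finer lattice is contained in the coarser
one, so the inner translation is absorbed by the outer average. -/
theorem avg_avg_of_le (h : LocalChar Ψ ϖ) {n j : ℕ} (hnj : n ≤ j)
    {f : Phase k d → E} (hf : LocallyIntegrable f) :
    avg Ψ ϖ n (avg Ψ ϖ j f) = avg Ψ ϖ n f := by
  ext X
  have hmeas := measurableSet_box (d := d) (Ψ := Ψ) h
  have hint : Integrable (Function.uncurry fun S T : Phase k d => f (X + S + T))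
      ((volume.restrict (lat Ψ ϖ d n : Set (Phase k d))).prod
        (volume.restrict (lat Ψ ϖ d j : Set (Phase k d)))) := by
    have hφ : Integrable ((lat Ψ ϖ d j : Set (Phase k d)).indicator fun _ => (1 : ℂ)) :=
      (integrable_indicator_iff (hmeas _ _)).2 (integrableOn_const (lat_vol_ne_top h j))
    have hg := (integrable_indicator_iff (hmeas _ _)).2 (integrableOn_translate h hf n X)
    have h1 := (integrable_shear hφ hg).integrableOn
      (s := (lat Ψ ϖ d n : Set (Phase k d)) ×ˢ (lat Ψ ϖ d j : Set (Phase k d)))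
    rw [Measure.prod_restrict]
    refine IntegrableOn.congr_fun h1 ?_ ((hmeas _ _).prod (hmeas _ _))
    rintro ⟨S, T⟩ ⟨hS, hT⟩
    simp only [Function.uncurry]
    rw [Set.indicator_of_mem hT, Set.indicator_of_mem, one_smul, add_assoc]
    exact add_mem hS (lat_anti h hnj hT)
  have key : ∀ T ∈ (lat Ψ ϖ d j : Set (Phase k d)),
      ∫ S in (lat Ψ ϖ d n : Set (Phase k d)), f (X + S + T)
        = ∫ S in (lat Ψ ϖ d n : Set (Phase k d)), f (X + S) := by
    intro T hT
    have := avg_add h f X (lat_anti h hnj hT)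
    unfold avg at this
    have h2 := (smul_right_injective E (inv_ne_zero (lat_vol_pos (d := d) h n).ne')) this
    simpa [add_right_comm] using h2
  unfold avg
  congr 1
  rw [integral_smul, integral_integral_swap hint,
    setIntegral_congr_fun (hmeas _ _) key, setIntegral_const, smul_smul,
    inv_mul_cancel₀ (lat_vol_pos h j).ne', one_smul]

theorem eventually_lat_subset (h : LocalChar Ψ ϖ) {U : Set (Phase k d)} (hU : U ∈ 𝓝 0) :
    ∀ᶠ n in atTop, (lat Ψ ϖ d n : Set (Phase k d)) ⊆ U := by
  obtain ⟨ε, hε, hεU⟩ := Metric.mem_nhds_iff.1 hU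
  have hC := h.cond_pos
  have h1 : Tendsto (fun n : ℕ => ‖ϖ‖ ^ n * (1 + conductorAbs Ψ)) atTop (𝓝 0) := by
    simpa using (tendsto_pow_atTop_nhds_zero_of_lt_one h.unif_pos.le h.unif_lt).mul_const
      (1 + conductorAbs Ψ)
  filter_upwards [h1.eventually_lt_const hε] with n hn X hX
  refine hεU ?_
  rw [SetLike.mem_coe, h.mem_box, norm_pow] at hX
  have hp : 0 < ‖ϖ‖ ^ n := pow_pos h.unif_pos n
  rw [Metric.mem_ball, dist_zero_right, Prod.norm_def]
  refine lt_of_le_of_lt (max_le (hX.1.trans ?_) (hX.2.trans ?_)) hn <;> nlinarith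

theorem integrable_indicator_lat (h : LocalChar Ψ ϖ) (n : ℕ) :
    Integrable ((lat Ψ ϖ d n : Set (Phase k d)).indicator fun _ => (1 : ℂ)) :=
  (integrable_indicator_iff (measurableSet_box h _ _)).2 (integrableOn_const (lat_vol_ne_top h n))

theorem integrable_restrict_shear (h : LocalChar Ψ ϖ) {φ : Phase k d → ℂ} (hφ : Integrable φ)
    {F : Phase k d → E} (hF : MemLp F ∞) (n : ℕ) :
    Integrable (Function.uncurry fun X Y : Phase k d => φ X • F (X + Y))
      (volume.prod (volume.restrict (lat Ψ ϖ d n : Set (Phase k d)))) := by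
  have h1 := (integrable_shear_bdd hφ (integrable_indicator_lat (d := d) h n) hF).integrableOn
    (s := Set.univ ×ˢ (lat Ψ ϖ d n : Set (Phase k d)))
  have h2 := h1.congr_fun (g := Function.uncurry fun X Y : Phase k d => φ X • F (X + Y)) (by
    rintro ⟨X, Y⟩ ⟨-, hY⟩
    simp only [Function.uncurry]
    rw [Set.indicator_of_mem hY, mul_one])
    (MeasurableSet.univ.prod (measurableSet_box h _ _))
  rw [IntegrableOn, ← Measure.prod_restrict, Measure.restrict_univ] at h2
  exact h2

theorem integral_smul_avg (h : LocalChar Ψ ϖ) {φ : Phase k d → ℂ} (hφ : Integrable φ)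
    {F : Phase k d → E} (hF : MemLp F ∞) (n : ℕ) :
    ∫ X, φ X • avg Ψ ϖ n F X = (volume.real (lat Ψ ϖ d n : Set (Phase k d)))⁻¹ •
      ∫ Y in (lat Ψ ϖ d n : Set (Phase k d)), ∫ X, φ X • F (X + Y) := by
  rw [← integral_integral_swap (integrable_restrict_shear h hφ hF n), ← integral_smul]
  congr 1
  ext X
  rw [avg, smul_comm, integral_smul]

/-- The lattices shrink to zero, so averages converge weakly against L¹. This substitutes for
pointwise convergence, and it makes bounded functions determined by their blocks. -/
theorem tendsto_integral_smul_avg (h : LocalChar Ψ ϖ) {φ : Phase k d → ℂ}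
    (hφ : Integrable φ) {F : Phase k d → E} (hF : MemLp F ∞) :
    Tendsto (fun n => ∫ X, φ X • avg Ψ ϖ n F X) atTop (𝓝 (∫ X, φ X • F X)) := by
  rw [Metric.tendsto_nhds]
  intro ε hε
  have h1 := Metric.tendsto_nhds.1 (tendsto_integral_smul_translate hφ hF) (ε / 2) (half_pos hε)
  filter_upwards [eventually_lat_subset h h1] with n hn
  have hv := lat_vol_pos (d := d) h n
  refine lt_of_le_of_lt ?_ (half_lt_self hε)
  have e1 : ∫ X, φ X • F X = (volume.real (lat Ψ ϖ d n : Set (Phase k d)))⁻¹ •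
      ∫ Y in (lat Ψ ϖ d n : Set (Phase k d)), ∫ X, φ X • F X := by
    rw [setIntegral_const, smul_smul, inv_mul_cancel₀ hv.ne', one_smul]
  have i1 := (integrable_restrict_shear h hφ hF n).integral_prod_right
  simp only [Function.uncurry] at i1
  rw [dist_eq_norm, e1, integral_smul_avg h hφ hF, ← smul_sub, ← integral_sub i1
    (integrableOn_const (lat_vol_ne_top h n)), norm_smul,
    norm_inv, Real.norm_of_nonneg hv.le, inv_mul_le_iff₀ hv, mul_comm]
  refine norm_setIntegral_le_of_norm_le_const (lat_vol_ne_top h n).lt_top fun Y hY => ?_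
  have := hn hY
  rw [Set.mem_ofPred_eq, dist_eq_norm] at this
  exact this.le

theorem locallyIntegrable_of_memLp_top {F : Phase k d → E} (hF : MemLp F ∞) :
    LocallyIntegrable F := hF.locallyIntegrable le_top

theorem ae_norm_le_of_memLp_top {F : Phase k d → E} (hF : MemLp F ∞) :
    ∀ᵐ X, ‖F X‖ ≤ (eLpNorm F ∞ volume).toReal := by
  have hfin := hF.2.ne
  rw [eLpNorm_exponent_top] at hfin ⊢
  filter_upwards [ae_le_eLpNormEssSup (f := F) (μ := volume)] with X hX
  rw [← toReal_enorm]
  exact (ENNReal.toReal_le_toReal (by simp) hfin).2 hX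

theorem continuous_avg (h : LocalChar Ψ ϖ) (n : ℕ) (F : Phase k d → E) :
    Continuous (avg Ψ ϖ n F) :=
  continuous_of_invariant h fun X _ hT => avg_add h F X hT

/-- A bounded function is the limit of its averages, if they converge. -/
theorem ae_eq_of_tendsto_avg (h : LocalChar Ψ ϖ) {F S : Phase k d → E}
    (hF : MemLp F ∞) (hS : ∀ X, Tendsto (fun n => avg Ψ ϖ n F X) atTop (𝓝 (S X))) :
    F =ᵐ[volume] S := by
  have hb := ae_norm_le_of_memLp_top hF
  have hSm : AEStronglyMeasurable S volume :=
    aestronglyMeasurable_of_tendsto_ae atTop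
      (fun n => (continuous_avg h n F).aestronglyMeasurable) (ae_of_all _ hS)
  have hSb : ∀ X, ‖S X‖ ≤ (eLpNorm F ∞ volume).toReal := fun X =>
    le_of_tendsto' (hS X).norm fun n => norm_avg_le h hb X
  have hS' : MemLp S ∞ := memLp_top_of_bound hSm _ (ae_of_all _ hSb)
  have hint : ∀ {f : Phase k d → E}, MemLp f ∞ → ∀ s, MeasurableSet s → volume s < ∞ →
      IntegrableOn f s := fun hf s _ hs => by
    haveI : IsFiniteMeasure (volume.restrict s) := ⟨by simpa using hs⟩
    exact (hf.restrict s).integrable le_top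
  refine ae_eq_of_forall_setIntegral_eq_of_sigmaFinite (hint hF) (hint hS') fun s hs hsv => ?_
  have hφ : Integrable (s.indicator fun _ => (1 : ℂ)) :=
    (integrable_indicator_iff hs).2 (integrableOn_const hsv.ne)
  have key : ∀ f : Phase k d → E, ∫ X, s.indicator (fun _ => (1 : ℂ)) X • f X = ∫ X in s, f X := by
    intro f
    rw [← integral_indicator hs]
    congr 1
    ext X
    by_cases hX : X ∈ s <;> simp [hX]
  rw [← key F, ← key S]
  refine tendsto_nhds_unique (tendsto_integral_smul_avg h hφ hF) ?_
  refine tendsto_integral_of_dominated_convergence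
    (fun X => ‖s.indicator (fun _ => (1 : ℂ)) X‖ * (eLpNorm F ∞ volume).toReal)
    (fun n => hφ.1.smul (continuous_avg h n F).aestronglyMeasurable) (hφ.norm.mul_const _)
    (fun n => ae_of_all _ fun X => ?_) (ae_of_all _ fun X => (hS X).const_smul _)
  rw [norm_smul]
  exact mul_le_mul_of_nonneg_left (norm_avg_le h hb X) (norm_nonneg _)

theorem ae_eq_of_avg_eq (h : LocalChar Ψ ϖ) {F G : Phase k d → E}
    (hF : MemLp F ∞) (hG : MemLp G ∞) (hFG : ∀ n, avg Ψ ϖ n F = avg Ψ ϖ n G) :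
    F =ᵐ[volume] G := by
  have hint : ∀ {f : Phase k d → E}, MemLp f ∞ → ∀ s, MeasurableSet s → volume s < ∞ →
      IntegrableOn f s := fun hf s _ hs => by
    haveI : IsFiniteMeasure (volume.restrict s) := ⟨by simpa using hs⟩
    exact (hf.restrict s).integrable le_top
  refine ae_eq_of_forall_setIntegral_eq_of_sigmaFinite (hint hF) (hint hG) fun s hs hsv => ?_
  have hφ : Integrable (s.indicator fun _ => (1 : ℂ)) :=
    (integrable_indicator_iff hs).2 (integrableOn_const hsv.ne)
  have key : ∀ f : Phase k d → E, ∫ X, s.indicator (fun _ => (1 : ℂ)) X • f X = ∫ X in s, f X := by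
    intro f
    rw [← integral_indicator hs]
    congr 1
    ext X
    by_cases hX : X ∈ s <;> simp [hX]
  rw [← key F, ← key G]
  refine tendsto_nhds_unique (tendsto_integral_smul_avg h hφ hF) ?_
  simp_rw [hFG]
  exact tendsto_integral_smul_avg h hφ hG

theorem integral_neg_phase (h : LocalChar Ψ ϖ) (f : Phase k d → E) :
    ∫ X, f (-X) = ∫ X, f X := by
  have := integral_scale (d := d) h (a := -1) (b := -1) (by simp) (by simp) f
  have e : ∀ X : Phase k d, ((-1 : k) • X.1, (-1 : k) • X.2) = -X := fun X => by
    ext <;> simp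
  simp only [e] at this
  simpa using this

/-- Averaging is convolution with a normalized indicator function, which is even because the lattice
is a group; hence it is self-adjoint. -/
theorem integral_smul_avg_comm (h : LocalChar Ψ ϖ) {φ : Phase k d → ℂ} (hφ : Integrable φ)
    {F : Phase k d → E} (hF : MemLp F ∞) (n : ℕ) :
    ∫ X, φ X • avg Ψ ϖ n F X = ∫ X, avg Ψ ϖ n φ X • F X := by
  have h1 : Integrable (Function.uncurry fun X Y : Phase k d => φ (X + Y) • F X)
      (volume.prod (volume.restrict (lat Ψ ϖ d n : Set (Phase k d)))) := by
    have h1 := (integrable_shear (integrable_indicator_lat (d := d) h n) hφ)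
    have h2 := (h1.smul_bdd (f := fun p : Phase k d × Phase k d => F p.1) _
      (hF.1.comp_quasiMeasurePreserving Measure.quasiMeasurePreserving_fst)
      (Measure.quasiMeasurePreserving_fst.ae (ae_norm_le_of_memLp_top hF))).integrableOn
      (s := Set.univ ×ˢ (lat Ψ ϖ d n : Set (Phase k d)))
    have h3 := h2.congr_fun (g := Function.uncurry fun X Y : Phase k d => φ (X + Y) • F X) (by
      rintro ⟨X, Y⟩ ⟨-, hY⟩
      simp only [Function.uncurry, Pi.smul_apply']
      rw [Set.indicator_of_mem hY, one_smul])
      (MeasurableSet.univ.prod (measurableSet_box h _ _))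
    rw [IntegrableOn, ← Measure.prod_restrict, Measure.restrict_univ] at h3
    exact h3
  have e1 : ∫ X, avg Ψ ϖ n φ X • F X = (volume.real (lat Ψ ϖ d n : Set (Phase k d)))⁻¹ •
      ∫ Y in (lat Ψ ϖ d n : Set (Phase k d)), ∫ X, φ (X + Y) • F X := by
    rw [← integral_integral_swap h1, ← integral_smul]
    congr 1
    ext X
    rw [avg, smul_assoc, integral_smul_const]
  rw [e1, integral_smul_avg h hφ hF]
  congr 1
  rw [← integral_indicator (measurableSet_box h _ _), ← integral_indicator (measurableSet_box h _ _),
    ← integral_neg_phase h]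
  congr 1
  ext Y
  have hY : -Y ∈ (lat Ψ ϖ d n : Set (Phase k d)) ↔ Y ∈ (lat Ψ ϖ d n : Set (Phase k d)) :=
    neg_mem_iff
  by_cases hY' : Y ∈ (lat Ψ ϖ d n : Set (Phase k d))
  · rw [Set.indicator_of_mem hY', Set.indicator_of_mem (hY.2 hY'),
      ← integral_add_right_eq_self _ Y]
    simp
  · rw [Set.indicator_of_notMem hY', Set.indicator_of_notMem (mt hY.1 hY')]

theorem avg_sub_fun (h : LocalChar Ψ ϖ) {f g : Phase k d → E} (hf : LocallyIntegrable f)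
    (hg : LocallyIntegrable g) (n : ℕ) (X : Phase k d) :
    avg Ψ ϖ n (fun Y => f Y - g Y) X = avg Ψ ϖ n f X - avg Ψ ϖ n g X := by
  unfold avg
  rw [integral_sub (integrableOn_translate h hf n X) (integrableOn_translate h hg n X), smul_sub]

theorem blk_add (h : LocalChar Ψ ϖ) {n : ℕ} (f : Phase k d → E) (X : Phase k d) {T : Phase k d}
    (hT : T ∈ lat Ψ ϖ d n) : blk Ψ ϖ n f (X + T) = blk Ψ ϖ n f X := by
  cases n with
  | zero => exact avg_add h f X hT
  | succ n => simp only [blk]; rw [avg_add h f X hT, avg_add h f X (lat_anti h n.le_succ hT)]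

theorem continuous_blk (h : LocalChar Ψ ϖ) (n : ℕ) (F : Phase k d → E) :
    Continuous (blk Ψ ϖ n F) :=
  continuous_of_invariant h fun X _ hT => blk_add h F X hT

theorem blk_congr {n : ℕ} {f g : Phase k d → E} (hfg : f =ᵐ[volume] g) :
    blk Ψ ϖ n f = blk Ψ ϖ n g := by
  cases n <;> simp only [blk] <;> simp only [avg_congr hfg]

theorem norm_blk_le (h : LocalChar Ψ ϖ) {n : ℕ} {f : Phase k d → E} {C : ℝ}
    (hf : ∀ᵐ X, ‖f X‖ ≤ C) (X : Phase k d) : ‖blk Ψ ϖ n f X‖ ≤ 2 * C := by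
  have hC : 0 ≤ C := (norm_nonneg _).trans (norm_avg_le h (n := 0) hf X)
  cases n with
  | zero => exact (norm_avg_le h hf X).trans (by linarith)
  | succ n =>
    refine (norm_sub_le _ _).trans ?_
    linarith [norm_avg_le h (n := n + 1) hf X, norm_avg_le h (n := n) hf X]

theorem avg_blk_of_le (h : LocalChar Ψ ϖ) {n m : ℕ} (hnm : n ≤ m) (f : Phase k d → E) :
    avg Ψ ϖ m (blk Ψ ϖ n f) = blk Ψ ϖ n f :=
  avg_of_invariant h fun X _ hT => blk_add h f X (lat_anti h hnm hT)

theorem avg_blk_of_lt (h : LocalChar Ψ ϖ) {n m : ℕ} (hnm : m < n) {f : Phase k d → E}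
    (hf : LocallyIntegrable f) (X : Phase k d) : avg Ψ ϖ m (blk Ψ ϖ n f) X = 0 := by
  cases n with
  | zero => omega
  | succ n =>
    simp only [blk]
    rw [avg_sub_fun h (continuous_avg h _ f).locallyIntegrable
      (continuous_avg h _ f).locallyIntegrable, avg_avg_of_le h hnm.le hf,
      avg_avg_of_le h (by omega) hf, sub_self]

/-- The blocks are mutually orthogonal projections: a block is fixed by finer averages and killed by
coarser ones. -/
theorem blk_blk (h : LocalChar Ψ ϖ) (m n : ℕ) {f : Phase k d → E}
    (hf : LocallyIntegrable f) (X : Phase k d) :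
    blk Ψ ϖ m (blk Ψ ϖ n f) X = if m = n then blk Ψ ϖ n f X else 0 := by
  cases m with
  | zero =>
    rw [blk_zero (blk Ψ ϖ n f)]
    rcases Nat.eq_zero_or_pos n with rfl | hn
    · rw [avg_blk_of_le h le_rfl, if_pos rfl]
    · rw [avg_blk_of_lt h hn hf, if_neg hn.ne]
  | succ m =>
    rw [blk_succ]
    rcases lt_trichotomy (m + 1) n with hn | rfl | hn
    · rw [avg_blk_of_lt h hn hf, avg_blk_of_lt h (by omega) hf, if_neg hn.ne, sub_zero]
    · rw [avg_blk_of_le h le_rfl, avg_blk_of_lt h (Nat.lt_succ_self m) hf, if_pos rfl, sub_zero]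
    · rw [avg_blk_of_le h hn.le, avg_blk_of_le h (by omega), if_neg hn.ne', sub_self]

/-- A function invariant under `lat n` has no frequencies beyond the level n. -/
theorem blk_of_invariant_of_lt (h : LocalChar Ψ ϖ) {m n : ℕ} (hnm : n < m) {f : Phase k d → E}
    (hf : ∀ X, ∀ T ∈ lat Ψ ϖ d n, f (X + T) = f X) (X : Phase k d) : blk Ψ ϖ m f X = 0 := by
  cases m with
  | zero => omega
  | succ m =>
    rw [blk_succ, avg_of_invariant h fun X T hT => hf X T (lat_anti h hnm.le hT),
      avg_of_invariant h fun X T hT => hf X T (lat_anti h (Nat.lt_succ_iff.1 hnm) hT), sub_self]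

theorem avg_hasSum (h : LocalChar Ψ ϖ) {ι : Type*} [Countable ι] {P : ι → Phase k d → E}
    {u : ι → ℝ} (hP : ∀ i, AEStronglyMeasurable (P i) volume) (hu : Summable u)
    (hPu : ∀ i X, ‖P i X‖ ≤ u i) (n : ℕ) (X : Phase k d) :
    HasSum (fun i => avg Ψ ϖ n (P i) X) (avg Ψ ϖ n (fun Y => ∑' i, P i Y) X) := by
  unfold avg
  refine HasSum.const_smul _ ?_
  have hfin : volume (lat Ψ ϖ d n : Set (Phase k d)) < ∞ := (lat_vol_ne_top h n).lt_top
  have hi : ∀ i, IntegrableOn (fun Y => P i (X + Y)) (lat Ψ ϖ d n : Set (Phase k d)) := fun i =>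
    integrableOn_translate h (locallyIntegrable_of_memLp_top
      (memLp_top_of_bound (hP i) _ (ae_of_all _ (hPu i)))) n X
  refine hasSum_integral_of_summable_integral_norm hi ?_
  refine Summable.of_nonneg_of_le (fun i => integral_nonneg fun _ => norm_nonneg _) (fun i => ?_)
    (hu.mul_right (volume.real (lat Ψ ϖ d n : Set (Phase k d))))
  have := setIntegral_mono_on (hi i).norm (integrableOn_const (C := u i) hfin.ne)
    (measurableSet_box h _ _) fun Y _ => hPu i (X + Y)
  rw [setIntegral_const, smul_eq_mul, mul_comm] at this
  exact this

theorem blk_hasSum (h : LocalChar Ψ ϖ) {ι : Type*} [Countable ι] {P : ι → Phase k d → E}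
    {u : ι → ℝ} (hP : ∀ i, AEStronglyMeasurable (P i) volume) (hu : Summable u)
    (hPu : ∀ i X, ‖P i X‖ ≤ u i) (n : ℕ) (X : Phase k d) :
    HasSum (fun i => blk Ψ ϖ n (P i) X) (blk Ψ ϖ n (fun Y => ∑' i, P i Y) X) := by
  cases n with
  | zero => exact avg_hasSum h hP hu hPu 0 X
  | succ n => exact (avg_hasSum h hP hu hPu (n + 1) X).sub (avg_hasSum h hP hu hPu n X)

theorem ae_eq_tsum_blk (h : LocalChar Ψ ϖ) {F : Phase k d → E} (hF : MemLp F ∞) {u : ℕ → ℝ}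
    (hu : Summable u) (hFu : ∀ n X, ‖blk Ψ ϖ n F X‖ ≤ u n) :
    F =ᵐ[volume] fun X => ∑' n, blk Ψ ϖ n F X := by
  refine ae_eq_of_tendsto_avg h hF fun X => ?_
  have h1 := (hu.of_norm_bounded (hFu · X)).hasSum.tendsto_sum_nat
  refine (h1.comp (tendsto_add_atTop_nat 1)).congr fun n => ?_
  exact sum_blk n F X

/-- The weighted averages `(1 - ρ) ∑ ρ^n E_n`. -/
theorem ae_eq_tsum_avg (h : LocalChar Ψ ϖ) {F G : Phase k d → E} (hF : MemLp F ∞)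
    (hG : MemLp G ∞) {ρ : ℝ} (hρ0 : 0 ≤ ρ) (hρ1 : ρ < 1)
    (hFG : ∀ n X, blk Ψ ϖ n F X = ρ ^ n • blk Ψ ϖ n G X) :
    F =ᵐ[volume] fun X => ∑' n, ((1 - ρ) * ρ ^ n) • avg Ψ ϖ n G X := by
  refine ae_eq_of_tendsto_avg h hF fun X => ?_
  set C := (eLpNorm G ∞ volume).toReal
  have hC : ∀ n, ‖avg Ψ ϖ n G X‖ ≤ C := fun n => norm_avg_le h (ae_norm_le_of_memLp_top hG) X
  have hs : Summable fun n : ℕ => ((1 - ρ) * ρ ^ n) * C :=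
    ((summable_geometric_of_lt_one hρ0 hρ1).mul_left _).mul_right _
  have h1 := (hs.of_norm_bounded (f := fun n => ((1 - ρ) * ρ ^ n) • avg Ψ ϖ n G X) fun n => by
    rw [norm_smul, Real.norm_of_nonneg (mul_nonneg (by linarith) (by positivity))]
    exact mul_le_mul_of_nonneg_left (hC n) (mul_nonneg (by linarith) (by positivity))
    ).hasSum.tendsto_sum_nat
  -- Abel summation of ∑ρʲ blk_j G: the average E_N F is the N-th partial sum of the new series plus
  -- the boundary term ρᴺE_N G, which tends to zero.
  have h2 : Tendsto (fun n => ρ ^ n • avg Ψ ϖ n G X) atTop (𝓝 0) := by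
    refine squeeze_zero_norm (a := fun n => ρ ^ n * C) (fun n => ?_)
      (by simpa using (tendsto_pow_atTop_nhds_zero_of_lt_one hρ0 hρ1).mul_const C)
    rw [norm_smul, Real.norm_of_nonneg (by positivity)]
    exact mul_le_mul_of_nonneg_left (hC n) (by positivity)
  have h3 := h1.add h2
  rw [add_zero] at h3
  refine h3.congr fun n => ?_
  induction n with
  | zero =>
    have := hFG 0 X
    rw [blk_zero, blk_zero, pow_zero, one_smul] at this
    simp [this]
  | succ n ih =>
    have := hFG (n + 1) X
    rw [blk_succ, blk_succ, sub_eq_iff_eq_add] at this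
    rw [Finset.sum_range_succ, this, ← ih]
    module

end Avg

/-! ### Symplectic Fourier transform and spectral decomposition of radial multipliers. -/

section Fourier
open Filter Topology

variable {k : Type*} [NontriviallyNormedField k] [IsUltrametricDist k] [ProperSpace k]
  [MeasureSpace k] [BorelSpace k] [(volume : Measure k).IsAddHaarMeasure]
  {d : ℕ} {Ψ : AddChar k Circle} {ϖ : k}

theorem integrable_mul_char (h : LocalChar Ψ ϖ) {g : Phase k d → ℂ} (hg : Integrable g)
    (κ : k) (X : Phase k d) : Integrable fun Y => g Y * (Ψ (κ * symp Y X) : ℂ) := by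
  refine hg.mul_bdd (c := 1) ?_ (ae_of_all _ fun Y => by simp)
  exact ((continuous_char_symp h κ).comp (Continuous.prodMk_left X)).aestronglyMeasurable

theorem continuous_sympFourier (h : LocalChar Ψ ϖ) {g : Phase k d → ℂ} (hg : Integrable g) :
    Continuous (sympFourier Ψ g) := by
  unfold sympFourier
  refine continuous_const.mul (continuous_of_dominated (bound := fun Y => ‖g Y‖)
    (fun X => (integrable_mul_char h hg 2 X).1) (fun X => ae_of_all _ fun Y => by simp) hg.norm
    (ae_of_all _ fun Y => continuous_const.mul ?_))
  exact (continuous_char_symp h 2).comp (Continuous.prodMk_right Y)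

theorem sympFourier_add (h : LocalChar Ψ ϖ) {f g : Phase k d → ℂ} (hf : Integrable f)
    (hg : Integrable g) (X : Phase k d) :
    sympFourier Ψ (fun Y => f Y + g Y) X = sympFourier Ψ f X + sympFourier Ψ g X := by
  simp only [sympFourier, add_mul]
  rw [integral_add (integrable_mul_char h hf 2 X) (integrable_mul_char h hg 2 X), mul_add]

theorem sympFourier_sub (h : LocalChar Ψ ϖ) {f g : Phase k d → ℂ} (hf : Integrable f)
    (hg : Integrable g) (X : Phase k d) :
    sympFourier Ψ (fun Y => f Y - g Y) X = sympFourier Ψ f X - sympFourier Ψ g X := by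
  simp only [sympFourier, sub_mul]
  rw [integral_sub (integrable_mul_char h hf 2 X) (integrable_mul_char h hg 2 X), mul_sub]

theorem sympFourier_const_mul (c : ℂ) (g : Phase k d → ℂ) (X : Phase k d) :
    sympFourier Ψ (fun Y => c * g Y) X = c * sympFourier Ψ g X := by
  simp only [sympFourier, mul_assoc]
  rw [integral_const_mul]
  ring

theorem two_pow_vol (h : LocalChar Ψ ϖ) (n : ℕ) :
    ‖(2 : k)‖ ^ d * ‖(2 : k)‖ ^ d * (‖(2 * ϖ ^ n)⁻¹‖ * ‖(2 * ϖ ^ n)⁻¹‖) ^ d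
      = (volume.real (lat Ψ ϖ d n : Set (Phase k d)))⁻¹ := by
  have h2 := norm_pos_iff.2 h.two_ne
  have hϖ := pow_pos h.unif_pos n
  rw [volume_real_box h, norm_inv, norm_mul, norm_pow, ← mul_pow, ← mul_pow, ← inv_pow]
  congr 1
  field_simp

/-- The average of a character over `lat n` is one if its frequency is in the dual lattice `dlat n`
and zero otherwise. -/
theorem avg_sympFourier (h : LocalChar Ψ ϖ) {g : Phase k d → ℂ} (hg : Integrable g) (n : ℕ)
    (X : Phase k d) : avg Ψ ϖ n (sympFourier Ψ g) X
      = sympFourier Ψ ((dlat Ψ ϖ d n : Set (Phase k d)).indicator g) X := by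
  classical
  have hv := lat_vol_pos (d := d) h n
  have hint : Integrable (Function.uncurry fun T Y : Phase k d =>
      g Y * (Ψ (2 * symp Y (X + T)) : ℂ))
      ((volume.restrict (lat Ψ ϖ d n : Set (Phase k d))).prod volume) := by
    haveI : IsFiniteMeasure (volume.restrict (lat Ψ ϖ d n : Set (Phase k d))) :=
      ⟨by simpa using (lat_vol_ne_top h n).lt_top⟩
    refine (hg.comp_snd (volume.restrict (lat Ψ ϖ d n : Set (Phase k d)))).mul_bdd (c := 1)
      ?_ (ae_of_all _ fun Y => by simp)
    exact ((continuous_char_symp h 2).comp (by fun_prop :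
      Continuous fun p : Phase k d × Phase k d => (p.2, X + p.1))).aestronglyMeasurable
  have key : ∀ Y : Phase k d, ∫ T in (lat Ψ ϖ d n : Set (Phase k d)),
      g Y * (Ψ (2 * symp Y (X + T)) : ℂ)
      = (volume.real (lat Ψ ϖ d n : Set (Phase k d)) : ℂ) *
        ((dlat Ψ ϖ d n : Set (Phase k d)).indicator g Y * (Ψ (2 * symp Y X) : ℂ)) := by
    intro Y
    have e : ∀ T, g Y * (Ψ (2 * symp Y (X + T)) : ℂ)
        = (g Y * (Ψ (2 * symp Y X) : ℂ)) * (Ψ (2 * symp T (-Y)) : ℂ) := fun T => by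
      rw [symp_add_right, mul_add, char_add, symp_neg_right, ← symp_swap, mul_assoc]
    simp_rw [e]
    rw [integral_const_mul, integral_box_char h h.two_ne (pow_unif_ne h n) (pow_unif_ne h n)]
    have hm : -Y ∈ box Ψ (2 * ϖ ^ n)⁻¹ (2 * ϖ ^ n)⁻¹ ↔ Y ∈ (dlat Ψ ϖ d n : Set (Phase k d)) :=
      neg_mem_iff
    by_cases hY : Y ∈ (dlat Ψ ϖ d n : Set (Phase k d))
    · rw [if_pos (hm.2 hY), Set.indicator_of_mem hY, volume_real_box h]; ring
    · rw [if_neg (mt hm.1 hY), Set.indicator_of_notMem hY]; ring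
  unfold avg sympFourier
  rw [integral_const_mul, integral_integral_swap hint]
  simp_rw [key]
  rw [integral_const_mul, Complex.real_smul, Complex.ofReal_inv]
  have : (volume.real (lat Ψ ϖ d n : Set (Phase k d)) : ℂ) ≠ 0 := by exact_mod_cast hv.ne'
  field_simp

/-- A truncated Fourier inversion: the transform of the indicator of `dlat n` is supported on `lat
n`, and `two_pow_vol` gives the normalization of an average. Because of the truncation no
integrability of 𝒢φ is required. -/
theorem avg_eq_sympFourier (h : LocalChar Ψ ϖ) {φ : Phase k d → ℂ} (hφ : Integrable φ) (n : ℕ)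
    (X : Phase k d) : avg Ψ ϖ n φ X
      = sympFourier Ψ ((dlat Ψ ϖ d n : Set (Phase k d)).indicator (sympFourier Ψ φ)) X := by
  classical
  have hms := measurableSet_box (d := d) h (2 * ϖ ^ n)⁻¹ (2 * ϖ ^ n)⁻¹
  have hfin : volume (dlat Ψ ϖ d n : Set (Phase k d)) < ∞ := by
    rw [volume_box h]; exact ENNReal.ofReal_lt_top
  have hint : Integrable (Function.uncurry fun Y Z : Phase k d =>
      (φ Z * (Ψ (2 * symp Z Y) : ℂ)) * (Ψ (2 * symp Y X) : ℂ))
      ((volume.restrict (dlat Ψ ϖ d n : Set (Phase k d))).prod volume) := by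
    haveI : IsFiniteMeasure (volume.restrict (dlat Ψ ϖ d n : Set (Phase k d))) :=
      ⟨by simpa using hfin⟩
    refine ((hφ.comp_snd (volume.restrict (dlat Ψ ϖ d n : Set (Phase k d)))).mul_bdd (c := 1)
      ?_ (ae_of_all _ fun Y => by simp)).mul_bdd (c := 1) ?_ (ae_of_all _ fun Y => by simp)
    · exact ((continuous_char_symp h 2).comp (by fun_prop :
        Continuous fun p : Phase k d × Phase k d => (p.2, p.1))).aestronglyMeasurable
    · exact ((continuous_char_symp h 2).comp (by fun_prop :
        Continuous fun p : Phase k d × Phase k d => (p.1, X))).aestronglyMeasurable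
  have key : ∀ Z : Phase k d, ∫ Y in (dlat Ψ ϖ d n : Set (Phase k d)),
      (φ Z * (Ψ (2 * symp Z Y) : ℂ)) * (Ψ (2 * symp Y X) : ℂ)
      = (((‖(2 * ϖ ^ n)⁻¹‖ * ‖(2 * ϖ ^ n)⁻¹‖) ^ d : ℝ) : ℂ) *
        ((lat Ψ ϖ d n : Set (Phase k d)).indicator (fun T => φ (X + T)) (Z - X)) := by
    intro Z
    have e : ∀ Y, (φ Z * (Ψ (2 * symp Z Y) : ℂ)) * (Ψ (2 * symp Y X) : ℂ)
        = φ Z * (Ψ (2 * symp Y (X - Z)) : ℂ) := fun Y => by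
      rw [symp_sub_right, mul_sub, sub_eq_neg_add, char_add, symp_swap Z Y, mul_neg, mul_assoc]
    simp_rw [e]
    rw [integral_const_mul, integral_box_char h h.two_ne (two_mul_unif_ne h n) (two_mul_unif_ne h n)]
    have hm : X - Z ∈ box Ψ (2 * (2 * ϖ ^ n)⁻¹)⁻¹ (2 * (2 * ϖ ^ n)⁻¹)⁻¹
        ↔ Z - X ∈ (lat Ψ ϖ d n : Set (Phase k d)) := by
      have : (2 * (2 * ϖ ^ n)⁻¹)⁻¹ = ϖ ^ n := by
        have := h.two_ne
        have := pow_unif_ne h n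
        field_simp
      rw [this, ← neg_sub Z X]
      exact neg_mem_iff
    by_cases hY : Z - X ∈ (lat Ψ ϖ d n : Set (Phase k d))
    · rw [if_pos (hm.2 hY), Set.indicator_of_mem hY, add_sub_cancel]; ring
    · rw [if_neg (mt hm.1 hY), Set.indicator_of_notMem hY]; ring
  have e2 : ∀ Y, (dlat Ψ ϖ d n : Set (Phase k d)).indicator (sympFourier Ψ φ) Y
      * (Ψ (2 * symp Y X) : ℂ) = (dlat Ψ ϖ d n : Set (Phase k d)).indicator
        (fun Y => ((‖(2 : k)‖ ^ d : ℝ) : ℂ) * ∫ Z, (φ Z * (Ψ (2 * symp Z Y) : ℂ)) *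
          (Ψ (2 * symp Y X) : ℂ)) Y := fun Y => by
    by_cases hY : Y ∈ (dlat Ψ ϖ d n : Set (Phase k d))
    · rw [Set.indicator_of_mem hY, Set.indicator_of_mem hY, sympFourier, integral_mul_const,
        mul_assoc]
    · rw [Set.indicator_of_notMem hY, Set.indicator_of_notMem hY, zero_mul]
  rw [sympFourier]
  simp_rw [e2]
  rw [integral_indicator hms, integral_const_mul, integral_integral_swap hint]
  simp_rw [key]
  rw [integral_const_mul,
    integral_sub_right_eq_self ((lat Ψ ϖ d n : Set (Phase k d)).indicator (fun T => φ (X + T))) X,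
    integral_indicator (measurableSet_box h _ _), avg, ← two_pow_vol h n, Complex.real_smul]
  push_cast
  ring

theorem dlat_indicator_succ (h : LocalChar Ψ ϖ) (n : ℕ) (g : Phase k d → ℂ) (Y : Phase k d) :
    (dlat Ψ ϖ d (n + 1) : Set (Phase k d)).indicator g Y
      - (dlat Ψ ϖ d n : Set (Phase k d)).indicator g Y = (shell Ψ ϖ d (n + 1)).indicator g Y := by
  rw [shell_succ h]
  by_cases h1 : Y ∈ (dlat Ψ ϖ d n : Set (Phase k d))
  · have h2 : Y ∈ (dlat Ψ ϖ d (n + 1) : Set (Phase k d)) := dlat_mono h n.le_succ h1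
    rw [Set.indicator_of_mem h1, Set.indicator_of_mem h2, Set.indicator_of_notMem, sub_self]
    exact fun hc => hc.2 h1
  · rw [Set.indicator_of_notMem h1, sub_zero]
    by_cases h2 : Y ∈ (dlat Ψ ϖ d (n + 1) : Set (Phase k d))
    · rw [Set.indicator_of_mem h2, Set.indicator_of_mem (Set.mem_sdiff _ |>.2 ⟨h2, h1⟩)]
    · rw [Set.indicator_of_notMem h2, Set.indicator_of_notMem fun hc => h2 hc.1]

theorem blk_sympFourier (h : LocalChar Ψ ϖ) {g : Phase k d → ℂ} (hg : Integrable g) (n : ℕ)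
    (X : Phase k d) : blk Ψ ϖ n (sympFourier Ψ g) X
      = sympFourier Ψ ((shell Ψ ϖ d n).indicator g) X := by
  have hms := measurableSet_box (d := d) h
  cases n with
  | zero => rw [blk_zero, avg_sympFourier h hg, shell_zero h]
  | succ n =>
    rw [blk_succ, avg_sympFourier h hg, avg_sympFourier h hg, ← sympFourier_sub h
      (hg.indicator (hms _ _)) (hg.indicator (hms _ _))]
    simp_rw [dlat_indicator_succ h]

theorem integrable_indicator_of_isCompact {g : Phase k d → ℂ} (hg : Continuous g)
    {s : Set (Phase k d)} (hs : IsCompact s) : Integrable (s.indicator g) :=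
  (integrable_indicator_iff hs.isClosed.measurableSet).2 (hg.continuousOn.integrableOn_compact hs)

theorem blk_eq_sympFourier (h : LocalChar Ψ ϖ) {φ : Phase k d → ℂ} (hφ : Integrable φ) (n : ℕ)
    (X : Phase k d) : blk Ψ ϖ n φ X
      = sympFourier Ψ ((shell Ψ ϖ d n).indicator (sympFourier Ψ φ)) X := by
  have hc := continuous_sympFourier h hφ
  cases n with
  | zero => rw [blk_zero, avg_eq_sympFourier h hφ, shell_zero h]
  | succ n =>
    rw [blk_succ, avg_eq_sympFourier h hφ, avg_eq_sympFourier h hφ, ← sympFourier_sub h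
      (integrable_indicator_of_isCompact hc (isCompact_box h _ _))
      (integrable_indicator_of_isCompact hc (isCompact_box h _ _))]
    simp_rw [dlat_indicator_succ h]

/-- A radial multiplier acts on blocks by scalars. -/
theorem blk_multOp (h : LocalChar Ψ ϖ) {φ : Phase k d → ℂ} (hφ : Integrable φ)
    {w : Phase k d → ℝ} (hw : Integrable fun X => (w X : ℂ) * sympFourier Ψ φ X) {n : ℕ} {v : ℝ}
    (hv : ∀ X ∈ shell Ψ ϖ d n, w X = v) (X : Phase k d) :
    blk Ψ ϖ n (multOp Ψ w φ) X = (v : ℂ) * blk Ψ ϖ n φ X := by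
  rw [multOp, blk_sympFourier h hw, blk_eq_sympFourier h hφ, ← sympFourier_const_mul]
  congr 1
  ext Y
  by_cases hY : Y ∈ shell Ψ ϖ d n
  · rw [Set.indicator_of_mem hY, Set.indicator_of_mem hY, hv Y hY]
  · rw [Set.indicator_of_notMem hY, Set.indicator_of_notMem hY, mul_zero]

theorem integrable_avg (h : LocalChar Ψ ϖ) {φ : Phase k d → ℂ} (hφ : Integrable φ) (n : ℕ) :
    Integrable (avg Ψ ϖ n φ) := by
  have h1 := (integrable_shear (integrable_indicator_lat (d := d) h n) hφ).integrableOn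
    (s := Set.univ ×ˢ (lat Ψ ϖ d n : Set (Phase k d)))
  have h3 := h1.congr_fun (g := Function.uncurry fun X Y : Phase k d => φ (X + Y)) (by
    rintro ⟨X, Y⟩ ⟨-, hY⟩
    simp only [Function.uncurry]
    rw [Set.indicator_of_mem hY, one_smul])
    (MeasurableSet.univ.prod (measurableSet_box h _ _))
  rw [IntegrableOn, ← Measure.prod_restrict, Measure.restrict_univ] at h3
  exact h3.integral_prod_left.smul _

theorem integrable_blk (h : LocalChar Ψ ϖ) {φ : Phase k d → ℂ} (hφ : Integrable φ) (n : ℕ) :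
    Integrable (blk Ψ ϖ n φ) := by
  cases n with
  | zero => exact integrable_avg h hφ 0
  | succ n => exact (integrable_avg h hφ (n + 1)).sub (integrable_avg h hφ n)

variable {E : Type*} [NormedAddCommGroup E] [NormedSpace ℂ E] [CompleteSpace E]

theorem integrable_smul_top {φ : Phase k d → ℂ} (hφ : Integrable φ) {F : Phase k d → E}
    (hF : MemLp F ∞) : Integrable fun X => φ X • F X := hφ.smul_of_top_left hF

theorem memLp_top_avg (h : LocalChar Ψ ϖ) {F : Phase k d → E} (hF : MemLp F ∞) (n : ℕ) :
    MemLp (avg Ψ ϖ n F) ∞ :=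
  memLp_top_of_bound (continuous_avg h n F).aestronglyMeasurable _
    (ae_of_all _ (norm_avg_le h (ae_norm_le_of_memLp_top hF)))

theorem memLp_top_blk (h : LocalChar Ψ ϖ) {F : Phase k d → E} (hF : MemLp F ∞) (n : ℕ) :
    MemLp (blk Ψ ϖ n F) ∞ :=
  memLp_top_of_bound (continuous_blk h n F).aestronglyMeasurable _
    (ae_of_all _ (norm_blk_le h (ae_norm_le_of_memLp_top hF)))

theorem integral_smul_blk_comm (h : LocalChar Ψ ϖ) {φ : Phase k d → ℂ} (hφ : Integrable φ)
    {F : Phase k d → E} (hF : MemLp F ∞) (n : ℕ) :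
    ∫ X, φ X • blk Ψ ϖ n F X = ∫ X, blk Ψ ϖ n φ X • F X := by
  cases n with
  | zero => exact integral_smul_avg_comm h hφ hF 0
  | succ n =>
    simp_rw [blk_succ, smul_sub, sub_smul]
    rw [integral_sub (integrable_smul_top hφ (memLp_top_avg h hF _))
      (integrable_smul_top hφ (memLp_top_avg h hF _)),
      integral_sub (integrable_smul_top (integrable_avg h hφ _) hF)
      (integrable_smul_top (integrable_avg h hφ _) hF), integral_smul_avg_comm h hφ hF,
      integral_smul_avg_comm h hφ hF]

/-- Criterion for a function to be the transform of another one. -/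
theorem integral_multOp_eq (h : LocalChar Ψ ϖ) {φ : Phase k d → ℂ} (hφ : Integrable φ)
    {w : Phase k d → ℝ} (hw : Integrable fun X => (w X : ℂ) * sympFourier Ψ φ X)
    (hwφ : Integrable (multOp Ψ w φ)) {v : ℕ → ℝ} (hv : ∀ n, ∀ X ∈ shell Ψ ϖ d n, w X = v n)
    {F G : Phase k d → E} (hF : MemLp F ∞) (hG : MemLp G ∞)
    (hFG : ∀ n X, blk Ψ ϖ n G X = (v n : ℂ) • blk Ψ ϖ n F X) :
    ∫ X, multOp Ψ w φ X • F X = ∫ X, φ X • G X := by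
  have key : ∀ n, ∫ X, multOp Ψ w φ X • blk Ψ ϖ n F X = ∫ X, φ X • blk Ψ ϖ n G X := fun n => by
    rw [integral_smul_blk_comm h hwφ hF]
    simp_rw [blk_multOp h hφ hw (hv n), hFG, mul_smul, smul_comm (φ _)]
    rw [integral_smul, integral_smul, integral_smul_blk_comm h hφ hF]
  -- Both pairings are weak limits of pairings with averages, which are finite sums of blocks; the
  -- blocks have just been compared.
  refine tendsto_nhds_unique ((tendsto_integral_smul_avg h hwφ hF).congr fun n => ?_)
    (tendsto_integral_smul_avg h hφ hG)
  simp_rw [← sum_blk, Finset.smul_sum]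
  rw [integral_finsetSum _ fun n _ => integrable_smul_top hwφ (memLp_top_blk h hF n),
    integral_finsetSum _ fun n _ => integrable_smul_top hφ (memLp_top_blk h hG n)]
  exact Finset.sum_congr rfl fun n _ => key n

/-! ### Test functions -/

/-- The normalized indicator function of `X₀ + lat n`. -/
def bump (Ψ : AddChar k Circle) (ϖ : k) (n : ℕ) (X₀ X : Phase k d) : ℂ :=
  (lat Ψ ϖ d n : Set (Phase k d)).indicator
    (fun _ => (((volume.real (lat Ψ ϖ d n : Set (Phase k d)))⁻¹ : ℝ) : ℂ)) (X - X₀)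

/-- The kernel of `blk n` at `X₀`. -/
def wavelet (Ψ : AddChar k Circle) (ϖ : k) : ℕ → Phase k d → Phase k d → ℂ
  | 0, X₀ => bump Ψ ϖ 0 X₀
  | n + 1, X₀ => fun X => bump Ψ ϖ (n + 1) X₀ X - bump Ψ ϖ n X₀ X

theorem bump_add (n : ℕ) (X₀ X : Phase k d) {T : Phase k d}
    (hT : T ∈ lat Ψ ϖ d n) : bump Ψ ϖ n X₀ (X + T) = bump Ψ ϖ n X₀ X := by
  unfold bump
  have hm : X + T - X₀ ∈ (lat Ψ ϖ d n : Set (Phase k d)) ↔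
      X - X₀ ∈ (lat Ψ ϖ d n : Set (Phase k d)) := by
    rw [add_sub_right_comm]; exact add_mem_cancel_right hT
  by_cases hX : X - X₀ ∈ (lat Ψ ϖ d n : Set (Phase k d))
  · rw [Set.indicator_of_mem hX, Set.indicator_of_mem (hm.2 hX)]
  · rw [Set.indicator_of_notMem hX, Set.indicator_of_notMem (mt hm.1 hX)]

theorem continuous_bump (h : LocalChar Ψ ϖ) (n : ℕ) (X₀ : Phase k d) :
    Continuous (bump Ψ ϖ n X₀) :=
  continuous_of_invariant h fun X _ hT => bump_add n X₀ X hT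

theorem hasCompactSupport_bump (h : LocalChar Ψ ϖ) (n : ℕ) (X₀ : Phase k d) :
    HasCompactSupport (bump Ψ ϖ n X₀) := by
  refine HasCompactSupport.intro ((isCompact_box h (ϖ ^ n) (ϖ ^ n)).image
    (continuous_add_const X₀)) fun X hX => ?_
  refine Set.indicator_of_notMem (fun hc => hX ⟨_, hc, by simp⟩) _

theorem continuous_wavelet (h : LocalChar Ψ ϖ) (n : ℕ) (X₀ : Phase k d) :
    Continuous (wavelet Ψ ϖ n X₀) := by
  cases n with
  | zero => exact continuous_bump h 0 X₀
  | succ n => exact (continuous_bump h _ X₀).sub (continuous_bump h _ X₀)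

theorem hasCompactSupport_wavelet (h : LocalChar Ψ ϖ) (n : ℕ) (X₀ : Phase k d) :
    HasCompactSupport (wavelet Ψ ϖ n X₀) := by
  cases n with
  | zero => exact hasCompactSupport_bump h 0 X₀
  | succ n =>
    exact (hasCompactSupport_bump h (n + 1) X₀).comp₂_left (hasCompactSupport_bump h n X₀)
      (m := fun a b : ℂ => a - b) (sub_zero 0)

theorem integrable_bump (h : LocalChar Ψ ϖ) (n : ℕ) (X₀ : Phase k d) :
    Integrable (bump Ψ ϖ n X₀) :=
  (continuous_bump h n X₀).integrable_of_hasCompactSupport (hasCompactSupport_bump h n X₀)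

theorem integral_bump_smul (h : LocalChar Ψ ϖ) (n : ℕ) (X₀ : Phase k d) (F : Phase k d → E) :
    ∫ X, bump Ψ ϖ n X₀ X • F X = avg Ψ ϖ n F X₀ := by
  rw [avg, ← integral_smul, ← integral_indicator (measurableSet_box h _ _),
    ← integral_add_left_eq_self (fun X => bump Ψ ϖ n X₀ X • F X) X₀]
  congr 1
  ext X
  rw [bump, add_sub_cancel_left]
  by_cases hX : X ∈ (lat Ψ ϖ d n : Set (Phase k d))
  · rw [Set.indicator_of_mem hX, Set.indicator_of_mem hX, Complex.coe_smul]
  · rw [Set.indicator_of_notMem hX, Set.indicator_of_notMem hX, zero_smul]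

theorem integral_wavelet_smul (h : LocalChar Ψ ϖ) (n : ℕ) (X₀ : Phase k d) {F : Phase k d → E}
    (hF : MemLp F ∞) : ∫ X, wavelet Ψ ϖ n X₀ X • F X = blk Ψ ϖ n F X₀ := by
  cases n with
  | zero => exact integral_bump_smul h 0 X₀ F
  | succ n =>
    simp only [wavelet, sub_smul]
    rw [integral_sub (integrable_smul_top (integrable_bump h _ _) hF)
      (integrable_smul_top (integrable_bump h _ _) hF), integral_bump_smul h,
      integral_bump_smul h, blk_succ]

theorem sympFourier_bump (h : LocalChar Ψ ϖ) (n : ℕ) (X₀ Y : Phase k d) :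
    sympFourier Ψ (bump Ψ ϖ n X₀) Y = (dlat Ψ ϖ d n : Set (Phase k d)).indicator
      (fun Y => ((‖(2 : k)‖ ^ d : ℝ) : ℂ) * (Ψ (2 * symp X₀ Y) : ℂ)) Y := by
  classical
  have hv : (volume.real (lat Ψ ϖ d n : Set (Phase k d)) : ℂ) ≠ 0 := by
    exact_mod_cast (lat_vol_pos h n).ne'
  have e := integral_bump_smul h n X₀ (fun X => (Ψ (2 * symp X Y) : ℂ))
  simp only [smul_eq_mul] at e
  rw [sympFourier, e, avg]
  simp_rw [symp_add_left, mul_add, char_add]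
  rw [integral_const_mul, integral_box_char h h.two_ne (pow_unif_ne h n) (pow_unif_ne h n),
    ← volume_real_box h, Complex.real_smul]
  by_cases hY : Y ∈ (dlat Ψ ϖ d n : Set (Phase k d))
  · rw [if_pos (show Y ∈ box Ψ (2 * ϖ ^ n)⁻¹ (2 * ϖ ^ n)⁻¹ from hY), Set.indicator_of_mem hY]
    push_cast
    field_simp
  · rw [if_neg (show ¬ Y ∈ box Ψ (2 * ϖ ^ n)⁻¹ (2 * ϖ ^ n)⁻¹ from hY),
      Set.indicator_of_notMem hY]
    simp

theorem sympFourier_indicator_char (h : LocalChar Ψ ϖ) (n : ℕ) (X₀ X : Phase k d) :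
    sympFourier Ψ ((dlat Ψ ϖ d n : Set (Phase k d)).indicator
      (fun Y => ((‖(2 : k)‖ ^ d : ℝ) : ℂ) * (Ψ (2 * symp X₀ Y) : ℂ))) X = bump Ψ ϖ n X₀ X := by
  classical
  have hm : X - X₀ ∈ box Ψ (2 * (2 * ϖ ^ n)⁻¹)⁻¹ (2 * (2 * ϖ ^ n)⁻¹)⁻¹
      ↔ X - X₀ ∈ (lat Ψ ϖ d n : Set (Phase k d)) := by
    have : (2 * (2 * ϖ ^ n)⁻¹)⁻¹ = ϖ ^ n := by
      have := h.two_ne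
      have := pow_unif_ne h n
      field_simp
    rw [this]; rfl
  have e : ∀ Y, (dlat Ψ ϖ d n : Set (Phase k d)).indicator
      (fun Y => ((‖(2 : k)‖ ^ d : ℝ) : ℂ) * (Ψ (2 * symp X₀ Y) : ℂ)) Y * (Ψ (2 * symp Y X) : ℂ)
      = (dlat Ψ ϖ d n : Set (Phase k d)).indicator
        (fun Y => ((‖(2 : k)‖ ^ d : ℝ) : ℂ) * (Ψ (2 * symp Y (X - X₀)) : ℂ)) Y := fun Y => by
    by_cases hY : Y ∈ (dlat Ψ ϖ d n : Set (Phase k d))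
    · rw [Set.indicator_of_mem hY, Set.indicator_of_mem hY, symp_sub_right, mul_sub,
        sub_eq_neg_add, char_add, symp_swap X₀ Y, mul_neg, mul_assoc]
    · rw [Set.indicator_of_notMem hY, Set.indicator_of_notMem hY, zero_mul]
  rw [sympFourier]
  simp_rw [e]
  rw [integral_indicator (measurableSet_box h _ _), integral_const_mul,
    integral_box_char h h.two_ne (two_mul_unif_ne h n) (two_mul_unif_ne h n), bump,
    ← two_pow_vol h n]
  by_cases hX : X - X₀ ∈ (lat Ψ ϖ d n : Set (Phase k d))
  · rw [if_pos (hm.2 hX), Set.indicator_of_mem hX]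
    push_cast
    ring
  · rw [if_neg (mt hm.1 hX), Set.indicator_of_notMem hX, mul_zero, mul_zero]

theorem integrable_dlat_char (h : LocalChar Ψ ϖ) (n : ℕ) (X₀ : Phase k d) :
    Integrable ((dlat Ψ ϖ d n : Set (Phase k d)).indicator
      (fun Y => ((‖(2 : k)‖ ^ d : ℝ) : ℂ) * (Ψ (2 * symp X₀ Y) : ℂ))) :=
  integrable_indicator_of_isCompact (continuous_const.mul
    ((continuous_char_symp h 2).comp (Continuous.prodMk_right X₀))) (isCompact_box h _ _)

/-- The difference of the two indicators of dual lattices is the indicator of one shell, so the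
wavelet has a single frequency level. -/
theorem sympFourier_wavelet (h : LocalChar Ψ ϖ) (n : ℕ) (X₀ Y : Phase k d) :
    sympFourier Ψ (wavelet Ψ ϖ n X₀) Y = (shell Ψ ϖ d n).indicator
      (fun Y => ((‖(2 : k)‖ ^ d : ℝ) : ℂ) * (Ψ (2 * symp X₀ Y) : ℂ)) Y := by
  cases n with
  | zero => rw [shell_zero h, ← sympFourier_bump h]; rfl
  | succ n =>
    simp only [wavelet]
    rw [sympFourier_sub h (integrable_bump h _ _) (integrable_bump h _ _), sympFourier_bump h,
      sympFourier_bump h, dlat_indicator_succ h]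

theorem sympFourier_shell_char (h : LocalChar Ψ ϖ) (n : ℕ) (X₀ X : Phase k d) :
    sympFourier Ψ ((shell Ψ ϖ d n).indicator
      (fun Y => ((‖(2 : k)‖ ^ d : ℝ) : ℂ) * (Ψ (2 * symp X₀ Y) : ℂ))) X
      = wavelet Ψ ϖ n X₀ X := by
  cases n with
  | zero => rw [shell_zero h, sympFourier_indicator_char h]; rfl
  | succ n =>
    rw [← funext (dlat_indicator_succ h n _), sympFourier_sub h (integrable_dlat_char h _ _)
      (integrable_dlat_char h _ _), sympFourier_indicator_char h, sympFourier_indicator_char h]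
    rfl

theorem integrable_shell_char (h : LocalChar Ψ ϖ) (n : ℕ) (X₀ : Phase k d) :
    Integrable ((shell Ψ ϖ d n).indicator
      (fun Y => ((‖(2 : k)‖ ^ d : ℝ) : ℂ) * (Ψ (2 * symp X₀ Y) : ℂ))) := by
  cases n with
  | zero => rw [shell_zero h]; exact integrable_dlat_char h _ _
  | succ n =>
    rw [← funext (dlat_indicator_succ h n _)]
    exact (integrable_dlat_char h _ _).sub (integrable_dlat_char h _ _)

theorem mul_shell_char {n : ℕ} {w : Phase k d → ℝ} {v : ℝ} (hv : ∀ X ∈ shell Ψ ϖ d n, w X = v)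
    (g : Phase k d → ℂ) (X : Phase k d) :
    (w X : ℂ) * (shell Ψ ϖ d n).indicator g X = (v : ℂ) * (shell Ψ ϖ d n).indicator g X := by
  by_cases hY : X ∈ shell Ψ ϖ d n
  · rw [hv X hY]
  · rw [Set.indicator_of_notMem hY, mul_zero, mul_zero]

/-- A radial weight is constant on the one shell that carries the transform of a wavelet, so
wavelets are eigenvectors. -/
theorem multOp_wavelet (h : LocalChar Ψ ϖ) {n : ℕ} {w : Phase k d → ℝ} {v : ℝ}
    (hv : ∀ X ∈ shell Ψ ϖ d n, w X = v) (X₀ X : Phase k d) :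
    multOp Ψ w (wavelet Ψ ϖ n X₀) X = (v : ℂ) * wavelet Ψ ϖ n X₀ X := by
  rw [multOp]
  simp_rw [sympFourier_wavelet h, mul_shell_char hv]
  rw [sympFourier_const_mul, sympFourier_shell_char h]

theorem shell_mu0_pow (m n : ℕ) : ∀ X ∈ shell Ψ ϖ d n, mu0 Ψ X ^ m = (‖ϖ‖⁻¹ ^ n) ^ m :=
  fun X hX => by rw [show mu0 Ψ X = _ from hX]

/-- Applying powers of J only multiplies a wavelet by scalars, and it is continuous with compact
support. These test functions suffice for everything: pairing F with the wavelet at X returns blk n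
F at X. -/
theorem isSchwartz_wavelet (h : LocalChar Ψ ϖ) (n : ℕ) (X₀ : Phase k d) :
    IsSchwartz Ψ (wavelet Ψ ϖ n X₀) := by
  have hc := continuous_wavelet h n X₀
  have hs := hasCompactSupport_wavelet h n X₀
  have hp : ∀ (p : ℝ≥0∞) (l m : ℕ), MemLp (fun X => ((mu0 Ψ X ^ l : ℝ) : ℂ)
      * multOp Ψ (fun T => mu0 Ψ T ^ m) (wavelet Ψ ϖ n X₀) X) p := by
    intro p l m
    simp_rw [multOp_wavelet h (shell_mu0_pow m n)]
    refine Continuous.memLp_of_hasCompactSupport ?_ ?_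
    · exact (Complex.continuous_ofReal.comp (continuous_mu0.pow l)).mul (continuous_const.mul hc)
    · exact (hs.mul_left).mul_left
  refine ⟨hc, hc.integrable_of_hasCompactSupport hs, fun m => ?_, hp 2, hp 1⟩
  simp_rw [sympFourier_wavelet h, mul_shell_char (shell_mu0_pow m n)]
  exact (integrable_shell_char h n X₀).const_mul _

end Fourier

/-! ### Symbols characterized by the decay of their blocks. -/

section Symbols
open Filter Topology

variable {k : Type*} [NontriviallyNormedField k] [IsUltrametricDist k] [ProperSpace k]
  [MeasureSpace k] [BorelSpace k] [(volume : Measure k).IsAddHaarMeasure]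
  {d : ℕ} {Ψ : AddChar k Circle} {ϖ : k}

theorem exists_norm_eq_pow (h : LocalChar Ψ ϖ) {t : k} (ht0 : t ≠ 0) (ht : ‖t‖ ≤ 1) :
    ∃ r : ℕ, ‖t‖ = ‖ϖ‖ ^ r := by
  classical
  have hpos := norm_pos_iff.2 ht0
  have hex : ∃ n : ℕ, ‖t⁻¹‖ ≤ ‖ϖ‖⁻¹ ^ n :=
    (pow_unbounded_of_one_lt _ (one_lt_q h)).imp fun n hn => hn.le
  obtain ⟨r, key⟩ : ∃ r : ℕ, ‖t⁻¹‖ = ‖ϖ‖⁻¹ ^ r := by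
    refine ⟨Nat.find hex, ?_⟩
    refine le_antisymm (Nat.find_spec hex) ?_
    rcases hn : Nat.find hex with _ | n
    · rw [pow_zero, norm_inv]; exact (one_le_inv₀ hpos).2 ht
    · exact q_pow_le_norm h (not_le.1 (Nat.find_min hex (m := n) (by omega)))
  rw [norm_inv, inv_pow] at key
  exact ⟨r, inv_injective key⟩

theorem mu0_smul {θ : k} (hθ : ‖θ‖ ≤ 1) (X : Phase k d) :
    mu0 Ψ (θ • X) = max 1 (‖θ‖ * mu0 Ψ X) := by
  simp only [mu0, Prod.smul_fst, Prod.smul_snd]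
  rw [smul_comm, smul_comm (2 : k) θ X.2, norm_smul, norm_smul θ, mul_div_assoc,
    mul_max_of_nonneg _ _ (norm_nonneg _), mul_max_of_nonneg _ _ (norm_nonneg _), mul_one,
    ← max_assoc, ← max_assoc, ← max_assoc, max_eq_left hθ, max_assoc]

/-- From μ₀(θX) = max(1, |θ|μ₀(X)) with |θ| = q⁻ʳ. The truncated subtraction n − r is exactly this
maximum with 1. -/
theorem shell_mu0_smul_pow (h : LocalChar Ψ ϖ) {θ : k} {r : ℕ} (hθ : ‖θ‖ = ‖ϖ‖ ^ r) (m n : ℕ) :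
    ∀ X ∈ shell Ψ ϖ d n, mu0 Ψ (θ • X) ^ m = (‖ϖ‖⁻¹ ^ (n - r)) ^ m := fun X hX => by
  have hϖ := h.unif_pos
  rw [mu0_smul (hθ.le.trans (pow_le_one₀ hϖ.le h.unif_lt.le)), show mu0 Ψ X = _ from hX, hθ]
  congr 1
  rcases le_total r n with hrn | hrn
  · obtain ⟨s, rfl⟩ := Nat.exists_eq_add_of_le hrn
    rw [Nat.add_sub_cancel_left, pow_add, ← mul_assoc, inv_pow, mul_inv_cancel₀ (by positivity),
      one_mul]
    exact max_eq_right (one_le_pow₀ (one_lt_q h).le)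
  · obtain ⟨s, rfl⟩ := Nat.exists_eq_add_of_le hrn
    rw [Nat.sub_eq_zero_of_le hrn, pow_zero, pow_add, mul_right_comm, inv_pow,
      mul_inv_cancel₀ (by positivity), one_mul]
    exact max_eq_left (pow_le_one₀ hϖ.le h.unif_lt.le)

theorem IsSchwartz.integrable_weight {φ : Phase k d → ℂ} (hφ : IsSchwartz Ψ φ) (m : ℕ) :
    Integrable fun X => ((mu0 Ψ X ^ m : ℝ) : ℂ) * sympFourier Ψ φ X := hφ.integrable_fourier m

theorem IsSchwartz.integrable_weight_dil {θ : k} (hθ : ‖θ‖ ≤ 1)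
    {φ : Phase k d → ℂ} (hφ : IsSchwartz Ψ φ) (m : ℕ) :
    Integrable fun X => ((mu0 Ψ (θ • X) ^ m : ℝ) : ℂ) * sympFourier Ψ φ X := by
  have h0 : Integrable (sympFourier Ψ φ) := by simpa using hφ.integrable_fourier 0
  refine (hφ.integrable_fourier m).mono ?_ (ae_of_all _ fun X => ?_)
  · exact ((Complex.continuous_ofReal.comp
      ((continuous_mu0.comp (continuous_const_smul θ)).pow m)).aestronglyMeasurable).mul h0.1
  · rw [norm_mul, norm_mul, Complex.norm_real, Complex.norm_real,
      Real.norm_of_nonneg (pow_nonneg (mu0_pos _).le _),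
      Real.norm_of_nonneg (pow_nonneg (mu0_pos _).le _)]
    refine mul_le_mul_of_nonneg_right (pow_le_pow_left₀ (mu0_pos _).le ?_ m) (norm_nonneg _)
    rw [mu0_smul hθ]
    exact max_le (one_le_mu0 X) (mul_le_of_le_one_left (mu0_pos X).le hθ)

theorem exists_shell (h : LocalChar Ψ ϖ) (X : Phase k d) : ∃ n, X ∈ shell Ψ ϖ d n :=
  exists_mu0_eq h X

theorem shell_disjoint (h : LocalChar Ψ ϖ) {m n : ℕ} {X : Phase k d} (hm : X ∈ shell Ψ ϖ d m)
    (hn : X ∈ shell Ψ ϖ d n) : m = n := by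
  have : ‖ϖ‖⁻¹ ^ m = ‖ϖ‖⁻¹ ^ n := (show mu0 Ψ X = _ from hm).symm.trans hn
  exact pow_right_injective₀ (inv_pos.2 h.unif_pos) (one_lt_q h).ne' this

/-- `J_θ^m φ` is integrable for Schwartz functions. -/
theorem IsSchwartz.integrable_multOp_dil (h : LocalChar Ψ ϖ) {θ : k} (hθ0 : θ ≠ 0)
    (hθ : ‖θ‖ ≤ 1) {φ : Phase k d → ℂ} (hφ : IsSchwartz Ψ φ) (m : ℕ) :
    Integrable (multOp Ψ (fun T => mu0 Ψ (θ • T) ^ m) φ) := by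
  obtain ⟨r, hr⟩ := exists_norm_eq_pow h hθ0 hθ
  set g := sympFourier Ψ φ with hg
  have hgc : Continuous g := continuous_sympFourier h hφ.integrable
  set c : ℕ → ℂ := fun j => 1 - (((‖ϖ‖ ^ r) ^ m * (‖ϖ‖⁻¹ ^ j) ^ m : ℝ) : ℂ) with hc
  have hI : ∀ j, Integrable ((shell Ψ ϖ d j).indicator g) := fun j => by
    have h0 : Integrable g := by simpa using hφ.integrable_fourier 0
    exact h0.indicator (measurableSet_shell j)
  -- The weight of J_θᵐ equals |θ|ᵐ times that of Jᵐ except on the shells j < r, where μ₀(θX) = 1; c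
  -- j is the correction there. So J_θᵐφ is a multiple of Jᵐφ plus finitely many blocks, all
  -- integrable.
  have hdec : ∀ X, ((mu0 Ψ (θ • X) ^ m : ℝ) : ℂ) * g X
      = ((((‖ϖ‖ ^ r) ^ m : ℝ) : ℂ) * (((mu0 Ψ X ^ m : ℝ) : ℂ) * g X))
        + ∑ j ∈ Finset.range r, c j * (shell Ψ ϖ d j).indicator g X := by
    intro X
    obtain ⟨n, hn⟩ := exists_shell h X
    have hs : ∀ j, c j * (shell Ψ ϖ d j).indicator g X = if j = n then c n * g X else 0 := by
      intro j
      split_ifs with hjn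
      · rw [hjn, Set.indicator_of_mem hn]
      · rw [Set.indicator_of_notMem fun hj => hjn (shell_disjoint h hj hn), mul_zero]
    simp_rw [hs]
    rw [Finset.sum_ite_eq', shell_mu0_smul_pow h hr m n X hn, shell_mu0_pow m n X hn]
    have hϖ := h.unif_pos.ne'
    split_ifs with hnr
    · rw [Finset.mem_range] at hnr
      rw [Nat.sub_eq_zero_of_le hnr.le, hc]
      push_cast
      ring
    · rw [Finset.mem_range, not_lt] at hnr
      obtain ⟨s, rfl⟩ := Nat.exists_eq_add_of_le hnr
      rw [Nat.add_sub_cancel_left, add_zero, ← mul_assoc, ← Complex.ofReal_mul, ← mul_pow, pow_add,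
        ← mul_assoc, ← mul_pow, mul_inv_cancel₀ hϖ, one_pow, one_mul]
  have e : multOp Ψ (fun T => mu0 Ψ (θ • T) ^ m) φ = fun X =>
      (((‖ϖ‖ ^ r) ^ m : ℝ) : ℂ) * multOp Ψ (fun T => mu0 Ψ T ^ m) φ X
        + ∑ j ∈ Finset.range r, c j * blk Ψ ϖ j φ X := by
    ext X
    rw [multOp]
    simp_rw [← hg, hdec]
    have hsum : ∀ s : Finset ℕ, Integrable (fun X => ∑ j ∈ s, c j * (shell Ψ ϖ d j).indicator g X)
        ∧ sympFourier Ψ (fun X => ∑ j ∈ s, c j * (shell Ψ ϖ d j).indicator g X) X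
          = ∑ j ∈ s, c j * blk Ψ ϖ j φ X := by
      intro s
      induction s using Finset.induction_on with
      | empty => simp [sympFourier]
      | insert a s has ih =>
        simp_rw [Finset.sum_insert has]
        refine ⟨((hI a).const_mul (c a)).add ih.1, ?_⟩
        rw [sympFourier_add h ((hI a).const_mul (c a)) ih.1, ih.2, sympFourier_const_mul,
          blk_eq_sympFourier h hφ.integrable]
    rw [sympFourier_add h ((hφ.integrable_fourier m).const_mul _) (hsum _).1, (hsum _).2,
      sympFourier_const_mul, multOp]
  rw [e]
  exact ((hφ.integrable_multOp m).const_mul _).add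
    (integrable_finsetSum _ fun j _ => (integrable_blk h hφ.integrable j).const_mul _)

variable {A : Type*} [NonUnitalCStarAlgebra A]

/-- The weight `w` is radial with values `v`, and acts on Schwartz functions. -/
structure IsWeight (Ψ : AddChar k Circle) (ϖ : k) (w : Phase k d → ℝ) (v : ℕ → ℝ) : Prop where
  eq_on : ∀ n, ∀ X ∈ shell Ψ ϖ d n, w X = v n
  integrable : ∀ φ, IsSchwartz Ψ φ → Integrable fun X => (w X : ℂ) * sympFourier Ψ φ X
  integrable_multOp : ∀ φ, IsSchwartz Ψ φ → Integrable (multOp Ψ w φ)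

theorem isWeight_pow (m : ℕ) :
    IsWeight (d := d) Ψ ϖ (fun T => mu0 Ψ T ^ m) fun n => (‖ϖ‖⁻¹ ^ n) ^ m :=
  ⟨shell_mu0_pow m, fun _ hφ => hφ.integrable_weight m, fun _ hφ => hφ.integrable_multOp m⟩

theorem isWeight_dil (h : LocalChar Ψ ϖ) {θ : k} (hθ0 : θ ≠ 0) {r : ℕ} (hr : ‖θ‖ = ‖ϖ‖ ^ r)
    (m : ℕ) :
    IsWeight (d := d) Ψ ϖ (fun T => mu0 Ψ (θ • T) ^ m) fun n => (‖ϖ‖⁻¹ ^ (n - r)) ^ m :=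
  have hθ : ‖θ‖ ≤ 1 := hr.le.trans (pow_le_one₀ h.unif_pos.le h.unif_lt.le)
  ⟨shell_mu0_smul_pow h hr m, fun _ hφ => hφ.integrable_weight_dil hθ m,
    fun _ hφ => hφ.integrable_multOp_dil h hθ0 hθ m⟩

/-- The transform by a radial weight multiplies the blocks by scalars. -/
theorem IsWeight.isMultOp_iff (h : LocalChar Ψ ϖ) {w : Phase k d → ℝ} {v : ℕ → ℝ}
    (hw : IsWeight Ψ ϖ w v) {F G : LInfty k d A} :
    IsMultOp Ψ w F G ↔ ∀ n X, blk Ψ ϖ n G X = (v n : ℂ) • blk Ψ ϖ n F X := by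
  constructor
  · intro hFG n X
    have := hFG _ (isSchwartz_wavelet h n X)
    simp_rw [multOp_wavelet h (hw.eq_on n), mul_smul] at this
    rwa [integral_smul, integral_wavelet_smul h n X (Lp.memLp F),
      integral_wavelet_smul h n X (Lp.memLp G), eq_comm] at this
  · intro hFG φ hφ
    exact integral_multOp_eq h hφ.integrable (hw.integrable φ hφ) (hw.integrable_multOp φ hφ)
      hw.eq_on (Lp.memLp F) (Lp.memLp G) hFG

theorem ae_norm_le_LInfty (F : LInfty k d A) : ∀ᵐ X, ‖F X‖ ≤ ‖F‖ := by
  simpa [Lp.norm_def] using ae_norm_le_of_memLp_top (Lp.memLp F)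

/-- Existence of the transform when the blocks decay. -/
theorem IsWeight.exists_isMultOp (h : LocalChar Ψ ϖ) {w : Phase k d → ℝ} {v : ℕ → ℝ}
    (hw : IsWeight Ψ ϖ w v) {F : LInfty k d A} {u : ℕ → ℝ} (hu : Summable u)
    (hF : ∀ n X, ‖(v n : ℂ) • blk Ψ ϖ n F X‖ ≤ u n) : ∃ G : LInfty k d A, IsMultOp Ψ w F G := by
  have hc : ∀ n, AEStronglyMeasurable (fun X => (v n : ℂ) • blk Ψ ϖ n F X) volume := fun n =>
    ((continuous_blk h n _).const_smul _).aestronglyMeasurable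
  have hs : ∀ X, Summable fun n => (v n : ℂ) • blk Ψ ϖ n F X := fun X =>
    hu.of_norm_bounded (hF · X)
  have hG : MemLp (fun X => ∑' n, (v n : ℂ) • blk Ψ ϖ n F X) ∞ := by
    refine memLp_top_of_bound (aestronglyMeasurable_of_tendsto_ae atTop
      (f := fun N X => ∑ n ∈ Finset.range N, (v n : ℂ) • blk Ψ ϖ n F X)
      (fun N => ?_) (ae_of_all _ fun X => (hs X).hasSum.tendsto_sum_nat)) (∑' n, u n)
      (ae_of_all _ fun X => tsum_of_norm_bounded hu.hasSum (hF · X))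
    exact Finset.aestronglyMeasurable_fun_sum _ fun n _ => hc n
  refine ⟨hG.toLp _, (hw.isMultOp_iff h).2 fun n X => ?_⟩
  rw [blk_congr hG.coeFn_toLp]
  -- By `blk_blk`, projecting the series on the n-th block keeps only its n-th term.
  have h1 := blk_hasSum h hc hu hF n X
  have h2 : ∀ j, blk Ψ ϖ n (fun X => (v j : ℂ) • blk Ψ ϖ j F X) X
      = if j = n then (v n : ℂ) • blk Ψ ϖ n F X else 0 := by
    intro j
    have h3 : blk Ψ ϖ n (fun X => (v j : ℂ) • blk Ψ ϖ j F X) X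
        = (v j : ℂ) • blk Ψ ϖ n (blk Ψ ϖ j F) X := by
      cases n with
      | zero => exact avg_smul _ _ _ _
      | succ n => rw [blk_succ, avg_smul, avg_smul, blk_succ n (blk Ψ ϖ j F), smul_sub]
    rw [h3, blk_blk h n j (locallyIntegrable_of_memLp_top (Lp.memLp F))]
    by_cases hjn : j = n
    · rw [if_pos hjn.symm, if_pos hjn, hjn]
    · rw [if_neg (Ne.symm hjn), if_neg hjn, smul_zero]
  simp_rw [h2] at h1
  exact h1.unique (by simpa using hasSum_ite_eq n ((v n : ℂ) • blk Ψ ϖ n F X))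

theorem isMultOp_applyMult {w : Phase k d → ℝ} {F : LInfty k d A}
    (hF : ∃ G : LInfty k d A, IsMultOp Ψ w F G) : IsMultOp Ψ w F (applyMult Ψ w F) := by
  rw [applyMult, dif_pos hF]
  exact hF.choose_spec

theorem blk_powJ (h : LocalChar Ψ ϖ) {F : LInfty k d A} (hF : F ∈ symbolSpace d A Ψ) (m n : ℕ)
    (X : Phase k d) :
    blk Ψ ϖ n (powJ Ψ m F) X = (((‖ϖ‖⁻¹ ^ n) ^ m : ℝ) : ℂ) • blk Ψ ϖ n F X :=
  ((isWeight_pow m).isMultOp_iff h).1 (isMultOp_applyMult (hF m)) n X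

theorem blk_eq_powJ (h : LocalChar Ψ ϖ) {F : LInfty k d A} (hF : F ∈ symbolSpace d A Ψ) (m n : ℕ)
    (X : Phase k d) :
    blk Ψ ϖ n F X = (‖ϖ‖ ^ m) ^ n • blk Ψ ϖ n (powJ Ψ m F) X := by
  rw [blk_powJ h hF, Complex.coe_smul, smul_smul, ← pow_mul, ← pow_mul, mul_comm n m, inv_pow,
    mul_inv_cancel₀ (pow_pos h.unif_pos _).ne', one_smul]

/-- Since Jᵐ acts on the n-th block by q^{nm}, boundedness of JᵐF forces the block of F to have size
O(q^{−nm}); the converse is `mem_symbolSpace_of_decay`. -/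
theorem norm_blk_le_powJ (h : LocalChar Ψ ϖ) {F : LInfty k d A} (hF : F ∈ symbolSpace d A Ψ)
    (m n : ℕ) (X : Phase k d) : ‖blk Ψ ϖ n F X‖ ≤ (‖ϖ‖ ^ m) ^ n * (2 * ‖powJ Ψ m F‖) := by
  have := h.unif_pos
  rw [blk_eq_powJ h hF m, norm_smul, Real.norm_of_nonneg (by positivity)]
  exact mul_le_mul_of_nonneg_left (norm_blk_le h (ae_norm_le_LInfty _) X) (by positivity)

theorem pow_unif_lt_one (h : LocalChar Ψ ϖ) (m : ℕ) : ‖ϖ‖ ^ (m + 1) < 1 :=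
  pow_lt_one₀ h.unif_pos.le h.unif_lt (Nat.succ_ne_zero m)

/-- The decay is asked with one power more than the weight consumes; the surplus makes the block
series geometric. -/
theorem exists_isMultOp_of_le (h : LocalChar Ψ ϖ) {F : LInfty k d A}
    {w : Phase k d → ℝ} {v : ℕ → ℝ} (hw : IsWeight Ψ ϖ w v) {m : ℕ}
    (hv : ∀ n, ‖v n‖ ≤ (‖ϖ‖⁻¹ ^ n) ^ m) {C : ℝ}
    (hF : ∀ n X, ‖blk Ψ ϖ n F X‖ ≤ (‖ϖ‖ ^ (m + 1)) ^ n * C) :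
    ∃ G : LInfty k d A, IsMultOp Ψ w F G := by
  have hϖ := h.unif_pos
  have hC : 0 ≤ C := by simpa using (norm_nonneg _).trans (hF 0 0)
  refine hw.exists_isMultOp h (u := fun n => ‖ϖ‖ ^ n * C)
    ((summable_geometric_of_lt_one hϖ.le h.unif_lt).mul_right _) fun n X => ?_
  rw [norm_smul, Complex.norm_real]
  calc _ ≤ (‖ϖ‖⁻¹ ^ n) ^ m * ((‖ϖ‖ ^ (m + 1)) ^ n * C) :=
        mul_le_mul (hv n) (hF n X) (norm_nonneg _) (by positivity)
    _ = ((‖ϖ‖⁻¹ * ‖ϖ‖) ^ n) ^ m * (‖ϖ‖ ^ n * C) := by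
        rw [mul_pow, mul_pow, pow_succ, mul_pow, ← pow_mul, ← pow_mul, ← pow_mul, mul_comm m n]; ring
    _ = _ := by rw [inv_mul_cancel₀ hϖ.ne', one_pow, one_pow, one_mul]

theorem mem_symbolSpace_of_decay (h : LocalChar Ψ ϖ) {F : LInfty k d A}
    (hF : ∀ m : ℕ, ∃ C : ℝ, ∀ n X, ‖blk Ψ ϖ n F X‖ ≤ (‖ϖ‖ ^ m) ^ n * C) :
    F ∈ symbolSpace d A Ψ := fun m => by
  obtain ⟨C, hC⟩ := hF (m + 1)
  refine exists_isMultOp_of_le h (isWeight_pow m) (m := m) (fun n => ?_) hC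
  have := h.unif_pos
  rw [Real.norm_of_nonneg (by positivity)]

theorem blk_powJdil (h : LocalChar Ψ ϖ) {θ : k} (hθ0 : θ ≠ 0) {r : ℕ} (hr : ‖θ‖ = ‖ϖ‖ ^ r)
    {F : LInfty k d A} (hF : F ∈ symbolSpace d A Ψ) (m n : ℕ) (X : Phase k d) :
    blk Ψ ϖ n (powJdil Ψ θ m F) X
      = (((‖ϖ‖⁻¹ ^ (n - r)) ^ m : ℝ) : ℂ) • blk Ψ ϖ n F X := by
  have hw := isWeight_dil (d := d) h hθ0 hr m
  refine (hw.isMultOp_iff h).1 (isMultOp_applyMult ?_) n X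
  refine exists_isMultOp_of_le h hw (m := m) (fun n => ?_) (norm_blk_le_powJ h hF (m + 1))
  have := h.unif_pos
  rw [Real.norm_of_nonneg (by positivity)]
  exact pow_le_pow_left₀ (by positivity)
    (pow_le_pow_right₀ (one_lt_q h).le (Nat.sub_le n r)) m

theorem LInfty_ext_of_blk (h : LocalChar Ψ ϖ) {F G : LInfty k d A}
    (hFG : ∀ n X, blk Ψ ϖ n F X = blk Ψ ϖ n G X) : F = G := by
  refine Lp.ext (ae_eq_of_avg_eq h (Lp.memLp F) (Lp.memLp G) fun n => ?_)
  ext X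
  rw [← sum_blk, ← sum_blk]
  exact Finset.sum_congr rfl fun j _ => hFG j X

theorem blk_add_LInfty (h : LocalChar Ψ ϖ) (F G : LInfty k d A) (n : ℕ) (X : Phase k d) :
    blk Ψ ϖ n (F + G : LInfty k d A) X = blk Ψ ϖ n F X + blk Ψ ϖ n G X := by
  have hF := locallyIntegrable_of_memLp_top (Lp.memLp F)
  have hG := locallyIntegrable_of_memLp_top (Lp.memLp G)
  rw [blk_congr (Lp.coeFn_add F G)]
  cases n with
  | zero => exact avg_add_fun h hF hG 0 X
  | succ n =>
    rw [blk_succ, blk_succ, blk_succ]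
    have e : (⇑F + ⇑G : Phase k d → A) = fun X => F X + G X := rfl
    rw [e, avg_add_fun h hF hG, avg_add_fun h hF hG]
    abel

theorem powJ_add (h : LocalChar Ψ ϖ) {F G : LInfty k d A} (hF : F ∈ symbolSpace d A Ψ)
    (hG : G ∈ symbolSpace d A Ψ) (m : ℕ) : powJ Ψ m (F + G) = powJ Ψ m F + powJ Ψ m G := by
  refine LInfty_ext_of_blk h fun n X => ?_
  rw [blk_powJ h (add_mem hF hG), blk_add_LInfty h, blk_add_LInfty h, blk_powJ h hF,
    blk_powJ h hG, smul_add]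

theorem powJ_zero (h : LocalChar Ψ ϖ) {F : LInfty k d A} (hF : F ∈ symbolSpace d A Ψ) :
    powJ Ψ 0 F = F :=
  LInfty_ext_of_blk h fun n X => by rw [blk_powJ h hF]; simp

theorem powJ_sub (h : LocalChar Ψ ϖ) {F G : LInfty k d A} (hF : F ∈ symbolSpace d A Ψ)
    (hG : G ∈ symbolSpace d A Ψ) (m : ℕ) : powJ Ψ m (F - G) = powJ Ψ m F - powJ Ψ m G := by
  rw [eq_sub_iff_add_eq, ← powJ_add h (sub_mem hF hG) hG, sub_add_cancel]

theorem avg_star (F : LInfty k d A) (n : ℕ) (X : Phase k d) :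
    avg Ψ ϖ n (fun Y => star (F Y)) X = star (avg Ψ ϖ n F X) := by
  unfold avg
  rw [star_smul, star_trivial]
  congr 1
  exact (starL' ℝ (A := A)).integral_comp_comm (fun Y => F (X + Y))

/-- The pointwise adjoint. -/
theorem exists_star (h : LocalChar Ψ ϖ) {F : LInfty k d A} (hF : F ∈ symbolSpace d A Ψ) :
    ∃ F' ∈ symbolSpace d A Ψ, ∀ᵐ X, (F' : LInfty k d A) X = star (F X) := by
  have hm : MemLp (fun X => star (F X)) ∞ :=
    ⟨continuous_star.comp_aestronglyMeasurable (Lp.memLp F).1, by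
      rw [eLpNorm_congr_norm_ae (g := F) (ae_of_all _ fun X => norm_star _)]
      exact (Lp.memLp F).2⟩
  refine ⟨hm.toLp _, mem_symbolSpace_of_decay h fun m => ⟨2 * ‖powJ Ψ m F‖, fun n X => ?_⟩,
    hm.coeFn_toLp⟩
  rw [blk_congr hm.coeFn_toLp]
  have : blk Ψ ϖ n (fun Y => star (F Y)) X = star (blk Ψ ϖ n F X) := by
    cases n with
    | zero => exact avg_star F 0 X
    | succ n => rw [blk_succ, avg_star, avg_star, blk_succ, star_sub]
  rw [this, norm_star]
  exact norm_blk_le_powJ h hF m n X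

end Symbols

/-! ### Explicit form of the Wigner functions. -/

section Wigner

open Filter Topology

variable {k : Type*} [NontriviallyNormedField k] [IsUltrametricDist k] [ProperSpace k]
  [MeasureSpace k] [BorelSpace k] [(volume : Measure k).IsAddHaarMeasure]
  {d : ℕ} {Ψ : AddChar k Circle} {ϖ : k}

theorem norm_sub_le_max_pi (x y : Fin d → k) : ‖x - y‖ ≤ max ‖x‖ ‖y‖ := by
  rw [sub_eq_add_neg, ← norm_neg y]
  exact IsUltrametricDist.norm_add_le_max _ _

theorem measurableSet_closedBall_pi (r : ℝ) :
    MeasurableSet (Metric.closedBall (0 : Fin d → k) r) :=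
  Metric.isClosed_closedBall.measurableSet

theorem continuous_char_dotProduct (h : LocalChar Ψ ϖ) :
    Continuous fun P : (Fin d → k) × (Fin d → k) => (Ψ (P.1 ⬝ᵥ P.2) : ℂ) := by
  have : Continuous fun P : (Fin d → k) × (Fin d → k) => P.1 ⬝ᵥ P.2 := by
    unfold dotProduct
    fun_prop
  exact continuous_subtype_val.comp (h.cont.comp this)

/-- Some coordinate of v is too large for the conductor, and a vector supported on this coordinate
detects it. -/
theorem LocalChar.exists_char_ne_one (h : LocalChar Ψ ϖ) {a : k} {v : Fin d → k}
    (hv : conductorAbs Ψ < ‖v‖ * ‖a‖) : ∃ T : Fin d → k, ‖T‖ ≤ ‖a‖ ∧ Ψ (v ⬝ᵥ T) ≠ 1 := by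
  have h0 : 0 < ‖v‖ * ‖a‖ := h.cond_pos.trans hv
  have ha : 0 < ‖a‖ := (norm_nonneg a).lt_of_ne fun h' => by simp [← h'] at h0
  have : ∃ i, conductorAbs Ψ < ‖v i‖ * ‖a‖ := by
    by_contra! hcon
    have h1 : ‖v‖ ≤ conductorAbs Ψ / ‖a‖ :=
      (pi_norm_le_iff_of_nonneg (div_nonneg h.cond_pos.le ha.le)).2 fun i =>
        (le_div_iff₀ ha).2 (hcon i)
    exact hv.not_ge ((le_div_iff₀ ha).1 h1)
  obtain ⟨i, hi⟩ := this
  rw [← norm_mul, ← not_le, ← h.cond_iff] at hi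
  push Not at hi
  obtain ⟨y, hy, hy1⟩ := hi
  refine ⟨Pi.single i (a * y), ?_, ?_⟩
  · rw [Pi.norm_single, norm_mul]
    exact mul_le_of_le_one_right ha.le hy
  · rwa [dotProduct_single, ← mul_assoc]

/-- The integral of a character over a ball. -/
theorem integral_closedBall_char (h : LocalChar Ψ ϖ) (a : k) (v : Fin d → k) :
    ∫ s in Metric.closedBall (0 : Fin d → k) ‖a‖, (Ψ (v ⬝ᵥ s) : ℂ)
      = {v : Fin d → k | ‖v‖ * ‖a‖ ≤ conductorAbs Ψ}.indicator
        (fun _ => ((volume.real (Metric.closedBall (0 : Fin d → k) ‖a‖) : ℝ) : ℂ)) v := by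
  by_cases hv : ‖v‖ * ‖a‖ ≤ conductorAbs Ψ
  · rw [Set.indicator_of_mem (by exact hv), setIntegral_congr_fun (g := fun _ => (1 : ℂ))
      (measurableSet_closedBall_pi _), setIntegral_const]
    · simp
    · intro s hs
      have : ‖v ⬝ᵥ s‖ ≤ conductorAbs Ψ := (norm_dotProduct_le v s).trans
        ((mul_le_mul_of_nonneg_left (by simpa using hs) (norm_nonneg _)).trans hv)
      simp [h.map_eq_one this]
  · rw [Set.indicator_of_notMem (by exact hv)]
    obtain ⟨T, hT, hT1⟩ := h.exists_char_ne_one (not_le.1 hv)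
    refine setIntegral_eq_zero_of_translate (measurableSet_closedBall_pi _) T
      (χ := Ψ (v ⬝ᵥ T)) (fun hc => hT1 (Subtype.ext hc)) (fun s => ?_) fun s _ => ?_
    · simp only [mem_closedBall_zero_iff]
      refine ⟨fun hs => ?_, fun hs => (IsUltrametricDist.norm_add_le_max _ _).trans (max_le hs hT)⟩
      have := (norm_sub_le_max_pi (s + T) T).trans (max_le hs hT)
      rwa [add_sub_cancel_right] at this
    · rw [dotProduct_add, char_add, smul_eq_mul, mul_comm]

theorem LocalChar.map_dotProduct_eq_one (h : LocalChar Ψ ϖ) {θ : k} (hθ0 : θ ≠ 0)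
    {a b : Fin d → k} (hb : ‖b‖ ≤ ‖θ‖ * conductorAbs Ψ) (ha : ‖a‖ ≤ 1) :
    Ψ (θ⁻¹ * (b ⬝ᵥ a)) = 1 := by
  refine h.map_eq_one ?_
  have hθ : 0 < ‖θ‖ := norm_pos_iff.2 hθ0
  rw [norm_mul, norm_inv, inv_mul_le_iff₀ hθ]
  refine (norm_dotProduct_le b a).trans ?_
  calc ‖b‖ * ‖a‖ ≤ (‖θ‖ * conductorAbs Ψ) * 1 :=
        mul_le_mul hb ha (norm_nonneg _) ((norm_nonneg _).trans hb)
    _ = _ := mul_one _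

theorem coherent_apply (θ : k) (X : Phase k d) (t : Fin d → k) :
    coherent Ψ θ X t
      = (Ψ (θ⁻¹ * (X.2 ⬝ᵥ (t - (2 : k)⁻¹ • X.1))) : ℂ) * vacuum k d (t - X.1) := rfl

theorem quantizer_apply (h : LocalChar Ψ ϖ) (θ : k) (Z : Phase k d) {E : Type*} [AddCommGroup E]
    [Module ℂ E] (φ : (Fin d → k) → E) (t : Fin d → k) :
    quantizer Ψ θ Z φ t
      = (Ψ (θ⁻¹ * (2 * (Z.2 ⬝ᵥ (t - Z.1)))) : ℂ) • φ ((2 : k) • Z.1 - t) := by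
  have h2 := h.two_ne
  have e1 : -(t - Z.1) - (-Z).1 = (2 : k) • Z.1 - t := by
    ext i
    simp only [Pi.sub_apply, Pi.neg_apply, Prod.fst_neg, Pi.smul_apply, smul_eq_mul]
    ring
  have e2 : θ⁻¹ * (Z.2 ⬝ᵥ (t - (2 : k)⁻¹ • Z.1))
      + θ⁻¹ * ((-Z).2 ⬝ᵥ (-(t - Z.1) - (2 : k)⁻¹ • (-Z).1))
      = θ⁻¹ * (2 * (Z.2 ⬝ᵥ (t - Z.1))) := by
    rw [← mul_add]
    congr 1
    simp only [dotProduct, Finset.mul_sum, ← Finset.sum_add_distrib]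
    refine Finset.sum_congr rfl fun i _ => ?_
    simp only [Pi.sub_apply, Pi.neg_apply, Prod.fst_neg, Prod.snd_neg, Pi.smul_apply, smul_eq_mul]
    field_simp
    ring
  simp only [quantizer, schrodinger]
  rw [e1, smul_smul, ← char_add, e2]

/-- The phase of the Wigner function. -/
def wexp (X Y Z : Phase k d) : k :=
  2⁻¹ * (X.2 ⬝ᵥ X.1) - 2 * (Z.2 ⬝ᵥ X.1) + 2 * (Z.2 ⬝ᵥ Z.1) - 2 * (Y.2 ⬝ᵥ Z.1) + Y.2 ⬝ᵥ X.1
    + 2⁻¹ * (Y.2 ⬝ᵥ Y.1)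

theorem vacuum_vol_pos :
    0 < volume.real (Metric.closedBall (0 : Fin d → k) 1) := by
  refine ENNReal.toReal_pos (Metric.measure_closedBall_pos _ _ one_pos).ne' ?_
  exact (isCompact_closedBall _ _).measure_lt_top.ne

/-- The reflection about Z moves the state at Y to one centred at 2Z − Y. Two balls of equal radius
are equal or disjoint, which gives the condition on positions; then a character remains to be
integrated over the unit ball, which gives the condition on momenta. -/
theorem wigner_eq (h : LocalChar Ψ ϖ) {θ : k} (hθ0 : θ ≠ 0) (X Y Z : Phase k d) :
    wigner Ψ θ X Y Z = (box (d := d) Ψ 1 θ : Set (Phase k d)).indicator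
      (fun _ => (Ψ (θ⁻¹ * wexp X Y Z) : ℂ)) (X + Y - (2 : k) • Z) := by
  have h2 := h.two_ne
  have hv := vacuum_vol_pos (k := k) (d := d)
  set v := volume.real (Metric.closedBall (0 : Fin d → k) 1) with hvdef
  have e0 : ∀ s : Fin d → k, coherent Ψ θ X (s + X.1)
        * conj (quantizer Ψ θ Z (coherent Ψ θ Y) (s + X.1))
      = (Metric.closedBall (0 : Fin d → k) 1).indicator (fun s =>
        (Metric.closedBall (0 : Fin d → k) 1).indicator (fun _ => ((v⁻¹ : ℝ) : ℂ)
          * Ψ (θ⁻¹ * wexp X Y Z)) (X.1 + Y.1 - (2 : k) • Z.1)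
          * Ψ ((θ⁻¹ • (X.2 + Y.2 - (2 : k) • Z.2)) ⬝ᵥ s)) s := by
    intro s
    rw [quantizer_apply h, smul_eq_mul, map_mul (starRingEnd ℂ), conj_char, coherent_apply, coherent_apply,
      map_mul (starRingEnd ℂ), conj_char, add_sub_cancel_right]
    by_cases hs : s ∈ Metric.closedBall (0 : Fin d → k) 1
    swap
    · simp [vacuum, hs]
    -- For s in the unit ball, adding s does not affect membership in this ball, so the second
    -- indicator function does not depend on s.
    have hmem : (2 : k) • Z.1 - (s + X.1) - Y.1 ∈ Metric.closedBall (0 : Fin d → k) 1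
        ↔ X.1 + Y.1 - (2 : k) • Z.1 ∈ Metric.closedBall (0 : Fin d → k) 1 := by
      simp only [mem_closedBall_zero_iff] at hs ⊢
      have e1 : (2 : k) • Z.1 - (s + X.1) - Y.1 = -(s + (X.1 + Y.1 - (2 : k) • Z.1)) := by abel
      rw [e1, norm_neg]
      constructor <;> intro hh
      · have := (norm_sub_le_max_pi (s + (X.1 + Y.1 - (2 : k) • Z.1)) s).trans (max_le hh hs)
        rwa [add_sub_cancel_left] at this
      · exact (IsUltrametricDist.norm_add_le_max _ _).trans (max_le hs hh)
    rw [Set.indicator_of_mem hs]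
    by_cases hm : X.1 + Y.1 - (2 : k) • Z.1 ∈ Metric.closedBall (0 : Fin d → k) 1
    swap
    · rw [Set.indicator_of_notMem hm]
      simp only [vacuum]
      rw [Set.indicator_of_notMem (fun h' => hm (hmem.1 h'))]
      simp
    simp only [vacuum]
    rw [Set.indicator_of_mem hm, Set.indicator_of_mem (hmem.2 hm), Set.indicator_of_mem hs,
      Complex.conj_ofReal]
    have e2 : θ⁻¹ * (X.2 ⬝ᵥ (s + X.1 - (2 : k)⁻¹ • X.1))
        + (-(θ⁻¹ * (2 * (Z.2 ⬝ᵥ (s + X.1 - Z.1))))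
          + -(θ⁻¹ * (Y.2 ⬝ᵥ ((2 : k) • Z.1 - (s + X.1) - (2 : k)⁻¹ • Y.1))))
        = θ⁻¹ * wexp X Y Z + (θ⁻¹ • (X.2 + Y.2 - (2 : k) • Z.2)) ⬝ᵥ s := by
      have e4 : X.2 ⬝ᵥ (s + X.1 - (2 : k)⁻¹ • X.1) - 2 * (Z.2 ⬝ᵥ (s + X.1 - Z.1))
          - Y.2 ⬝ᵥ ((2 : k) • Z.1 - (s + X.1) - (2 : k)⁻¹ • Y.1)
          = wexp X Y Z + (X.2 + Y.2 - (2 : k) • Z.2) ⬝ᵥ s := by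
        simp only [wexp, dotProduct, Finset.mul_sum, ← Finset.sum_add_distrib,
          ← Finset.sum_sub_distrib]
        refine Finset.sum_congr rfl fun i _ => ?_
        simp only [Pi.sub_apply, Pi.add_apply, Pi.smul_apply, smul_eq_mul]
        field_simp
        ring
      rw [smul_dotProduct, smul_eq_mul]
      linear_combination θ⁻¹ * e4
    have e3 : ((((√v)⁻¹ : ℝ)) : ℂ) * (((√v)⁻¹ : ℝ) : ℂ) = ((v⁻¹ : ℝ) : ℂ) := by
      rw [← Complex.ofReal_mul, ← mul_inv, Real.mul_self_sqrt hv.le]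
    have e5 := congrArg (fun x => (Ψ x : ℂ)) e2
    simp only [char_add] at e5
    rw [← hvdef, ← e3]
    linear_combination (((√v)⁻¹ : ℝ) : ℂ) * (((√v)⁻¹ : ℝ) : ℂ) * e5
  unfold wigner
  rw [← integral_add_right_eq_self _ X.1]
  simp_rw [e0]
  rw [integral_indicator (measurableSet_closedBall_pi 1), integral_const_mul,
    ← norm_one (α := k), integral_closedBall_char h]
  have hbox : X + Y - (2 : k) • Z ∈ (box (d := d) Ψ 1 θ : Set (Phase k d)) ↔
      (X.1 + Y.1 - (2 : k) • Z.1 ∈ Metric.closedBall (0 : Fin d → k) ‖(1 : k)‖ ∧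
        θ⁻¹ • (X.2 + Y.2 - (2 : k) • Z.2) ∈
          {v : Fin d → k | ‖v‖ * ‖(1 : k)‖ ≤ conductorAbs Ψ}) := by
    rw [SetLike.mem_coe, h.mem_box, mem_closedBall_zero_iff, Set.mem_ofPred_eq, norm_smul,
      norm_one, mul_one, norm_inv, inv_mul_le_iff₀ (norm_pos_iff.2 hθ0)]
    rfl
  by_cases hb : X + Y - (2 : k) • Z ∈ (box (d := d) Ψ 1 θ : Set (Phase k d))
  · rw [Set.indicator_of_mem hb, Set.indicator_of_mem (hbox.1 hb).1,
      Set.indicator_of_mem (hbox.1 hb).2]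
    rw [mul_right_comm, norm_one, ← Complex.ofReal_mul, inv_mul_cancel₀ hv.ne', Complex.ofReal_one,
      one_mul]
  · rw [Set.indicator_of_notMem hb]
    rw [hbox, not_and_or] at hb
    rcases hb with hb | hb <;> rw [Set.indicator_of_notMem hb] <;> simp

end Wigner

/-! ### Symmetries of Wigner functions and localization of matrix coefficients. -/

section WignerBounds

open Filter Topology

variable {k : Type*} [NontriviallyNormedField k] [IsUltrametricDist k] [ProperSpace k]
  [MeasureSpace k] [BorelSpace k] [(volume : Measure k).IsAddHaarMeasure]
  {d : ℕ} {Ψ : AddChar k Circle} {ϖ : k} {E : Type*} [NormedAddCommGroup E] [NormedSpace ℂ E]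
  [CompleteSpace E]

/-- Exchanging X and Y changes the sign of the phase up to a pairing of the components of X+Y−2Z, on
which Ψ is trivial when this vector lies in the support box. It amounts to the self-adjointness of
Ω_θ(Z). -/
theorem wigner_conj (h : LocalChar Ψ ϖ) {θ : k} (hθ0 : θ ≠ 0) (X Y Z : Phase k d) :
    conj (wigner Ψ θ X Y Z) = wigner Ψ θ Y X Z := by
  have h2 := h.two_ne
  rw [wigner_eq h hθ0, wigner_eq h hθ0, add_comm Y X]
  by_cases hb : X + Y - (2 : k) • Z ∈ (box (d := d) Ψ 1 θ : Set (Phase k d))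
  swap
  · simp [Set.indicator_of_notMem hb]
  rw [Set.indicator_of_mem hb, Set.indicator_of_mem hb, conj_char]
  have hb' := h.mem_box.1 hb
  rw [norm_one] at hb'
  have e1 := h.map_dotProduct_eq_one hθ0 hb'.2 hb'.1
  have e2 : θ⁻¹ * wexp Y X Z = -(θ⁻¹ * wexp X Y Z)
      + θ⁻¹ * ((X + Y - (2 : k) • Z).2 ⬝ᵥ (X + Y - (2 : k) • Z).1) := by
    rw [← mul_neg, ← mul_add]
    congr 1
    simp only [wexp, dotProduct, Finset.mul_sum, ← Finset.sum_add_distrib,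
      ← Finset.sum_sub_distrib, ← Finset.sum_neg_distrib]
    refine Finset.sum_congr rfl fun i _ => ?_
    simp only [Pi.sub_apply, Pi.add_apply, Pi.smul_apply, smul_eq_mul, Prod.fst_add, Prod.fst_sub,
      Prod.snd_add, Prod.snd_sub, Prod.smul_fst, Prod.smul_snd]
    field_simp
    ring
  rw [e2, char_add, e1]
  simp

theorem two_smul_mem_box (h : LocalChar Ψ ϖ) {a b : k} {T : Phase k d} (hT : T ∈ box Ψ a b) :
    (2 : k) • T ∈ box Ψ a b := by
  rw [h.mem_box] at hT ⊢
  rw [Prod.smul_fst, Prod.smul_snd, norm_smul, norm_smul]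
  exact ⟨(mul_le_of_le_one_left (norm_nonneg _) norm_two_le).trans hT.1,
    (mul_le_of_le_one_left (norm_nonneg _) norm_two_le).trans hT.2⟩

/-- The phase is quadratic in Z. For T in `box 1 θ` the support condition is unchanged, and the
terms pairing T with itself or with X+Y−2Z are trivial on the support, so only a symplectic
character is left. -/
theorem wigner_add (h : LocalChar Ψ ϖ) {θ : k} (hθ0 : θ ≠ 0) (X Y Z : Phase k d)
    {T : Phase k d} (hT : T ∈ box Ψ 1 θ) :
    wigner Ψ θ X Y (Z + T) = Ψ (θ⁻¹ * symp T (Y - X)) * wigner Ψ θ X Y Z := by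
  have h2 := h.two_ne
  have e0 : X + Y - (2 : k) • (Z + T) = X + Y - (2 : k) • Z - (2 : k) • T := by
    rw [smul_add, sub_add_eq_sub_sub]
  rw [wigner_eq h hθ0, wigner_eq h hθ0, e0]
  by_cases hb : X + Y - (2 : k) • Z ∈ (box (d := d) Ψ 1 θ : Set (Phase k d))
  swap
  · rw [Set.indicator_of_notMem hb, Set.indicator_of_notMem, mul_zero]
    exact fun h' => hb (by simpa using add_mem h' (two_smul_mem_box h hT))
  rw [Set.indicator_of_mem hb, Set.indicator_of_mem (sub_mem hb (two_smul_mem_box h hT))]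
  have hb' := h.mem_box.1 hb
  have hT' := h.mem_box.1 hT
  rw [norm_one] at hb' hT'
  have e1 := h.map_dotProduct_eq_one hθ0 hT'.2 hT'.1
  have e2 := h.map_dotProduct_eq_one hθ0 hT'.2 hb'.1
  have e3 := h.map_dotProduct_eq_one hθ0 hb'.2 hT'.1
  have e4 : θ⁻¹ * wexp X Y (Z + T) + (θ⁻¹ * (T.2 ⬝ᵥ (X + Y - (2 : k) • Z).1)
      + θ⁻¹ * ((X + Y - (2 : k) • Z).2 ⬝ᵥ T.1))
      = θ⁻¹ * symp T (Y - X) + θ⁻¹ * wexp X Y Z + (θ⁻¹ * (T.2 ⬝ᵥ T.1) + θ⁻¹ * (T.2 ⬝ᵥ T.1)) := by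
    simp only [← mul_add]
    congr 1
    simp only [wexp, symp, dotProduct, Finset.mul_sum, ← Finset.sum_add_distrib,
      ← Finset.sum_sub_distrib]
    refine Finset.sum_congr rfl fun i _ => ?_
    simp only [Pi.sub_apply, Pi.add_apply, Pi.smul_apply, smul_eq_mul, Prod.fst_add, Prod.fst_sub,
      Prod.snd_add, Prod.snd_sub, Prod.smul_fst, Prod.smul_snd]
    field_simp
    ring
  have e5 := congrArg (fun x => (Ψ x : ℂ)) e4
  simp only [char_add, e1, e2, e3, Circle.coe_one, mul_one] at e5
  exact e5

theorem vacuum_add {s t : Fin d → k} (ht : ‖t‖ ≤ 1) :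
    vacuum k d (s + t) = vacuum k d s := by
  have : s + t ∈ Metric.closedBall (0 : Fin d → k) 1 ↔ s ∈ Metric.closedBall (0 : Fin d → k) 1 := by
    simp only [mem_closedBall_zero_iff]
    refine ⟨fun hh => ?_, fun hh => (IsUltrametricDist.norm_add_le_max _ _).trans (max_le hh ht)⟩
    have := (norm_sub_le_max_pi (s + t) t).trans (max_le hh ht)
    rwa [add_sub_cancel_right] at this
  unfold vacuum
  by_cases hs : s ∈ Metric.closedBall (0 : Fin d → k) 1
  · rw [Set.indicator_of_mem hs, Set.indicator_of_mem (this.2 hs)]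
  · rw [Set.indicator_of_notMem hs, Set.indicator_of_notMem (fun h' => hs (this.1 h'))]

theorem norm_le_one_of_vacuum_ne_zero {t : Fin d → k} (ht : vacuum k d t ≠ 0) : ‖t‖ ≤ 1 := by
  by_contra hn
  exact ht (Set.indicator_of_notMem (by simpa using hn) _)

/-- Coherent states depend, up to a phase, on the class modulo the lattice `box 1 θ`. -/
theorem coherent_add (h : LocalChar Ψ ϖ) {θ : k} (hθ0 : θ ≠ 0) (X : Phase k d)
    {T : Phase k d} (hT : T ∈ box Ψ 1 θ) :
    ∃ c : ℂ, ‖c‖ = 1 ∧ ∀ t, coherent Ψ θ (X + T) t = c * coherent Ψ θ X t := by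
  have h2 := h.two_ne
  have hT' := h.mem_box.1 hT
  rw [norm_one] at hT'
  refine ⟨Ψ (θ⁻¹ * (2⁻¹ * (T.2 ⬝ᵥ X.1) - 2⁻¹ * (X.2 ⬝ᵥ T.1) - 2⁻¹ * (T.2 ⬝ᵥ T.1))), norm_char _,
    fun t => ?_⟩
  have e0 : t - (X + T).1 = t - X.1 + -T.1 := by
    rw [Prod.fst_add]
    abel
  rw [coherent_apply, coherent_apply, e0, vacuum_add (by simpa using hT'.1)]
  by_cases hv : vacuum k d (t - X.1) = 0
  · simp [hv]
  have e1 := h.map_dotProduct_eq_one hθ0 hT'.2 (norm_le_one_of_vacuum_ne_zero hv)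
  have e2 : θ⁻¹ * ((X + T).2 ⬝ᵥ (t - (2 : k)⁻¹ • (X + T).1))
      = θ⁻¹ * (2⁻¹ * (T.2 ⬝ᵥ X.1) - 2⁻¹ * (X.2 ⬝ᵥ T.1) - 2⁻¹ * (T.2 ⬝ᵥ T.1))
        + θ⁻¹ * (X.2 ⬝ᵥ (t - (2 : k)⁻¹ • X.1)) + θ⁻¹ * (T.2 ⬝ᵥ (t - X.1)) := by
    simp only [← mul_add]
    congr 1
    simp only [dotProduct, Finset.mul_sum, ← Finset.sum_add_distrib, ← Finset.sum_sub_distrib]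
    refine Finset.sum_congr rfl fun i _ => ?_
    simp only [Pi.sub_apply, Pi.add_apply, Pi.smul_apply, smul_eq_mul, Prod.fst_add,
      Prod.snd_add]
    field_simp
    ring
  rw [e2, char_add, char_add, e1]
  simp only [Circle.coe_one, mul_one]
  ring

/-- Either the positions differ by more than one and the supports are disjoint, or the momenta
differ enough for the character on the common ball to be non-trivial. -/
theorem integral_conj_coherent_mul (h : LocalChar Ψ ϖ) {θ : k} (hθ0 : θ ≠ 0)
    {X Y : Phase k d} (hXY : X - Y ∉ box Ψ 1 θ) :
    ∫ s, conj (coherent Ψ θ X s) * coherent Ψ θ Y s = 0 := by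
  rw [← integral_add_right_eq_self _ Y.1]
  have hXY' : ‖Y.1 - X.1‖ ≤ 1 → ¬ ‖θ⁻¹ • (Y.2 - X.2)‖ * ‖(1 : k)‖ ≤ conductorAbs Ψ := by
    intro h1 h3
    refine hXY (h.mem_box.2 ⟨?_, ?_⟩)
    · rwa [norm_one, Prod.fst_sub, norm_sub_rev]
    · rwa [norm_smul, norm_one, mul_one, norm_inv, inv_mul_le_iff₀ (norm_pos_iff.2 hθ0),
        norm_sub_rev] at h3
  have e0 : ∀ s : Fin d → k, conj (coherent Ψ θ X (s + Y.1)) * coherent Ψ θ Y (s + Y.1)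
      = (Metric.closedBall (0 : Fin d → k) ‖(1 : k)‖).indicator (fun s =>
        (conj (vacuum k d (Y.1 - X.1)) * vacuum k d 0
          * Ψ (θ⁻¹ * (Y.2 ⬝ᵥ (Y.1 - (2 : k)⁻¹ • Y.1) - X.2 ⬝ᵥ (Y.1 - (2 : k)⁻¹ • X.1))))
          * Ψ ((θ⁻¹ • (Y.2 - X.2)) ⬝ᵥ s)) s := by
    intro s
    rw [coherent_apply, coherent_apply, map_mul (starRingEnd ℂ), conj_char, add_sub_cancel_right,
      norm_one]
    by_cases hs : s ∈ Metric.closedBall (0 : Fin d → k) 1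
    swap
    · simp [vacuum, hs]
    rw [Set.indicator_of_mem hs]
    rw [mem_closedBall_zero_iff] at hs
    rw [show s + Y.1 - X.1 = Y.1 - X.1 + s by abel, vacuum_add hs,
      ← vacuum_add (s := (0 : Fin d → k)) hs, zero_add]
    have e2 : -(θ⁻¹ * (X.2 ⬝ᵥ (s + Y.1 - (2 : k)⁻¹ • X.1)))
        + θ⁻¹ * (Y.2 ⬝ᵥ (s + Y.1 - (2 : k)⁻¹ • Y.1))
        = θ⁻¹ * (Y.2 ⬝ᵥ (Y.1 - (2 : k)⁻¹ • Y.1) - X.2 ⬝ᵥ (Y.1 - (2 : k)⁻¹ • X.1))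
          + (θ⁻¹ • (Y.2 - X.2)) ⬝ᵥ s := by
      simp only [smul_dotProduct, dotProduct_add, dotProduct_sub, sub_dotProduct, smul_eq_mul]
      ring
    have e5 := congrArg (fun x => (Ψ x : ℂ)) e2
    simp only [char_add] at e5
    linear_combination conj (vacuum k d (Y.1 - X.1)) * vacuum k d s * e5
  simp_rw [e0]
  rw [integral_indicator (measurableSet_closedBall_pi _), integral_const_mul,
    integral_closedBall_char h]
  by_cases h1 : vacuum k d (Y.1 - X.1) = 0
  · simp [h1]
  · rw [Set.indicator_of_notMem (by exact hXY' (norm_le_one_of_vacuum_ne_zero h1)), mul_zero]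

theorem norm_coherent (θ : k) (X : Phase k d) (t : Fin d → k) :
    ‖coherent Ψ θ X t‖ = ‖vacuum k d (t - X.1)‖ := by
  rw [coherent_apply, norm_mul, norm_char, one_mul]

theorem norm_vacuum_sq (t : Fin d → k) :
    ‖vacuum k d t‖ ^ 2 = (Metric.closedBall (0 : Fin d → k) 1).indicator
      (fun _ => (volume.real (Metric.closedBall (0 : Fin d → k) 1))⁻¹) t := by
  unfold vacuum
  by_cases ht : t ∈ Metric.closedBall (0 : Fin d → k) 1
  · rw [Set.indicator_of_mem ht, Set.indicator_of_mem ht, Complex.norm_real, Real.norm_eq_abs,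
      sq_abs, inv_pow, Real.sq_sqrt measureReal_nonneg]
  · rw [Set.indicator_of_notMem ht, Set.indicator_of_notMem ht]
    simp

theorem integral_conj_coherent_mul_self (θ : k) (X : Phase k d) :
    ∫ s, conj (coherent Ψ θ X s) * coherent Ψ θ X s = 1 := by
  rw [← integral_add_right_eq_self _ X.1]
  have : ∀ s : Fin d → k, conj (coherent Ψ θ X (s + X.1)) * coherent Ψ θ X (s + X.1)
      = (Metric.closedBall (0 : Fin d → k) 1).indicator
      (fun _ => (((volume.real (Metric.closedBall (0 : Fin d → k) 1))⁻¹ : ℝ) : ℂ)) s := by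
    intro s
    rw [Complex.conj_mul', norm_coherent, add_sub_cancel_right, ← Complex.ofReal_pow,
      norm_vacuum_sq]
    exact (Set.indicator_comp_of_zero (g := Complex.ofReal) Complex.ofReal_zero).symm ▸ rfl
  simp_rw [this]
  rw [integral_indicator (measurableSet_closedBall_pi 1), setIntegral_const, Complex.real_smul,
    ← Complex.ofReal_mul, mul_inv_cancel₀ vacuum_vol_pos.ne', Complex.ofReal_one]

theorem measurable_vacuum : Measurable (vacuum k d) :=
  measurable_const.indicator (measurableSet_closedBall_pi 1)

theorem measurable_coherent (h : LocalChar Ψ ϖ) (θ : k) :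
    Measurable fun P : Phase k d × (Fin d → k) => coherent Ψ θ P.1 P.2 := by
  simp_rw [coherent_apply]
  refine Measurable.mul ?_ (measurable_vacuum.comp (by fun_prop))
  have : Continuous fun P : Phase k d × (Fin d → k) =>
      (Ψ ((θ⁻¹ • P.1.2) ⬝ᵥ (P.2 - (2 : k)⁻¹ • P.1.1)) : ℂ) :=
    (continuous_char_dotProduct h).comp (f := fun P : Phase k d × (Fin d → k) =>
      (θ⁻¹ • P.1.2, P.2 - (2 : k)⁻¹ • P.1.1)) (by fun_prop)
  simp_rw [smul_dotProduct, smul_eq_mul] at this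
  exact this.measurable

theorem measurable_wigner (h : LocalChar Ψ ϖ) {θ : k} (hθ0 : θ ≠ 0) :
    Measurable fun P : (Phase k d × Phase k d) × Phase k d => wigner Ψ θ P.1.1 P.1.2 P.2 := by
  have e : (fun P : (Phase k d × Phase k d) × Phase k d => wigner Ψ θ P.1.1 P.1.2 P.2)
      = {P : (Phase k d × Phase k d) × Phase k d |
          P.1.1 + P.1.2 - (2 : k) • P.2 ∈ (box (d := d) Ψ 1 θ : Set (Phase k d))}.indicator
        fun P => (Ψ (θ⁻¹ * wexp P.1.1 P.1.2 P.2) : ℂ) := by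
    funext P
    rw [wigner_eq h hθ0]
    by_cases hb : P.1.1 + P.1.2 - (2 : k) • P.2 ∈ (box (d := d) Ψ 1 θ : Set (Phase k d))
    · rw [Set.indicator_of_mem hb, Set.indicator_of_mem (by exact hb)]
    · rw [Set.indicator_of_notMem hb, Set.indicator_of_notMem (by exact hb)]
  rw [e]
  refine Measurable.indicator ?_ ?_
  · refine (continuous_subtype_val.comp (h.cont.comp ?_)).measurable
    unfold wexp dotProduct
    fun_prop
  · refine measurableSet_preimage (f := fun P : (Phase k d × Phase k d) × Phase k d =>
      P.1.1 + P.1.2 - (2 : k) • P.2) ?_ (measurableSet_box h 1 θ)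
    fun_prop

theorem norm_wigner (h : LocalChar Ψ ϖ) {θ : k} (hθ0 : θ ≠ 0) (X Y Z : Phase k d) :
    ‖wigner Ψ θ X Y Z‖ = (box (d := d) Ψ 1 θ : Set (Phase k d)).indicator
      (fun _ => (1 : ℝ)) (X + Y - (2 : k) • Z) := by
  rw [wigner_eq h hθ0, norm_indicator_eq_indicator_norm]
  simp

theorem norm_wigner_le_one (h : LocalChar Ψ ϖ) {θ : k} (hθ0 : θ ≠ 0) (X Y Z : Phase k d) :
    ‖wigner Ψ θ X Y Z‖ ≤ 1 := by
  rw [norm_wigner h hθ0]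
  exact Set.indicator_le_self' (fun _ _ => zero_le_one) _

theorem integral_sub_two_smul (h : LocalChar Ψ ϖ) (X : Phase k d) {F : Type*}
    [NormedAddCommGroup F] [NormedSpace ℝ F] (f : Phase k d → F) :
    ∫ Z, f (X - (2 : k) • Z) = ((‖(2 : k)‖ * ‖(2 : k)‖) ^ d)⁻¹ • ∫ Z, f Z := by
  have h2 := neg_ne_zero.2 h.two_ne
  have h1 := integral_scale h h2 h2 (fun Z : Phase k d => f (X + Z))
  rw [integral_add_left_eq_self f X, norm_neg] at h1
  rw [← h1]
  refine integral_congr_ae (ae_of_all _ fun Z => ?_)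
  dsimp only
  congr 1
  rw [sub_eq_add_neg, ← neg_smul]
  rfl

theorem integrable_sub_two_smul (h : LocalChar Ψ ϖ) (X : Phase k d) {F : Type*}
    [NormedAddCommGroup F] {f : Phase k d → F} (hf : Integrable f) :
    Integrable fun Z => f (X - (2 : k) • Z) := by
  have h2 := neg_ne_zero.2 h.two_ne
  refine (integrable_scale h h2 h2 (hf.comp_add_left X)).congr (ae_of_all _ fun Z => ?_)
  dsimp only
  congr 1
  rw [sub_eq_add_neg, ← neg_smul]
  rfl

theorem integrable_wigner (h : LocalChar Ψ ϖ) {θ : k} (hθ0 : θ ≠ 0) (X Y : Phase k d) :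
    Integrable (wigner Ψ θ X Y) := by
  have h1 : Integrable ((box (d := d) Ψ 1 θ : Set (Phase k d)).indicator fun _ => (1 : ℝ)) :=
    (integrable_indicator_iff (measurableSet_box h 1 θ)).2
      (integrableOn_const (isCompact_box h 1 θ).measure_lt_top.ne)
  refine (integrable_sub_two_smul h (X + Y) h1).mono' ?_
    (ae_of_all _ fun Z => (norm_wigner h hθ0 X Y Z).le)
  exact ((measurable_wigner h hθ0).comp (measurable_const.prodMk measurable_id :
    Measurable fun Z : Phase k d => ((X, Y), Z))).aestronglyMeasurable

theorem integral_norm_wigner (h : LocalChar Ψ ϖ) {θ : k} (hθ0 : θ ≠ 0) (X Y : Phase k d) :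
    ∫ Z, ‖wigner Ψ θ X Y Z‖ = ((‖(2 : k)‖ * ‖(2 : k)‖) ^ d)⁻¹ * ‖θ‖ ^ d := by
  simp_rw [norm_wigner h hθ0]
  rw [integral_sub_two_smul h (X + Y)
    ((box (d := d) Ψ 1 θ : Set (Phase k d)).indicator fun _ => (1 : ℝ)),
    integral_indicator (measurableSet_box h 1 θ), setIntegral_const, volume_real_box h, norm_one,
    one_mul, smul_eq_mul, smul_eq_mul, mul_one]

/-- The matrix coefficients `|2/θ|^d ∫ W_{X,Y}(Z) H(Z) dZ`. -/
def wignerInt (Ψ : AddChar k Circle) (θ : k) (H : Phase k d → E) (X Y : Phase k d) : E :=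
  ((‖2 / θ‖ ^ d : ℝ) : ℂ) • ∫ Z : Phase k d, wigner Ψ θ X Y Z • H Z

/-- The support of Z ↦ W_{X,Y}(Z) has volume |2|^{−2d}|θ|^d; the prefactor |2/θ|^d leaves |2|^{−d},
free of θ. -/
theorem norm_wignerInt_le (h : LocalChar Ψ ϖ) {θ : k} (hθ0 : θ ≠ 0) {H : Phase k d → E} {C : ℝ}
    (hH : ∀ᵐ Z, ‖H Z‖ ≤ C) (X Y : Phase k d) :
    ‖wignerInt Ψ θ H X Y‖ ≤ (‖(2 : k)‖ ^ d)⁻¹ * C := by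
  have h1 : ‖∫ Z : Phase k d, wigner Ψ θ X Y Z • H Z‖
      ≤ ∫ Z, ‖wigner Ψ θ X Y Z‖ * C := by
    refine norm_integral_le_of_norm_le ((integrable_wigner h hθ0 X Y).norm.mul_const C) ?_
    filter_upwards [hH] with Z hZ
    rw [norm_smul]
    exact mul_le_mul_of_nonneg_left hZ (norm_nonneg _)
  rw [integral_mul_const, integral_norm_wigner h hθ0] at h1
  unfold wignerInt
  rw [norm_smul, Complex.norm_real, norm_pow, norm_norm]
  refine (mul_le_mul_of_nonneg_left h1 (by positivity)).trans_eq ?_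
  have h2 : ‖(2 : k)‖ ≠ 0 := norm_ne_zero_iff.2 h.two_ne
  have h3 : ‖θ‖ ≠ 0 := norm_ne_zero_iff.2 hθ0
  rw [norm_div, div_pow, mul_pow]
  field_simp

theorem wignerInt_congr {θ : k} {H H' : Phase k d → E} (hH : H =ᵐ[volume] H') (X Y : Phase k d) :
    wignerInt Ψ θ H X Y = wignerInt Ψ θ H' X Y := by
  unfold wignerInt
  congr 1
  refine integral_congr_ae ?_
  filter_upwards [hH] with Z hZ
  rw [hZ]

theorem wignerInt_hasSum (h : LocalChar Ψ ϖ) {θ : k} (hθ0 : θ ≠ 0) {ι : Type*} [Countable ι]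
    {P : ι → Phase k d → E} {u : ι → ℝ} (hP : ∀ i, AEStronglyMeasurable (P i) volume)
    (hu : Summable u) (hPu : ∀ i X, ‖P i X‖ ≤ u i) (X Y : Phase k d) :
    HasSum (fun i => wignerInt Ψ θ (P i) X Y) (wignerInt Ψ θ (fun Z => ∑' i, P i Z) X Y) := by
  unfold wignerInt
  refine HasSum.const_smul _ ?_
  have hi : ∀ i, Integrable fun Z => wigner Ψ θ X Y Z • P i Z := fun i =>
    integrable_smul_top (integrable_wigner h hθ0 X Y)
      (memLp_top_of_bound (hP i) _ (ae_of_all _ (hPu i)))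
  have hs : ∀ Z, ∑' i, wigner Ψ θ X Y Z • P i Z = wigner Ψ θ X Y Z • ∑' i, P i Z := fun Z =>
    (hu.of_norm_bounded (hPu · Z)).tsum_const_smul _
  simp_rw [← hs]
  refine hasSum_integral_of_summable_integral_norm hi ?_
  refine Summable.of_nonneg_of_le (fun i => integral_nonneg fun _ => norm_nonneg _) (fun i => ?_)
    (hu.mul_left (∫ Z, ‖wigner Ψ θ X Y Z‖))
  rw [← integral_mul_const]
  refine integral_mono (hi i).norm ((integrable_wigner h hθ0 X Y).norm.mul_const _) fun Z => ?_
  simp only [norm_smul]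
  exact mul_le_mul_of_nonneg_left (hPu i Z) (norm_nonneg _)

/-- Vectors T of the box with radii ϖⁿ and θϖⁿ lie both in `lat n`, which fixes H, and in `box 1 θ`,
which multiplies W_{X,Y} by Ψ(θ⁻¹[T,Y−X]). Outside of the dual of this box some such character value
is not one and the integral vanishes. -/
theorem wignerInt_eq_zero (h : LocalChar Ψ ϖ) {θ : k} (hθ0 : θ ≠ 0) (hθ : ‖θ‖ ≤ 1) {n : ℕ}
    {H : Phase k d → E} (hH : ∀ X, ∀ T ∈ lat Ψ ϖ d n, H (X + T) = H X) {X Y : Phase k d}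
    (hXY : Y - X ∉ box Ψ (ϖ ^ n)⁻¹ (θ * (ϖ ^ n)⁻¹)) : wignerInt Ψ θ H X Y = 0 := by
  have hp := pow_unif_ne h n
  have hp1 : ‖ϖ ^ n‖ ≤ 1 := by
    rw [norm_pow]
    exact pow_le_one₀ (norm_nonneg _) h.unif_lt.le
  have e : box (d := d) Ψ (θ⁻¹ * (θ * ϖ ^ n))⁻¹ (θ⁻¹ * ϖ ^ n)⁻¹
      = box Ψ (ϖ ^ n)⁻¹ (θ * (ϖ ^ n)⁻¹) := by
    rw [inv_mul_cancel_left₀ hθ0, mul_inv, inv_inv]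
  rw [← e, ← mem_box_dual h (inv_ne_zero hθ0) hp (mul_ne_zero hθ0 hp)] at hXY
  push Not at hXY
  obtain ⟨T, hT, hT1⟩ := hXY
  have hTl : T ∈ lat Ψ ϖ d n := box_mono le_rfl
    (by rw [norm_mul]; exact mul_le_of_le_one_left (norm_nonneg _) hθ) hT
  have hTb : T ∈ box Ψ 1 θ := box_mono (by rwa [norm_one])
    (by rw [norm_mul]; exact mul_le_of_le_one_right (norm_nonneg _) hp1) hT
  unfold wignerInt
  rw [integral_eq_zero_of_translate T (χ := Ψ (θ⁻¹ * symp T (Y - X)))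
    (fun hc => hT1 (Subtype.ext hc)), smul_zero]
  intro Z
  rw [wigner_add h hθ0 X Y Z hTb, hH Z T hTl, mul_smul]

end WignerBounds

/-! ### Integrability of the weight and decay of the kernel. -/

section Kappa

open Filter Topology

variable {k : Type*} [NontriviallyNormedField k] [IsUltrametricDist k] [ProperSpace k]
  [MeasureSpace k] [BorelSpace k] [(volume : Measure k).IsAddHaarMeasure]
  {d : ℕ} {Ψ : AddChar k Circle} {ϖ : k} {A : Type*} [NonUnitalCStarAlgebra A]

/-- If μ₀(X) = qᴺ, the series is the tail (1−ρ)∑_{n≥N}ρⁿ = ρᴺ. It has the same coefficients as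
`ae_eq_tsum_avg`, which is what makes the kernel estimate come out with constant one. -/
theorem hasSum_mu0_inv (h : LocalChar Ψ ϖ) (m : ℕ) (X : Phase k d) :
    HasSum (fun n => (1 - ‖ϖ‖ ^ (m + 1)) * (‖ϖ‖ ^ (m + 1)) ^ n
      * (dlat Ψ ϖ d n : Set (Phase k d)).indicator (fun _ => (1 : ℝ)) X)
      (mu0 Ψ X ^ (m + 1))⁻¹ := by
  obtain ⟨N, hN⟩ := exists_mu0_eq h X
  set ρ := ‖ϖ‖ ^ (m + 1) with hρ
  have hρ0 : 0 ≤ ρ := by positivity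
  have hρ1 : ρ < 1 := pow_unif_lt_one h m
  have e : (mu0 Ψ X ^ (m + 1))⁻¹ = ρ ^ N := by
    rw [hN, ← pow_mul, mul_comm N, pow_mul, inv_pow ‖ϖ‖, ← hρ, inv_pow, inv_inv]
  have hmem : ∀ n, X ∈ (dlat Ψ ϖ d n : Set (Phase k d)) ↔ N ≤ n := fun n => by
    rw [SetLike.mem_coe, mem_box_level h, hN, pow_le_pow_iff_right₀ (one_lt_q h)]
  rw [e, ← hasSum_nat_add_iff' N]
  have h0 : ∑ i ∈ Finset.range N, (1 - ρ) * ρ ^ i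
      * (dlat Ψ ϖ d i : Set (Phase k d)).indicator (fun _ => (1 : ℝ)) X = 0 := by
    refine Finset.sum_eq_zero fun i hi => ?_
    rw [Set.indicator_of_notMem (fun h' => (Finset.mem_range.1 hi).not_ge ((hmem i).1 h')),
      mul_zero]
  rw [h0, sub_zero]
  have h1 : ∀ n, (1 - ρ) * ρ ^ (n + N)
      * (dlat Ψ ϖ d (n + N) : Set (Phase k d)).indicator (fun _ => (1 : ℝ)) X
      = ((1 - ρ) * ρ ^ N) * ρ ^ n := fun n => by
    rw [Set.indicator_of_mem ((hmem _).2 (Nat.le_add_left N n)), pow_add]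
    ring
  simp_rw [h1]
  have h2 := (hasSum_geometric_of_lt_one hρ0 hρ1).mul_left ((1 - ρ) * ρ ^ N)
  rwa [mul_right_comm, mul_inv_cancel₀ (sub_pos.2 hρ1).ne', one_mul] at h2

theorem continuous_mu0_inv (m : ℕ) : Continuous fun X : Phase k d => (mu0 Ψ X ^ m)⁻¹ :=
  (continuous_mu0.pow m).inv₀ fun X => (pow_pos (mu0_pos X) m).ne'

theorem mu0_inv_nonneg (m : ℕ) (X : Phase k d) : 0 ≤ (mu0 Ψ X ^ m)⁻¹ :=
  inv_nonneg.2 (pow_pos (mu0_pos X) m).le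

theorem mu0_inv_le_one (m : ℕ) (X : Phase k d) : (mu0 Ψ X ^ m)⁻¹ ≤ 1 :=
  inv_le_one_of_one_le₀ (one_le_pow₀ (one_le_mu0 X))

/-- The volume of `dlat n` grows like q^{2dn}, while the coefficient of its indicator decays like
q^{−(2d+1)n}; a geometric series of ratio q⁻¹ remains. -/
theorem integrable_mu0_inv (h : LocalChar Ψ ϖ) :
    Integrable fun X : Phase k d => (mu0 Ψ X ^ (2 * d + 1))⁻¹ := by
  set ρ := ‖ϖ‖ ^ (2 * d + 1) with hρ
  have hρ0 : 0 ≤ ρ := by positivity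
  have hρ1 : ρ < 1 := pow_unif_lt_one h _
  have hc : ∀ n, 0 ≤ (1 - ρ) * ρ ^ n := fun n => mul_nonneg (sub_nonneg.2 hρ1.le) (by positivity)
  refine ⟨(continuous_mu0_inv _).aestronglyMeasurable, ?_⟩
  rw [hasFiniteIntegral_iff_ofReal (ae_of_all _ (mu0_inv_nonneg _))]
  have e : ∀ X : Phase k d, ENNReal.ofReal ((mu0 Ψ X ^ (2 * d + 1))⁻¹)
      = ∑' n, ENNReal.ofReal ((1 - ρ) * ρ ^ n
        * (dlat Ψ ϖ d n : Set (Phase k d)).indicator (fun _ => (1 : ℝ)) X) := fun X => by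
    rw [← (hasSum_mu0_inv h (2 * d) X).tsum_eq, ENNReal.ofReal_tsum_of_nonneg _
      (hasSum_mu0_inv h (2 * d) X).summable]
    exact fun n => mul_nonneg (hc n) (Set.indicator_nonneg (fun _ _ => zero_le_one) _)
  simp_rw [e]
  have hmeas : ∀ n, Measurable fun X : Phase k d => ENNReal.ofReal ((1 - ρ) * ρ ^ n
      * (dlat Ψ ϖ d n : Set (Phase k d)).indicator (fun _ => (1 : ℝ)) X) := fun n =>
    ((measurable_const.indicator (measurableSet_box h _ _)).const_mul _).ennreal_ofReal
  rw [lintegral_tsum fun n => (hmeas n).aemeasurable]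
  have e2 : ∀ n, ∫⁻ X : Phase k d, ENNReal.ofReal ((1 - ρ) * ρ ^ n
      * (dlat Ψ ϖ d n : Set (Phase k d)).indicator (fun _ => (1 : ℝ)) X)
      = ENNReal.ofReal ((1 - ρ) * ((‖(2 : k)‖ * ‖(2 : k)‖) ^ d)⁻¹ * ‖ϖ‖ ^ n) := fun n => by
    have h3 : ∀ X : Phase k d, ENNReal.ofReal ((1 - ρ) * ρ ^ n
      * (dlat Ψ ϖ d n : Set (Phase k d)).indicator (fun _ => (1 : ℝ)) X)
      = (dlat Ψ ϖ d n : Set (Phase k d)).indicator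
        (fun _ => ENNReal.ofReal ((1 - ρ) * ρ ^ n)) X := fun X => by
      by_cases hX : X ∈ (dlat Ψ ϖ d n : Set (Phase k d))
      · rw [Set.indicator_of_mem hX, Set.indicator_of_mem hX, mul_one]
      · rw [Set.indicator_of_notMem hX, Set.indicator_of_notMem hX, mul_zero, ENNReal.ofReal_zero]
    simp_rw [h3]
    have hfin : volume (dlat Ψ ϖ d n : Set (Phase k d)) ≠ ∞ :=
      (isCompact_box h _ _).measure_lt_top.ne
    rw [lintegral_indicator (measurableSet_box h _ _), setLIntegral_const,
      ← ENNReal.ofReal_toReal hfin, ← ENNReal.ofReal_mul (hc n)]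
    congr 1
    change _ * volume.real _ = _
    rw [volume_real_box h, norm_inv, norm_mul, norm_pow, hρ]
    have h2 : ‖(2 : k)‖ ≠ 0 := norm_ne_zero_iff.2 h.two_ne
    have h4 : ‖ϖ‖ ≠ 0 := h.unif_pos.ne'
    simp only [mul_inv, mul_pow, inv_pow]
    field_simp
    ring
  simp_rw [e2]
  rw [← ENNReal.ofReal_tsum_of_nonneg]
  · exact ENNReal.ofReal_lt_top
  · intro n
    have := sub_nonneg.2 hρ1.le
    positivity
  · exact (summable_geometric_of_lt_one (norm_nonneg _) h.unif_lt).mul_left _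

/-- The decay profile of the matrix coefficients of an operator. -/
def decay (Ψ : AddChar k Circle) (θ : k) (m : ℕ) (V : Phase k d) : ℝ :=
  (mu0 Ψ (((2 : k)⁻¹ • V.1, ((2 : k)⁻¹ * θ⁻¹) • V.2) : Phase k d) ^ m)⁻¹

/-- The scaling in `decay` is chosen so that the n-th localization box of `wignerInt_eq_zero` is the
preimage of `dlat n`. -/
theorem hasSum_decay (h : LocalChar Ψ ϖ) {θ : k} (hθ0 : θ ≠ 0) (m : ℕ) (V : Phase k d) :
    HasSum (fun n => (1 - ‖ϖ‖ ^ (m + 1)) * (‖ϖ‖ ^ (m + 1)) ^ n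
      * (box (d := d) Ψ (ϖ ^ n)⁻¹ (θ * (ϖ ^ n)⁻¹) : Set (Phase k d)).indicator
        (fun _ => (1 : ℝ)) V) (decay Ψ θ (m + 1) V) := by
  refine (hasSum_mu0_inv h m (((2 : k)⁻¹ • V.1, ((2 : k)⁻¹ * θ⁻¹) • V.2) : Phase k d)).congr_fun
    fun n => ?_
  congr 1
  have h2 : 0 < ‖(2 : k)‖ := norm_pos_iff.2 h.two_ne
  have h3 : 0 < ‖θ‖ := norm_pos_iff.2 hθ0
  have : V ∈ (box (d := d) Ψ (ϖ ^ n)⁻¹ (θ * (ϖ ^ n)⁻¹) : Set (Phase k d)) ↔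
      (((2 : k)⁻¹ • V.1, ((2 : k)⁻¹ * θ⁻¹) • V.2) : Phase k d) ∈
        (dlat Ψ ϖ d n : Set (Phase k d)) := by
    rw [SetLike.mem_coe, SetLike.mem_coe, h.mem_box, h.mem_box]
    simp only [norm_smul, norm_mul, norm_inv, mul_inv]
    refine and_congr ?_ ?_
    · rw [mul_le_mul_iff_right₀ (inv_pos.2 h2)]
    · rw [mul_assoc, mul_assoc, mul_assoc, mul_le_mul_iff_right₀ (inv_pos.2 h2),
        inv_mul_le_iff₀ h3]
  by_cases hV : V ∈ (box (d := d) Ψ (ϖ ^ n)⁻¹ (θ * (ϖ ^ n)⁻¹) : Set (Phase k d))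
  · rw [Set.indicator_of_mem hV, Set.indicator_of_mem (this.1 hV)]
  · rw [Set.indicator_of_notMem hV, Set.indicator_of_notMem (fun h' => hV (this.2 h'))]

theorem decay_nonneg (θ : k) (m : ℕ) (V : Phase k d) : 0 ≤ decay Ψ θ m V := mu0_inv_nonneg _ _

theorem decay_le_one (θ : k) (m : ℕ) (V : Phase k d) : decay Ψ θ m V ≤ 1 := mu0_inv_le_one _ _

theorem decay_neg (θ : k) (m : ℕ) (V : Phase k d) : decay Ψ θ m (-V) = decay Ψ θ m V := by
  unfold decay
  rw [← mu0_neg]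
  simp

theorem integrable_decay (h : LocalChar Ψ ϖ) {θ : k} (hθ0 : θ ≠ 0) :
    Integrable (decay (d := d) Ψ θ (2 * d + 1)) :=
  integrable_scale h (inv_ne_zero h.two_ne)
    (mul_ne_zero (inv_ne_zero h.two_ne) (inv_ne_zero hθ0)) (integrable_mu0_inv h)

theorem integral_decay (h : LocalChar Ψ ϖ) {θ : k} (hθ0 : θ ≠ 0) :
    (‖θ‖ ^ d)⁻¹ * (‖(2 : k)‖ ^ d)⁻¹ * ∫ V, decay (d := d) Ψ θ (2 * d + 1) V
      = ‖(2 : k)‖ ^ d * ∫ X : Phase k d, (mu0 Ψ X ^ (2 * d + 1))⁻¹ := by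
  have h1 := integral_scale h (inv_ne_zero h.two_ne)
    (mul_ne_zero (inv_ne_zero h.two_ne) (inv_ne_zero hθ0))
    (fun X : Phase k d => (mu0 Ψ X ^ (2 * d + 1))⁻¹)
  unfold decay
  rw [h1, smul_eq_mul]
  have h2 : ‖(2 : k)‖ ≠ 0 := norm_ne_zero_iff.2 h.two_ne
  have h3 : ‖θ‖ ≠ 0 := norm_ne_zero_iff.2 hθ0
  simp only [norm_mul, norm_inv, mul_pow, inv_pow]
  field_simp

/-- The integral operator with kernel `decay` has norm at most `‖μ₀^{-2d-1}‖₁`. -/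
theorem integral_decay_le (h : LocalChar Ψ ϖ) {θ : k} (hθ0 : θ ≠ 0) :
    (‖θ‖ ^ d)⁻¹ * (‖(2 : k)‖ ^ d)⁻¹ * ∫ V, decay (d := d) Ψ θ (2 * d + 1) V
      ≤ ∫ X : Phase k d, (mu0 Ψ X ^ (2 * d + 1))⁻¹ := by
  rw [integral_decay h hθ0]
  -- The preceding identity is exact; only |2|^d ≤ 1 is given away, with equality when the residue
  -- characteristic is odd.
  exact mul_le_of_le_one_left (integral_nonneg fun X => mu0_inv_nonneg _ X)
    (pow_le_one₀ (norm_nonneg _) norm_two_le)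

/-- F is the convex combination of the averages E_n of G = J^{m+1}F with weights (1−ρ)ρⁿ. The n-th
average contributes at most |2|^{−d}‖G‖, and only for Y − X in the n-th localization box; by
`hasSum_decay` the sum of the weights over the boxes containing Y − X is the decay profile. -/
theorem norm_wignerSymbol_le (h : LocalChar Ψ ϖ) {θ : k} (hθ0 : θ ≠ 0) (hθ : ‖θ‖ ≤ 1)
    {F : LInfty k d A} (hF : F ∈ symbolSpace d A Ψ) (m : ℕ) (X Y : Phase k d) :
    ‖wignerSymbol Ψ θ F X Y‖
      ≤ (‖(2 : k)‖ ^ d)⁻¹ * ‖powJ Ψ (m + 1) F‖ * decay Ψ θ (m + 1) (Y - X) := by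
  set G := powJ Ψ (m + 1) F with hG
  set ρ := ‖ϖ‖ ^ (m + 1) with hρ
  have hρ0 : 0 ≤ ρ := by positivity
  have hρ1 : ρ < 1 := pow_unif_lt_one h _
  have hc : ∀ n, 0 ≤ (1 - ρ) * ρ ^ n := fun n => mul_nonneg (sub_nonneg.2 hρ1.le) (by positivity)
  have hGn : ∀ᵐ X, ‖G X‖ ≤ ‖G‖ := ae_norm_le_LInfty G
  have hae := ae_eq_tsum_avg h (Lp.memLp F) (Lp.memLp G) hρ0 hρ1 (fun n X => blk_eq_powJ h hF _ n X)
  have hb : ∀ n X, ‖((1 - ρ) * ρ ^ n) • avg Ψ ϖ n G X‖ ≤ (1 - ρ) * ρ ^ n * ‖G‖ := fun n X => by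
    rw [norm_smul, Real.norm_of_nonneg (hc n)]
    exact mul_le_mul_of_nonneg_left (norm_avg_le h hGn X) (hc n)
  have hsum : Summable fun n => (1 - ρ) * ρ ^ n * ‖G‖ :=
    ((summable_geometric_of_lt_one hρ0 hρ1).mul_left _).mul_right _
  have hS := wignerInt_hasSum h hθ0 (P := fun n X => ((1 - ρ) * ρ ^ n) • avg Ψ ϖ n G X)
    (fun n => ((continuous_avg h n G).const_smul _).aestronglyMeasurable) hsum hb X Y
  rw [← wignerInt_congr hae] at hS
  change ‖wignerInt Ψ θ F X Y‖ ≤ _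
  rw [← hS.tsum_eq]
  refine tsum_of_norm_bounded ((hasSum_decay h hθ0 m (Y - X)).mul_left _) fun n => ?_
  rw [← hρ]
  by_cases hXY : Y - X ∈ (box (d := d) Ψ (ϖ ^ n)⁻¹ (θ * (ϖ ^ n)⁻¹) : Set (Phase k d))
  · rw [Set.indicator_of_mem hXY]
    refine (norm_wignerInt_le h hθ0 (ae_of_all _ (hb n)) X Y).trans_eq ?_
    ring
  · rw [Set.indicator_of_notMem hXY, wignerInt_eq_zero h hθ0 hθ (n := n) _ hXY]
    · simp
    · intro X T hT
      rw [avg_add h _ X hT]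

end Kappa

/-! ### Functions with a single frequency level and radial weights. -/

section Levels

open Filter Topology

variable {k : Type*} [NontriviallyNormedField k] [IsUltrametricDist k] [ProperSpace k]
  [MeasureSpace k] [BorelSpace k] [(volume : Measure k).IsAddHaarMeasure]
  {d : ℕ} {Ψ : AddChar k Circle} {ϖ : k} {E : Type*} [NormedAddCommGroup E] [NormedSpace ℂ E]
  [CompleteSpace E]

/-- Bounded functions whose symplectic Fourier transform lives on the shell `l`. -/
structure IsLevel (Ψ : AddChar k Circle) (ϖ : k) (l : ℕ) (f : Phase k d → E) : Prop where
  inv : ∀ X, ∀ T ∈ lat Ψ ϖ d l, f (X + T) = f X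
  avg_eq_zero : ∀ j < l, ∀ X, avg Ψ ϖ j f X = 0
  bdd : ∃ C : ℝ, ∀ X, ‖f X‖ ≤ C

theorem IsLevel.continuous (h : LocalChar Ψ ϖ) {l : ℕ} {f : Phase k d → E}
    (hf : IsLevel Ψ ϖ l f) : Continuous f :=
  continuous_of_invariant h hf.inv

theorem IsLevel.memLp_top (h : LocalChar Ψ ϖ) {l : ℕ} {f : Phase k d → E}
    (hf : IsLevel Ψ ϖ l f) : MemLp f ∞ := by
  obtain ⟨C, hC⟩ := hf.bdd
  exact memLp_top_of_bound (hf.continuous h).aestronglyMeasurable C (ae_of_all _ hC)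

theorem isLevel_blk (h : LocalChar Ψ ϖ) {F : Phase k d → E} (hF : MemLp F ∞) (l : ℕ) :
    IsLevel Ψ ϖ l (blk Ψ ϖ l F) :=
  ⟨fun X _ hT => blk_add h F X hT,
    fun _ hj X => avg_blk_of_lt h hj (locallyIntegrable_of_memLp_top hF) X,
    ⟨_, fun X => norm_blk_le h (ae_norm_le_of_memLp_top hF) X⟩⟩

theorem IsLevel.translate {l : ℕ} {f : Phase k d → E} (hf : IsLevel Ψ ϖ l f) (X₀ : Phase k d) :
    IsLevel Ψ ϖ l fun X => f (X₀ + X) := by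
  refine ⟨fun X T hT => by rw [← add_assoc, hf.inv _ T hT], fun j hj X => ?_, ?_⟩
  · rw [← hf.avg_eq_zero j hj (X₀ + X)]
    unfold avg
    simp_rw [add_assoc]
  · obtain ⟨C, hC⟩ := hf.bdd
    exact ⟨C, fun X => hC _⟩

theorem smul_mem_lat_iff (h : LocalChar Ψ ϖ) {θ : k} {r : ℕ} (hr : ‖θ‖ = ‖ϖ‖ ^ r) {j : ℕ}
    {T : Phase k d} : θ • T ∈ lat Ψ ϖ d (j + r) ↔ T ∈ lat Ψ ϖ d j := by
  have hθ : 0 < ‖θ‖ := hr ▸ pow_pos h.unif_pos r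
  rw [h.mem_box, h.mem_box, Prod.smul_fst, Prod.smul_snd, norm_smul, norm_smul, pow_add,
    norm_mul, norm_pow ϖ r, ← hr, mul_comm _ ‖θ‖, mul_le_mul_iff_right₀ hθ, mul_assoc,
    mul_le_mul_iff_right₀ hθ]

/-- The change of variables turns an average over `lat j` of the dilated function into one over `lat
(j + r)`. If n ≤ r the new level is zero, where no vanishing is required. -/
theorem IsLevel.dilate (h : LocalChar Ψ ϖ) {θ : k} {r : ℕ} (hr : ‖θ‖ = ‖ϖ‖ ^ r) {n : ℕ}
    {f : Phase k d → E} (hf : IsLevel Ψ ϖ n f) : IsLevel Ψ ϖ (n - r) fun X => f (θ • X) := by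
  have hθ : 0 < ‖θ‖ := hr ▸ pow_pos h.unif_pos r
  have hθ0 : θ ≠ 0 := norm_pos_iff.1 hθ
  refine ⟨fun X T hT => ?_, fun j hj X => ?_, ?_⟩
  · rw [smul_add]
    exact hf.inv _ _ (lat_anti h (by omega) ((smul_mem_lat_iff h hr).2 hT))
  · have h0 := hf.avg_eq_zero (j + r) (by omega) (θ • X)
    have h1 := (lat_vol_pos (d := d) h (j + r)).ne'
    unfold avg at h0 ⊢
    rw [smul_eq_zero_iff_right (inv_ne_zero h1)] at h0
    have h2 := integral_scale h hθ0 hθ0 fun Y : Phase k d =>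
      (lat Ψ ϖ d (j + r) : Set (Phase k d)).indicator (fun Y => f (θ • X + Y)) Y
    rw [integral_indicator (measurableSet_box h _ _), h0, smul_zero] at h2
    rw [← integral_indicator (measurableSet_box h _ _)]
    convert smul_zero _
    rw [← h2]
    refine integral_congr_ae (ae_of_all _ fun Y => ?_)
    change _ = (lat Ψ ϖ d (j + r) : Set (Phase k d)).indicator (fun Y => f (θ • X + Y)) (θ • Y)
    by_cases hY : Y ∈ (lat Ψ ϖ d j : Set (Phase k d))
    · rw [Set.indicator_of_mem hY, Set.indicator_of_mem (by exact (smul_mem_lat_iff h hr).2 hY)]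
      exact congrArg f (smul_add θ X Y)
    · rw [Set.indicator_of_notMem hY,
        Set.indicator_of_notMem (fun h' => hY ((smul_mem_lat_iff h hr).1 h'))]
  · obtain ⟨C, hC⟩ := hf.bdd
    exact ⟨C, fun X => hC _⟩

/-- Integrable weights invariant under the lattice `dlat 0`, such as functions of `μ₀`. -/
structure IsRadial (Ψ : AddChar k Circle) (ϖ : k) (u : Phase k d → ℝ) : Prop where
  integrable : Integrable u
  add : ∀ X, ∀ T ∈ dlat Ψ ϖ d 0, u (X + T) = u X

theorem isRadial_mu0_inv (h : LocalChar Ψ ϖ) :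
    IsRadial (d := d) Ψ ϖ fun X => (mu0 Ψ X ^ (2 * d + 1))⁻¹ :=
  ⟨integrable_mu0_inv h, fun X T hT => by rw [mu0_add_of_mem h hT]⟩

theorem IsRadial.indicator_shell (h : LocalChar Ψ ϖ) {u : Phase k d → ℝ} (hu : IsRadial Ψ ϖ u)
    (l : ℕ) : IsRadial Ψ ϖ ((shell Ψ ϖ d l).indicator u) := by
  refine ⟨hu.integrable.indicator (measurableSet_shell l), fun X T hT => ?_⟩
  have : X + T ∈ shell Ψ ϖ d l ↔ X ∈ shell Ψ ϖ d l := by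
    unfold shell
    simp only [Set.mem_ofPred_eq, mu0_add_of_mem h hT]
  by_cases hX : X ∈ shell Ψ ϖ d l
  · rw [Set.indicator_of_mem hX, Set.indicator_of_mem (this.2 hX), hu.add X T hT]
  · rw [Set.indicator_of_notMem hX, Set.indicator_of_notMem (fun h' => hX (this.1 h'))]

theorem isRadial_indicator_dlat (h : LocalChar Ψ ϖ) (R : ℕ) :
    IsRadial Ψ ϖ ((dlat Ψ ϖ d R : Set (Phase k d)).indicator fun _ => (1 : ℝ)) := by
  refine ⟨(integrable_indicator_iff (measurableSet_box h _ _)).2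
    (integrableOn_const (isCompact_box h _ _).measure_lt_top.ne), fun X T hT => ?_⟩
  have : X + T ∈ (dlat Ψ ϖ d R : Set (Phase k d)) ↔ X ∈ (dlat Ψ ϖ d R : Set (Phase k d)) :=
    add_mem_cancel_right (dlat_mono h (Nat.zero_le R) hT)
  by_cases hX : X ∈ (dlat Ψ ϖ d R : Set (Phase k d))
  · rw [Set.indicator_of_mem hX, Set.indicator_of_mem (this.2 hX)]
  · rw [Set.indicator_of_notMem hX, Set.indicator_of_notMem (fun h' => hX (this.1 h'))]

/-- The Fourier transform of a radial weight times a function of level `l` vanishes outside of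
the shell `l`. -/
theorem IsLevel.integral_char_eq_zero (h : LocalChar Ψ ϖ) {l : ℕ} {f : Phase k d → E}
    (hf : IsLevel Ψ ϖ l f) {v : Phase k d → ℝ} (hv : IsRadial Ψ ϖ v) {V : Phase k d}
    (hV : V ∉ shell Ψ ϖ d l) :
    ∫ Z, ((v Z : ℂ) * (Ψ (2 * symp Z V) : ℂ)) • f Z = 0 := by
  -- Off the shell there are two cases. If V is in `dlat l`, then l > 0 and V is in `dlat (l-1)`, so
  -- the weight times the character is invariant under `lat (l-1)`, over which f averages to zero.
  -- If V is not in `dlat l`, a translation in `lat l` fixes the weight and f but not the character.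
  by_cases hVl : V ∈ dlat Ψ ϖ d l
  · have hl : l ≠ 0 := by
      rintro rfl
      exact hV (by rw [shell_zero h]; exact hVl)
    obtain ⟨j, rfl⟩ := Nat.exists_eq_succ_of_ne_zero hl
    have hVj : V ∈ dlat Ψ ϖ d j := by
      by_contra hn
      exact hV (by rw [Nat.succ_eq_add_one, shell_succ h]; exact ⟨hVl, hn⟩)
    rw [← mem_dlat_iff h] at hVj
    have hφ : Integrable fun Z : Phase k d => (v Z : ℂ) * (Ψ (2 * symp Z V) : ℂ) :=
      integrable_mul_char h hv.integrable.ofReal 2 V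
    have hinv : avg Ψ ϖ j (fun Z : Phase k d => (v Z : ℂ) * (Ψ (2 * symp Z V) : ℂ))
        = fun Z => (v Z : ℂ) * (Ψ (2 * symp Z V) : ℂ) :=
      avg_of_invariant h fun X T hT => by
        rw [hv.add X T (lat_le_dlat h j 0 hT), symp_add_left, mul_add, char_add, hVj T hT]
        simp
    have := integral_smul_avg_comm h hφ (hf.memLp_top h) j
    rw [hinv] at this
    rw [← this]
    simp [hf.avg_eq_zero j (Nat.lt_succ_self j)]
  · rw [← mem_dlat_iff h] at hVl
    push Not at hVl
    obtain ⟨T, hT, hT1⟩ := hVl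
    refine integral_eq_zero_of_translate T (χ := Ψ (2 * symp T V))
      (fun hc => hT1 (Subtype.ext hc)) fun Z => ?_
    rw [hv.add Z T (lat_le_dlat h l 0 hT), hf.inv Z T hT, symp_add_left, mul_add, char_add,
      smul_smul]
    congr 1
    ring

theorem neg_mem_shell {l : ℕ} {X : Phase k d} : -X ∈ shell Ψ ϖ d l ↔ X ∈ shell Ψ ϖ d l := by
  unfold shell
  simp only [Set.mem_ofPred_eq, mu0_neg]

end Levels

/-! ### The deformed product with arbitrary radial weights. -/

section StarProduct

open Filter Topology

variable {k : Type*} [NontriviallyNormedField k] [IsUltrametricDist k] [ProperSpace k]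
  [MeasureSpace k] [BorelSpace k] [(volume : Measure k).IsAddHaarMeasure]
  {d : ℕ} {Ψ : AddChar k Circle} {ϖ : k} {A : Type*} [NonUnitalCStarAlgebra A]

/-- The deformed product, with weights `u`, `v` inserted in the oscillatory integral. -/
def starInt (Ψ : AddChar k Circle) (θ : k) (u v : Phase k d → ℝ) (f g : Phase k d → A)
    (X : Phase k d) : A :=
  ((‖(2 : k)‖ ^ (2 * d) : ℝ) : ℂ) • ∫ P : Phase k d × Phase k d,
    (conj (Ψ (2 * symp P.1 P.2) : ℂ) * ((u P.1 * v P.2 : ℝ) : ℂ)) •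
      (f (X + θ • P.1) * g (X + P.2))

theorem integrable_starInt (h : LocalChar Ψ ϖ) (θ : k) {u v : Phase k d → ℝ} (hu : Integrable u)
    (hv : Integrable v) {f g : Phase k d → A} (hf : Continuous f) (hg : Continuous g) {B C : ℝ}
    (hfB : ∀ X, ‖f X‖ ≤ B) (hgC : ∀ X, ‖g X‖ ≤ C) (X : Phase k d) :
    Integrable fun P : Phase k d × Phase k d =>
      (conj (Ψ (2 * symp P.1 P.2) : ℂ) * ((u P.1 * v P.2 : ℝ) : ℂ)) •
        (f (X + θ • P.1) * g (X + P.2)) := by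
  have hB : 0 ≤ B := (norm_nonneg _).trans (hfB 0)
  have huv : Integrable fun P : Phase k d × Phase k d => u P.1 * v P.2 := hu.mul_prod hv
  refine (huv.norm.mul_const (B * C)).mono' ?_ (ae_of_all _ fun P => ?_)
  · refine AEStronglyMeasurable.smul (AEStronglyMeasurable.mul ?_
      (Complex.continuous_ofReal.comp_aestronglyMeasurable huv.aestronglyMeasurable)) ?_
    · exact (Complex.continuous_conj.comp (continuous_char_symp h 2)).aestronglyMeasurable
    · exact Continuous.aestronglyMeasurable (by fun_prop)
  · rw [norm_smul, norm_mul, RCLike.norm_conj, norm_char, one_mul, Complex.norm_real]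
    refine mul_le_mul_of_nonneg_left ((norm_mul_le _ _).trans ?_) (norm_nonneg _)
    exact mul_le_mul (hfB _) (hgC _) (norm_nonneg _) hB

theorem norm_starInt_le (θ : k) {u v : Phase k d → ℝ} (hu : Integrable u)
    (hv : Integrable v) {f g : Phase k d → A} {B C : ℝ} (hB : 0 ≤ B)
    (hfB : ∀ X, ‖f X‖ ≤ B) (hgC : ∀ X, ‖g X‖ ≤ C) (X : Phase k d) :
    ‖starInt Ψ θ u v f g X‖ ≤ (∫ Y, ‖u Y‖) * (∫ Z, ‖v Z‖) * (B * C) := by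
  unfold starInt
  have huv : Integrable fun P : Phase k d × Phase k d => u P.1 * v P.2 := hu.mul_prod hv
  have h1 : ‖∫ P : Phase k d × Phase k d,
    (conj (Ψ (2 * symp P.1 P.2) : ℂ) * ((u P.1 * v P.2 : ℝ) : ℂ)) •
      (f (X + θ • P.1) * g (X + P.2))‖ ≤ ∫ P : Phase k d × Phase k d, ‖u P.1 * v P.2‖ * (B * C) := by
    refine norm_integral_le_of_norm_le (huv.norm.mul_const (B * C)) (ae_of_all _ fun P => ?_)
    rw [norm_smul, norm_mul, RCLike.norm_conj, norm_char, one_mul, Complex.norm_real]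
    refine mul_le_mul_of_nonneg_left ((norm_mul_le _ _).trans ?_) (norm_nonneg _)
    exact mul_le_mul (hfB _) (hgC _) (norm_nonneg _) hB
  rw [integral_mul_const] at h1
  simp_rw [norm_mul] at h1
  have h2 : ∫ P : Phase k d × Phase k d, ‖u P.1‖ * ‖v P.2‖ = (∫ Y, ‖u Y‖) * (∫ Z, ‖v Z‖) :=
    integral_prod_mul (fun Y => ‖u Y‖) fun Z => ‖v Z‖
  rw [h2] at h1
  rw [norm_smul]
  refine (mul_le_of_le_one_left (norm_nonneg _) ?_).trans h1
  rw [Complex.norm_real, norm_pow, norm_norm]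
  exact pow_le_one₀ (norm_nonneg _) norm_two_le

theorem starInt_smul (θ : k) (u v : Phase k d → ℝ) (f g : Phase k d → A) (a b c e : ℝ)
    (X : Phase k d) :
    starInt Ψ θ (fun Y => a * u Y) (fun Z => b * v Z) (fun Y => (c : ℂ) • f Y)
      (fun Z => (e : ℂ) • g Z) X = ((a * b * c * e : ℝ) : ℂ) • starInt Ψ θ u v f g X := by
  unfold starInt
  rw [smul_comm, ← integral_smul ((a * b * c * e : ℝ) : ℂ)]
  congr 1
  refine integral_congr_ae (ae_of_all _ fun P => ?_)
  dsimp only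
  rw [smul_mul_assoc, mul_smul_comm, smul_smul, smul_smul, smul_smul]
  congr 1
  push_cast
  ring

/-- For fixed Y, the integral over Z is the Fourier transform at Y of a radial weight times a
function of level l, which vanishes off the shell l. For fixed Z, the integral over Y involves
f(X+θ·), of level n − r. So the values of u off shell l, and of v off shell n − r, are irrelevant.
-/
theorem starInt_eq_shell (h : LocalChar Ψ ϖ) {θ : k} {r : ℕ} (hr : ‖θ‖ = ‖ϖ‖ ^ r)
    {u v : Phase k d → ℝ} (hu : IsRadial Ψ ϖ u) (hv : IsRadial Ψ ϖ v) {n l : ℕ}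
    {f g : Phase k d → A} (hf : IsLevel Ψ ϖ n f) (hg : IsLevel Ψ ϖ l g) (X : Phase k d) :
    starInt Ψ θ u v f g X = starInt Ψ θ ((shell Ψ ϖ d l).indicator u)
      ((shell Ψ ϖ d (n - r)).indicator v) f g X := by
  obtain ⟨B, hB⟩ := hf.bdd
  obtain ⟨C, hC⟩ := hg.bdd
  have hi := fun {u v : Phase k d → ℝ} (hu : IsRadial Ψ ϖ u) (hv : IsRadial Ψ ϖ v) =>
    integrable_starInt h θ hu.integrable hv.integrable (hf.continuous h) (hg.continuous h) hB hC X
  have hgX := hg.translate X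
  have hfX : IsLevel Ψ ϖ (n - r) fun Y => f (X + θ • Y) := (hf.translate X).dilate h hr
  -- Integration over Z first localizes Y; then integration over Y first localizes Z. The two steps
  -- cannot be merged, since each one uses the weight of the other variable as an integrable radial
  -- function.
  have step1 : starInt Ψ θ u v f g X = starInt Ψ θ ((shell Ψ ϖ d l).indicator u) v f g X := by
    unfold starInt
    congr 1
    change ∫ P, _ ∂(volume.prod volume) = ∫ P, _ ∂(volume.prod volume)
    rw [integral_prod _ (hi hu hv), integral_prod _ (hi (hu.indicator_shell h l) hv)]
    refine integral_congr_ae (ae_of_all _ fun Y => ?_)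
    dsimp only
    by_cases hY : Y ∈ shell Ψ ϖ d l
    · rw [Set.indicator_of_mem hY]
    rw [Set.indicator_of_notMem hY]
    have h0 := hgX.integral_char_eq_zero h hv hY
    have hint : Integrable fun Z => ((v Z : ℂ) * (Ψ (2 * symp Z Y) : ℂ)) • g (X + Z) :=
      integrable_smul_top (integrable_mul_char h hv.integrable.ofReal 2 Y) (hgX.memLp_top h)
    have h1 : ∀ Z, (conj (Ψ (2 * symp Y Z) : ℂ) * ((u Y * v Z : ℝ) : ℂ)) •
        (f (X + θ • Y) * g (X + Z))
        = (u Y : ℂ) • (f (X + θ • Y) * (((v Z : ℂ) * (Ψ (2 * symp Z Y) : ℂ)) • g (X + Z))) := by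
      intro Z
      rw [mul_smul_comm, smul_smul, conj_char, symp_swap Z Y]
      congr 1
      push_cast
      ring_nf
    simp_rw [h1]
    rw [integral_smul, integral_const_mul_of_integrable hint, h0]
    simp
  have step2 : ∀ u : Phase k d → ℝ, IsRadial Ψ ϖ u → starInt Ψ θ u v f g X
      = starInt Ψ θ u ((shell Ψ ϖ d (n - r)).indicator v) f g X := by
    intro u hu
    unfold starInt
    congr 1
    change ∫ P, _ ∂(volume.prod volume) = ∫ P, _ ∂(volume.prod volume)
    rw [integral_prod_symm _ (hi hu hv), integral_prod_symm _ (hi hu (hv.indicator_shell h _))]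
    refine integral_congr_ae (ae_of_all _ fun Z => ?_)
    dsimp only
    by_cases hZ : Z ∈ shell Ψ ϖ d (n - r)
    · rw [Set.indicator_of_mem hZ]
    rw [Set.indicator_of_notMem hZ]
    have h0 := hfX.integral_char_eq_zero h hu (V := -Z) (fun h' => hZ (neg_mem_shell.1 h'))
    have hint : Integrable fun Y => ((u Y : ℂ) * (Ψ (2 * symp Y (-Z)) : ℂ)) • f (X + θ • Y) :=
      integrable_smul_top (integrable_mul_char h hu.integrable.ofReal 2 (-Z)) (hfX.memLp_top h)
    have h1 : ∀ Y, (conj (Ψ (2 * symp Y Z) : ℂ) * ((u Y * v Z : ℝ) : ℂ)) •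
        (f (X + θ • Y) * g (X + Z))
        = (v Z : ℂ) • ((((u Y : ℂ) * (Ψ (2 * symp Y (-Z)) : ℂ)) • f (X + θ • Y)) * g (X + Z)) := by
      intro Y
      rw [smul_mul_assoc, smul_smul, conj_char, symp_neg_right]
      congr 1
      push_cast
      ring_nf
    simp_rw [h1]
    rw [integral_smul, integral_mul_const_of_integrable hint, h0]
    simp
  rw [step1, step2 _ (hu.indicator_shell h l)]

end StarProduct

/-! ### Block decomposition of the deformed product. -/

section StarSymbol

open Filter Topology

variable {k : Type*} [NontriviallyNormedField k] [IsUltrametricDist k] [ProperSpace k]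
  [MeasureSpace k] [BorelSpace k] [(volume : Measure k).IsAddHaarMeasure]
  {d : ℕ} {Ψ : AddChar k Circle} {ϖ : k} {A : Type*} [NonUnitalCStarAlgebra A]

/-- The indicator function of a shell, as a weight. -/
abbrev shellWeight (Ψ : AddChar k Circle) (ϖ : k) (j : ℕ) : Phase k d → ℝ :=
  (shell Ψ ϖ d j).indicator fun _ => 1

theorem shell_subset_dlat (h : LocalChar Ψ ϖ) {j n : ℕ} (hjn : j ≤ n) :
    shell Ψ ϖ d j ⊆ dlat Ψ ϖ d n := by
  refine Set.Subset.trans ?_ (dlat_mono h hjn)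
  intro X hX
  exact (mem_box_level h).2 (le_of_eq hX)

theorem shellWeight_eq (h : LocalChar Ψ ϖ) {j n : ℕ} (hjn : j ≤ n) :
    shellWeight (d := d) Ψ ϖ j = (shell Ψ ϖ d j).indicator
      ((dlat Ψ ϖ d n : Set (Phase k d)).indicator fun _ => (1 : ℝ)) := by
  rw [Set.indicator_indicator, Set.inter_eq_left.2 (shell_subset_dlat h hjn)]

theorem isRadial_shellWeight (h : LocalChar Ψ ϖ) (j : ℕ) :
    IsRadial (d := d) Ψ ϖ (shellWeight Ψ ϖ j) := by
  rw [shellWeight_eq h le_rfl]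
  exact (isRadial_indicator_dlat h j).indicator_shell h j

theorem integral_norm_shellWeight_le (h : LocalChar Ψ ϖ) {j n : ℕ} (hjn : j ≤ n) :
    ∫ X, ‖shellWeight (d := d) Ψ ϖ j X‖
      ≤ (‖(2 : k)‖⁻¹ * ‖(2 : k)‖⁻¹) ^ d * (‖ϖ‖⁻¹ ^ (2 * d)) ^ n := by
  have h1 : ∫ X, (dlat Ψ ϖ d n : Set (Phase k d)).indicator (fun _ => (1 : ℝ)) X
      = (‖(2 : k)‖⁻¹ * ‖(2 : k)‖⁻¹) ^ d * (‖ϖ‖⁻¹ ^ (2 * d)) ^ n := by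
    rw [integral_indicator (measurableSet_box h _ _), setIntegral_const, volume_real_box h,
      smul_eq_mul, mul_one]
    simp only [norm_inv, norm_mul, norm_pow, mul_inv, inv_pow, mul_pow]
    ring
  rw [← h1]
  refine integral_mono (isRadial_shellWeight h j).integrable.norm
    (isRadial_indicator_dlat h n).integrable fun X => ?_
  by_cases hX : X ∈ shell Ψ ϖ d j
  · dsimp only
    rw [shellWeight, Set.indicator_of_mem hX, Set.indicator_of_mem (shell_subset_dlat h hjn hX)]
    simp
  · dsimp only
    rw [shellWeight, Set.indicator_of_notMem hX, norm_zero]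
    exact Set.indicator_nonneg (fun _ _ => zero_le_one) _

/-- The product of two blocks. -/
def starBlk (Ψ : AddChar k Circle) (ϖ θ : k) (r : ℕ) (F₁ F₂ : Phase k d → A) (p : ℕ × ℕ)
    (X : Phase k d) : A :=
  starInt Ψ θ (shellWeight Ψ ϖ p.2) (shellWeight Ψ ϖ (p.1 - r)) (blk Ψ ϖ p.1 F₁)
    (blk Ψ ϖ p.2 F₂) X

theorem starInt_add {θ : k} {u v : Phase k d → ℝ} {f g : Phase k d → A} {T : Phase k d}
    (hf : ∀ X, f (X + T) = f X) (hg : ∀ X, g (X + T) = g X) (X : Phase k d) :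
    starInt Ψ θ u v f g (X + T) = starInt Ψ θ u v f g X := by
  unfold starInt
  simp_rw [add_right_comm X T, hf, hg]

theorem starBlk_add (h : LocalChar Ψ ϖ) (θ : k) (r : ℕ) (F₁ F₂ : Phase k d → A) (p : ℕ × ℕ)
    (X : Phase k d) {T : Phase k d} (hT : T ∈ lat Ψ ϖ d (max p.1 p.2)) :
    starBlk Ψ ϖ θ r F₁ F₂ p (X + T) = starBlk Ψ ϖ θ r F₁ F₂ p X :=
  starInt_add (fun X => blk_add h _ X (lat_anti h (le_max_left _ _) hT))
    (fun X => blk_add h _ X (lat_anti h (le_max_right _ _) hT)) X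

theorem continuous_starBlk (h : LocalChar Ψ ϖ) (θ : k) (r : ℕ) (F₁ F₂ : Phase k d → A)
    (p : ℕ × ℕ) : Continuous (starBlk Ψ ϖ θ r F₁ F₂ p) :=
  continuous_of_invariant h fun X _ hT => starBlk_add h θ r F₁ F₂ p X hT

/-- The two shell weights cost volumes of order q^{2dp.1} and q^{2dp.2}; the decay of the blocks
with exponent M = 2d + N pays for them and leaves N powers. -/
theorem norm_starBlk_le (h : LocalChar Ψ ϖ) (θ : k) (r : ℕ) {F₁ F₂ : LInfty k d A}
    (hF₁ : F₁ ∈ symbolSpace d A Ψ) (hF₂ : F₂ ∈ symbolSpace d A Ψ) (N : ℕ) :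
    ∃ C : ℝ, 0 ≤ C ∧ ∀ p X, ‖starBlk Ψ ϖ θ r F₁ F₂ p X‖
      ≤ C * ((‖ϖ‖ ^ N) ^ p.1 * (‖ϖ‖ ^ N) ^ p.2) := by
  set v := (‖(2 : k)‖⁻¹ * ‖(2 : k)‖⁻¹) ^ d with hv
  have hv0 : 0 ≤ v := by positivity
  set M := 2 * d + N with hM
  refine ⟨v * v * (2 * ‖powJ Ψ M F₁‖ * (2 * ‖powJ Ψ M F₂‖)), by positivity, fun p X => ?_⟩
  refine (norm_starInt_le θ (isRadial_shellWeight h _).integrable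
    (isRadial_shellWeight h _).integrable (by positivity)
    (norm_blk_le_powJ h hF₁ M p.1) (norm_blk_le_powJ h hF₂ M p.2) X).trans ?_
  have h1 := integral_norm_shellWeight_le (d := d) h (le_refl p.2)
  have h2 := integral_norm_shellWeight_le (d := d) h (Nat.sub_le p.1 r)
  refine (mul_le_mul_of_nonneg_right (mul_le_mul h1 h2 (integral_nonneg fun _ => norm_nonneg _)
    (by positivity)) (by positivity)).trans_eq ?_
  have e : ∀ n, (‖ϖ‖⁻¹ ^ (2 * d)) ^ n * (‖ϖ‖ ^ M) ^ n = (‖ϖ‖ ^ N) ^ n := fun n => by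
    rw [← mul_pow, hM, pow_add, ← mul_assoc, ← mul_pow, inv_mul_cancel₀ h.unif_pos.ne', one_pow,
      one_mul]
  rw [← e p.1, ← e p.2]
  ring

theorem summable_pow_mul_pow (h : LocalChar Ψ ϖ) (C : ℝ) :
    Summable fun p : ℕ × ℕ => C * ((‖ϖ‖ ^ 1) ^ p.1 * (‖ϖ‖ ^ 1) ^ p.2) := by
  refine Summable.mul_left _ ?_
  have := summable_geometric_of_lt_one (pow_nonneg (norm_nonneg ϖ) 1)
    (by simpa using h.unif_lt : ‖ϖ‖ ^ 1 < 1)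
  exact this.mul_of_nonneg this (fun n => by positivity) (fun n => by positivity)

/-- The product of blocks of levels p.1 and p.2 is invariant under `lat (max p.1 p.2)`, hence has no
blocks beyond this level. Only pairs with max p.1 p.2 ≥ n enter the n-th block of the sum, and these
are small. -/
theorem exists_symbol_tsum_starBlk (h : LocalChar Ψ ϖ) (θ : k) (r : ℕ) {F₁ F₂ : LInfty k d A}
    (hF₁ : F₁ ∈ symbolSpace d A Ψ) (hF₂ : F₂ ∈ symbolSpace d A Ψ) :
    ∃ G ∈ symbolSpace d A Ψ,
      (G : LInfty k d A) =ᵐ[volume] fun X => ∑' p, starBlk Ψ ϖ θ r F₁ F₂ p X := by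
  obtain ⟨C, hC0, hC⟩ := norm_starBlk_le h θ r hF₁ hF₂ 1
  have hsum := summable_pow_mul_pow h C
  have hmeas : ∀ p, AEStronglyMeasurable (starBlk Ψ ϖ θ r F₁ F₂ p) volume := fun p =>
    (continuous_starBlk h θ r F₁ F₂ p).aestronglyMeasurable
  have hcont : Continuous fun X => ∑' p, starBlk Ψ ϖ θ r F₁ F₂ p X :=
    continuous_tsum (fun p => continuous_starBlk h θ r F₁ F₂ p) hsum fun p X => hC p X
  have hmem : MemLp (fun X => ∑' p, starBlk Ψ ϖ θ r F₁ F₂ p X) ∞ :=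
    memLp_top_of_bound hcont.aestronglyMeasurable _
      (ae_of_all _ fun X => tsum_of_norm_bounded hsum.hasSum fun p => hC p X)
  refine ⟨hmem.toLp _, mem_symbolSpace_of_decay h fun N => ?_, hmem.coeFn_toLp⟩
  obtain ⟨D, hD0, hD⟩ := norm_starBlk_le h θ r hF₁ hF₂ (N + 1)
  refine ⟨∑' p : ℕ × ℕ, 2 * D * ((‖ϖ‖ ^ 1) ^ p.1 * (‖ϖ‖ ^ 1) ^ p.2), fun n X => ?_⟩
  rw [blk_congr hmem.coeFn_toLp, ← (blk_hasSum h hmeas hsum hC n X).tsum_eq]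
  refine tsum_of_norm_bounded ((summable_pow_mul_pow h (2 * D)).hasSum.mul_left _) fun p => ?_
  by_cases hp : max p.1 p.2 < n
  · rw [blk_of_invariant_of_lt h hp (fun X T hT => starBlk_add h θ r F₁ F₂ p X hT), norm_zero]
    positivity
  -- N powers of the decay in p are converted into decay in n; the one remaining power keeps the sum
  -- over the pairs finite.
  have hn : n ≤ p.1 + p.2 := (not_lt.1 hp).trans (max_le (Nat.le_add_right _ _)
    (Nat.le_add_left _ _))
  refine (norm_blk_le h (ae_of_all _ (hD p)) X).trans ?_
  have h1 : (‖ϖ‖ ^ N) ^ (p.1 + p.2) ≤ (‖ϖ‖ ^ N) ^ n :=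
    pow_le_pow_of_le_one (by positivity) (pow_le_one₀ (norm_nonneg _) h.unif_lt.le) hn
  calc 2 * (D * ((‖ϖ‖ ^ (N + 1)) ^ p.1 * (‖ϖ‖ ^ (N + 1)) ^ p.2))
      = (‖ϖ‖ ^ N) ^ (p.1 + p.2) * (2 * D * ((‖ϖ‖ ^ 1) ^ p.1 * (‖ϖ‖ ^ 1) ^ p.2)) := by
        rw [pow_add (‖ϖ‖ ^ N), pow_succ, pow_one, mul_pow, mul_pow]
        ring
    _ ≤ _ := mul_le_mul_of_nonneg_right h1 (by positivity)

theorem starInt_congr (h : LocalChar Ψ ϖ) {θ : k} (hθ0 : θ ≠ 0) (u v : Phase k d → ℝ)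
    {f f' g g' : Phase k d → A} (hf : f =ᵐ[volume] f') (hg : g =ᵐ[volume] g') (X : Phase k d) :
    starInt Ψ θ u v f g X = starInt Ψ θ u v f' g' X := by
  unfold starInt
  congr 1
  refine integral_congr_ae ?_
  have h1 : ∀ᵐ Y : Phase k d, f (X + θ • Y) = f' (X + θ • Y) := by
    have q1 : Measure.QuasiMeasurePreserving (fun Y : Phase k d => X + Y) :=
      (measurePreserving_add_left volume X).quasiMeasurePreserving
    exact (q1.comp (quasiMeasurePreserving_scale h hθ0 hθ0)).ae hf
  have h2 : ∀ᵐ Z : Phase k d, g (X + Z) = g' (X + Z) :=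
    (measurePreserving_add_left volume X).quasiMeasurePreserving.ae hg
  have h1' : ∀ᵐ P : Phase k d × Phase k d, f (X + θ • P.1) = f' (X + θ • P.1) :=
    Measure.quasiMeasurePreserving_fst.ae h1
  have h2' : ∀ᵐ P : Phase k d × Phase k d, g (X + P.2) = g' (X + P.2) :=
    Measure.quasiMeasurePreserving_snd.ae h2
  filter_upwards [h1', h2'] with P hP1 hP2
  rw [hP1, hP2]

/-- The factors cancel crosswise: the shell of Y is governed by the level of F₂ and the shell of Z
by the level of F₁ minus r, and on these shells the inverse powers of μ₀ are the inverses of the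
eigenvalues of J^{2d+1} and J_θ^{2d+1}. -/
theorem starProd_eq_tsum (h : LocalChar Ψ ϖ) {θ : k} (hθ0 : θ ≠ 0) {r : ℕ}
    (hr : ‖θ‖ = ‖ϖ‖ ^ r) {F₁ F₂ : LInfty k d A}
    (hF₁ : F₁ ∈ symbolSpace d A Ψ) (hF₂ : F₂ ∈ symbolSpace d A Ψ) (X : Phase k d) :
    starProd Ψ θ F₁ F₂ X = ∑' p, starBlk Ψ ϖ θ r F₁ F₂ p X := by
  set m := 2 * d + 1 with hm
  have hq := one_lt_q h
  set w : ℕ → ℝ := fun n => (‖ϖ‖⁻¹ ^ (n - r)) ^ m with hw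
  set z : ℕ → ℝ := fun n => (‖ϖ‖⁻¹ ^ n) ^ m with hz
  have hz0 : ∀ n, 0 < z n := fun n => by positivity
  have hw0 : ∀ n, 0 < w n := fun n => by positivity
  have hwz : ∀ n, w n ≤ z n := fun n => pow_le_pow_left₀ (by positivity)
    (pow_le_pow_right₀ hq.le (Nat.sub_le n r)) m
  -- Using J^{m+1} instead of Jᵐ leaves a factor q⁻ⁿ, so that the block expansions of J_θᵐF₁ and
  -- JᵐF₂ converge uniformly.
  have hblk : ∀ {F : LInfty k d A}, F ∈ symbolSpace d A Ψ → ∀ n X,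
      z n * ‖blk Ψ ϖ n F X‖ ≤ ‖ϖ‖ ^ n * (2 * ‖powJ Ψ (m + 1) F‖) := fun hF n X => by
    refine (mul_le_mul_of_nonneg_left (norm_blk_le_powJ h hF (m + 1) n X) (hz0 n).le).trans_eq ?_
    have e : z n * (‖ϖ‖ ^ (m + 1)) ^ n = ‖ϖ‖ ^ n := by
      have h4 : ‖ϖ‖ ≠ 0 := h.unif_pos.ne'
      simp only [hz, inv_pow]
      field_simp
      ring
    rw [← mul_assoc, e]
  have hb1 : ∀ n X, ‖(w n : ℂ) • blk Ψ ϖ n F₁ X‖ ≤ ‖ϖ‖ ^ n * (2 * ‖powJ Ψ (m + 1) F₁‖) :=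
    fun n X => by
    rw [norm_smul, Complex.norm_real, Real.norm_of_nonneg (hw0 n).le]
    exact (mul_le_mul_of_nonneg_right (hwz n) (norm_nonneg _)).trans (hblk hF₁ n X)
  have hb2 : ∀ n X, ‖(z n : ℂ) • blk Ψ ϖ n F₂ X‖ ≤ ‖ϖ‖ ^ n * (2 * ‖powJ Ψ (m + 1) F₂‖) :=
    fun n X => by
    rw [norm_smul, Complex.norm_real, Real.norm_of_nonneg (hz0 n).le]
    exact hblk hF₂ n X
  have hgeo := summable_geometric_of_lt_one (norm_nonneg ϖ) h.unif_lt
  have hs1 := hgeo.mul_right (2 * ‖powJ Ψ (m + 1) F₁‖)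
  have hs2 := hgeo.mul_right (2 * ‖powJ Ψ (m + 1) F₂‖)
  have hG1 : (powJdil Ψ θ m F₁ : LInfty k d A) =ᵐ[volume]
      fun X => ∑' n, (w n : ℂ) • blk Ψ ϖ n F₁ X := by
    have := ae_eq_tsum_blk h (Lp.memLp (powJdil Ψ θ m F₁)) hs1
      (fun n X => by rw [blk_powJdil h hθ0 hr hF₁]; exact hb1 n X)
    simpa only [blk_powJdil h hθ0 hr hF₁] using this
  have hG2 : (powJ Ψ m F₂ : LInfty k d A) =ᵐ[volume]
      fun X => ∑' n, (z n : ℂ) • blk Ψ ϖ n F₂ X := by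
    have := ae_eq_tsum_blk h (Lp.memLp (powJ Ψ m F₂)) hs2
      (fun n X => by rw [blk_powJ h hF₂]; exact hb2 n X)
    simpa only [blk_powJ h hF₂] using this
  change starInt Ψ θ (fun Y => (mu0 Ψ Y ^ m)⁻¹) (fun Z => (mu0 Ψ Z ^ m)⁻¹)
    (powJdil Ψ θ m F₁) (powJ Ψ m F₂) X = _
  rw [starInt_congr h hθ0 _ _ hG1 hG2]
  have hterm : ∀ p : ℕ × ℕ, starInt Ψ θ (fun Y => (mu0 Ψ Y ^ m)⁻¹) (fun Z => (mu0 Ψ Z ^ m)⁻¹)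
      (fun X => (w p.1 : ℂ) • blk Ψ ϖ p.1 F₁ X) (fun X => (z p.2 : ℂ) • blk Ψ ϖ p.2 F₂ X) X
      = starBlk Ψ ϖ θ r F₁ F₂ p X := fun p => by
    have e0 := starInt_smul (Ψ := Ψ) θ (fun Y => (mu0 Ψ Y ^ m)⁻¹) (fun Z => (mu0 Ψ Z ^ m)⁻¹)
      (blk Ψ ϖ p.1 F₁) (blk Ψ ϖ p.2 F₂) 1 1 (w p.1) (z p.2) X
    have e1 := starInt_eq_shell h hr (isRadial_mu0_inv h) (isRadial_mu0_inv h)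
      (isLevel_blk h (Lp.memLp F₁) p.1) (isLevel_blk h (Lp.memLp F₂) p.2) X
    have e2 : ∀ j, (shell Ψ ϖ d j).indicator (fun Y : Phase k d => (mu0 Ψ Y ^ m)⁻¹)
        = fun Y => (z j)⁻¹ * shellWeight Ψ ϖ j Y := fun j => by
      funext Y
      by_cases hY : Y ∈ shell Ψ ϖ d j
      · rw [shellWeight, Set.indicator_of_mem hY, Set.indicator_of_mem hY, mul_one,
          shell_mu0_pow m j Y hY]
      · rw [shellWeight, Set.indicator_of_notMem hY, Set.indicator_of_notMem hY, mul_zero]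
    have e3 := starInt_smul (Ψ := Ψ) θ (shellWeight Ψ ϖ p.2) (shellWeight Ψ ϖ (p.1 - r))
      (blk Ψ ϖ p.1 F₁) (blk Ψ ϖ p.2 F₂) (z p.2)⁻¹ (z (p.1 - r))⁻¹ 1 1 X
    simp only [one_mul, Complex.ofReal_one, one_smul, mul_one] at e0 e3
    rw [e0, e1, e2, e2, e3, smul_smul, ← Complex.ofReal_mul]
    have e4 : w p.1 * z p.2 * ((z p.2)⁻¹ * (z (p.1 - r))⁻¹) = 1 := by
      have := (hz0 p.2).ne'
      have h5 : w p.1 = z (p.1 - r) := rfl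
      have := (hz0 (p.1 - r)).ne'
      rw [h5]
      field_simp
    rw [e4, Complex.ofReal_one, one_smul]
    rfl
  simp_rw [← hterm]
  unfold starInt
  have hprod : ∀ P : Phase k d × Phase k d, (conj (Ψ (2 * symp P.1 P.2) : ℂ)
        * (((mu0 Ψ P.1 ^ m)⁻¹ * (mu0 Ψ P.2 ^ m)⁻¹ : ℝ) : ℂ)) •
      ((∑' n, (w n : ℂ) • blk Ψ ϖ n F₁ (X + θ • P.1)) * ∑' n, (z n : ℂ) • blk Ψ ϖ n F₂ (X + P.2))
      = ∑' p : ℕ × ℕ, (conj (Ψ (2 * symp P.1 P.2) : ℂ)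
        * (((mu0 Ψ P.1 ^ m)⁻¹ * (mu0 Ψ P.2 ^ m)⁻¹ : ℝ) : ℂ)) •
        (((w p.1 : ℂ) • blk Ψ ϖ p.1 F₁ (X + θ • P.1))
          * ((z p.2 : ℂ) • blk Ψ ϖ p.2 F₂ (X + P.2))) := fun P => by
    have s1 : Summable fun n => (w n : ℂ) • blk Ψ ϖ n F₁ (X + θ • P.1) :=
      hs1.of_norm_bounded fun n => hb1 n _
    have s2 : Summable fun n => (z n : ℂ) • blk Ψ ϖ n F₂ (X + P.2) :=
      hs2.of_norm_bounded fun n => hb2 n _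
    have s3 : Summable fun p : ℕ × ℕ => ((w p.1 : ℂ) • blk Ψ ϖ p.1 F₁ (X + θ • P.1))
        * ((z p.2 : ℂ) • blk Ψ ϖ p.2 F₂ (X + P.2)) :=
      (hs1.mul_of_nonneg hs2 (fun n => by positivity) (fun n => by positivity)).of_norm_bounded
        fun p => (norm_mul_le _ _).trans
          (mul_le_mul (hb1 _ _) (hb2 _ _) (norm_nonneg _) (by positivity))
    rw [s1.tsum_mul_tsum s2 s3, s3.tsum_const_smul]
  have hi : ∀ p : ℕ × ℕ, Integrable fun P : Phase k d × Phase k d =>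
      (conj (Ψ (2 * symp P.1 P.2) : ℂ) * (((mu0 Ψ P.1 ^ m)⁻¹ * (mu0 Ψ P.2 ^ m)⁻¹ : ℝ) : ℂ)) •
        (((w p.1 : ℂ) • blk Ψ ϖ p.1 F₁ (X + θ • P.1))
          * ((z p.2 : ℂ) • blk Ψ ϖ p.2 F₂ (X + P.2))) := fun p =>
    integrable_starInt h θ (integrable_mu0_inv h) (integrable_mu0_inv h)
      (f := fun X => (w p.1 : ℂ) • blk Ψ ϖ p.1 F₁ X) (g := fun X => (z p.2 : ℂ) • blk Ψ ϖ p.2 F₂ X)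
      ((continuous_blk h _ _).const_smul _) ((continuous_blk h _ _).const_smul _)
      (hb1 p.1) (hb2 p.2) X
  have hμ : Integrable fun P : Phase k d × Phase k d =>
      (mu0 Ψ P.1 ^ m)⁻¹ * (mu0 Ψ P.2 ^ m)⁻¹ :=
    (integrable_mu0_inv h).mul_prod (integrable_mu0_inv h)
  -- Sum and integral are exchanged while the integrable weights are still present; only afterwards
  -- is each term rewritten by shells.
  have hHS := hasSum_integral_of_summable_integral_norm hi (by
    refine Summable.of_nonneg_of_le (fun p => integral_nonneg fun _ => norm_nonneg _) (fun p => ?_)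
      ((hs1.mul_of_nonneg hs2 (fun n => by positivity) (fun n => by positivity)).mul_left
        (∫ P : Phase k d × Phase k d, (mu0 Ψ P.1 ^ m)⁻¹ * (mu0 Ψ P.2 ^ m)⁻¹))
    rw [← integral_mul_const]
    refine integral_mono (hi p).norm (hμ.mul_const _) fun P => ?_
    dsimp only
    rw [norm_smul, norm_mul, RCLike.norm_conj, norm_char, one_mul, Complex.norm_real,
      Real.norm_of_nonneg (mul_nonneg (mu0_inv_nonneg _ _) (mu0_inv_nonneg _ _))]
    refine mul_le_mul_of_nonneg_left ((norm_mul_le _ _).trans ?_)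
      (mul_nonneg (mu0_inv_nonneg _ _) (mu0_inv_nonneg _ _))
    exact mul_le_mul (hb1 _ _) (hb2 _ _) (norm_nonneg _) (by positivity))
  simp_rw [hprod]
  rw [← hHS.tsum_eq, hHS.summable.tsum_const_smul]

end StarSymbol

/-! ### The Gauss integral and the composition of two Wigner functions. -/

section Composition

open Filter Topology

variable {k : Type*} [NontriviallyNormedField k] [IsUltrametricDist k] [ProperSpace k]
  [MeasureSpace k] [BorelSpace k] [(volume : Measure k).IsAddHaarMeasure]
  {d : ℕ} {Ψ : AddChar k Circle} {ϖ : k}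

theorem box_eq_prod (h : LocalChar Ψ ϖ) (a b c : k) (hc : ‖c‖ = conductorAbs Ψ) :
    (box (d := d) Ψ a b : Set (Phase k d))
      = Metric.closedBall (0 : Fin d → k) ‖a‖ ×ˢ Metric.closedBall (0 : Fin d → k) ‖b * c‖ := by
  ext X
  rw [SetLike.mem_coe, h.mem_box, Set.mem_prod, mem_closedBall_zero_iff, mem_closedBall_zero_iff,
    norm_mul, hc]

theorem volume_real_pi_closedBall (h : LocalChar Ψ ϖ) (a : k) :
    volume.real (Metric.closedBall (0 : Fin d → k) ‖a‖)
      = ‖a‖ ^ d * volume.real (Metric.closedBall (0 : Fin d → k) 1) := by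
  have h1 := volume_pi_closedBall (d := d) h a
  have h2 := volume_pi_closedBall (d := d) h 1
  rw [norm_one, ENNReal.ofReal_one, one_mul] at h2
  rw [Measure.real, Measure.real, h1, h2, mul_pow, ENNReal.toReal_mul, ENNReal.toReal_pow,
    ENNReal.toReal_ofReal (norm_nonneg a)]

theorem norm_add_le_iff {x a : Fin d → k} {r : ℝ} (hx : ‖x‖ ≤ r) : ‖x + a‖ ≤ r ↔ ‖a‖ ≤ r := by
  refine ⟨fun hh => ?_, fun hh => (IsUltrametricDist.norm_add_le_max _ _).trans (max_le hx hh)⟩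
  have := (norm_sub_le_max_pi (x + a) x).trans (max_le hh hx)
  rwa [add_sub_cancel_left] at this

/-- A quadratic Gauss integral. -/
theorem integral_box_gauss (h : LocalChar Ψ ϖ) {θ : k} (hθ0 : θ ≠ 0) (D : Phase k d) :
    ∫ L in (box (d := d) Ψ 1 θ : Set (Phase k d)),
      (Ψ (θ⁻¹ * (2⁻¹ * (L.2 ⬝ᵥ L.1 + D.2 ⬝ᵥ L.1 - L.2 ⬝ᵥ D.1))) : ℂ)
      = (box (d := d) Ψ 1 θ : Set (Phase k d)).indicator
        (fun D => ((‖(2 : k)‖ ^ d * ‖θ‖ ^ d : ℝ) : ℂ) * (Ψ (θ⁻¹ * (2⁻¹ * (D.2 ⬝ᵥ D.1))) : ℂ)) D := by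
  obtain ⟨c, hc⟩ := h.exists_gen
  have h2 := h.two_ne
  have h2' : 0 < ‖(2 : k)‖ := norm_pos_iff.2 h2
  have hθ' : 0 < ‖θ‖ := norm_pos_iff.2 hθ0
  have hc' : 0 < ‖c‖ := hc ▸ h.cond_pos
  set V₁ := volume.real (Metric.closedBall (0 : Fin d → k) 1) with hV₁
  set V₂ := volume.real (Metric.closedBall (0 : Fin d → k) ‖θ * c‖) with hV₂
  have hV : V₁ * V₂ = ‖θ‖ ^ d := by
    have e1 := volume_real_box (d := d) h (1 : k) θ
    rw [box_eq_prod h _ _ c hc, norm_one, one_mul] at e1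
    rw [← e1, Measure.volume_eq_prod, measureReal_prod_prod]
  have hint : IntegrableOn (fun L : Phase k d =>
      (Ψ (θ⁻¹ * (2⁻¹ * (L.2 ⬝ᵥ L.1 + D.2 ⬝ᵥ L.1 - L.2 ⬝ᵥ D.1))) : ℂ))
      (box (d := d) Ψ 1 θ : Set (Phase k d)) := by
    refine ContinuousOn.integrableOn_compact (isCompact_box h _ _) (Continuous.continuousOn ?_)
    refine continuous_subtype_val.comp (h.cont.comp ?_)
    unfold dotProduct
    fun_prop
  rw [box_eq_prod h _ _ c hc] at hint ⊢
  rw [Measure.volume_eq_prod, setIntegral_prod _ hint]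
  -- The momentum integral is that of a character: it confines x to the ball of radius |2| around
  -- D.1. This ball meets the unit ball only if D.1 is in the latter, which then contains it. After
  -- recentring, the position integral is again that of a character and yields the condition on D.2.
  have inner : ∀ x : Fin d → k, ∫ y in Metric.closedBall (0 : Fin d → k) ‖θ * c‖,
      (Ψ (θ⁻¹ * (2⁻¹ * (y ⬝ᵥ x + D.2 ⬝ᵥ x - y ⬝ᵥ D.1))) : ℂ)
      = (Metric.closedBall (0 : Fin d → k) ‖(2 : k)‖).indicator
        (fun _ => (Ψ (θ⁻¹ * (2⁻¹ * (D.2 ⬝ᵥ x))) : ℂ) * (V₂ : ℂ)) (x - D.1) := by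
    intro x
    have e1 : ∀ y : Fin d → k, (Ψ (θ⁻¹ * (2⁻¹ * (y ⬝ᵥ x + D.2 ⬝ᵥ x - y ⬝ᵥ D.1))) : ℂ)
        = (Ψ (θ⁻¹ * (2⁻¹ * (D.2 ⬝ᵥ x))) : ℂ) * (Ψ (((θ⁻¹ * 2⁻¹) • (x - D.1)) ⬝ᵥ y) : ℂ) := by
      intro y
      rw [← char_add, smul_dotProduct, sub_dotProduct, dotProduct_comm x y, dotProduct_comm D.1 y,
        smul_eq_mul]
      congr 3
      ring
    simp_rw [e1]
    rw [integral_const_mul, integral_closedBall_char h]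
    have e2 : (θ⁻¹ * 2⁻¹) • (x - D.1) ∈ {v : Fin d → k | ‖v‖ * ‖θ * c‖ ≤ conductorAbs Ψ}
        ↔ x - D.1 ∈ Metric.closedBall (0 : Fin d → k) ‖(2 : k)‖ := by
      rw [Set.mem_ofPred_eq, mem_closedBall_zero_iff, norm_smul, norm_mul, norm_mul, norm_inv,
        norm_inv, ← hc, ← mul_assoc, mul_le_iff_le_one_left hc']
      rw [show ‖θ‖⁻¹ * ‖(2 : k)‖⁻¹ * ‖x - D.1‖ * ‖θ‖ = ‖(2 : k)‖⁻¹ * ‖x - D.1‖ by field_simp,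
        inv_mul_le_iff₀ h2', mul_one]
    by_cases hx : x - D.1 ∈ Metric.closedBall (0 : Fin d → k) ‖(2 : k)‖
    · rw [Set.indicator_of_mem (e2.2 hx), Set.indicator_of_mem hx]
    · rw [Set.indicator_of_notMem (fun h' => hx (e2.1 h')), Set.indicator_of_notMem hx, mul_zero]
  simp_rw [inner]
  rw [← integral_indicator (measurableSet_closedBall_pi _), ← integral_add_right_eq_self _ D.1]
  have e3 : ∀ s : Fin d → k, (Metric.closedBall (0 : Fin d → k) ‖(1 : k)‖).indicator
      (fun x => (Metric.closedBall (0 : Fin d → k) ‖(2 : k)‖).indicator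
        (fun _ => (Ψ (θ⁻¹ * (2⁻¹ * (D.2 ⬝ᵥ x))) : ℂ) * (V₂ : ℂ)) (x - D.1)) (s + D.1)
      = (Metric.closedBall (0 : Fin d → k) ‖(2 : k)‖).indicator (fun s =>
        ((Metric.closedBall (0 : Fin d → k) ‖(1 : k)‖).indicator
          (fun _ => (V₂ : ℂ) * (Ψ (θ⁻¹ * (2⁻¹ * (D.2 ⬝ᵥ D.1))) : ℂ)) D.1)
          * (Ψ (((θ⁻¹ * 2⁻¹) • D.2) ⬝ᵥ s) : ℂ)) s := by
    intro s
    by_cases hs : s ∈ Metric.closedBall (0 : Fin d → k) ‖(2 : k)‖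
    swap
    · classical
      rw [Set.indicator_of_notMem hs, Set.indicator_apply]
      rw [add_sub_cancel_right, Set.indicator_of_notMem hs, ite_self]
    rw [Set.indicator_of_mem hs]
    have hs1 : ‖s‖ ≤ ‖(1 : k)‖ := by
      rw [norm_one]
      exact (mem_closedBall_zero_iff.1 hs).trans norm_two_le
    by_cases ha : D.1 ∈ Metric.closedBall (0 : Fin d → k) ‖(1 : k)‖
    · rw [Set.indicator_of_mem ha, Set.indicator_of_mem (mem_closedBall_zero_iff.2
        ((norm_add_le_iff hs1).2 (mem_closedBall_zero_iff.1 ha))), add_sub_cancel_right,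
        Set.indicator_of_mem hs, mul_comm, mul_assoc, ← char_add, dotProduct_add, smul_dotProduct,
        smul_eq_mul]
      congr 3
      ring_nf
    · rw [Set.indicator_of_notMem ha, Set.indicator_of_notMem, zero_mul]
      exact fun h' => ha (mem_closedBall_zero_iff.2
        ((norm_add_le_iff hs1).1 (mem_closedBall_zero_iff.1 h')))
  simp_rw [e3]
  rw [integral_indicator (measurableSet_closedBall_pi _), integral_const_mul,
    integral_closedBall_char h, volume_real_pi_closedBall h]
  have e4 : (θ⁻¹ * 2⁻¹) • D.2 ∈ {v : Fin d → k | ‖v‖ * ‖(2 : k)‖ ≤ conductorAbs Ψ}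
      ↔ D.2 ∈ Metric.closedBall (0 : Fin d → k) ‖θ * c‖ := by
    rw [Set.mem_ofPred_eq, mem_closedBall_zero_iff, norm_smul, norm_mul, norm_mul, norm_inv,
      norm_inv, ← hc, show ‖θ‖⁻¹ * ‖(2 : k)‖⁻¹ * ‖D.2‖ * ‖(2 : k)‖ = ‖θ‖⁻¹ * ‖D.2‖ by field_simp,
      inv_mul_le_iff₀ hθ']
  by_cases ha : D.1 ∈ Metric.closedBall (0 : Fin d → k) ‖(1 : k)‖
  swap
  · rw [Set.indicator_of_notMem ha, zero_mul, Set.indicator_of_notMem (fun h' => ha h'.1)]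
  by_cases hb : D.2 ∈ Metric.closedBall (0 : Fin d → k) ‖θ * c‖
  swap
  · rw [Set.indicator_of_notMem (fun h' => hb (e4.1 h')), mul_zero,
      Set.indicator_of_notMem (fun h' => hb h'.2)]
  have hDm : D ∈ Metric.closedBall (0 : Fin d → k) ‖(1 : k)‖
      ×ˢ Metric.closedBall (0 : Fin d → k) ‖θ * c‖ := ⟨ha, hb⟩
  rw [Set.indicator_of_mem ha, Set.indicator_of_mem (e4.2 hb), Set.indicator_of_mem hDm, ← hV]
  push_cast
  ring

/-- `∫ W_{Z,Y}(P) W_{X,Z}(Q) dZ` in terms of `W_{X,Y}`. -/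
theorem integral_wigner_mul_wigner (h : LocalChar Ψ ϖ) {θ : k} (hθ0 : θ ≠ 0)
    (X Y P Q : Phase k d) :
    ∫ Z, wigner Ψ θ Z Y P * wigner Ψ θ X Z Q
      = ((‖(2 : k)‖ ^ d : ℝ) : ℂ) * ∫ Z, wigner Ψ θ X Y Z
        * conj (Ψ (2 * θ⁻¹ * symp (P - Z) (Q - Z)) : ℂ) := by
  have h2 := h.two_ne
  have hn2 : ‖(2 : k)‖ ≠ 0 := norm_ne_zero_iff.2 h2
  -- W_{X,Z}(Q) is supported on the coset of Z₀ modulo `box 1 θ`, and D is the vector whose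
  -- membership in this box decides whether W_{Z₀,Y}(P) is nonzero.
  set Z₀ := (2 : k) • Q - X with hZ₀
  set D := Z₀ + Y - (2 : k) • P with hD
  set M : k := wexp Z₀ Y P + wexp X Z₀ Q with hM
  have lhs : ∫ Z, wigner Ψ θ Z Y P * wigner Ψ θ X Z Q
      = ((‖θ‖ ^ d : ℝ) : ℂ) * (box (d := d) Ψ 1 θ : Set (Phase k d)).indicator
        (fun _ => (Ψ (θ⁻¹ * M) : ℂ)) D := by
    rw [← integral_add_left_eq_self _ Z₀]
    -- On this coset the state at Z only changes by a phase, which enters one factor directly and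
    -- the other one conjugated; the integrand is constant there.
    have e1 : ∀ T : Phase k d, wigner Ψ θ (Z₀ + T) Y P * wigner Ψ θ X (Z₀ + T) Q
        = (box (d := d) Ψ 1 θ : Set (Phase k d)).indicator (fun _ =>
          wigner Ψ θ Z₀ Y P * wigner Ψ θ X Z₀ Q) T := by
      intro T
      by_cases hT : T ∈ (box (d := d) Ψ 1 θ : Set (Phase k d))
      · rw [Set.indicator_of_mem hT]
        obtain ⟨c, hc1, hc⟩ := coherent_add h hθ0 Z₀ hT
        have e2 : wigner Ψ θ (Z₀ + T) Y P = c * wigner Ψ θ Z₀ Y P := by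
          unfold wigner
          rw [← integral_const_mul]
          simp_rw [hc, mul_assoc]
        have e3 : wigner Ψ θ X (Z₀ + T) Q = conj c * wigner Ψ θ X Z₀ Q := by
          rw [← wigner_conj h hθ0, ← wigner_conj h hθ0 Z₀ X Q, ← map_mul (starRingEnd ℂ)]
          congr 1
          unfold wigner
          rw [← integral_const_mul]
          simp_rw [hc, mul_assoc]
        rw [e2, e3, mul_mul_mul_comm, Complex.mul_conj', hc1]
        simp
      · rw [Set.indicator_of_notMem hT, wigner_eq h hθ0 X (Z₀ + T) Q, Set.indicator_of_notMem,
          mul_zero]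
        rwa [hZ₀, show X + ((2 : k) • Q - X + T) - (2 : k) • Q = T by abel]
    simp_rw [e1]
    rw [integral_indicator (measurableSet_box h _ _), setIntegral_const, volume_real_box h,
      norm_one, one_mul, Complex.real_smul]
    congr 1
    have e4 : X + Z₀ - (2 : k) • Q ∈ (box (d := d) Ψ 1 θ : Set (Phase k d)) := by
      rw [hZ₀, show X + ((2 : k) • Q - X) - (2 : k) • Q = 0 by abel]
      exact zero_mem _
    rw [wigner_eq h hθ0, wigner_eq h hθ0, Set.indicator_of_mem e4]
    by_cases hDb : D ∈ (box (d := d) Ψ 1 θ : Set (Phase k d))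
    · rw [Set.indicator_of_mem hDb, Set.indicator_of_mem hDb, ← char_add, ← mul_add]
    · rw [Set.indicator_of_notMem hDb, Set.indicator_of_notMem hDb, zero_mul]
  -- Completing the square in L = X + Y − 2Z: E₀ is the constant term, and the phase produced by the
  -- Gauss integral restores M.
  set E₀ : k := M - 2⁻¹ * (D.2 ⬝ᵥ D.1) with hE₀
  have rhs : ∀ Z, wigner Ψ θ X Y Z * conj (Ψ (2 * θ⁻¹ * symp (P - Z) (Q - Z)) : ℂ)
      = (fun L : Phase k d => (box (d := d) Ψ 1 θ : Set (Phase k d)).indicator (fun L =>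
        (Ψ (θ⁻¹ * E₀) : ℂ)
          * (Ψ (θ⁻¹ * (2⁻¹ * (L.2 ⬝ᵥ L.1 + D.2 ⬝ᵥ L.1 - L.2 ⬝ᵥ D.1))) : ℂ)) L)
        (X + Y - (2 : k) • Z) := by
    intro Z
    dsimp only
    rw [wigner_eq h hθ0, conj_char]
    by_cases hb : X + Y - (2 : k) • Z ∈ (box (d := d) Ψ 1 θ : Set (Phase k d))
    · rw [Set.indicator_of_mem hb, Set.indicator_of_mem hb, ← char_add, ← char_add]
      have e5 : wexp X Y Z - 2 * symp (P - Z) (Q - Z)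
          + (2⁻¹ * (D.2 ⬝ᵥ D.1)) = M + 2⁻¹ * ((X + Y - (2 : k) • Z).2 ⬝ᵥ (X + Y - (2 : k) • Z).1
            + D.2 ⬝ᵥ (X + Y - (2 : k) • Z).1 - (X + Y - (2 : k) • Z).2 ⬝ᵥ D.1) := by
        simp only [hM, hD, hZ₀, wexp, symp, dotProduct, Finset.mul_sum, ← Finset.sum_add_distrib,
          ← Finset.sum_sub_distrib]
        refine Finset.sum_congr rfl fun i _ => ?_
        simp only [Pi.sub_apply, Pi.add_apply, Pi.smul_apply, smul_eq_mul, Prod.fst_add,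
          Prod.fst_sub, Prod.snd_add, Prod.snd_sub, Prod.smul_fst, Prod.smul_snd]
        field_simp
        ring
      congr 2
      rw [hE₀]
      linear_combination θ⁻¹ * e5
    · rw [Set.indicator_of_notMem hb, Set.indicator_of_notMem hb, zero_mul]
  rw [lhs]
  simp_rw [rhs]
  rw [integral_sub_two_smul h (X + Y), integral_indicator (measurableSet_box h _ _),
    integral_const_mul, integral_box_gauss h hθ0]
  by_cases hDb : D ∈ (box (d := d) Ψ 1 θ : Set (Phase k d))
  · rw [Set.indicator_of_mem hDb, Set.indicator_of_mem hDb, hE₀, mul_sub, sub_eq_add_neg, char_add,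
      Complex.real_smul]
    have e6 : (Ψ (-(θ⁻¹ * (2⁻¹ * (D.2 ⬝ᵥ D.1)))) : ℂ) * (Ψ (θ⁻¹ * (2⁻¹ * (D.2 ⬝ᵥ D.1))) : ℂ)
        = 1 := by
      rw [← char_add, neg_add_cancel]
      simp
    have e7 : ‖(2 : k)‖ ^ d * ((‖(2 : k)‖ * ‖(2 : k)‖) ^ d)⁻¹ * (‖(2 : k)‖ ^ d * ‖θ‖ ^ d)
        = ‖θ‖ ^ d := by
      rw [mul_pow]
      field_simp
    have e8 := congrArg Complex.ofReal e7
    rw [Complex.ofReal_mul, Complex.ofReal_mul] at e8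
    rw [← e8]
    linear_combination (-((‖(2 : k)‖ ^ d : ℝ) : ℂ) * ((((‖(2 : k)‖ * ‖(2 : k)‖) ^ d)⁻¹ : ℝ) : ℂ)
      * ((‖(2 : k)‖ ^ d * ‖θ‖ ^ d : ℝ) : ℂ) * (Ψ (θ⁻¹ * M) : ℂ)) * e6
  · rw [Set.indicator_of_notMem hDb, Set.indicator_of_notMem hDb]
    simp

end Composition

/-! ### Fubini for kernels of integrable symbols. -/

section SymbolComposition

open Filter Topology

variable {k : Type*} [NontriviallyNormedField k] [IsUltrametricDist k] [ProperSpace k]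
  [MeasureSpace k] [BorelSpace k] [(volume : Measure k).IsAddHaarMeasure]
  {d : ℕ} {Ψ : AddChar k Circle} {ϖ : k} {A : Type*} [NonUnitalCStarAlgebra A]

instance : (volume : Measure (Phase k d × Phase k d)).IsAddHaarMeasure :=
  Measure.prod.instIsAddHaarMeasure volume volume

theorem stronglyMeasurable_wignerInt (h : LocalChar Ψ ϖ) {θ : k} (hθ0 : θ ≠ 0)
    {H : Phase k d → A} (hH : AEStronglyMeasurable H volume) :
    StronglyMeasurable fun P : Phase k d × Phase k d => wignerInt Ψ θ H P.1 P.2 := by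
  have e : (fun P : Phase k d × Phase k d => wignerInt Ψ θ H P.1 P.2)
      = fun P => wignerInt Ψ θ (hH.mk H) P.1 P.2 := by
    funext P
    exact wignerInt_congr hH.ae_eq_mk _ _
  rw [e]
  unfold wignerInt
  refine StronglyMeasurable.const_smul ?_ _
  refine StronglyMeasurable.integral_prod_right'
    (f := fun Q : (Phase k d × Phase k d) × Phase k d =>
      wigner Ψ θ Q.1.1 Q.1.2 Q.2 • hH.mk H Q.2) ?_
  exact (measurable_wigner h hθ0).stronglyMeasurable.smul
    (hH.stronglyMeasurable_mk.comp_measurable measurable_snd)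

theorem integrable_mul_fst_snd {a b : Phase k d → A} (ha : Integrable a) (hb : Integrable b) :
    Integrable fun p : Phase k d × Phase k d => a p.1 * b p.2 :=
  ha.op_fst_snd (op := fun x y : A => x * y) (by fun_prop)
    ⟨1, fun x y => by rw [one_mul]; exact norm_mul_le x y⟩ hb

theorem integral_mul_fst_snd {a b : Phase k d → A} (ha : Integrable a) (hb : Integrable b) :
    ∫ p : Phase k d × Phase k d, a p.1 * b p.2 = (∫ P, a P) * ∫ Q, b Q :=
  integral_prod_bilin (ContinuousLinearMap.mul ℂ A) ha hb

theorem integrable_wigner_mul_wigner (h : LocalChar Ψ ϖ) {θ : k} (hθ0 : θ ≠ 0)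
    (X Y P Q : Phase k d) :
    Integrable (fun Z => wigner Ψ θ Z Y P * wigner Ψ θ X Z Q)
      ∧ ∫ Z, ‖wigner Ψ θ Z Y P * wigner Ψ θ X Z Q‖ ≤ ‖θ‖ ^ d := by
  have hb : ∀ Z, ‖wigner Ψ θ Z Y P * wigner Ψ θ X Z Q‖
      ≤ (box (d := d) Ψ 1 θ : Set (Phase k d)).indicator (fun _ => (1 : ℝ))
        (Z + (X - (2 : k) • Q)) := fun Z => by
    rw [norm_mul, norm_wigner h hθ0 X Z Q, show Z + (X - (2 : k) • Q) = X + Z - (2 : k) • Q by abel]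
    exact mul_le_of_le_one_left (Set.indicator_nonneg (fun _ _ => zero_le_one) _)
      (norm_wigner_le_one h hθ0 _ _ _)
  have h1 : Integrable ((box (d := d) Ψ 1 θ : Set (Phase k d)).indicator fun _ => (1 : ℝ)) :=
    (integrable_indicator_iff (measurableSet_box h 1 θ)).2
      (integrableOn_const (isCompact_box h 1 θ).measure_lt_top.ne)
  have h2 := h1.comp_add_right (X - (2 : k) • Q)
  have hi : Integrable (fun Z => wigner Ψ θ Z Y P * wigner Ψ θ X Z Q) := by
    refine h2.mono' ?_ (ae_of_all _ hb)
    refine Measurable.aestronglyMeasurable (Measurable.mul ?_ ?_)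
    · exact (measurable_wigner h hθ0).comp (f := fun Z : Phase k d => ((Z, Y), P)) (by fun_prop)
    · exact (measurable_wigner h hθ0).comp (f := fun Z : Phase k d => ((X, Z), Q)) (by fun_prop)
  refine ⟨hi, (integral_mono hi.norm h2 hb).trans_eq ?_⟩
  rw [integral_add_right_eq_self, integral_indicator (measurableSet_box h 1 θ), setIntegral_const,
    volume_real_box h, norm_one, one_mul, smul_eq_mul, mul_one]

theorem integral_wignerInt_mul_eq (h : LocalChar Ψ ϖ) {θ : k} (hθ0 : θ ≠ 0) {a b : Phase k d → A}
    (ha : Integrable a) (hb : Integrable b) (X Y : Phase k d) :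
    ∫ Z, wignerInt Ψ θ a Z Y * wignerInt Ψ θ b X Z
      = ((‖2 / θ‖ ^ d * ‖2 / θ‖ ^ d : ℝ) : ℂ) • ∫ p : Phase k d × Phase k d,
        (∫ Z, wigner Ψ θ Z Y p.1 * wigner Ψ θ X Z p.2) • (a p.1 * b p.2) := by
  have hab := integrable_mul_fst_snd ha hb
  have hmeas : AEStronglyMeasurable (fun q : Phase k d × (Phase k d × Phase k d) =>
      (wigner Ψ θ q.1 Y q.2.1 * wigner Ψ θ X q.1 q.2.2) • (a q.2.1 * b q.2.2))
      (volume.prod volume) := by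
    refine AEStronglyMeasurable.smul (Measurable.aestronglyMeasurable (Measurable.mul ?_ ?_))
      hab.aestronglyMeasurable.comp_snd
    · exact (measurable_wigner h hθ0).comp
        (f := fun q : Phase k d × (Phase k d × Phase k d) => ((q.1, Y), q.2.1)) (by fun_prop)
    · exact (measurable_wigner h hθ0).comp
        (f := fun q : Phase k d × (Phase k d × Phase k d) => ((X, q.1), q.2.2)) (by fun_prop)
  have hint : Integrable (fun q : Phase k d × (Phase k d × Phase k d) =>
      (wigner Ψ θ q.1 Y q.2.1 * wigner Ψ θ X q.1 q.2.2) • (a q.2.1 * b q.2.2))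
      (volume.prod volume) := by
    rw [integrable_prod_iff' hmeas]
    refine ⟨ae_of_all _ fun p => (integrable_wigner_mul_wigner h hθ0 X Y p.1 p.2).1.smul_const
        (a p.1 * b p.2),
      (hab.norm.const_mul (‖θ‖ ^ d)).mono' hmeas.norm.prod_swap.integral_prod_right'
        (ae_of_all _ fun p => ?_)⟩
    simp only [norm_smul]
    rw [integral_mul_const, norm_mul, norm_norm,
      Real.norm_of_nonneg (integral_nonneg fun _ => norm_nonneg _)]
    exact mul_le_mul_of_nonneg_right (integrable_wigner_mul_wigner h hθ0 X Y p.1 p.2).2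
      (norm_nonneg _)
  have e1 : ∀ Z, wignerInt Ψ θ a Z Y * wignerInt Ψ θ b X Z
      = ((‖2 / θ‖ ^ d * ‖2 / θ‖ ^ d : ℝ) : ℂ) • ∫ p : Phase k d × Phase k d,
        (wigner Ψ θ Z Y p.1 * wigner Ψ θ X Z p.2) • (a p.1 * b p.2) := by
    intro Z
    have i1 : Integrable fun P => wigner Ψ θ Z Y P • a P :=
      ha.bdd_smul 1 (integrable_wigner h hθ0 Z Y).aestronglyMeasurable
        (ae_of_all _ fun P => norm_wigner_le_one h hθ0 _ _ _)
    have i2 : Integrable fun Q => wigner Ψ θ X Z Q • b Q :=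
      hb.bdd_smul 1 (integrable_wigner h hθ0 X Z).aestronglyMeasurable
        (ae_of_all _ fun P => norm_wigner_le_one h hθ0 _ _ _)
    unfold wignerInt
    rw [smul_mul_smul_comm, ← integral_mul_fst_snd i1 i2, ← Complex.ofReal_mul]
    simp_rw [smul_mul_smul_comm]
  simp_rw [e1]
  rw [integral_smul]
  congr 1
  rw [integral_integral_swap hint]
  simp_rw [integral_smul_const]

theorem integral_kernel_smul_eq (h : LocalChar Ψ ϖ) {θ : k} (hθ0 : θ ≠ 0) {a b : Phase k d → A}
    (ha : Integrable a) (hb : Integrable b) (X Y : Phase k d) :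
    ∫ p : Phase k d × Phase k d, (∫ Z, wigner Ψ θ X Y Z
        * conj (Ψ (2 * θ⁻¹ * symp (p.1 - Z) (p.2 - Z)) : ℂ)) • (a p.1 * b p.2)
      = ∫ Z, wigner Ψ θ X Y Z • ∫ p : Phase k d × Phase k d,
        conj (Ψ (2 * θ⁻¹ * symp (p.1 - Z) (p.2 - Z)) : ℂ) • (a p.1 * b p.2) := by
  have hab := integrable_mul_fst_snd ha hb
  have hcont : Continuous fun q : (Phase k d × Phase k d) × Phase k d =>
      (conj (Ψ (2 * θ⁻¹ * symp (q.1.1 - q.2) (q.1.2 - q.2)) : ℂ)) :=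
    Complex.continuous_conj.comp ((continuous_char_symp h (2 * θ⁻¹)).comp
      (f := fun q : (Phase k d × Phase k d) × Phase k d => (q.1.1 - q.2, q.1.2 - q.2))
      (by fun_prop))
  have hint : Integrable (fun q : (Phase k d × Phase k d) × Phase k d =>
      (wigner Ψ θ X Y q.2 * conj (Ψ (2 * θ⁻¹ * symp (q.1.1 - q.2) (q.1.2 - q.2)) : ℂ))
        • (a q.1.1 * b q.1.2)) (volume.prod volume) := by
    refine (hab.norm.mul_prod (integrable_wigner h hθ0 X Y).norm).mono' ?_
      (ae_of_all _ fun q => ?_)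
    · exact AEStronglyMeasurable.smul
        ((integrable_wigner h hθ0 X Y).aestronglyMeasurable.comp_snd.mul
          hcont.aestronglyMeasurable) hab.aestronglyMeasurable.comp_fst
    · rw [norm_smul, norm_mul, RCLike.norm_conj, norm_char, mul_one, mul_comm]
  simp_rw [← integral_smul_const]
  rw [integral_integral_swap hint]
  simp_rw [mul_smul, integral_smul]

theorem integral_prod_scale (h : LocalChar Ψ ϖ) {θ : k} (hθ0 : θ ≠ 0) (Z : Phase k d)
    {g : Phase k d × Phase k d → A} (hg : Integrable g)
    (hg' : Integrable fun P : Phase k d × Phase k d => g (Z + θ • P.1, Z + P.2)) :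
    ∫ p, g p = (‖θ‖ ^ (2 * d)) • ∫ P : Phase k d × Phase k d, g (Z + θ • P.1, Z + P.2) := by
  have hθ : ‖θ‖ ≠ 0 := norm_ne_zero_iff.2 hθ0
  change ∫ p, _ ∂(volume.prod volume) = _ • ∫ p, _ ∂(volume.prod volume)
  rw [integral_prod _ hg, integral_prod _ hg']
  have e1 : ∀ Y, ∫ W, g (Z + θ • Y, Z + W) = ∫ W, g (Z + θ • Y, W) := fun Y =>
    integral_add_left_eq_self (fun W => g (Z + θ • Y, W)) Z
  simp_rw [e1]
  have e2 := integral_scale h hθ0 hθ0 fun Y : Phase k d => ∫ W, g (Z + Y, W)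
  rw [integral_add_left_eq_self (fun Y => ∫ W, g (Y, W)) Z] at e2
  have e3 : ∫ Y : Phase k d, ∫ W, g (Z + θ • Y, W)
      = ∫ Y : Phase k d, ∫ W, g (Z + (θ • Y.1, θ • Y.2), W) := rfl
  rw [e3, e2, smul_smul, pow_mul, sq, mul_inv_cancel₀ (pow_ne_zero _ (mul_ne_zero hθ hθ)),
    one_smul]

end SymbolComposition

/-! ### The kernel of a product of operators. -/

section BlockComposition

open Filter Topology

variable {k : Type*} [NontriviallyNormedField k] [IsUltrametricDist k] [ProperSpace k]
  [MeasureSpace k] [BorelSpace k] [(volume : Measure k).IsAddHaarMeasure]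
  {d : ℕ} {Ψ : AddChar k Circle} {ϖ : k} {A : Type*} [NonUnitalCStarAlgebra A]

theorem exists_forall_norm_le (h : LocalChar Ψ ϖ) {θ : k} (hθ0 : θ ≠ 0) (M : ℝ) :
    ∃ R₀ : ℕ, ∀ R ≥ R₀, M ≤ ‖θ * (ϖ ^ R)⁻¹‖ := by
  have hθ : 0 < ‖θ‖ := norm_pos_iff.2 hθ0
  obtain ⟨R₀, hR₀⟩ := pow_unbounded_of_one_lt (M / ‖θ‖) (one_lt_q h)
  refine ⟨R₀, fun R hR => ?_⟩
  rw [norm_mul, norm_inv, norm_pow, ← inv_pow, mul_comm, ← div_le_iff₀ hθ]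
  exact hR₀.le.trans (pow_le_pow_right₀ (one_lt_q h).le hR)

theorem exists_forall_mem_box (h : LocalChar Ψ ϖ) {θ : k} (hθ0 : θ ≠ 0) (X : Phase k d) :
    ∃ R₀ : ℕ, ∀ R ≥ R₀, X ∈ box Ψ (θ * (ϖ ^ R)⁻¹) (θ * (ϖ ^ R)⁻¹) := by
  obtain ⟨R₁, h1⟩ := exists_forall_norm_le h hθ0 ‖X.1‖
  obtain ⟨R₂, h2⟩ := exists_forall_norm_le h hθ0 (‖X.2‖ / conductorAbs Ψ)
  exact ⟨max R₁ R₂, fun R hR => h.mem_box.2 ⟨h1 R ((le_max_left _ _).trans hR),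
    (div_le_iff₀ h.cond_pos).1 (h2 R ((le_max_right _ _).trans hR))⟩⟩

theorem two_smul_mem_box_iff (h : LocalChar Ψ ϖ) {θ : k} {R : ℕ} {P : Phase k d} :
    (2 : k) • P ∈ box Ψ (θ * (ϖ ^ R)⁻¹) (θ * (ϖ ^ R)⁻¹)
      ↔ P ∈ box Ψ (θ * (2 * ϖ ^ R)⁻¹) (θ * (2 * ϖ ^ R)⁻¹) := by
  have h2 : 0 < ‖(2 : k)‖ := norm_pos_iff.2 h.two_ne
  rw [h.mem_box, h.mem_box, Prod.smul_fst, Prod.smul_snd, norm_smul, norm_smul,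
    show ‖θ * (2 * ϖ ^ R)⁻¹‖ = ‖(2 : k)‖⁻¹ * ‖θ * (ϖ ^ R)⁻¹‖ by
      simp only [norm_mul, norm_inv, mul_inv]; ring, le_inv_mul_iff₀ h2, mul_assoc,
    le_inv_mul_iff₀ h2]

theorem smul_mem_box_iff (h : LocalChar Ψ ϖ) {θ : k} (hθ0 : θ ≠ 0) {a b : k} {P : Phase k d} :
    θ • P ∈ box Ψ (θ * a) (θ * b) ↔ P ∈ box Ψ a b := by
  have hθ : 0 < ‖θ‖ := norm_pos_iff.2 hθ0
  rw [h.mem_box, h.mem_box, Prod.smul_fst, Prod.smul_snd, norm_smul, norm_smul, norm_mul, norm_mul,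
    mul_le_mul_iff_right₀ hθ, mul_assoc, mul_le_mul_iff_right₀ hθ]

theorem integrable_indicator_box (h : LocalChar Ψ ϖ) {f : Phase k d → A} (hf : Continuous f)
    (a b : k) : Integrable ((box (d := d) Ψ a b : Set (Phase k d)).indicator f) :=
  (integrable_indicator_iff (measurableSet_box h a b)).2
    (hf.continuousOn.integrableOn_compact (isCompact_box h a b))

theorem indicator_add_of_mem {S : AddSubgroup (Phase k d)} {f : Phase k d → A} {T : Phase k d}
    (hT : T ∈ S) (hf : ∀ X, f (X + T) = f X) (X : Phase k d) :
    (S : Set (Phase k d)).indicator f (X + T) = (S : Set (Phase k d)).indicator f X := by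
  by_cases hX : X ∈ (S : Set (Phase k d))
  · rw [Set.indicator_of_mem hX, Set.indicator_of_mem (by exact add_mem hX hT), hf]
  · rw [Set.indicator_of_notMem hX,
      Set.indicator_of_notMem (fun h' => hX ((add_mem_cancel_right hT).1 h'))]

/-- The kernel of a product of two operators whose symbols have bounded frequencies. -/
theorem integral_wignerInt_mul_wignerInt (h : LocalChar Ψ ϖ) {θ : k} (hθ0 : θ ≠ 0)
    (hθ : ‖θ‖ ≤ 1) {n l : ℕ} {f g : Phase k d → A} (hf : IsLevel Ψ ϖ n f) (hg : IsLevel Ψ ϖ l g)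
    (X Y : Phase k d) :
    ∃ R₀ : ℕ, ∀ R ≥ R₀,
      (((‖θ‖ ^ d)⁻¹ : ℝ) : ℂ) • ∫ Z, wignerInt Ψ θ f Z Y * wignerInt Ψ θ g X Z
        = wignerInt Ψ θ (starInt Ψ θ ((dlat Ψ ϖ d R : Set (Phase k d)).indicator fun _ => 1)
          ((dlat Ψ ϖ d R : Set (Phase k d)).indicator fun _ => 1) f g) X Y := by
  have hθ' : 0 < ‖θ‖ := norm_pos_iff.2 hθ0
  obtain ⟨R₁, h1⟩ := exists_forall_mem_box h hθ0 X
  obtain ⟨R₂, h2⟩ := exists_forall_mem_box h hθ0 Y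
  obtain ⟨R₃, h3⟩ := exists_forall_norm_le h hθ0 ‖(ϖ ^ l)⁻¹‖
  refine ⟨max (max R₁ R₂) R₃, fun R hR => ?_⟩
  replace h1 := h1 R (((le_max_left _ _).trans (le_max_left _ _)).trans hR)
  replace h2 := h2 R (((le_max_right _ _).trans (le_max_left _ _)).trans hR)
  replace h3 := h3 R ((le_max_right _ _).trans hR)
  have hϖl : 1 ≤ ‖(ϖ ^ l)⁻¹‖ := by
    rw [norm_inv, norm_pow, ← inv_pow]
    exact one_le_pow₀ (one_lt_q h).le
  -- R is so large that B contains X, Y, the support box of the Wigner functions and the box of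
  -- differences Z − X where the kernel of g lives. As B is a group, every Wigner function met below
  -- is supported where 2P ∈ B, that is in BP.
  set B : AddSubgroup (Phase k d) := box Ψ (θ * (ϖ ^ R)⁻¹) (θ * (ϖ ^ R)⁻¹) with hB
  set BP : AddSubgroup (Phase k d) := box Ψ (θ * (2 * ϖ ^ R)⁻¹) (θ * (2 * ϖ ^ R)⁻¹) with hBP
  set BQ : AddSubgroup (Phase k d) := dlat Ψ ϖ d R with hBQ
  have hΛl : box Ψ (ϖ ^ l)⁻¹ (θ * (ϖ ^ l)⁻¹) ≤ B := box_mono h3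
    (le_trans (by rw [norm_mul]; exact mul_le_of_le_one_left (norm_nonneg _) hθ) h3)
  have hΛ : box Ψ 1 θ ≤ B := (box_mono (by rwa [norm_one])
    (by rw [norm_mul]; exact le_mul_of_one_le_right hθ'.le hϖl)).trans hΛl
  have hPQ : BP ≤ BQ := box_mono
    (by rw [norm_mul]; exact mul_le_of_le_one_left (norm_nonneg _) hθ)
    (by rw [norm_mul]; exact mul_le_of_le_one_left (norm_nonneg _) hθ)
  have hsupp : ∀ {Z Y P : Phase k d}, Z ∈ B → Y ∈ B → wigner Ψ θ Z Y P ≠ 0 → P ∈ BP := by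
    intro Z Y P hZ hY hne
    rw [wigner_eq h hθ0] at hne
    have hm := Set.mem_of_indicator_ne_zero hne
    refine (two_smul_mem_box_iff h).1 ?_
    have := sub_mem (add_mem hZ hY) (hΛ hm)
    rwa [sub_sub_cancel] at this
  set a := (BP : Set (Phase k d)).indicator f with ha
  set b := (BQ : Set (Phase k d)).indicator g with hb
  have hai : Integrable a := integrable_indicator_box h (hf.continuous h) _ _
  have hbi : Integrable b := integrable_indicator_box h (hg.continuous h) _ _
  have hcut : ∀ Z, wignerInt Ψ θ f Z Y * wignerInt Ψ θ g X Z
      = wignerInt Ψ θ a Z Y * wignerInt Ψ θ b X Z := by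
    intro Z
    by_cases hZ : Z - X ∈ box Ψ (ϖ ^ l)⁻¹ (θ * (ϖ ^ l)⁻¹)
    · have hZB : Z ∈ B := by
        have := add_mem (hΛl hZ) h1
        rwa [sub_add_cancel] at this
      congr 1
      · unfold wignerInt
        congr 1
        refine integral_congr_ae (ae_of_all _ fun P => ?_)
        by_cases hw : wigner Ψ θ Z Y P = 0
        · simp [hw]
        · dsimp only
          rw [ha, Set.indicator_of_mem (by exact hsupp hZB h2 hw)]
      · unfold wignerInt
        congr 1
        refine integral_congr_ae (ae_of_all _ fun Q => ?_)
        by_cases hw : wigner Ψ θ X Z Q = 0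
        · simp [hw]
        · dsimp only
          rw [hb, Set.indicator_of_mem (by exact hPQ (hsupp h1 hZB hw))]
    -- For other Z both sides vanish. This needs g to be cut along BQ, which contains `lat l`, so
    -- that the cut function is still invariant.
    · rw [wignerInt_eq_zero h hθ0 hθ hg.inv hZ, wignerInt_eq_zero h hθ0 hθ (n := l) _ hZ, mul_zero,
        mul_zero]
      exact fun X T hT => indicator_add_of_mem (lat_le_dlat h l R hT) (fun X => hg.inv X T hT) X
  simp_rw [hcut]
  rw [integral_wignerInt_mul_eq h hθ0 hai hbi]
  simp_rw [integral_wigner_mul_wigner h hθ0, mul_smul]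
  rw [integral_smul, integral_kernel_smul_eq h hθ0 hai hbi, smul_smul, smul_smul]
  obtain ⟨Cf, hCf⟩ := hf.bdd
  obtain ⟨Cg, hCg⟩ := hg.bdd
  -- BP is θ·BQ. Hence in the variables P = Z + θP', Q = Z + Q', with Z in BP ⊆ BQ, both cutoffs
  -- become the indicator of `dlat R`, a radial weight.
  have hdl : ∀ {P : Phase k d}, P ∈ BQ ↔ θ • P ∈ BP := fun {P} => (smul_mem_box_iff h hθ0).symm
  have hZ' : ∀ Z, wigner Ψ θ X Y Z • ∫ p : Phase k d × Phase k d,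
      conj (Ψ (2 * θ⁻¹ * symp (p.1 - Z) (p.2 - Z)) : ℂ) • (a p.1 * b p.2)
      = (((‖θ‖ ^ (2 * d) / ‖(2 : k)‖ ^ (2 * d) : ℝ)) : ℂ) • (wigner Ψ θ X Y Z •
        starInt Ψ θ ((BQ : Set (Phase k d)).indicator fun _ => 1)
          ((BQ : Set (Phase k d)).indicator fun _ => 1) f g Z) := by
    intro Z
    by_cases hw : wigner Ψ θ X Y Z = 0
    · simp [hw]
    have hZ : Z ∈ BP := hsupp h1 h2 hw
    rw [smul_comm]
    congr 1
    have hab := integrable_mul_fst_snd hai hbi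
    have hgi : Integrable fun p : Phase k d × Phase k d =>
        conj (Ψ (2 * θ⁻¹ * symp (p.1 - Z) (p.2 - Z)) : ℂ) • (a p.1 * b p.2) := by
      refine hab.bdd_smul 1 (Continuous.aestronglyMeasurable ?_) (ae_of_all _ fun p => ?_)
      · exact Complex.continuous_conj.comp ((continuous_char_symp h (2 * θ⁻¹)).comp
          (f := fun q : Phase k d × Phase k d => (q.1 - Z, q.2 - Z)) (by fun_prop))
      · rw [RCLike.norm_conj, norm_char]
    have e1 : ∀ P : Phase k d × Phase k d,
        conj (Ψ (2 * θ⁻¹ * symp (Z + θ • P.1 - Z) (Z + P.2 - Z)) : ℂ)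
          • (a (Z + θ • P.1) * b (Z + P.2))
        = (conj (Ψ (2 * symp P.1 P.2) : ℂ)
          * (((BQ : Set (Phase k d)).indicator (fun _ => (1 : ℝ)) P.1
            * (BQ : Set (Phase k d)).indicator (fun _ => (1 : ℝ)) P.2 : ℝ) : ℂ))
          • (f (Z + θ • P.1) * g (Z + P.2)) := by
      intro P
      rw [add_sub_cancel_left, add_sub_cancel_left, symp_smul_left, mul_assoc,
        inv_mul_cancel_left₀ hθ0]
      have m1 : Z + θ • P.1 ∈ (BP : Set (Phase k d)) ↔ P.1 ∈ (BQ : Set (Phase k d)) :=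
        (add_mem_cancel_left hZ).trans hdl.symm
      have m2 : Z + P.2 ∈ (BQ : Set (Phase k d)) ↔ P.2 ∈ (BQ : Set (Phase k d)) :=
        add_mem_cancel_left (hPQ hZ)
      by_cases hP1 : P.1 ∈ (BQ : Set (Phase k d))
      swap
      · rw [ha, Set.indicator_of_notMem (fun h' => hP1 (m1.1 h')), Set.indicator_of_notMem hP1]
        simp
      by_cases hP2 : P.2 ∈ (BQ : Set (Phase k d))
      swap
      · rw [hb, Set.indicator_of_notMem (fun h' => hP2 (m2.1 h')), Set.indicator_of_notMem hP2]
        simp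
      rw [ha, hb, Set.indicator_of_mem (m1.2 hP1), Set.indicator_of_mem (m2.2 hP2),
        Set.indicator_of_mem hP1, Set.indicator_of_mem hP2]
      simp
    have hi2 := integrable_starInt h θ (isRadial_indicator_dlat h R).integrable
      (isRadial_indicator_dlat h R).integrable (hf.continuous h) (hg.continuous h) hCf hCg Z
    rw [integral_prod_scale h hθ0 Z hgi (hi2.congr (ae_of_all _ fun P => (e1 P).symm))]
    simp_rw [e1]
    unfold starInt
    rw [smul_smul, ← Complex.ofReal_mul, div_mul_cancel₀ _
      (pow_ne_zero _ (norm_ne_zero_iff.2 h.two_ne)), Complex.coe_smul]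
  simp_rw [hZ']
  rw [integral_smul, smul_smul]
  unfold wignerInt
  congr 1
  rw [← Complex.ofReal_mul, ← Complex.ofReal_mul, ← Complex.ofReal_mul]
  congr 1
  have h4 : ‖(2 : k)‖ ≠ 0 := norm_ne_zero_iff.2 h.two_ne
  rw [norm_div, div_pow, pow_mul, pow_mul]
  have := hθ'.ne'
  field_simp
  ring

/-- By `starInt_eq_shell` the cutoff weights may be replaced by shell weights as soon as R exceeds
both levels, so the dependence on R, X and Y of the cutoff disappears. -/
theorem integral_wignerInt_blk (h : LocalChar Ψ ϖ) {θ : k} (hθ0 : θ ≠ 0) {r : ℕ}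
    (hr : ‖θ‖ = ‖ϖ‖ ^ r) {F₁ F₂ : Phase k d → A} (hF₁ : MemLp F₁ ∞) (hF₂ : MemLp F₂ ∞)
    (p : ℕ × ℕ) (X Y : Phase k d) :
    (((‖θ‖ ^ d)⁻¹ : ℝ) : ℂ) • ∫ Z, wignerInt Ψ θ (blk Ψ ϖ p.1 F₁) Z Y
        * wignerInt Ψ θ (blk Ψ ϖ p.2 F₂) X Z
      = wignerInt Ψ θ (starBlk Ψ ϖ θ r F₁ F₂ p) X Y := by
  have hθ : ‖θ‖ ≤ 1 := by
    rw [hr]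
    exact pow_le_one₀ (norm_nonneg _) h.unif_lt.le
  have l1 := isLevel_blk h hF₁ p.1
  have l2 := isLevel_blk h hF₂ p.2
  obtain ⟨R₀, hR₀⟩ := integral_wignerInt_mul_wignerInt h hθ0 hθ l1 l2 X Y
  rw [hR₀ (max R₀ (max p.2 (p.1 - r))) (le_max_left _ _)]
  congr 1
  funext Z
  rw [starInt_eq_shell h hr (isRadial_indicator_dlat h _) (isRadial_indicator_dlat h _) l1 l2,
    ← shellWeight_eq h ((le_max_left _ _).trans (le_max_right _ _)),
    ← shellWeight_eq h ((le_max_right _ _).trans (le_max_right _ _))]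
  rfl

/-- The kernel of the product of two operators is the kernel of the deformed product. -/
theorem integral_wignerSymbol_mul (h : LocalChar Ψ ϖ) {θ : k} (hθ0 : θ ≠ 0) {r : ℕ}
    (hr : ‖θ‖ = ‖ϖ‖ ^ r) {F₁ F₂ F₃ : LInfty k d A}
    (hF₁ : F₁ ∈ symbolSpace d A Ψ) (hF₂ : F₂ ∈ symbolSpace d A Ψ)
    (hF₃ : (F₃ : Phase k d → A) =ᵐ[volume] fun X => ∑' p, starBlk Ψ ϖ θ r F₁ F₂ p X)
    (X Y : Phase k d) :
    (((‖θ‖ ^ d)⁻¹ : ℝ) : ℂ) • ∫ Z, wignerSymbol Ψ θ F₁ Z Y * wignerSymbol Ψ θ F₂ X Z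
      = wignerSymbol Ψ θ F₃ X Y := by
  have hθ : ‖θ‖ ≤ 1 := by
    rw [hr]
    exact pow_le_one₀ (norm_nonneg _) h.unif_lt.le
  set m := 2 * d + 1 with hm
  have hgeo : Summable fun n : ℕ => (‖ϖ‖ ^ m) ^ n := summable_geometric_of_lt_one (by positivity)
    (pow_unif_lt_one h _)
  have hser : ∀ {F : LInfty k d A}, F ∈ symbolSpace d A Ψ → ∀ X Y,
      HasSum (fun n => wignerInt Ψ θ (blk Ψ ϖ n F) X Y) (wignerSymbol Ψ θ F X Y) := by
    intro F hF X Y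
    have hs := hgeo.mul_right (2 * ‖powJ Ψ m F‖)
    have := wignerInt_hasSum h hθ0 (P := fun n => blk Ψ ϖ n F)
      (fun n => (continuous_blk h n F).aestronglyMeasurable) hs (norm_blk_le_powJ h hF m) X Y
    rwa [← wignerInt_congr (ae_eq_tsum_blk h (Lp.memLp F) hs (norm_blk_le_powJ h hF m))] at this
  obtain ⟨C, hC0, hC⟩ := norm_starBlk_le h θ r hF₁ hF₂ 1
  have hS3 := wignerInt_hasSum h hθ0 (P := fun p => starBlk Ψ ϖ θ r F₁ F₂ p)
    (fun p => (continuous_starBlk h θ r F₁ F₂ p).aestronglyMeasurable)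
    (summable_pow_mul_pow h C) hC X Y
  rw [← wignerInt_congr hF₃] at hS3
  change _ = wignerInt Ψ θ F₃ X Y
  rw [← hS3.tsum_eq]
  simp_rw [← integral_wignerInt_blk h hθ0 hr (Lp.memLp F₁) (Lp.memLp F₂)]
  set c := (‖(2 : k)‖ ^ d)⁻¹ with hc
  have hc0 : 0 ≤ c := by positivity
  set b₁ : ℕ → ℝ := fun n => c * ((‖ϖ‖ ^ m) ^ n * (2 * ‖powJ Ψ m F₁‖)) with hb₁
  set b₂ : ℕ → ℝ := fun n => c * ((‖ϖ‖ ^ m) ^ n * (2 * ‖powJ Ψ m F₂‖)) with hb₂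
  have hn₁ : ∀ n X Y, ‖wignerInt Ψ θ (blk Ψ ϖ n F₁) X Y‖ ≤ b₁ n := fun n X Y =>
    norm_wignerInt_le h hθ0 (ae_of_all _ (norm_blk_le_powJ h hF₁ m n)) X Y
  have hn₂ : ∀ n X Y, ‖wignerInt Ψ θ (blk Ψ ϖ n F₂) X Y‖ ≤ b₂ n := fun n X Y =>
    norm_wignerInt_le h hθ0 (ae_of_all _ (norm_blk_le_powJ h hF₂ m n)) X Y
  have hs₁ : Summable b₁ := (hgeo.mul_right _).mul_left c
  have hs₂ : Summable b₂ := (hgeo.mul_right _).mul_left c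
  have hb₁0 : ∀ n, 0 ≤ b₁ n := fun n => by positivity
  have hb₂0 : ∀ n, 0 ≤ b₂ n := fun n => by positivity
  have hprod : ∀ Z, wignerSymbol Ψ θ F₁ Z Y * wignerSymbol Ψ θ F₂ X Z
      = ∑' p : ℕ × ℕ, wignerInt Ψ θ (blk Ψ ϖ p.1 F₁) Z Y * wignerInt Ψ θ (blk Ψ ϖ p.2 F₂) X Z := by
    intro Z
    rw [← (hser hF₁ Z Y).tsum_eq, ← (hser hF₂ X Z).tsum_eq]
    exact (hser hF₁ Z Y).summable.tsum_mul_tsum (hser hF₂ X Z).summable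
      ((hs₁.mul_of_nonneg hs₂ hb₁0 hb₂0).of_norm_bounded fun p => (norm_mul_le _ _).trans
        (mul_le_mul (hn₁ _ _ _) (hn₂ _ _ _) (norm_nonneg _) (hb₁0 _)))
  simp_rw [hprod]
  have hΛint : ∀ l, Integrable (fun Z => (box (d := d) Ψ (ϖ ^ l)⁻¹ (θ * (ϖ ^ l)⁻¹) :
      Set (Phase k d)).indicator (fun _ => (1 : ℝ)) (Z - X)) := fun l =>
    ((integrable_indicator_iff (measurableSet_box h _ _)).2
      (integrableOn_const (isCompact_box h _ _).measure_lt_top.ne)).comp_sub_right X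
  have hΛvol : ∀ l, ∫ Z, (box (d := d) Ψ (ϖ ^ l)⁻¹ (θ * (ϖ ^ l)⁻¹) :
      Set (Phase k d)).indicator (fun _ => (1 : ℝ)) (Z - X)
      = ‖θ‖ ^ d * (‖ϖ‖⁻¹ ^ (2 * d)) ^ l := fun l => by
    rw [integral_sub_right_eq_self (fun Z => (box (d := d) Ψ (ϖ ^ l)⁻¹ (θ * (ϖ ^ l)⁻¹) :
      Set (Phase k d)).indicator (fun _ => (1 : ℝ)) Z), integral_indicator (measurableSet_box h _ _),
      setIntegral_const, volume_real_box h, smul_eq_mul, mul_one]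
    simp only [norm_inv, norm_mul, norm_pow, mul_pow, inv_pow]
    ring
  -- The kernel of the second block has bounded support in Z − X, of volume |θ|^d q^{2dp.2}; the
  -- exponent m = 2d + 1 in the block decay makes the sum of the integrals converge.
  have hbd : ∀ (p : ℕ × ℕ) Z,
      ‖wignerInt Ψ θ (blk Ψ ϖ p.1 F₁) Z Y * wignerInt Ψ θ (blk Ψ ϖ p.2 F₂) X Z‖
      ≤ b₁ p.1 * b₂ p.2 * (box (d := d) Ψ (ϖ ^ p.2)⁻¹ (θ * (ϖ ^ p.2)⁻¹) :
        Set (Phase k d)).indicator (fun _ => (1 : ℝ)) (Z - X) := by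
    intro p Z
    by_cases hZ : Z - X ∈ (box (d := d) Ψ (ϖ ^ p.2)⁻¹ (θ * (ϖ ^ p.2)⁻¹) : Set (Phase k d))
    · rw [Set.indicator_of_mem hZ, mul_one]
      exact (norm_mul_le _ _).trans
        (mul_le_mul (hn₁ _ _ _) (hn₂ _ _ _) (norm_nonneg _) (hb₁0 _))
    · rw [Set.indicator_of_notMem hZ,
        wignerInt_eq_zero h hθ0 hθ (fun X T hT => blk_add h F₂ X hT) hZ]
      simp
  have hi : ∀ p : ℕ × ℕ, Integrable fun Z =>
      wignerInt Ψ θ (blk Ψ ϖ p.1 F₁) Z Y * wignerInt Ψ θ (blk Ψ ϖ p.2 F₂) X Z := by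
    intro p
    refine ((hΛint p.2).const_mul _).mono' (StronglyMeasurable.aestronglyMeasurable ?_)
      (ae_of_all _ (hbd p))
    refine StronglyMeasurable.mul ?_ ?_
    · exact (stronglyMeasurable_wignerInt h hθ0
        (continuous_blk h p.1 F₁).aestronglyMeasurable).comp_measurable
        (g := fun Z : Phase k d => (Z, Y)) (by fun_prop)
    · exact (stronglyMeasurable_wignerInt h hθ0
        (continuous_blk h p.2 F₂).aestronglyMeasurable).comp_measurable
        (g := fun Z : Phase k d => (X, Z)) (by fun_prop)
  have hb₃ : Summable fun l => b₂ l * (‖θ‖ ^ d * (‖ϖ‖⁻¹ ^ (2 * d)) ^ l) := by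
    have e : ∀ l, b₂ l * (‖θ‖ ^ d * (‖ϖ‖⁻¹ ^ (2 * d)) ^ l)
        = c * (2 * ‖powJ Ψ m F₂‖) * ‖θ‖ ^ d * ‖ϖ‖ ^ l := fun l => by
      have h4 : ‖ϖ‖ ≠ 0 := h.unif_pos.ne'
      simp only [hb₂, hm, inv_pow]
      field_simp
      ring
    simp_rw [e]
    exact (summable_geometric_of_lt_one (norm_nonneg _) h.unif_lt).mul_left _
  have hHS := hasSum_integral_of_summable_integral_norm hi (by
    refine Summable.of_nonneg_of_le (fun p => integral_nonneg fun _ => norm_nonneg _) (fun p => ?_)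
      (hs₁.mul_of_nonneg hb₃ hb₁0 fun l => mul_nonneg (hb₂0 l) (by positivity))
    refine (integral_mono (hi p).norm ((hΛint p.2).const_mul _) (hbd p)).trans_eq ?_
    rw [integral_const_mul, hΛvol, mul_assoc])
  rw [← hHS.tsum_eq, hHS.summable.tsum_const_smul]

end BlockComposition

/-! ### Plancherel formula for vector-valued functions. -/

section Plancherel

open Filter Topology

variable {k : Type*} [NontriviallyNormedField k] [IsUltrametricDist k] [ProperSpace k]
  [MeasureSpace k] [BorelSpace k] [(volume : Measure k).IsAddHaarMeasure]
  {d : ℕ} {Ψ : AddChar k Circle} {ϖ : k}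
  {H : Type*} [NormedAddCommGroup H] [InnerProductSpace ℂ H] [CompleteSpace H]

/-- The Fourier transform `ξ ↦ ∫ Ψ(-θ⁻¹⟨ξ, s⟩) f(s) ds`. -/
def fourierV (Ψ : AddChar k Circle) (θ : k) (f : (Fin d → k) → H) (ξ : Fin d → k) : H :=
  ∫ s, (Ψ (-(θ⁻¹ * (ξ ⬝ᵥ s))) : ℂ) • f s

theorem continuous_char_mul_dotProduct (h : LocalChar Ψ ϖ) (κ : k) :
    Continuous fun P : (Fin d → k) × (Fin d → k) => (Ψ (κ * (P.1 ⬝ᵥ P.2)) : ℂ) := by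
  refine continuous_subtype_val.comp (h.cont.comp ?_)
  unfold dotProduct
  fun_prop

theorem continuous_char_neg_dotProduct (h : LocalChar Ψ ϖ) (θ : k) :
    Continuous fun P : (Fin d → k) × (Fin d → k) => (Ψ (-(θ⁻¹ * (P.1 ⬝ᵥ P.2))) : ℂ) := by
  simpa only [neg_mul] using continuous_char_mul_dotProduct (d := d) h (-θ⁻¹)

theorem integrable_char_smul (h : LocalChar Ψ ϖ) (θ : k) {f : (Fin d → k) → H}
    (hf : Integrable f) (ξ : Fin d → k) :
    Integrable fun s => (Ψ (-(θ⁻¹ * (ξ ⬝ᵥ s))) : ℂ) • f s :=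
  hf.bdd_smul 1 ((continuous_char_neg_dotProduct h θ).comp
    (continuous_const.prodMk continuous_id)).aestronglyMeasurable
    (ae_of_all _ fun _ => (norm_char _).le)

theorem norm_fourierV_le (θ : k) (f : (Fin d → k) → H) (ξ : Fin d → k) :
    ‖fourierV Ψ θ f ξ‖ ≤ ∫ s, ‖f s‖ := by
  refine (norm_integral_le_integral_norm _).trans_eq ?_
  simp [norm_smul]

theorem aestronglyMeasurable_fourierV (h : LocalChar Ψ ϖ) (θ : k) {f : (Fin d → k) → H}
    (hf : AEStronglyMeasurable f volume) : AEStronglyMeasurable (fourierV Ψ θ f) volume :=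
  AEStronglyMeasurable.integral_prod_right' (f := fun P : (Fin d → k) × (Fin d → k) =>
    (Ψ (-(θ⁻¹ * (P.1 ⬝ᵥ P.2))) : ℂ) • f P.2)
    ((continuous_char_neg_dotProduct h θ).aestronglyMeasurable.smul hf.comp_snd)

theorem pi_closedBall_volume_lt_top (r : ℝ) :
    volume (Metric.closedBall (0 : Fin d → k) r) < ∞ :=
  (isCompact_closedBall _ _).measure_lt_top

/-- Truncated inversion: ‖e‖ is the radius of the ball dual to that of radius ‖a‖ for Ψ(θ⁻¹⟨ξ,s⟩),
and the integral of the characters over one ball is a multiple of the indicator of the other. -/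
theorem setIntegral_closedBall_fourierV (h : LocalChar Ψ ϖ) {θ a e : k} (hθ0 : θ ≠ 0)
    (ha : a ≠ 0) (he : ‖e‖ = ‖θ‖ * ‖a‖⁻¹ * conductorAbs Ψ)
    {f : (Fin d → k) → H} (hf : Integrable f) (t : Fin d → k) :
    ∫ ξ in Metric.closedBall (0 : Fin d → k) ‖a‖, (Ψ (θ⁻¹ * (ξ ⬝ᵥ t)) : ℂ) • fourierV Ψ θ f ξ
      = volume.real (Metric.closedBall (0 : Fin d → k) ‖a‖) •
        ∫ s in Metric.closedBall (0 : Fin d → k) ‖e‖, f (t + s) := by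
  have hθ : 0 < ‖θ‖ := norm_pos_iff.2 hθ0
  have ha' : 0 < ‖a‖ := norm_pos_iff.2 ha
  set v := volume.real (Metric.closedBall (0 : Fin d → k) ‖a‖) with hv
  have e1 : ∀ ξ, (Ψ (θ⁻¹ * (ξ ⬝ᵥ t)) : ℂ) • fourierV Ψ θ f ξ
      = ∫ s, (Ψ ((θ⁻¹ • (t - s)) ⬝ᵥ ξ) : ℂ) • f s := by
    intro ξ
    unfold fourierV
    rw [← integral_smul]
    refine integral_congr_ae (ae_of_all _ fun s => ?_)
    dsimp only
    rw [smul_smul, ← char_add, smul_dotProduct, sub_dotProduct, dotProduct_comm t, dotProduct_comm s,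
      smul_eq_mul]
    congr 3
    ring
  simp_rw [e1]
  have hcont : Continuous fun P : (Fin d → k) × (Fin d → k) =>
      (Ψ ((θ⁻¹ • (t - P.2)) ⬝ᵥ P.1) : ℂ) :=
    (continuous_char_dotProduct h).comp (f := fun P : (Fin d → k) × (Fin d → k) =>
      (θ⁻¹ • (t - P.2), P.1)) (by fun_prop)
  haveI : IsFiniteMeasure (volume.restrict (Metric.closedBall (0 : Fin d → k) ‖a‖)) :=
    ⟨by rw [Measure.restrict_apply_univ]; exact pi_closedBall_volume_lt_top _⟩
  have hint : Integrable (fun P : (Fin d → k) × (Fin d → k) =>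
      (Ψ ((θ⁻¹ • (t - P.2)) ⬝ᵥ P.1) : ℂ) • f P.2)
      ((volume.restrict (Metric.closedBall (0 : Fin d → k) ‖a‖)).prod volume) :=
    (hf.comp_snd _).bdd_smul 1 hcont.aestronglyMeasurable (ae_of_all _ fun _ => (norm_char _).le)
  rw [integral_integral_swap hint]
  simp_rw [integral_smul_const, integral_closedBall_char h]
  rw [← integral_smul, ← integral_indicator (measurableSet_closedBall_pi _),
    ← integral_add_left_eq_self _ t]
  refine integral_congr_ae (ae_of_all _ fun s => ?_)
  dsimp only
  rw [sub_add_cancel_left]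
  have hm : θ⁻¹ • -s ∈ {v : Fin d → k | ‖v‖ * ‖a‖ ≤ conductorAbs Ψ}
      ↔ s ∈ Metric.closedBall (0 : Fin d → k) ‖e‖ := by
    rw [Set.mem_ofPred_eq, mem_closedBall_zero_iff, norm_smul, norm_neg, norm_inv, he,
      ← le_div_iff₀ ha', inv_mul_le_iff₀ hθ, div_eq_mul_inv, mul_assoc,
      mul_comm (conductorAbs Ψ)]
  by_cases hs : s ∈ Metric.closedBall (0 : Fin d → k) ‖e‖
  · rw [Set.indicator_of_mem (hm.2 hs), Set.indicator_of_mem hs, Complex.coe_smul]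
  · rw [Set.indicator_of_notMem (fun h' => hs (hm.1 h')), Set.indicator_of_notMem hs, zero_smul]

theorem integrable_inner_shear {f g : (Fin d → k) → H} (hf : Integrable f) (hg : Integrable g) :
    Integrable (fun P : (Fin d → k) × (Fin d → k) => inner ℂ (f (P.2 + P.1)) (g P.2))
      (volume.prod volume) := by
  have h1 : Integrable (fun P : (Fin d → k) × (Fin d → k) => (‖f P.1‖ : ℝ) * ‖g P.2‖)
      (volume.prod volume) := hf.norm.mul_prod hg.norm
  have mp : MeasurePreserving (fun P : (Fin d → k) × (Fin d → k) => (P.2 + P.1, P.2))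
      (volume.prod volume) (volume.prod volume) :=
    by
    have e : (fun P : (Fin d → k) × (Fin d → k) => (P.2 + P.1, P.2))
        = fun P => (P.1 + P.2, P.2) := funext fun P => by rw [add_comm]
    rw [e]
    exact measurePreserving_add_prod (volume : Measure (Fin d → k)) volume
  have h2 := (mp.integrable_comp_of_integrable h1)
  refine h2.mono' ?_ (ae_of_all _ fun P => norm_inner_le_norm _ _)
  exact (hf.aestronglyMeasurable.comp_fst.comp_quasiMeasurePreserving
    mp.quasiMeasurePreserving).inner hg.aestronglyMeasurable.comp_snd

/-- On a ball, Plancherel is an exact identity with the correlation s ↦ ∫⟨f(t+s), g(t)⟩dt integrated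
over the dual ball. Its limit as the ball grows is the value of the correlation at s = 0. -/
theorem setIntegral_inner_fourierV (h : LocalChar Ψ ϖ) {θ a e : k} (hθ0 : θ ≠ 0)
    (ha : a ≠ 0) (he : ‖e‖ = ‖θ‖ * ‖a‖⁻¹ * conductorAbs Ψ)
    {f g : (Fin d → k) → H} (hf : Integrable f) (hg : Integrable g) :
    ∫ ξ in Metric.closedBall (0 : Fin d → k) ‖a‖, inner ℂ (fourierV Ψ θ f ξ) (fourierV Ψ θ g ξ)
      = volume.real (Metric.closedBall (0 : Fin d → k) ‖a‖) •
        ∫ s in Metric.closedBall (0 : Fin d → k) ‖e‖, ∫ t, inner ℂ (f (t + s)) (g t) := by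
  haveI : IsFiniteMeasure (volume.restrict (Metric.closedBall (0 : Fin d → k) ‖a‖)) :=
    ⟨by rw [Measure.restrict_apply_univ]; exact pi_closedBall_volume_lt_top _⟩
  have e1 : ∀ ξ, inner ℂ (fourierV Ψ θ f ξ) (fourierV Ψ θ g ξ)
      = ∫ t, inner ℂ ((Ψ (θ⁻¹ * (ξ ⬝ᵥ t)) : ℂ) • fourierV Ψ θ f ξ) (g t) := by
    intro ξ
    conv_lhs => rw [fourierV.eq_1 Ψ θ g, ← integral_inner (integrable_char_smul h θ hg ξ)]
    refine integral_congr_ae (ae_of_all _ fun t => ?_)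
    dsimp only
    rw [inner_smul_left, inner_smul_right, conj_char]
  simp_rw [e1]
  have hfb : Integrable (fourierV Ψ θ f)
      (volume.restrict (Metric.closedBall (0 : Fin d → k) ‖a‖)) :=
    Integrable.of_bound (aestronglyMeasurable_fourierV h θ hf.aestronglyMeasurable).restrict _
      (ae_of_all _ fun ξ => norm_fourierV_le θ f ξ)
  have hint : Integrable (fun P : (Fin d → k) × (Fin d → k) =>
      inner ℂ ((Ψ (θ⁻¹ * (P.1 ⬝ᵥ P.2)) : ℂ) • fourierV Ψ θ f P.1) (g P.2))
      ((volume.restrict (Metric.closedBall (0 : Fin d → k) ‖a‖)).prod volume) := by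
    refine (hfb.norm.mul_prod hg.norm).mono' ?_ (ae_of_all _ fun P => ?_)
    · exact ((continuous_char_mul_dotProduct h θ⁻¹).aestronglyMeasurable.smul
        hfb.aestronglyMeasurable.comp_fst).inner hg.aestronglyMeasurable.comp_snd
    · refine (norm_inner_le_norm _ _).trans_eq ?_
      rw [norm_smul, norm_char, one_mul]
  rw [integral_integral_swap hint]
  have hi : ∀ t, Integrable (fun ξ => (Ψ (θ⁻¹ * (ξ ⬝ᵥ t)) : ℂ) • fourierV Ψ θ f ξ)
      (volume.restrict (Metric.closedBall (0 : Fin d → k) ‖a‖)) := fun t =>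
    hfb.bdd_smul 1 ((continuous_char_mul_dotProduct h θ⁻¹).comp
      (continuous_id.prodMk continuous_const)).aestronglyMeasurable
      (ae_of_all _ fun _ => (norm_char _).le)
  have inner_int : ∀ (μ : Measure (Fin d → k)) {u : (Fin d → k) → H}, Integrable u μ → ∀ c : H,
      ∫ ξ, inner ℂ (u ξ) c ∂μ = inner ℂ (∫ ξ, u ξ ∂μ) c := by
    intro μ u hu c
    rw [← inner_conj_symm, ← integral_inner hu, ← integral_conj]
    simp_rw [inner_conj_symm]
  have e2 : ∀ t, ∫ ξ in Metric.closedBall (0 : Fin d → k) ‖a‖,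
      inner ℂ ((Ψ (θ⁻¹ * (ξ ⬝ᵥ t)) : ℂ) • fourierV Ψ θ f ξ) (g t)
      = volume.real (Metric.closedBall (0 : Fin d → k) ‖a‖) •
        ∫ s in Metric.closedBall (0 : Fin d → k) ‖e‖, inner ℂ (f (t + s)) (g t) := by
    intro t
    have hs : Integrable (fun s => f (t + s))
      (volume.restrict (Metric.closedBall (0 : Fin d → k) ‖e‖)) := (hf.comp_add_left t).restrict
    rw [inner_int _ (hi t), setIntegral_closedBall_fourierV h hθ0 ha he hf, inner_int _ hs,
      inner_smul_left_eq_smul]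
  simp_rw [e2]
  rw [integral_smul]
  congr 1
  have h3 := integrable_inner_shear hf hg
  have h4 : Integrable (fun P : (Fin d → k) × (Fin d → k) => inner ℂ (f (P.1 + P.2)) (g P.1))
      (volume.prod (volume.restrict (Metric.closedBall (0 : Fin d → k) ‖e‖))) := by
    have := h3.swap
    refine this.mono_measure ?_
    exact Measure.prod_mono le_rfl Measure.restrict_le_self
  exact integral_integral_swap h4

/-- Averages of a continuous function over small balls. -/
theorem tendsto_average_closedBall (h : LocalChar Ψ ϖ) {φ : (Fin d → k) → ℂ} (hφ : Continuous φ)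
    {e : ℕ → k} (he0 : ∀ n, e n ≠ 0) (he : Tendsto (fun n => ‖e n‖) atTop (𝓝 0)) :
    Tendsto (fun n => (volume.real (Metric.closedBall (0 : Fin d → k) ‖e n‖))⁻¹ •
      ∫ s in Metric.closedBall (0 : Fin d → k) ‖e n‖, φ s) atTop (𝓝 (φ 0)) := by
  rw [Metric.tendsto_nhds]
  intro ε hε
  obtain ⟨δ, hδ, hδ'⟩ := Metric.continuousAt_iff.1
    (hφ.continuousAt (x := (0 : Fin d → k))) (ε / 2) (half_pos hε)
  filter_upwards [he.eventually (gt_mem_nhds hδ)] with n hn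
  have hv : 0 < volume.real (Metric.closedBall (0 : Fin d → k) ‖e n‖) := by
    rw [volume_real_pi_closedBall h]
    exact mul_pos (pow_pos (norm_pos_iff.2 (he0 n)) d) vacuum_vol_pos
  have hfin := (pi_closedBall_volume_lt_top (k := k) (d := d) ‖e n‖)
  have hi : IntegrableOn φ (Metric.closedBall (0 : Fin d → k) ‖e n‖) :=
    hφ.continuousOn.integrableOn_compact (isCompact_closedBall _ _)
  have e1 : (volume.real (Metric.closedBall (0 : Fin d → k) ‖e n‖))⁻¹ •
      (∫ s in Metric.closedBall (0 : Fin d → k) ‖e n‖, φ s) - φ 0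
      = (volume.real (Metric.closedBall (0 : Fin d → k) ‖e n‖))⁻¹ •
        ∫ s in Metric.closedBall (0 : Fin d → k) ‖e n‖, (φ s - φ 0) := by
    rw [integral_sub hi (integrableOn_const hfin.ne), setIntegral_const, smul_sub,
      inv_smul_smul₀ hv.ne']
  rw [dist_eq_norm, e1, norm_smul, norm_inv, Real.norm_of_nonneg hv.le, inv_mul_lt_iff₀ hv]
  have := norm_setIntegral_le_of_norm_le_const hfin (f := fun s => φ s - φ 0) (C := ε / 2)
    fun s hs => by
      rw [← dist_eq_norm]
      refine (hδ' ?_).le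
      rw [dist_zero_right]
      exact (mem_closedBall_zero_iff.1 hs).trans_lt hn
  refine this.trans_lt ?_
  rw [mul_comm]
  exact mul_lt_mul_of_pos_left (half_lt_self hε) hv

theorem continuous_integral_inner_translate {f g : (Fin d → k) → H} (hf : MemLp f 2)
    (hg : MemLp g 2) : Continuous fun s => ∫ t, inner ℂ (f (t + s)) (g t) := by
  haveI : Fact ((2 : ℝ≥0∞) ≠ ∞) := ⟨ENNReal.ofNat_ne_top⟩
  have hc : Continuous fun s : Fin d → k => DomAddAct.mk s +ᵥ hf.toLp f :=
    Continuous.vadd (DomAddAct.continuous_mk) continuous_const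
  refine (hc.inner (continuous_const (y := hg.toLp g)) (𝕜 := ℂ)).congr fun s => ?_
  rw [L2.inner_def]
  refine integral_congr_ae ?_
  have e3 := (measurePreserving_add_left volume s).quasiMeasurePreserving.ae_eq_comp hf.coeFn_toLp
  filter_upwards [DomAddAct.vadd_Lp_ae_eq (DomAddAct.mk s) (hf.toLp f), hg.coeFn_toLp, e3]
    with t h1 h2 h4
  rw [h1, h2]
  simp only [Function.comp_apply, Equiv.symm_apply_apply, vadd_eq_add] at h4 ⊢
  rw [h4, add_comm]

/-- The Plancherel formula. -/
theorem plancherel (h : LocalChar Ψ ϖ) {θ : k} (hθ0 : θ ≠ 0) {f g : (Fin d → k) → H}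
    (hf : Integrable f) (hg : Integrable g) (hf2 : MemLp f 2) (hg2 : MemLp g 2) :
    Integrable (fun ξ => ‖fourierV Ψ θ f ξ‖ ^ 2) ∧
    ∫ ξ, inner ℂ (fourierV Ψ θ f ξ) (fourierV Ψ θ g ξ)
      = ((‖θ‖ ^ d : ℝ) : ℂ) * ∫ t, inner ℂ (f t) (g t) := by
  obtain ⟨c, hc⟩ := h.exists_gen
  have hθ : 0 < ‖θ‖ := norm_pos_iff.2 hθ0
  have hc0 : c ≠ 0 := norm_pos_iff.1 (hc ▸ h.cond_pos)
  set a : ℕ → k := fun n => (ϖ ^ n)⁻¹ with ha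
  set e : ℕ → k := fun n => θ * ϖ ^ n * c with he
  have ha0 : ∀ n, a n ≠ 0 := fun n => inv_ne_zero (pow_unif_ne h n)
  have he0 : ∀ n, e n ≠ 0 := fun n => mul_ne_zero (mul_ne_zero hθ0 (pow_unif_ne h n)) hc0
  have hea : ∀ n, ‖e n‖ = ‖θ‖ * ‖a n‖⁻¹ * conductorAbs Ψ := fun n => by
    simp only [ha, he, norm_mul, norm_inv, inv_inv, hc]
  have he_lim : Tendsto (fun n => ‖e n‖) atTop (𝓝 0) := by
    have := ((tendsto_pow_atTop_nhds_zero_of_lt_one (norm_nonneg ϖ) h.unif_lt).const_mul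
      ‖θ‖).mul_const ‖c‖
    simpa [he] using this
  have ha_lim : Tendsto (fun n => ‖a n‖) atTop atTop := by
    have := tendsto_pow_atTop_atTop_of_one_lt (one_lt_q h)
    simpa [ha] using this
  have hcov : AECover (volume : Measure (Fin d → k)) atTop
      (fun n => Metric.closedBall (0 : Fin d → k) ‖a n‖) := aecover_closedBall ha_lim
  -- Dual balls have volumes with product |θ|^d, so the prefactor is |θ|^d times that of an average
  -- over the small ball.
  have hvol : ∀ n, volume.real (Metric.closedBall (0 : Fin d → k) ‖a n‖)
      = ‖θ‖ ^ d * (volume.real (Metric.closedBall (0 : Fin d → k) ‖e n‖))⁻¹ := fun n => by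
    have hv : 0 < volume.real (Metric.closedBall (0 : Fin d → k) ‖e n‖) := by
      rw [volume_real_pi_closedBall h]
      exact mul_pos (pow_pos (norm_pos_iff.2 (he0 n)) d) vacuum_vol_pos
    have e1 := volume_real_box (d := d) h (a n) (θ * ϖ ^ n)
    rw [box_eq_prod h _ _ c hc, Measure.volume_eq_prod, measureReal_prod_prod] at e1
    rw [eq_mul_inv_iff_mul_eq₀ hv.ne', e1, ← norm_mul, mul_comm θ, inv_mul_cancel_left₀
      (pow_unif_ne h n)]
  have lim : ∀ {f g : (Fin d → k) → H}, Integrable f → Integrable g → MemLp f 2 → MemLp g 2 →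
      Tendsto (fun n => ∫ ξ in Metric.closedBall (0 : Fin d → k) ‖a n‖,
        inner ℂ (fourierV Ψ θ f ξ) (fourierV Ψ θ g ξ)) atTop
        (𝓝 (((‖θ‖ ^ d : ℝ) : ℂ) * ∫ t, inner ℂ (f t) (g t))) := by
    intro f g hf hg hf2 hg2
    have h1 := tendsto_average_closedBall h (continuous_integral_inner_translate hf2 hg2) he0 he_lim
    have h2 := h1.const_smul (‖θ‖ ^ d)
    simp only [add_zero, smul_smul, ← hvol] at h2
    rw [Complex.real_smul] at h2
    refine h2.congr fun n => ?_
    rw [setIntegral_inner_fourierV h hθ0 (ha0 n) (hea n) hf hg]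
  have hmeas : ∀ {f : (Fin d → k) → H}, Integrable f → ∀ n,
      IntegrableOn (fun ξ => ‖fourierV Ψ θ f ξ‖ ^ 2)
        (Metric.closedBall (0 : Fin d → k) ‖a n‖) := fun {f} hf n => by
    haveI : IsFiniteMeasure (volume.restrict (Metric.closedBall (0 : Fin d → k) ‖a n‖)) :=
      ⟨by rw [Measure.restrict_apply_univ]; exact pi_closedBall_volume_lt_top _⟩
    refine Integrable.of_bound
      ((aestronglyMeasurable_fourierV h θ hf.aestronglyMeasurable).norm.pow 2).restrict
      ((∫ s, ‖f s‖) ^ 2) (ae_of_all _ fun ξ => ?_)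
    rw [norm_pow, norm_norm]
    exact pow_le_pow_left₀ (norm_nonneg _) (norm_fourierV_le θ f ξ) 2
  -- Square-integrability of the transform is not assumed: the integrals over the exhausting balls
  -- converge and the integrand is nonnegative.
  have sq : ∀ {f : (Fin d → k) → H}, Integrable f → MemLp f 2 →
      Integrable (fun ξ => ‖fourierV Ψ θ f ξ‖ ^ 2) := by
    intro f hf hf2
    have h1 := lim hf hf hf2 hf2
    have h2 := (Complex.continuous_re.tendsto _).comp h1
    refine hcov.integrable_of_integral_tendsto_of_nonneg_ae _ (hmeas hf)
      (ae_of_all _ fun ξ => sq_nonneg _) (h2.congr fun n => ?_)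
    simp only [Function.comp_apply]
    have : ∀ ξ, inner ℂ (fourierV Ψ θ f ξ) (fourierV Ψ θ f ξ)
        = ((‖fourierV Ψ θ f ξ‖ ^ 2 : ℝ) : ℂ) := fun ξ => by
      rw [inner_self_eq_norm_sq_to_K]
      norm_cast
    simp_rw [this]
    rw [integral_complex_ofReal, Complex.ofReal_re]
  refine ⟨sq hf hf2, hcov.integral_eq_of_tendsto _ ?_ (lim hf hg hf2 hg2)⟩
  refine ((sq hf hf2).add (sq hg hg2)).mono'
    ((aestronglyMeasurable_fourierV h θ hf.aestronglyMeasurable).inner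
      (aestronglyMeasurable_fourierV h θ hg.aestronglyMeasurable)) (ae_of_all _ fun ξ => ?_)
  refine (norm_inner_le_norm _ _).trans ?_
  simp only [Pi.add_apply]
  nlinarith [sq_nonneg (‖fourierV Ψ θ f ξ‖ - ‖fourierV Ψ θ g ξ‖),
    sq_nonneg (‖fourierV Ψ θ f ξ‖), sq_nonneg (‖fourierV Ψ θ g ξ‖)]

end Plancherel

/-! ### Coefficients on coherent states and Parseval's formula. -/

section Coeff

open Filter Topology

variable {k : Type*} [NontriviallyNormedField k] [IsUltrametricDist k] [ProperSpace k]
  [MeasureSpace k] [BorelSpace k] [(volume : Measure k).IsAddHaarMeasure]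
  {d : ℕ} {Ψ : AddChar k Circle} {ϖ : k}
  {H : Type*} [NormedAddCommGroup H] [InnerProductSpace ℂ H] [CompleteSpace H]

theorem integrable_mul_sub_snd {G : Type*} [MeasurableSpace G] [AddGroup G] [MeasurableAdd₂ G]
    [MeasurableNeg G] {μ : Measure G} [SFinite μ] [μ.IsAddRightInvariant]
    {κ f : G → ℝ} (hκ : Integrable κ μ) (hf : Integrable f μ) :
    Integrable (fun z : G × G => κ (z.1 - z.2) * f z.2) (μ.prod μ) :=
  (measurePreserving_sub_prod μ μ).integrable_comp_of_integrable (hκ.mul_prod hf)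

/-- The coefficient `b_f(X) = ∫ conj η_X(s) f(s) ds` of a vector on a coherent state. -/
def coeff (Ψ : AddChar k Circle) (θ : k) (f : (Fin d → k) → H) (X : Phase k d) : H :=
  ∫ s, conj (coherent Ψ θ X s) • f s

theorem coeff_congr {θ : k} {f g : (Fin d → k) → H} (hfg : f =ᵐ[volume] g) :
    coeff Ψ θ f = coeff Ψ θ g := by
  funext X
  refine integral_congr_ae ?_
  filter_upwards [hfg] with s hs
  rw [hs]

theorem memLp_vacuum : MemLp (vacuum k d) 2 :=
  memLp_indicator_const 2 (measurableSet_closedBall_pi 1) _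
    (Or.inr (pi_closedBall_volume_lt_top 1).ne)

theorem norm_vacuum_le (t : Fin d → k) :
    ‖vacuum k d t‖ ≤ (√(volume.real (Metric.closedBall (0 : Fin d → k) 1)))⁻¹ := by
  unfold vacuum
  refine (norm_indicator_le_norm_self _ _).trans_eq ?_
  rw [Complex.norm_real, Real.norm_of_nonneg (by positivity)]

theorem memLp_coherent (h : LocalChar Ψ ϖ) (θ : k) (X : Phase k d) :
    MemLp (coherent Ψ θ X) 2 := by
  have h1 : MemLp (fun t => vacuum k d (t - X.1)) 2 :=
    memLp_vacuum.comp_measurePreserving (measurePreserving_sub_right volume X.1)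
  refine h1.of_le ?_ (ae_of_all _ fun t => (norm_coherent θ X t).le)
  exact ((measurable_coherent h θ).comp measurable_prodMk_left).aestronglyMeasurable

theorem memLp_conj_coherent (h : LocalChar Ψ ϖ) (θ : k) (X : Phase k d) :
    MemLp (fun s => conj (coherent Ψ θ X s)) 2 := (memLp_coherent h θ X).star

theorem integrable_coherent_smul (h : LocalChar Ψ ϖ) (θ : k) (X : Phase k d)
    {f : (Fin d → k) → H} (hf : MemLp f 2) :
    Integrable fun s => conj (coherent Ψ θ X s) • f s :=
  memLp_one_iff_integrable.1 (MemLp.smul (r := 1) hf (memLp_conj_coherent h θ X))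

theorem aestronglyMeasurable_coeff (h : LocalChar Ψ ϖ) (θ : k) {f : (Fin d → k) → H}
    (hf : AEStronglyMeasurable f volume) :
    AEStronglyMeasurable (coeff Ψ θ f) (volume : Measure (Phase k d)) :=
  AEStronglyMeasurable.integral_prod_right' (f := fun P : Phase k d × (Fin d → k) =>
    conj (coherent Ψ θ P.1 P.2) • f P.2)
    ((Complex.continuous_conj.measurable.comp
      (measurable_coherent h θ)).aestronglyMeasurable.smul hf.comp_snd)

theorem coeff_add (h : LocalChar Ψ ϖ) (θ : k) {f g : (Fin d → k) → H} (hf : MemLp f 2)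
    (hg : MemLp g 2) (X : Phase k d) :
    coeff Ψ θ (fun s => f s + g s) X = coeff Ψ θ f X + coeff Ψ θ g X := by
  unfold coeff
  simp only [smul_add]
  exact integral_add (integrable_coherent_smul h θ X hf) (integrable_coherent_smul h θ X hg)

theorem coeff_smul (θ : k) (c : ℂ) (f : (Fin d → k) → H) (X : Phase k d) :
    coeff Ψ θ (fun s => c • f s) X = c • coeff Ψ θ f X := by
  unfold coeff
  simp only [smul_comm _ c]
  exact integral_smul _ _

theorem coeff_clm (h : LocalChar Ψ ϖ) (θ : k) (a : H →L[ℂ] H) {f : (Fin d → k) → H}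
    (hf : MemLp f 2) (X : Phase k d) :
    coeff Ψ θ (fun s => a (f s)) X = a (coeff Ψ θ f X) := by
  unfold coeff
  simp only [← map_smul]
  exact a.integral_comp_comm (integrable_coherent_smul h θ X hf)

/-- For fixed position x, the coefficient is up to a phase the Fourier transform in ξ of f localized
to the unit ball around x. Parseval's formula thus follows from Plancherel for each x and
∫|η(t−x)|²dx = 1. -/
theorem coeff_eq_fourierV (θ : k) (f : (Fin d → k) → H) (X : Phase k d) :
    coeff Ψ θ f X = (Ψ (θ⁻¹ * (X.2 ⬝ᵥ ((2 : k)⁻¹ • X.1))) : ℂ) •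
      fourierV Ψ θ (fun s => conj (vacuum k d (s - X.1)) • f s) X.2 := by
  unfold coeff fourierV
  rw [← integral_smul]
  refine integral_congr_ae (ae_of_all _ fun s => ?_)
  dsimp only
  have e : (Ψ (-(θ⁻¹ * (X.2 ⬝ᵥ (s - (2 : k)⁻¹ • X.1)))) : ℂ)
      = Ψ (θ⁻¹ * (X.2 ⬝ᵥ ((2 : k)⁻¹ • X.1))) * Ψ (-(θ⁻¹ * (X.2 ⬝ᵥ s))) := by
    rw [← char_add, dotProduct_sub]
    refine congrArg (fun x => (Ψ x : ℂ)) ?_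
    ring
  rw [coherent_apply, map_mul (starRingEnd ℂ), conj_char, e]
  simp only [smul_smul, mul_assoc]

theorem integrable_vacuum_sq : Integrable fun t : Fin d → k => ‖vacuum k d t‖ ^ 2 :=
  (memLp_two_iff_integrable_sq_norm measurable_vacuum.aestronglyMeasurable).1 memLp_vacuum

theorem integral_norm_vacuum_sq (s : Fin d → k) :
    ∫ x, ‖vacuum k d (s - x)‖ ^ 2 = 1 := by
  rw [integral_sub_left_eq_self (fun t => ‖vacuum k d t‖ ^ 2) volume s]
  simp_rw [norm_vacuum_sq]
  rw [integral_indicator (measurableSet_closedBall_pi 1), setIntegral_const, smul_eq_mul,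
    mul_inv_cancel₀ vacuum_vol_pos.ne']

theorem integrable_vacuum_shear {u : (Fin d → k) → ℝ} (hu : Integrable u) :
    Integrable (fun P : (Fin d → k) × (Fin d → k) => ‖vacuum k d (P.2 - P.1)‖ ^ 2 * u P.2)
      (volume.prod volume) := by
  have h1 := integrable_mul_sub_snd (integrable_vacuum_sq (k := k) (d := d)).comp_neg hu
  simpa only [neg_sub] using h1

theorem memLp_inner {f g : (Fin d → k) → H} (hf : MemLp f 2) (hg : MemLp g 2) :
    Integrable fun s => inner ℂ (f s) (g s) := by
  have h1 := L2.integrable_inner (𝕜 := ℂ) (hf.toLp f) (hg.toLp g)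
  refine h1.congr ?_
  filter_upwards [hf.coeFn_toLp, hg.coeFn_toLp] with s h1 h2
  rw [h1, h2]

theorem inner_self_eq_ofReal (v : H) : inner ℂ v v = ((‖v‖ ^ 2 : ℝ) : ℂ) := by
  rw [inner_self_eq_norm_sq_to_K]
  norm_cast

/-- Parseval's formula for the coherent states. -/
theorem parseval (h : LocalChar Ψ ϖ) {θ : k} (hθ0 : θ ≠ 0) {f g : (Fin d → k) → H}
    (hf : MemLp f 2) (hg : MemLp g 2) :
    Integrable (fun X => ‖coeff Ψ θ f X‖ ^ 2) ∧
    ∫ X, inner ℂ (coeff Ψ θ f X) (coeff Ψ θ g X)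
      = ((‖θ‖ ^ d : ℝ) : ℂ) * ∫ t, inner ℂ (f t) (g t) := by
  have loc : ∀ {f : (Fin d → k) → H}, MemLp f 2 → ∀ x : Fin d → k,
      Integrable (fun s => conj (vacuum k d (s - x)) • f s) ∧
      MemLp (fun s => conj (vacuum k d (s - x)) • f s) 2 := by
    intro f hf x
    have h1 : MemLp (fun t => conj (vacuum k d (t - x))) 2 :=
      (memLp_vacuum.comp_measurePreserving (measurePreserving_sub_right volume x)).star
    refine ⟨memLp_one_iff_integrable.1 (MemLp.smul (r := 1) hf h1),
      hf.of_le_mul (c := (√(volume.real (Metric.closedBall (0 : Fin d → k) 1)))⁻¹)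
        (h1.aestronglyMeasurable.smul hf.aestronglyMeasurable) (ae_of_all _ fun s => ?_)⟩
    rw [norm_smul, RCLike.norm_conj]
    exact mul_le_mul_of_nonneg_right (norm_vacuum_le _) (norm_nonneg _)
  have slice : ∀ {f g : (Fin d → k) → H}, MemLp f 2 → MemLp g 2 → ∀ x : Fin d → k,
      Integrable (fun ξ => ‖coeff Ψ θ f (x, ξ)‖ ^ 2) ∧
      ∫ ξ, inner ℂ (coeff Ψ θ f (x, ξ)) (coeff Ψ θ g (x, ξ))
        = ((‖θ‖ ^ d : ℝ) : ℂ) *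
          ∫ t, ((‖vacuum k d (t - x)‖ ^ 2 : ℝ) : ℂ) * inner ℂ (f t) (g t) := by
    intro f g hf hg x
    obtain ⟨i1, i2⟩ := plancherel h hθ0 (loc hf x).1 (loc hg x).1 (loc hf x).2 (loc hg x).2
    refine ⟨i1.congr (ae_of_all _ fun ξ => ?_), Eq.trans ?_ (i2.trans ?_)⟩
    · dsimp only
      rw [coeff_eq_fourierV, norm_smul, norm_char, one_mul]
    · refine integral_congr_ae (ae_of_all _ fun ξ => ?_)
      dsimp only
      rw [coeff_eq_fourierV, coeff_eq_fourierV, inner_smul_left, inner_smul_right, ← mul_assoc,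
        conj_char, ← char_add, neg_add_cancel]
      simp
    · congr 1
      refine integral_congr_ae (ae_of_all _ fun t => ?_)
      dsimp only
      rw [inner_smul_left, inner_smul_right, ← mul_assoc, Complex.conj_conj, Complex.mul_conj,
        Complex.normSq_eq_norm_sq]
  have int : ∀ {f : (Fin d → k) → H}, MemLp f 2 →
      Integrable (fun X => ‖coeff Ψ θ f X‖ ^ 2) := by
    intro f hf
    have hf2 := (memLp_two_iff_integrable_sq_norm hf.aestronglyMeasurable).1 hf
    refine (integrable_prod_iff
      ((aestronglyMeasurable_coeff h θ hf.aestronglyMeasurable).norm.pow 2)).2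
      ⟨ae_of_all _ fun x => (slice hf hf x).1, ?_⟩
    have e1 : ∀ x, ∫ ξ, ‖‖coeff Ψ θ f (x, ξ)‖ ^ 2‖
        = ‖θ‖ ^ d * ∫ t, ‖vacuum k d (t - x)‖ ^ 2 * ‖f t‖ ^ 2 := by
      intro x
      have e := (slice hf hf x).2
      simp_rw [inner_self_eq_ofReal, ← Complex.ofReal_mul] at e
      rw [integral_complex_ofReal, integral_complex_ofReal, ← Complex.ofReal_mul] at e
      simp_rw [norm_pow, norm_norm]
      exact Complex.ofReal_injective e
    refine Integrable.congr ?_ (ae_of_all _ fun x => (e1 x).symm)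
    exact (integrable_vacuum_shear hf2).integral_prod_left.const_mul _
  refine ⟨int hf, ?_⟩
  have hint : Integrable (fun X : Phase k d => inner ℂ (coeff Ψ θ f X) (coeff Ψ θ g X)) := by
    refine ((int hf).add (int hg)).mono'
      ((aestronglyMeasurable_coeff h θ hf.aestronglyMeasurable).inner
        (aestronglyMeasurable_coeff h θ hg.aestronglyMeasurable)) (ae_of_all _ fun X => ?_)
    refine (norm_inner_le_norm _ _).trans ?_
    simp only [Pi.add_apply]
    nlinarith [sq_nonneg (‖coeff Ψ θ f X‖ - ‖coeff Ψ θ g X‖),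
      sq_nonneg (‖coeff Ψ θ f X‖), sq_nonneg (‖coeff Ψ θ g X‖)]
  change ∫ X, _ ∂(volume.prod volume) = _
  rw [integral_prod _ hint]
  simp_rw [(slice hf hg _).2]
  rw [integral_const_mul]
  congr 1
  have hi : Integrable (fun P : (Fin d → k) × (Fin d → k) =>
      ((‖vacuum k d (P.2 - P.1)‖ ^ 2 : ℝ) : ℂ) * inner ℂ (f P.2) (g P.2))
      (volume.prod volume) := by
    refine (integrable_vacuum_shear (memLp_inner hf hg).norm).mono' ?_
      (ae_of_all _ fun P => ?_)
    · refine AEStronglyMeasurable.mul ?_ (memLp_inner hf hg).aestronglyMeasurable.comp_snd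
      refine Measurable.aestronglyMeasurable ?_
      exact Complex.measurable_ofReal.comp ((measurable_vacuum.comp
        (measurable_snd.sub measurable_fst)).norm.pow_const 2)
    · rw [norm_mul, Complex.norm_real, Real.norm_of_nonneg (sq_nonneg _)]
  rw [integral_integral_swap hi]
  refine integral_congr_ae (ae_of_all _ fun t => ?_)
  dsimp only
  rw [integral_mul_const, integral_complex_ofReal, integral_norm_vacuum_sq, Complex.ofReal_one,
    one_mul]

theorem integral_norm_coeff_sq_of_memLp (h : LocalChar Ψ ϖ) {θ : k} (hθ0 : θ ≠ 0)
    {f : (Fin d → k) → H} (hf : MemLp f 2) :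
    ∫ X, ‖coeff Ψ θ f X‖ ^ 2 = ‖θ‖ ^ d * ∫ t, ‖f t‖ ^ 2 := by
  have e := (parseval h hθ0 hf hf).2
  simp_rw [inner_self_eq_ofReal] at e
  rw [integral_complex_ofReal, integral_complex_ofReal, ← Complex.ofReal_mul] at e
  exact Complex.ofReal_injective e

theorem integral_norm_sq (Φ : L2Space k d H) : ∫ t, ‖Φ t‖ ^ 2 = ‖Φ‖ ^ 2 := by
  have e := L2.inner_def (𝕜 := ℂ) Φ Φ
  rw [inner_self_eq_norm_sq_to_K] at e
  simp_rw [inner_self_eq_ofReal] at e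
  rw [integral_complex_ofReal] at e
  refine Complex.ofReal_injective (e.symm.trans ?_)
  push_cast
  rfl

theorem integral_norm_coeff_sq (h : LocalChar Ψ ϖ) {θ : k} (hθ0 : θ ≠ 0) (Φ : L2Space k d H) :
    ∫ X, ‖coeff Ψ θ Φ X‖ ^ 2 = ‖θ‖ ^ d * ‖Φ‖ ^ 2 := by
  rw [integral_norm_coeff_sq_of_memLp h hθ0 (Lp.memLp Φ), integral_norm_sq]

/-- The vector `η_X ⊗ v`. -/
def cohVec (h : LocalChar Ψ ϖ) (θ : k) (X : Phase k d) (v : H) : L2Space k d H :=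
  ((ContinuousLinearMap.toSpanSingleton ℂ v).comp_memLp' (memLp_coherent h θ X)).toLp _

theorem coeFn_cohVec (h : LocalChar Ψ ϖ) (θ : k) (X : Phase k d) (v : H) :
    cohVec h θ X v =ᵐ[volume] fun t => coherent Ψ θ X t • v :=
  MemLp.coeFn_toLp _

theorem inner_cohVec (h : LocalChar Ψ ϖ) (θ : k) (X : Phase k d) (v : H) (Φ : L2Space k d H) :
    inner ℂ (cohVec h θ X v) Φ = inner ℂ v (coeff Ψ θ Φ X) := by
  rw [L2.inner_def, coeff, ← integral_inner (integrable_coherent_smul h θ X (Lp.memLp Φ))]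
  refine integral_congr_ae ?_
  filter_upwards [coeFn_cohVec h θ X v] with t ht
  rw [ht, inner_smul_left, inner_smul_right]

theorem coeff_cohVec (h : LocalChar Ψ ϖ) (θ : k) (X Y : Phase k d) (v : H) :
    coeff Ψ θ (cohVec h θ X v) Y
      = (∫ s, conj (coherent Ψ θ Y s) * coherent Ψ θ X s) • v := by
  rw [coeff_congr (coeFn_cohVec h θ X v), coeff, ← integral_smul_const]
  simp only [smul_smul]

theorem norm_cohVec (h : LocalChar Ψ ϖ) (θ : k) (X : Phase k d) (v : H) :
    ‖cohVec h θ X v‖ = ‖v‖ := by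
  have e := inner_cohVec h θ X v (cohVec h θ X v)
  rw [coeff_cohVec, integral_conj_coherent_mul_self, one_smul, inner_self_eq_norm_sq_to_K,
    inner_self_eq_norm_sq_to_K] at e
  have e' : ‖cohVec h θ X v‖ ^ 2 = ‖v‖ ^ 2 := by exact_mod_cast e
  exact (pow_left_inj₀ (norm_nonneg _) (norm_nonneg _) two_ne_zero).1 e'

/-- The coefficient is the contraction of Φ with a unit vector, as seen by pairing with η_X ⊗ v for
v the coefficient itself. -/
theorem norm_coeff_le (h : LocalChar Ψ ϖ) (θ : k) (Φ : L2Space k d H) (X : Phase k d) :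
    ‖coeff Ψ θ Φ X‖ ≤ ‖Φ‖ := by
  have e := norm_inner_le_norm (𝕜 := ℂ) (cohVec h θ X (coeff Ψ θ Φ X)) Φ
  rw [inner_cohVec, norm_cohVec, inner_self_eq_norm_sq_to_K, norm_pow, RCLike.norm_ofReal,
    abs_norm] at e
  rcases (norm_nonneg (coeff Ψ θ Φ X)).eq_or_lt with h0 | h0
  · rw [← h0]
    exact norm_nonneg _
  · rw [sq] at e
    exact le_of_mul_le_mul_left e h0

theorem coeff_add_box {θ : k} {X T : Phase k d} {c : ℂ}
    (hc : ∀ t, coherent Ψ θ (X + T) t = c * coherent Ψ θ X t) (f : (Fin d → k) → H) :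
    coeff Ψ θ f (X + T) = conj c • coeff Ψ θ f X := by
  unfold coeff
  rw [← integral_smul]
  simp only [hc, map_mul (starRingEnd ℂ), smul_smul]

theorem inner_eq_integral_coeff (h : LocalChar Ψ ϖ) {θ : k} (hθ0 : θ ≠ 0) (Φ₁ Φ₂ : L2Space k d H) :
    inner ℂ Φ₁ Φ₂ = (((‖θ‖ ^ d)⁻¹ : ℝ) : ℂ) *
      ∫ X, inner ℂ (coeff Ψ θ Φ₁ X) (coeff Ψ θ Φ₂ X) := by
  rw [(parseval h hθ0 (Lp.memLp Φ₁) (Lp.memLp Φ₂)).2, ← mul_assoc, ← Complex.ofReal_mul,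
    inv_mul_cancel₀ (pow_pos (norm_pos_iff.2 hθ0) d).ne', Complex.ofReal_one, one_mul,
    L2.inner_def]

theorem coeff_injective (h : LocalChar Ψ ϖ) {θ : k} (hθ0 : θ ≠ 0) {Φ₁ Φ₂ : L2Space k d H}
    (hΦ : ∀ X, coeff Ψ θ Φ₁ X = coeff Ψ θ Φ₂ X) : Φ₁ = Φ₂ := by
  refine ext_inner_left ℂ fun Φ => ?_
  simp only [inner_eq_integral_coeff h hθ0, hΦ]

end Coeff

/-! ### Operators defined by kernels on coherent states. -/

section KernelOperators

open Filter Topology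

variable {k : Type*} [NontriviallyNormedField k] [IsUltrametricDist k] [ProperSpace k]
  [MeasureSpace k] [BorelSpace k] [(volume : Measure k).IsAddHaarMeasure]
  {d : ℕ} {Ψ : AddChar k Circle} {ϖ : k}
  {H : Type*} [NormedAddCommGroup H] [InnerProductSpace ℂ H] [CompleteSpace H]

instance : (volume : Measure (Phase k d)).IsNegInvariant :=
  ⟨((Measure.measurePreserving_neg (volume : Measure (Fin d → k))).prod
    (Measure.measurePreserving_neg (volume : Measure (Fin d → k)))).map_eq⟩

theorem integral_mul_sub_snd {G : Type*} [MeasurableSpace G] [AddGroup G] [MeasurableAdd₂ G]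
    [MeasurableNeg G] {μ : Measure G} [SFinite μ] [μ.IsAddRightInvariant]
    {κ f : G → ℝ} (hκ : Integrable κ μ) (hf : Integrable f μ) :
    ∫ z : G × G, κ (z.1 - z.2) * f z.2 ∂(μ.prod μ) = (∫ x, κ x ∂μ) * ∫ x, f x ∂μ := by
  rw [integral_prod_symm _ (integrable_mul_sub_snd hκ hf)]
  simp_rw [integral_mul_const, integral_sub_right_eq_self κ]
  rw [integral_const_mul]

/-- A bounded sesquilinear form is the form of a bounded operator. -/
theorem exists_clm_of_form {V : Type*} [NormedAddCommGroup V] [InnerProductSpace ℂ V]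
    [CompleteSpace V] (S : V →ₗ⋆[ℂ] V →ₗ[ℂ] ℂ) {C : ℝ} (hC : 0 ≤ C)
    (hS : ∀ u v, ‖S u v‖ ≤ C / 2 * (‖u‖ ^ 2 + ‖v‖ ^ 2)) :
    ∃ T : V →L[ℂ] V, ‖T‖ ≤ C ∧ ∀ u v, inner ℂ u (T v) = S u v := by
  have hS' : ∀ u v, ‖S u v‖ ≤ C * ‖u‖ * ‖v‖ := by
    intro u v
    rcases eq_or_ne u 0 with rfl | hu
    · simp
    rcases eq_or_ne v 0 with rfl | hv
    · simp
    have hu' := norm_pos_iff.2 hu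
    have hv' := norm_pos_iff.2 hv
    -- On unit vectors the symmetric quadratic bound is C; homogeneity then gives the bound C‖u‖‖v‖.
    have h1 := hS (((‖u‖⁻¹ : ℝ) : ℂ) • u) (((‖v‖⁻¹ : ℝ) : ℂ) • v)
    have n1 : ‖((‖u‖⁻¹ : ℝ) : ℂ)‖ = ‖u‖⁻¹ := by
      rw [Complex.norm_real, norm_inv, norm_norm]
    have n2 : ‖((‖v‖⁻¹ : ℝ) : ℂ)‖ = ‖v‖⁻¹ := by
      rw [Complex.norm_real, norm_inv, norm_norm]
    rw [map_smul, LinearMap.map_smulₛₗ, LinearMap.smul_apply, norm_smul, norm_smul, norm_smul,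
      norm_smul, RCLike.norm_conj, n1, n2, inv_mul_cancel₀ hu'.ne', inv_mul_cancel₀ hv'.ne',
      inv_mul_le_iff₀ hv', inv_mul_le_iff₀ hu'] at h1
    linarith
  let B := LinearMap.mkContinuous₂ S C hS'
  refine ⟨ContinuousLinearMap.adjoint (InnerProductSpace.continuousLinearMapOfBilin B), ?_,
    fun u v => ?_⟩
  · rw [LinearIsometryEquiv.norm_map]
    refine ContinuousLinearMap.opNorm_le_of_re_inner_le hC fun u v hu hv => ?_
    refine (RCLike.re_le_norm _).trans ?_
    rw [InnerProductSpace.continuousLinearMapOfBilin_apply]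
    refine (hS' u v).trans_eq ?_
    rw [hu, hv, mul_one, mul_one]
  · rw [ContinuousLinearMap.adjoint_inner_right,
      InnerProductSpace.continuousLinearMapOfBilin_apply]
    rfl

/-- The form of the integral operator with kernel `a` on the coherent states. -/
theorem integrable_kernelForm (h : LocalChar Ψ ϖ) {θ : k} (hθ0 : θ ≠ 0)
    {a : Phase k d × Phase k d → H →L[ℂ] H} (ha : AEStronglyMeasurable a volume)
    {κ : Phase k d → ℝ} (hκ : Integrable κ) {C : ℝ} (hb : ∀ P, ‖a P‖ ≤ C * κ (P.2 - P.1))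
    (Φ₁ Φ₂ : L2Space k d H) :
    Integrable (fun P : Phase k d × Phase k d =>
      inner ℂ (coeff Ψ θ Φ₁ P.2) (a P (coeff Ψ θ Φ₂ P.1))) ∧
    ‖∫ P : Phase k d × Phase k d, inner ℂ (coeff Ψ θ Φ₁ P.2) (a P (coeff Ψ θ Φ₂ P.1))‖
      ≤ C * (∫ V, κ V) * ‖θ‖ ^ d / 2 * (‖Φ₁‖ ^ 2 + ‖Φ₂‖ ^ 2) := by
  have p1 := (parseval h hθ0 (Lp.memLp Φ₁) (Lp.memLp Φ₁)).1
  have p2 := (parseval h hθ0 (Lp.memLp Φ₂) (Lp.memLp Φ₂)).1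
  have j1 := integrable_mul_sub_snd hκ.comp_neg p1
  have j2 := (integrable_mul_sub_snd hκ p2)
  have e1 := integral_mul_sub_snd hκ.comp_neg p1
  have e2 := integral_mul_sub_snd hκ p2
  rw [integral_neg_eq_self κ, integral_norm_coeff_sq h hθ0] at e1
  rw [integral_norm_coeff_sq h hθ0] at e2
  have j := (j1.add j2.swap).const_mul (C / 2)
  have hm : AEStronglyMeasurable (fun P : Phase k d × Phase k d =>
      inner ℂ (coeff Ψ θ Φ₁ P.2) (a P (coeff Ψ θ Φ₂ P.1))) (volume.prod volume) := by
    have m1 : AEStronglyMeasurable (fun P : Phase k d × Phase k d => coeff Ψ θ Φ₁ P.2)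
      (volume.prod volume) :=
      (aestronglyMeasurable_coeff h θ (Lp.aestronglyMeasurable Φ₁)).comp_snd
    have m2 : AEStronglyMeasurable (fun P : Phase k d × Phase k d => coeff Ψ θ Φ₂ P.1)
      (volume.prod volume) :=
      (aestronglyMeasurable_coeff h θ (Lp.aestronglyMeasurable Φ₂)).comp_fst
    exact m1.inner (isBoundedBilinearMap_apply.continuous.comp_aestronglyMeasurable (ha.prodMk m2))
  -- Schur's test through 2ab ≤ a² + b²: each half of the kernel is charged to one coefficient, and
  -- integrating κ over the other variable leaves ∫κ times |θ|^d‖Φ‖².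
  have hle : ∀ P : Phase k d × Phase k d,
      ‖inner ℂ (coeff Ψ θ Φ₁ P.2) (a P (coeff Ψ θ Φ₂ P.1))‖ ≤
        C / 2 * (κ (-(P.1 - P.2)) * ‖coeff Ψ θ Φ₁ P.2‖ ^ 2
          + κ (P.2 - P.1) * ‖coeff Ψ θ Φ₂ P.1‖ ^ 2) := by
    intro P
    refine (norm_inner_le_norm _ _).trans ?_
    have h0 : 0 ≤ C * κ (P.2 - P.1) := (norm_nonneg _).trans (hb P)
    have h1 : ‖a P (coeff Ψ θ Φ₂ P.1)‖ ≤ C * κ (P.2 - P.1) * ‖coeff Ψ θ Φ₂ P.1‖ :=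
      (a P).le_of_opNorm_le (hb P) _
    refine (mul_le_mul_of_nonneg_left h1 (norm_nonneg _)).trans ?_
    rw [neg_sub]
    nlinarith [mul_nonneg h0 (sq_nonneg (‖coeff Ψ θ Φ₁ P.2‖ - ‖coeff Ψ θ Φ₂ P.1‖))]
  refine ⟨j.mono' hm (ae_of_all _ hle), ?_⟩
  refine (norm_integral_le_of_norm_le j (ae_of_all _ hle)).trans_eq ?_
  have e3 := integral_prod_swap (μ := (volume : Measure (Phase k d))) (ν := volume)
    (fun z : Phase k d × Phase k d => κ (z.1 - z.2) * ‖coeff Ψ θ Φ₂ z.2‖ ^ 2)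
  rw [e2] at e3
  rw [integral_const_mul]
  have e4 := integral_add j1 j2.swap
  rw [e1] at e4
  refine (congrArg (C / 2 * ·) (e4.trans (congrArg _ e3))).trans ?_
  ring

theorem integral_inner_const {α : Type*} [MeasurableSpace α] {μ : Measure α} {u : α → H}
    (hu : Integrable u μ) (c : H) : ∫ x, inner ℂ (u x) c ∂μ = inner ℂ (∫ x, u x ∂μ) c := by
  rw [← inner_conj_symm, ← integral_inner hu, ← integral_conj]
  simp_rw [inner_conj_symm]

/-- The operator with kernel `a` on the coherent states. -/
theorem exists_kernelOp (h : LocalChar Ψ ϖ) {θ : k} (hθ0 : θ ≠ 0)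
    {a : Phase k d × Phase k d → H →L[ℂ] H} (ha : AEStronglyMeasurable a volume)
    {κ : Phase k d → ℝ} (hκ : Integrable κ) (hκ0 : 0 ≤ ∫ V, κ V) {C : ℝ} (hC : 0 ≤ C)
    (hb : ∀ P, ‖a P‖ ≤ C * κ (P.2 - P.1)) :
    ∃ T : L2Space k d H →L[ℂ] L2Space k d H, ‖T‖ ≤ C * (∫ V, κ V) * (‖θ‖ ^ d)⁻¹ ∧
      ∀ Φ₁ Φ₂, inner ℂ Φ₁ (T Φ₂) = (((‖θ‖ ^ (2 * d))⁻¹ : ℝ) : ℂ) *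
        ∫ P : Phase k d × Phase k d, inner ℂ (coeff Ψ θ Φ₁ P.2) (a P (coeff Ψ θ Φ₂ P.1)) := by
  have hθ : 0 < ‖θ‖ := norm_pos_iff.2 hθ0
  have int := fun Φ₁ Φ₂ => (integrable_kernelForm h hθ0 ha hκ hb Φ₁ Φ₂).1
  have hadd : ∀ (Φ₁ Φ₂ : L2Space k d H) X,
      coeff Ψ θ (Φ₁ + Φ₂ : L2Space k d H) X = coeff Ψ θ Φ₁ X + coeff Ψ θ Φ₂ X := by
    intro Φ₁ Φ₂ X
    rw [coeff_congr (Lp.coeFn_add Φ₁ Φ₂), ← coeff_add h θ (Lp.memLp Φ₁) (Lp.memLp Φ₂)]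
    rfl
  have hsmul : ∀ (c : ℂ) (Φ : L2Space k d H) X,
      coeff Ψ θ (c • Φ : L2Space k d H) X = c • coeff Ψ θ Φ X := by
    intro c Φ X
    rw [coeff_congr (Lp.coeFn_smul c Φ), ← coeff_smul]
    rfl
  let S : L2Space k d H →ₗ⋆[ℂ] L2Space k d H →ₗ[ℂ] ℂ := LinearMap.mk₂'ₛₗ (starRingEnd ℂ)
    (RingHom.id ℂ) (fun Φ₁ Φ₂ => (((‖θ‖ ^ (2 * d))⁻¹ : ℝ) : ℂ) *
      ∫ P : Phase k d × Phase k d, inner ℂ (coeff Ψ θ Φ₁ P.2) (a P (coeff Ψ θ Φ₂ P.1)))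
    (by
      intro Φ₁ Φ₁' Φ₂
      simp only [hadd, inner_add_left]
      rw [integral_add (int _ _) (int _ _), mul_add])
    (by
      intro c Φ₁ Φ₂
      simp only [hsmul, inner_smul_left]
      rw [integral_const_mul, smul_eq_mul]
      ring)
    (by
      intro Φ₁ Φ₂ Φ₂'
      simp only [hadd, map_add, inner_add_right]
      rw [integral_add (int _ _) (int _ _), mul_add])
    (by
      intro c Φ₁ Φ₂
      simp only [hsmul, map_smul, inner_smul_right]
      rw [integral_const_mul, smul_eq_mul, RingHom.id_apply]
      ring)
  refine exists_clm_of_form S (by positivity) fun u v => ?_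
  change ‖(((‖θ‖ ^ (2 * d))⁻¹ : ℝ) : ℂ) * _‖ ≤ _
  rw [norm_mul, Complex.norm_real, norm_inv, norm_pow, norm_norm, inv_mul_le_iff₀ (by positivity)]
  refine (integrable_kernelForm h hθ0 ha hκ hb u v).2.trans_eq ?_
  rw [two_mul, pow_add]
  field_simp

theorem integral_inner_ketBra (h : LocalChar Ψ ϖ) (θ : k) (X Y : Phase k d) (c : ℂ)
    (a : H →L[ℂ] H) (Φ₁ Φ₂ : L2Space k d H) :
    ∫ t, inner ℂ (Φ₁ t) (c • ketBra (coherent Ψ θ Y) (coherent Ψ θ X) a Φ₂ t)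
      = c * inner ℂ (coeff Ψ θ Φ₁ Y) (a (coeff Ψ θ Φ₂ X)) := by
  rw [coeff.eq_1 Ψ θ Φ₁, ← integral_inner_const (integrable_coherent_smul h θ Y (Lp.memLp Φ₁)),
    ← integral_const_mul]
  refine integral_congr_ae (ae_of_all _ fun t => ?_)
  simp only [ketBra, inner_smul_left, inner_smul_right, Complex.conj_conj]
  rfl

end KernelOperators

/-! ### Construction of the operators W(F) and their coefficients. -/

section WeylOperator

open Filter Topology

variable {k : Type*} [NontriviallyNormedField k] [IsUltrametricDist k] [ProperSpace k]
  [MeasureSpace k] [BorelSpace k] [(volume : Measure k).IsAddHaarMeasure]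
  {d : ℕ} {Ψ : AddChar k Circle} {ϖ : k} {A : Type*} [NonUnitalCStarAlgebra A]
  {H : Type*} [NormedAddCommGroup H] [InnerProductSpace ℂ H] [CompleteSpace H]

/-- A representation of a `C^*`-algebra, as a continuous linear map. -/
def repCLM (π : A →⋆ₙₐ[ℂ] (H →L[ℂ] H)) : A →L[ℂ] (H →L[ℂ] H) :=
  LinearMap.mkContinuous
    { toFun := π
      map_add' := map_add π
      map_smul' := map_smul π } 1 fun a => by
    rw [one_mul]
    exact NonUnitalStarAlgHom.norm_apply_le π a

theorem norm_rep_le (π : A →⋆ₙₐ[ℂ] (H →L[ℂ] H)) (a : A) : ‖π a‖ ≤ ‖a‖ :=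
  NonUnitalStarAlgHom.norm_apply_le π a

theorem norm_rep_apply_le (π : A →⋆ₙₐ[ℂ] (H →L[ℂ] H)) (a : A) (v : H) :
    ‖π a v‖ ≤ ‖a‖ * ‖v‖ := (π a).le_of_opNorm_le (norm_rep_le π a) v

theorem aestronglyMeasurable_rep_apply {α : Type*} [MeasurableSpace α] {μ : Measure α}
    (π : A →⋆ₙₐ[ℂ] (H →L[ℂ] H)) {a : α → A} {v : α → H} (ha : AEStronglyMeasurable a μ)
    (hv : AEStronglyMeasurable v μ) : AEStronglyMeasurable (fun x => π (a x) (v x)) μ :=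
  isBoundedBilinearMap_apply.continuous.comp_aestronglyMeasurable
    (((repCLM π).continuous.comp_aestronglyMeasurable ha).prodMk hv)

theorem integral_rep_apply {α : Type*} [MeasurableSpace α] {μ : Measure α}
    (π : A →⋆ₙₐ[ℂ] (H →L[ℂ] H)) {a : α → A} (ha : Integrable a μ) (v : H) :
    ∫ x, π (a x) v ∂μ = π (∫ x, a x ∂μ) v := by
  have h1 := (repCLM π).integral_comp_comm ha
  have h2 := (ContinuousLinearMap.apply ℂ H v).integral_comp_comm ((repCLM π).integrable_comp ha)
  rw [h1] at h2
  exact h2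

theorem stronglyMeasurable_wignerSymbol (h : LocalChar Ψ ϖ) {θ : k} (hθ0 : θ ≠ 0)
    (F : LInfty k d A) :
    StronglyMeasurable fun P : Phase k d × Phase k d => wignerSymbol Ψ θ F P.1 P.2 :=
  stronglyMeasurable_wignerInt h hθ0 (Lp.aestronglyMeasurable F)

/-- Representations of C*-algebras are contractive, so the kernel inherits the bound of
`norm_wignerSymbol_le`, and Schur's test with `integral_decay_le` gives a norm independent of θ. -/
theorem exists_weylOp (h : LocalChar Ψ ϖ) {θ : k} (hθ0 : θ ≠ 0) (hθ : ‖θ‖ ≤ 1)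
    (π : A →⋆ₙₐ[ℂ] (H →L[ℂ] H)) {F : LInfty k d A} (hF : F ∈ symbolSpace d A Ψ) :
    ∃ T : L2Space k d H →L[ℂ] L2Space k d H,
      ‖T‖ ≤ (∫ X : Phase k d, (mu0 Ψ X ^ (2 * d + 1))⁻¹) * seminormP Ψ (2 * d + 1) F ∧
      ∀ Φ₁ Φ₂ : L2Space k d H,
        Integrable (fun P : Phase k d × Phase k d =>
          inner ℂ (coeff Ψ θ Φ₁ P.2) (π (wignerSymbol Ψ θ F P.1 P.2) (coeff Ψ θ Φ₂ P.1))) ∧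
        inner ℂ Φ₁ (T Φ₂) = (((‖θ‖ ^ (2 * d))⁻¹ : ℝ) : ℂ) * ∫ P : Phase k d × Phase k d,
          inner ℂ (coeff Ψ θ Φ₁ P.2) (π (wignerSymbol Ψ θ F P.1 P.2) (coeff Ψ θ Φ₂ P.1)) := by
  have ha : AEStronglyMeasurable (fun P : Phase k d × Phase k d =>
      π (wignerSymbol Ψ θ F P.1 P.2)) volume :=
    (repCLM π).continuous.comp_aestronglyMeasurable
      (stronglyMeasurable_wignerSymbol h hθ0 F).aestronglyMeasurable
  have hb : ∀ P : Phase k d × Phase k d, ‖π (wignerSymbol Ψ θ F P.1 P.2)‖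
      ≤ (‖(2 : k)‖ ^ d)⁻¹ * ‖powJ Ψ (2 * d + 1) F‖ * decay Ψ θ (2 * d + 1) (P.2 - P.1) := fun P =>
    (norm_rep_le π _).trans (norm_wignerSymbol_le h hθ0 hθ hF (2 * d) P.1 P.2)
  obtain ⟨T, hT, hT'⟩ := exists_kernelOp h hθ0 ha (integrable_decay h hθ0)
    (integral_nonneg fun V => decay_nonneg _ _ _) (by positivity) hb
  refine ⟨T, hT.trans ?_, fun Φ₁ Φ₂ =>
    ⟨(integrable_kernelForm h hθ0 ha (integrable_decay h hθ0) hb Φ₁ Φ₂).1, hT' Φ₁ Φ₂⟩⟩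
  refine le_trans (le_of_eq ?_)
    (mul_le_mul_of_nonneg_right (integral_decay_le (d := d) h hθ0) (norm_nonneg _))
  unfold seminormP
  ring

/-- The operator `𝐖_θ^A(F)`. -/
def weylOp (h : LocalChar Ψ ϖ) {θ : k} (hθ0 : θ ≠ 0) (hθ : ‖θ‖ ≤ 1)
    (π : A →⋆ₙₐ[ℂ] (H →L[ℂ] H)) (F : symbolSpace d A Ψ) : L2Space k d H →L[ℂ] L2Space k d H :=
  (exists_weylOp h hθ0 hθ π F.2).choose

theorem norm_weylOp_le (h : LocalChar Ψ ϖ) {θ : k} (hθ0 : θ ≠ 0) (hθ : ‖θ‖ ≤ 1)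
    (π : A →⋆ₙₐ[ℂ] (H →L[ℂ] H)) (F : symbolSpace d A Ψ) : ‖weylOp h hθ0 hθ π F‖ ≤
    (∫ X : Phase k d, (mu0 Ψ X ^ (2 * d + 1))⁻¹) *
      seminormP Ψ (2 * d + 1) (F : LInfty k d A) :=
  (exists_weylOp h hθ0 hθ π F.2).choose_spec.1

theorem integrable_weylForm (h : LocalChar Ψ ϖ) {θ : k} (hθ0 : θ ≠ 0) (hθ : ‖θ‖ ≤ 1)
    (π : A →⋆ₙₐ[ℂ] (H →L[ℂ] H)) (F : symbolSpace d A Ψ) (Φ₁ Φ₂ : L2Space k d H) :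
    Integrable (fun P : Phase k d × Phase k d => inner ℂ (coeff Ψ θ Φ₁ P.2)
      (π (wignerSymbol Ψ θ (F : LInfty k d A) P.1 P.2) (coeff Ψ θ Φ₂ P.1))) :=
  ((exists_weylOp h hθ0 hθ π F.2).choose_spec.2 Φ₁ Φ₂).1

theorem inner_weylOp (h : LocalChar Ψ ϖ) {θ : k} (hθ0 : θ ≠ 0) (hθ : ‖θ‖ ≤ 1)
    (π : A →⋆ₙₐ[ℂ] (H →L[ℂ] H)) (F : symbolSpace d A Ψ) (Φ₁ Φ₂ : L2Space k d H) :
    inner ℂ Φ₁ (weylOp h hθ0 hθ π F Φ₂) = (((‖θ‖ ^ (2 * d))⁻¹ : ℝ) : ℂ) *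
      ∫ P : Phase k d × Phase k d, inner ℂ (coeff Ψ θ Φ₁ P.2)
        (π (wignerSymbol Ψ θ (F : LInfty k d A) P.1 P.2) (coeff Ψ θ Φ₂ P.1)) :=
  ((exists_weylOp h hθ0 hθ π F.2).choose_spec.2 Φ₁ Φ₂).2

theorem isWeylOp_weylOp (h : LocalChar Ψ ϖ) {θ : k} (hθ0 : θ ≠ 0) (hθ : ‖θ‖ ≤ 1)
    (π : A →⋆ₙₐ[ℂ] (H →L[ℂ] H)) (F : symbolSpace d A Ψ) :
    IsWeylOp Ψ θ π (F : LInfty k d A) (weylOp h hθ0 hθ π F) := by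
  intro Φ₁ Φ₂
  simp only [integral_inner_ketBra h]
  refine ⟨(integrable_weylForm h hθ0 hθ π F Φ₁ Φ₂).const_mul _, ?_⟩
  rw [integral_const_mul]
  exact inner_weylOp h hθ0 hθ π F Φ₁ Φ₂

theorem integrable_wigner_smul (h : LocalChar Ψ ϖ) {θ : k} (hθ0 : θ ≠ 0)
    (F : LInfty k d A) (X Y : Phase k d) :
    Integrable fun Z => wigner Ψ θ X Y Z • F Z :=
  integrable_smul_LInfty (integrable_wigner h hθ0 X Y) F

/-- `𝐖_θ^A` as a linear map. -/
def weylMap (h : LocalChar Ψ ϖ) {θ : k} (hθ0 : θ ≠ 0) (hθ : ‖θ‖ ≤ 1)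
    (π : A →⋆ₙₐ[ℂ] (H →L[ℂ] H)) : symbolSpace d A Ψ →ₗ[ℂ] (L2Space k d H →L[ℂ] L2Space k d H) where
  toFun := weylOp h hθ0 hθ π
  map_add' F G := by
    refine ContinuousLinearMap.ext fun Φ₂ => ext_inner_left ℂ fun Φ₁ => ?_
    have e : ∀ X Y, wignerSymbol Ψ θ (F + G : LInfty k d A) X Y
        = wignerSymbol Ψ θ (F : LInfty k d A) X Y + wignerSymbol Ψ θ (G : LInfty k d A) X Y := by
      intro X Y
      unfold wignerSymbol
      rw [← smul_add, ← integral_add (integrable_wigner_smul h hθ0 _ X Y)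
        (integrable_wigner_smul h hθ0 _ X Y)]
      congr 1
      refine integral_congr_ae ?_
      filter_upwards [Lp.coeFn_add (F : LInfty k d A) G] with Z hZ
      rw [hZ, Pi.add_apply, smul_add]
    rw [add_apply, inner_add_right]
    simp only [inner_weylOp, Submodule.coe_add, e, map_add, add_apply,
      inner_add_right]
    rw [integral_add (integrable_weylForm h hθ0 hθ π F _ _)
      (integrable_weylForm h hθ0 hθ π G _ _), mul_add]
  map_smul' c F := by
    refine ContinuousLinearMap.ext fun Φ₂ => ext_inner_left ℂ fun Φ₁ => ?_
    have e : ∀ X Y, wignerSymbol Ψ θ (c • F : LInfty k d A) X Y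
        = c • wignerSymbol Ψ θ (F : LInfty k d A) X Y := by
      intro X Y
      unfold wignerSymbol
      rw [smul_comm c, ← integral_smul c]
      congr 1
      refine integral_congr_ae ?_
      filter_upwards [Lp.coeFn_smul c (F : LInfty k d A)] with Z hZ
      rw [hZ, Pi.smul_apply, smul_comm]
    rw [RingHom.id_apply, smul_apply, inner_smul_right]
    simp only [inner_weylOp, Submodule.coe_smul, e, map_smul, smul_apply,
      inner_smul_right]
    rw [integral_const_mul]
    ring

theorem exists_norm_wignerSymbol_le (h : LocalChar Ψ ϖ) {θ : k} (hθ0 : θ ≠ 0) (hθ : ‖θ‖ ≤ 1)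
    (F : symbolSpace d A Ψ) :
    ∃ C, 0 ≤ C ∧ ∀ X Y, ‖wignerSymbol Ψ θ (F : LInfty k d A) X Y‖
      ≤ C * decay Ψ θ (2 * d + 1) (Y - X) :=
  ⟨_, by positivity, fun X Y => norm_wignerSymbol_le h hθ0 hθ F.2 (2 * d) X Y⟩

theorem integrable_wignerSymbol_coeff (h : LocalChar Ψ ϖ) {θ : k} (hθ0 : θ ≠ 0) (hθ : ‖θ‖ ≤ 1)
    (π : A →⋆ₙₐ[ℂ] (H →L[ℂ] H)) (F : symbolSpace d A Ψ) (Φ : L2Space k d H) (Y : Phase k d) :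
    Integrable fun X => π (wignerSymbol Ψ θ (F : LInfty k d A) X Y) (coeff Ψ θ Φ X) := by
  obtain ⟨C, hC, hb⟩ := exists_norm_wignerSymbol_le h hθ0 hθ F
  have h1 : Integrable fun X => decay Ψ θ (2 * d + 1) (Y - X) :=
    (integrable_decay h hθ0).comp_sub_left Y
  refine (h1.const_mul (C * ‖Φ‖)).mono' (aestronglyMeasurable_rep_apply π
    ((stronglyMeasurable_wignerSymbol h hθ0 _).comp_measurable
      measurable_prodMk_right).aestronglyMeasurable
    (aestronglyMeasurable_coeff h θ (Lp.aestronglyMeasurable Φ))) (ae_of_all _ fun X => ?_)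
  refine (norm_rep_apply_le π _ _).trans ((mul_le_mul (hb X Y) (norm_coeff_le h θ Φ X)
    (norm_nonneg _) (mul_nonneg hC (decay_nonneg _ _ _))).trans_eq ?_)
  ring

/-- Pairing with η_Y ⊗ v isolates the class of Y modulo `box 1 θ`, since other coherent states are
orthogonal to η_Y. On this class the phases cancel and its volume |θ|^d turns |θ|^{−2d} into
|θ|^{−d}. -/
theorem coeff_weylOp (h : LocalChar Ψ ϖ) {θ : k} (hθ0 : θ ≠ 0) (hθ : ‖θ‖ ≤ 1)
    (π : A →⋆ₙₐ[ℂ] (H →L[ℂ] H)) (F : symbolSpace d A Ψ) (Φ : L2Space k d H) (Y : Phase k d) :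
    coeff Ψ θ (weylOp h hθ0 hθ π F Φ) Y = (((‖θ‖ ^ d)⁻¹ : ℝ) : ℂ) •
      ∫ X, π (wignerSymbol Ψ θ (F : LInfty k d A) X Y) (coeff Ψ θ Φ X) := by
  have hθ' : 0 < ‖θ‖ := norm_pos_iff.2 hθ0
  refine ext_inner_left ℂ fun v => ?_
  set g : Phase k d → H := fun Y =>
    ∫ X, π (wignerSymbol Ψ θ (F : LInfty k d A) X Y) (coeff Ψ θ Φ X) with hg
  rw [← inner_cohVec h θ Y v, inner_weylOp, inner_smul_right]
  have e1 : ∫ P : Phase k d × Phase k d, inner ℂ (coeff Ψ θ (cohVec h θ Y v) P.2)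
      (π (wignerSymbol Ψ θ (F : LInfty k d A) P.1 P.2) (coeff Ψ θ Φ P.1))
      = ∫ Y', inner ℂ (coeff Ψ θ (cohVec h θ Y v) Y') (g Y') := by
    refine (integral_prod_symm _ (integrable_weylForm h hθ0 hθ π F _ _)).trans ?_
    refine integral_congr_ae (ae_of_all _ fun Y' => ?_)
    dsimp only [hg]
    rw [← integral_inner (𝕜 := ℂ) (integrable_wignerSymbol_coeff h hθ0 hθ π F Φ Y')]
  have e2 : ∫ Y', inner ℂ (coeff Ψ θ (cohVec h θ Y v) Y') (g Y')
      = ∫ T, (box (d := d) Ψ 1 θ : Set (Phase k d)).indicator (fun _ => inner ℂ v (g Y)) T := by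
    rw [← integral_add_left_eq_self _ Y]
    refine integral_congr_ae (ae_of_all _ fun T => ?_)
    dsimp only
    by_cases hT : T ∈ box (d := d) Ψ 1 θ
    · obtain ⟨c, hc, hc'⟩ := coherent_add h hθ0 Y hT
      -- The second index of W_{X,Y} enters conjugated, so the kernel changes by the same phase as
      -- the coefficient of η_Y ⊗ v, and the two cancel in the inner product.
      have eg : g (Y + T) = conj c • g Y := by
        have ew : ∀ X, wignerSymbol Ψ θ (F : LInfty k d A) X (Y + T)
            = conj c • wignerSymbol Ψ θ (F : LInfty k d A) X Y := by
          intro X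
          unfold wignerSymbol
          rw [smul_comm (conj c), ← integral_smul (conj c)]
          congr 1
          refine integral_congr_ae (ae_of_all _ fun Z => ?_)
          dsimp only
          rw [smul_smul]
          congr 1
          unfold wigner
          rw [← integral_const_mul]
          refine integral_congr_ae (ae_of_all _ fun t => ?_)
          dsimp only
          rw [quantizer_apply h, quantizer_apply h, hc', smul_eq_mul, smul_eq_mul,
            map_mul (starRingEnd ℂ), map_mul (starRingEnd ℂ), map_mul (starRingEnd ℂ)]
          ring
        simp only [hg, ew, map_smul, smul_apply]
        exact integral_smul _ _
      rw [Set.indicator_of_mem hT, eg, coeff_add_box hc', coeff_cohVec,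
        integral_conj_coherent_mul_self, one_smul, inner_smul_left, inner_smul_right, ← mul_assoc,
        Complex.conj_conj, Complex.mul_conj, Complex.normSq_eq_norm_sq, hc]
      simp
    · rw [Set.indicator_of_notMem hT, coeff_cohVec,
        integral_conj_coherent_mul h hθ0 (by rwa [add_sub_cancel_left]), zero_smul, inner_zero_left]
  rw [e1, e2, integral_indicator ((isOpen_box h one_ne_zero hθ0).measurableSet),
    setIntegral_const, volume_real_box h, norm_one, one_mul, Complex.real_smul, ← mul_assoc,
    ← Complex.ofReal_mul]
  congr 2
  rw [two_mul, pow_add]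
  field_simp

end WeylOperator

/-! ### Adjoints, products and continuity. -/

section WeylHom

open Filter Topology

variable {k : Type*} [NontriviallyNormedField k] [IsUltrametricDist k] [ProperSpace k]
  [MeasureSpace k] [BorelSpace k] [(volume : Measure k).IsAddHaarMeasure]
  {d : ℕ} {Ψ : AddChar k Circle} {ϖ : k} {A : Type*} [NonUnitalCStarAlgebra A]
  {H : Type*} [NormedAddCommGroup H] [InnerProductSpace ℂ H] [CompleteSpace H]

theorem wignerSymbol_star (h : LocalChar Ψ ϖ) {θ : k} (hθ0 : θ ≠ 0) {F F' : LInfty k d A}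
    (hF : ∀ᵐ X, F' X = star (F X)) (X Y : Phase k d) :
    wignerSymbol Ψ θ F' X Y = star (wignerSymbol Ψ θ F Y X) := by
  unfold wignerSymbol
  rw [star_smul, ← starRingEnd_apply, Complex.conj_ofReal]
  congr 1
  have e := ((starL' ℝ (A := A)) : A →L[ℝ] A).integral_comp_comm
    (integrable_smul_LInfty (integrable_wigner h hθ0 Y X) F)
  refine Eq.trans ?_ e
  refine integral_congr_ae ?_
  filter_upwards [hF] with Z hZ
  rw [hZ]
  change _ = star (wigner Ψ θ Y X Z • F Z)
  rw [star_smul, ← starRingEnd_apply, wigner_conj h hθ0]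

/-- Exchanging the two variables of the double integral, the claim is that W_{X,Y}(F*) is the
adjoint of W_{Y,X}(F), which comes from `wigner_conj`. -/
theorem adjoint_weylOp (h : LocalChar Ψ ϖ) {θ : k} (hθ0 : θ ≠ 0) (hθ : ‖θ‖ ≤ 1)
    (π : A →⋆ₙₐ[ℂ] (H →L[ℂ] H)) {F F' : symbolSpace d A Ψ}
    (hF : ∀ᵐ X, (F' : LInfty k d A) X = star ((F : LInfty k d A) X)) :
    ContinuousLinearMap.adjoint (weylOp h hθ0 hθ π F) = weylOp h hθ0 hθ π F' := by
  refine ContinuousLinearMap.ext fun Φ₂ => ext_inner_left ℂ fun Φ₁ => ?_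
  rw [ContinuousLinearMap.adjoint_inner_right, ← inner_conj_symm, inner_weylOp, inner_weylOp,
    map_mul (starRingEnd ℂ), Complex.conj_ofReal, ← integral_conj]
  congr 1
  refine (integral_prod_swap (μ := (volume : Measure (Phase k d))) (ν := volume) _).symm.trans ?_
  refine integral_congr_ae (ae_of_all _ fun P => ?_)
  dsimp only [Prod.fst_swap, Prod.snd_swap]
  rw [wignerSymbol_star h hθ0 hF, map_star, ContinuousLinearMap.star_eq_adjoint,
    ContinuousLinearMap.adjoint_inner_right, inner_conj_symm]

theorem stronglyMeasurable_wignerSymbol_left (h : LocalChar Ψ ϖ) {θ : k} (hθ0 : θ ≠ 0)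
    (F : LInfty k d A) (Y : Phase k d) : StronglyMeasurable fun X => wignerSymbol Ψ θ F X Y :=
  StronglyMeasurable.comp_measurable (f := fun P : Phase k d × Phase k d =>
    wignerSymbol Ψ θ F P.1 P.2) (g := fun X => (X, Y)) (stronglyMeasurable_wignerSymbol h hθ0 F)
    measurable_prodMk_right

theorem stronglyMeasurable_wignerSymbol_right (h : LocalChar Ψ ϖ) {θ : k} (hθ0 : θ ≠ 0)
    (F : LInfty k d A) (X : Phase k d) : StronglyMeasurable fun Y => wignerSymbol Ψ θ F X Y :=
  StronglyMeasurable.comp_measurable (f := fun P : Phase k d × Phase k d =>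
    wignerSymbol Ψ θ F P.1 P.2) (g := fun Y => (X, Y)) (stronglyMeasurable_wignerSymbol h hθ0 F)
    measurable_prodMk_left

theorem integrable_wignerSymbol_wignerSymbol_coeff (h : LocalChar Ψ ϖ) {θ : k} (hθ0 : θ ≠ 0)
    (hθ : ‖θ‖ ≤ 1) (π : A →⋆ₙₐ[ℂ] (H →L[ℂ] H)) (F₁ F₂ : symbolSpace d A Ψ) (Φ : L2Space k d H)
    (Y : Phase k d) :
    Integrable (fun P : Phase k d × Phase k d =>
      π (wignerSymbol Ψ θ (F₁ : LInfty k d A) P.1 Y)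
        (π (wignerSymbol Ψ θ (F₂ : LInfty k d A) P.2 P.1) (coeff Ψ θ Φ P.2)))
      (volume.prod volume) := by
  obtain ⟨C₁, hC₁, hb₁⟩ := exists_norm_wignerSymbol_le h hθ0 hθ F₁
  obtain ⟨C₂, hC₂, hb₂⟩ := exists_norm_wignerSymbol_le h hθ0 hθ F₂
  have hdec := integrable_decay (d := d) h hθ0
  have m1 : StronglyMeasurable fun Z => wignerSymbol Ψ θ (F₁ : LInfty k d A) Z Y :=
    stronglyMeasurable_wignerSymbol_left h hθ0 _ Y
  have m2 := stronglyMeasurable_wignerSymbol h hθ0 (F₂ : LInfty k d A)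
  have hdY : Integrable fun Z => decay Ψ θ (2 * d + 1) (Y - Z) := hdec.comp_sub_left Y
  have j := ((integrable_mul_sub_snd hdec hdY).swap).const_mul (C₁ * C₂ * ‖Φ‖)
  refine j.mono' ?_ (ae_of_all _ fun P => ?_)
  · refine aestronglyMeasurable_rep_apply π (m1.comp_measurable
      measurable_fst).aestronglyMeasurable (aestronglyMeasurable_rep_apply π
      (m2.comp_measurable measurable_swap).aestronglyMeasurable ?_)
    exact (aestronglyMeasurable_coeff h θ (Lp.aestronglyMeasurable Φ)).comp_snd
  · have n1 := norm_rep_apply_le π (wignerSymbol Ψ θ (F₁ : LInfty k d A) P.1 Y)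
      (π (wignerSymbol Ψ θ (F₂ : LInfty k d A) P.2 P.1) (coeff Ψ θ Φ P.2))
    have n2 := norm_rep_apply_le π (wignerSymbol Ψ θ (F₂ : LInfty k d A) P.2 P.1)
      (coeff Ψ θ Φ P.2)
    have n3 := mul_le_mul (hb₂ P.2 P.1) (norm_coeff_le h θ Φ P.2) (norm_nonneg _)
      (mul_nonneg hC₂ (decay_nonneg _ _ _))
    refine n1.trans ((mul_le_mul (hb₁ P.1 Y) (n2.trans n3) (norm_nonneg _)
      (mul_nonneg hC₁ (decay_nonneg _ _ _))).trans_eq ?_)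
    simp only [Function.comp_apply, Prod.fst_swap, Prod.snd_swap]
    rw [← decay_neg θ _ (P.2 - P.1), neg_sub]
    ring

/-- Vectors are determined by their coefficients, on which the operators act by integral kernels.
Fubini reduces the claim to the composition of kernels, which is `integral_wignerSymbol_mul`. -/
theorem weylOp_comp (h : LocalChar Ψ ϖ) {θ : k} (hθ0 : θ ≠ 0) (hθ : ‖θ‖ ≤ 1)
    (π : A →⋆ₙₐ[ℂ] (H →L[ℂ] H)) {r : ℕ} (hr : ‖θ‖ = ‖ϖ‖ ^ r) {F₁ F₂ F₃ : symbolSpace d A Ψ}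
    (hF₃ : ((F₃ : LInfty k d A) : Phase k d → A)
      =ᵐ[volume] fun X => ∑' p, starBlk Ψ ϖ θ r F₁ F₂ p X) :
    weylOp h hθ0 hθ π F₁ ∘L weylOp h hθ0 hθ π F₂ = weylOp h hθ0 hθ π F₃ := by
  refine ContinuousLinearMap.ext fun Φ => coeff_injective h hθ0 fun Y => ?_
  rw [ContinuousLinearMap.comp_apply, coeff_weylOp, coeff_weylOp]
  congr 1
  obtain ⟨C₁, hC₁, hb₁⟩ := exists_norm_wignerSymbol_le h hθ0 hθ F₁
  obtain ⟨C₂, hC₂, hb₂⟩ := exists_norm_wignerSymbol_le h hθ0 hθ F₂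
  have hdec := integrable_decay (d := d) h hθ0
  have m1 : StronglyMeasurable fun Z => wignerSymbol Ψ θ (F₁ : LInfty k d A) Z Y :=
    stronglyMeasurable_wignerSymbol_left h hθ0 _ Y
  have m2 := stronglyMeasurable_wignerSymbol h hθ0 (F₂ : LInfty k d A)
  have hint := integrable_wignerSymbol_wignerSymbol_coeff h hθ0 hθ π F₁ F₂ Φ Y
  have e1 : ∀ Z, π (wignerSymbol Ψ θ (F₁ : LInfty k d A) Z Y)
      (coeff Ψ θ (weylOp h hθ0 hθ π F₂ Φ) Z) = (((‖θ‖ ^ d)⁻¹ : ℝ) : ℂ) •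
        ∫ X, π (wignerSymbol Ψ θ (F₁ : LInfty k d A) Z Y)
          (π (wignerSymbol Ψ θ (F₂ : LInfty k d A) X Z) (coeff Ψ θ Φ X)) := by
    intro Z
    rw [coeff_weylOp, map_smul, ContinuousLinearMap.integral_comp_comm _
      (integrable_wignerSymbol_coeff h hθ0 hθ π F₂ Φ Z)]
  simp_rw [e1]
  rw [integral_smul, integral_integral_swap hint, ← integral_smul]
  refine integral_congr_ae (ae_of_all _ fun X => ?_)
  dsimp only
  have hprod : Integrable fun Z => wignerSymbol Ψ θ (F₁ : LInfty k d A) Z Y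
      * wignerSymbol Ψ θ (F₂ : LInfty k d A) X Z := by
    refine ((hdec.comp_sub_left Y).const_mul (C₁ * C₂)).mono' (m1.aestronglyMeasurable.mul
      (stronglyMeasurable_wignerSymbol_right h hθ0 _ X).aestronglyMeasurable) (ae_of_all _ fun Z => ?_)
    refine (norm_mul_le _ _).trans ((mul_le_mul (hb₁ Z Y) ((hb₂ X Z).trans
      (mul_le_of_le_one_right hC₂ (decay_le_one _ _ _))) (norm_nonneg _)
      (mul_nonneg hC₁ (decay_nonneg _ _ _))).trans_eq ?_)
    ring
  rw [← integral_wignerSymbol_mul h hθ0 hr F₁.2 F₂.2 hF₃ X Y, map_smul, smul_apply,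
    ← integral_rep_apply π hprod]
  simp only [map_mul]
  rfl

/-- Continuity of `𝐖_θ^A`. -/
theorem continuous_weylMap (h : LocalChar Ψ ϖ) {θ : k} (hθ0 : θ ≠ 0) (hθ : ‖θ‖ ≤ 1)
    (π : A →⋆ₙₐ[ℂ] (H →L[ℂ] H)) :
    @Continuous _ _ (symbolTopology d A Ψ) _ (weylMap h hθ0 hθ π) := by
  have h1 : @Continuous _ _ (TopologicalSpace.induced
      (fun F : symbolSpace d A Ψ => powJ Ψ (2 * d + 1) (F : LInfty k d A)) inferInstance) _
      (weylMap h hθ0 hθ π) := by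
    letI : TopologicalSpace (symbolSpace d A Ψ) := TopologicalSpace.induced
      (fun F : symbolSpace d A Ψ => powJ Ψ (2 * d + 1) (F : LInfty k d A)) inferInstance
    have hc : Continuous fun F : symbolSpace d A Ψ => powJ Ψ (2 * d + 1) (F : LInfty k d A) :=
      continuous_induced_dom
    refine continuous_iff_continuousAt.2 fun F₀ => ?_
    rw [ContinuousAt, tendsto_iff_norm_sub_tendsto_zero]
    have h2 : Tendsto (fun F : symbolSpace d A Ψ =>
        (∫ X : Phase k d, (mu0 Ψ X ^ (2 * d + 1))⁻¹) *
          ‖powJ Ψ (2 * d + 1) (F : LInfty k d A) - powJ Ψ (2 * d + 1) (F₀ : LInfty k d A)‖)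
        (𝓝 F₀) (𝓝 0) := by
      have := (tendsto_iff_norm_sub_tendsto_zero.1 (hc.tendsto F₀)).const_mul
        (∫ X : Phase k d, (mu0 Ψ X ^ (2 * d + 1))⁻¹)
      rwa [mul_zero] at this
    refine squeeze_zero (fun _ => norm_nonneg _) (fun F => ?_) h2
    rw [← map_sub]
    refine (norm_weylOp_le h hθ0 hθ π (F - F₀)).trans_eq ?_
    rw [seminormP, Submodule.coe_sub, powJ_sub h F.2 F₀.2]
  -- The topology of all seminorms is finer than that of 𝔓_{2d+1} alone, and the latter already
  -- controls the operator norm.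
  exact continuous_iff_le_induced.2 ((iInf_le _ (2 * d + 1)).trans
    (continuous_iff_le_induced.1 h1))

end WeylHom

/-! ### Agreement with the quantization of integrable symbols. -/

section Quantization

open Filter Topology

variable {k : Type*} [NontriviallyNormedField k] [IsUltrametricDist k] [ProperSpace k]
  [MeasureSpace k] [BorelSpace k] [(volume : Measure k).IsAddHaarMeasure]
  {d : ℕ} {Ψ : AddChar k Circle} {ϖ : k} {A : Type*} [NonUnitalCStarAlgebra A]
  {H : Type*} [NormedAddCommGroup H] [InnerProductSpace ℂ H] [CompleteSpace H]

theorem memLp_quantizer (h : LocalChar Ψ ϖ) (θ : k) (Z : Phase k d) {f : (Fin d → k) → H}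
    (hf : MemLp f 2) : MemLp (quantizer Ψ θ Z f) 2 := by
  have h1 : MemLp (fun t => f ((2 : k) • Z.1 - t)) 2 :=
    hf.comp_measurePreserving (Measure.measurePreserving_sub_left volume _)
  have hc : Continuous fun t : Fin d → k => (Ψ (θ⁻¹ * (2 * (Z.2 ⬝ᵥ (t - Z.1)))) : ℂ) := by
    refine continuous_subtype_val.comp (h.cont.comp ?_)
    unfold dotProduct
    fun_prop
  have e : quantizer Ψ θ Z f = fun t => (Ψ (θ⁻¹ * (2 * (Z.2 ⬝ᵥ (t - Z.1)))) : ℂ) •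
      f ((2 : k) • Z.1 - t) := funext fun t => quantizer_apply h θ Z f t
  rw [e]
  refine h1.of_le (hc.aestronglyMeasurable.smul h1.aestronglyMeasurable) (ae_of_all _ fun t => ?_)
  rw [norm_smul, norm_char, one_mul]

theorem integral_norm_coeff_quantizer_sq (h : LocalChar Ψ ϖ) {θ : k} (hθ0 : θ ≠ 0) (Z : Phase k d)
    (Φ : L2Space k d H) :
    ∫ Y, ‖coeff Ψ θ (quantizer Ψ θ Z Φ) Y‖ ^ 2 = ‖θ‖ ^ d * ‖Φ‖ ^ 2 := by
  rw [integral_norm_coeff_sq_of_memLp h hθ0 (memLp_quantizer h θ Z (Lp.memLp Φ))]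
  simp_rw [quantizer_apply h, norm_smul, norm_char, one_mul]
  rw [integral_sub_left_eq_self (fun t => ‖Φ t‖ ^ 2) volume, integral_norm_sq]

theorem wigner_eq_conj_coeff (X Y Z : Phase k d) (θ : k) :
    wigner Ψ θ X Y Z = conj (coeff Ψ θ (quantizer Ψ θ Z (coherent Ψ θ Y)) X) := by
  unfold wigner coeff
  rw [← integral_conj]
  refine integral_congr_ae (ae_of_all _ fun t => ?_)
  dsimp only
  rw [smul_eq_mul, map_mul (starRingEnd ℂ), Complex.conj_conj]

theorem integrable_wigner_left (h : LocalChar Ψ ϖ) {θ : k} (hθ0 : θ ≠ 0) (Y Z : Phase k d) :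
    Integrable (fun X => wigner Ψ θ X Y Z) ∧ ∫ X, ‖wigner Ψ θ X Y Z‖ = ‖θ‖ ^ d := by
  have hbox := (isOpen_box (d := d) h one_ne_zero hθ0).measurableSet
  have hi : Integrable ((box (d := d) Ψ 1 θ : Set (Phase k d)).indicator (fun _ => (1 : ℝ))) := by
    refine (integrable_indicator_iff hbox).2 (integrableOn_const ?_)
    rw [volume_box h]
    exact ENNReal.ofReal_ne_top
  have hm : Measurable fun X => wigner Ψ θ X Y Z :=
    (measurable_wigner h hθ0).comp (g := fun P : (Phase k d × Phase k d) × Phase k d =>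
      wigner Ψ θ P.1.1 P.1.2 P.2) (f := fun X => ((X, Y), Z)) (by fun_prop)
  have e : ∀ X, ‖wigner Ψ θ X Y Z‖ = (box (d := d) Ψ 1 θ : Set (Phase k d)).indicator
      (fun _ => (1 : ℝ)) (X + (Y - (2 : k) • Z)) := fun X => by
    rw [norm_wigner h hθ0, add_sub_assoc]
  refine ⟨(hi.comp_add_right (Y - (2 : k) • Z)).mono' hm.aestronglyMeasurable
    (ae_of_all _ fun X => (e X).le), ?_⟩
  simp_rw [e]
  rw [integral_add_right_eq_self (μ := (volume : Measure (Phase k d)))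
    ((box (d := d) Ψ 1 θ : Set (Phase k d)).indicator (fun _ => (1 : ℝ))),
    integral_indicator hbox, setIntegral_const, volume_real_box h]
  simp

theorem integrable_wigner_smul_coeff (h : LocalChar Ψ ϖ) {θ : k} (hθ0 : θ ≠ 0) (Y Z : Phase k d)
    (Φ : L2Space k d H) : Integrable fun X => wigner Ψ θ X Y Z • coeff Ψ θ Φ X :=
  (integrable_wigner_left h hθ0 Y Z).1.smul_bdd ‖Φ‖
    (aestronglyMeasurable_coeff h θ (Lp.aestronglyMeasurable Φ))
    (ae_of_all _ fun X => norm_coeff_le h θ Φ X)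

/-- W_{X,Y}(Z) is the conjugate of the coefficient at X of Ω(Z)η_Y. Parseval thus gives
|θ|^d⟨Ω(Z)η_Y, Φ⟩, and the substitution t ↦ 2Z − t moves Ω(Z) to Φ. -/
theorem integral_wigner_smul_coeff (h : LocalChar Ψ ϖ) {θ : k} (hθ0 : θ ≠ 0) (Y Z : Phase k d)
    (Φ : L2Space k d H) :
    ∫ X, wigner Ψ θ X Y Z • coeff Ψ θ Φ X
      = ((‖θ‖ ^ d : ℝ) : ℂ) • coeff Ψ θ (quantizer Ψ θ Z Φ) Y := by
  refine ext_inner_left ℂ fun v => ?_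
  have hq := memLp_quantizer h θ Z (memLp_coherent h θ Y)
  have hqv : MemLp (fun t => quantizer Ψ θ Z (coherent Ψ θ Y) t • v) 2 :=
    (ContinuousLinearMap.toSpanSingleton ℂ v).comp_memLp' hq
  rw [← integral_inner (integrable_wigner_smul_coeff h hθ0 Y Z Φ), inner_smul_right]
  have e1 : ∀ X, inner ℂ v (wigner Ψ θ X Y Z • coeff Ψ θ Φ X)
      = inner ℂ (coeff Ψ θ (fun t => quantizer Ψ θ Z (coherent Ψ θ Y) t • v) X)
        (coeff Ψ θ Φ X) := by
    intro X
    have : coeff Ψ θ (fun t => quantizer Ψ θ Z (coherent Ψ θ Y) t • v) X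
        = coeff Ψ θ (quantizer Ψ θ Z (coherent Ψ θ Y)) X • v := by
      unfold coeff
      rw [← integral_smul_const]
      simp only [smul_smul, smul_eq_mul]
    rw [this, inner_smul_left, inner_smul_right, wigner_eq_conj_coeff]
  simp_rw [e1]
  rw [(parseval h hθ0 hqv (Lp.memLp Φ)).2]
  congr 1
  rw [coeff, ← integral_inner (integrable_coherent_smul h θ Y (memLp_quantizer h θ Z (Lp.memLp Φ))),
    ← integral_sub_left_eq_self _ volume ((2 : k) • Z.1)]
  refine integral_congr_ae (ae_of_all _ fun s => ?_)
  dsimp only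
  rw [quantizer_apply h, quantizer_apply h, sub_sub_cancel, inner_smul_left, inner_smul_right,
    inner_smul_right, smul_eq_mul, map_mul (starRingEnd ℂ), conj_char]
  have e2 : (2 : k) • Z.1 - s - Z.1 = -(s - Z.1) := by
    rw [two_smul]
    abel
  rw [e2, dotProduct_neg, mul_neg, mul_neg, neg_neg]
  ring

theorem aestronglyMeasurable_coeff_quantizer (h : LocalChar Ψ ϖ) {θ : k} (hθ0 : θ ≠ 0)
    (Φ : L2Space k d H) :
    AEStronglyMeasurable (fun P : Phase k d × Phase k d => coeff Ψ θ (quantizer Ψ θ P.1 Φ) P.2)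
      (volume.prod volume) := by
  have e : ∀ P : Phase k d × Phase k d, coeff Ψ θ (quantizer Ψ θ P.1 Φ) P.2
      = (((‖θ‖ ^ d)⁻¹ : ℝ) : ℂ) • ∫ X, wigner Ψ θ X P.2 P.1 • coeff Ψ θ Φ X := fun P => by
    rw [integral_wigner_smul_coeff h hθ0, smul_smul, ← Complex.ofReal_mul,
      inv_mul_cancel₀ (pow_pos (norm_pos_iff.2 hθ0) d).ne', Complex.ofReal_one, one_smul]
  simp_rw [e]
  refine AEStronglyMeasurable.const_smul ?_ _
  have hm : Measurable fun Q : (Phase k d × Phase k d) × Phase k d =>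
      wigner Ψ θ Q.2 Q.1.2 Q.1.1 :=
    (measurable_wigner h hθ0).comp (g := fun P : (Phase k d × Phase k d) × Phase k d =>
      wigner Ψ θ P.1.1 P.1.2 P.2) (f := fun Q : (Phase k d × Phase k d) × Phase k d =>
        ((Q.2, Q.1.2), Q.1.1)) (by fun_prop)
  exact AEStronglyMeasurable.integral_prod_right' (f := fun Q : (Phase k d × Phase k d) × Phase k d =>
    wigner Ψ θ Q.2 Q.1.2 Q.1.1 • coeff Ψ θ Φ Q.2) (hm.aestronglyMeasurable.smul
      (aestronglyMeasurable_coeff h θ (Lp.aestronglyMeasurable Φ)).comp_snd)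

/-- Boundedness of I^{2d+1}f suffices, since μ₀^{−2d−1} is integrable. -/
theorem IsSchwartzSymbol.integrable (h : LocalChar Ψ ϖ) {f : LInfty k d A}
    (hf : IsSchwartzSymbol Ψ f) : Integrable f := by
  have h1 := hf.2 (2 * d + 1) 0
  rw [powJ_zero h hf.1] at h1
  have h2 : Integrable fun X : Phase k d => (((mu0 Ψ X ^ (2 * d + 1))⁻¹ : ℝ) : ℂ) :=
    (integrable_mu0_inv h).ofReal
  refine (memLp_one_iff_integrable.1 (MemLp.smul (r := 1) h1
    (memLp_one_iff_integrable.2 h2))).congr (ae_of_all _ fun X => ?_)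
  have h3 := (pow_pos (mu0_pos (Ψ := Ψ) X) (2 * d + 1)).ne'
  rw [Pi.smul_apply', smul_smul, ← Complex.ofReal_mul, inv_mul_cancel₀ h3, Complex.ofReal_one,
    one_smul]

theorem integrable_rep_coeff_quantizer (h : LocalChar Ψ ϖ) {θ : k} (hθ0 : θ ≠ 0)
    (π : A →⋆ₙₐ[ℂ] (H →L[ℂ] H)) {f : Phase k d → A} (hf : Integrable f) (Φ₁ Φ₂ : L2Space k d H) :
    Integrable (fun P : Phase k d × Phase k d => inner ℂ (coeff Ψ θ Φ₁ P.2)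
      (π (f P.1) (coeff Ψ θ (quantizer Ψ θ P.1 Φ₂) P.2))) (volume.prod volume) := by
  have p1 := (parseval h hθ0 (Lp.memLp Φ₁) (Lp.memLp Φ₁)).1
  have m := aestronglyMeasurable_coeff_quantizer h hθ0 Φ₂
  have j1 : Integrable (fun P : Phase k d × Phase k d => ‖f P.1‖ * ‖coeff Ψ θ Φ₁ P.2‖ ^ 2)
    (volume.prod volume) := hf.norm.mul_prod p1
  have j2 : Integrable (fun P : Phase k d × Phase k d =>
      ‖f P.1‖ * ‖coeff Ψ θ (quantizer Ψ θ P.1 Φ₂) P.2‖ ^ 2) (volume.prod volume) := by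
    have hm2 : AEStronglyMeasurable (fun P : Phase k d × Phase k d =>
        ‖f P.1‖ * ‖coeff Ψ θ (quantizer Ψ θ P.1 Φ₂) P.2‖ ^ 2) (volume.prod volume) :=
      hf.aestronglyMeasurable.comp_fst.norm.mul (m.norm.pow 2)
    refine (integrable_prod_iff hm2).2
      ⟨ae_of_all _ fun Z => ?_, ?_⟩
    · have hq := memLp_quantizer h θ Z (Lp.memLp Φ₂)
      exact (parseval h hθ0 hq hq).1.const_mul ‖f Z‖
    · have e : ∀ Z, ∫ Y, ‖‖f Z‖ * ‖coeff Ψ θ (quantizer Ψ θ Z Φ₂) Y‖ ^ 2‖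
          = ‖f Z‖ * (‖θ‖ ^ d * ‖Φ₂‖ ^ 2) := fun Z => by
        simp_rw [norm_mul, norm_pow, norm_norm]
        rw [integral_const_mul, integral_norm_coeff_quantizer_sq h hθ0]
      simp_rw [e]
      exact hf.norm.mul_const _
  refine (j1.add j2).mono' ?_ (ae_of_all _ fun P => ?_)
  · exact (aestronglyMeasurable_coeff h θ (Lp.aestronglyMeasurable Φ₁)).comp_snd.inner
      (aestronglyMeasurable_rep_apply π hf.aestronglyMeasurable.comp_fst m)
  · refine (norm_inner_le_norm _ _).trans ((mul_le_mul_of_nonneg_left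
      (norm_rep_apply_le π _ _) (norm_nonneg _)).trans ?_)
    simp only [Pi.add_apply]
    have h0 := norm_nonneg (f P.1)
    nlinarith [mul_nonneg h0 (sq_nonneg (‖coeff Ψ θ Φ₁ P.2‖
      - ‖coeff Ψ θ (quantizer Ψ θ P.1 Φ₂) P.2‖)), mul_nonneg h0 (sq_nonneg (‖coeff Ψ θ Φ₁ P.2‖)),
      mul_nonneg h0 (sq_nonneg (‖coeff Ψ θ (quantizer Ψ θ P.1 Φ₂) P.2‖))]

/-- Expanding the coefficient of Ω(Z)Φ over the coherent states and integrating over Z first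
rebuilds the kernel W_{X,Y}(f). Integrability of f allows Fubini here, as it does not for a general
symbol. -/
theorem integral_rep_coeff_quantizer (h : LocalChar Ψ ϖ) {θ : k} (hθ0 : θ ≠ 0) (hθ : ‖θ‖ ≤ 1)
    (π : A →⋆ₙₐ[ℂ] (H →L[ℂ] H)) (f : symbolSpace d A Ψ) (hf : Integrable (f : LInfty k d A))
    (Φ : L2Space k d H) (Y : Phase k d) :
    Integrable (fun Z => π ((f : LInfty k d A) Z) (coeff Ψ θ (quantizer Ψ θ Z Φ) Y)) ∧
    ((‖2 / θ‖ ^ d : ℝ) : ℂ) •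
        ∫ Z, π ((f : LInfty k d A) Z) (coeff Ψ θ (quantizer Ψ θ Z Φ) Y)
      = coeff Ψ θ (weylOp h hθ0 hθ π f Φ) Y := by
  have e : ∀ Z, coeff Ψ θ (quantizer Ψ θ Z Φ) Y
      = (((‖θ‖ ^ d)⁻¹ : ℝ) : ℂ) • ∫ X, wigner Ψ θ X Y Z • coeff Ψ θ Φ X := fun Z => by
    rw [integral_wigner_smul_coeff h hθ0, smul_smul, ← Complex.ofReal_mul,
      inv_mul_cancel₀ (pow_pos (norm_pos_iff.2 hθ0) d).ne', Complex.ofReal_one, one_smul]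
  have hb := aestronglyMeasurable_coeff h θ (Lp.aestronglyMeasurable Φ)
  have hm : Measurable fun P : Phase k d × Phase k d => wigner Ψ θ P.2 Y P.1 :=
    (measurable_wigner h hθ0).comp (g := fun P : (Phase k d × Phase k d) × Phase k d =>
      wigner Ψ θ P.1.1 P.1.2 P.2) (f := fun P : Phase k d × Phase k d => ((P.2, Y), P.1))
      (by fun_prop)
  have j : Integrable (fun P : Phase k d × Phase k d => ‖(f : LInfty k d A) P.1‖ *
      ‖wigner Ψ θ P.2 Y P.1‖) (volume.prod volume) := by
    have hm2 : AEStronglyMeasurable (fun P : Phase k d × Phase k d =>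
        ‖(f : LInfty k d A) P.1‖ * ‖wigner Ψ θ P.2 Y P.1‖) (volume.prod volume) :=
      hf.aestronglyMeasurable.comp_fst.norm.mul hm.aestronglyMeasurable.norm
    refine (integrable_prod_iff hm2).2 ⟨ae_of_all _ fun Z => ?_, ?_⟩
    · exact (integrable_wigner_left h hθ0 Y Z).1.norm.const_mul ‖(f : LInfty k d A) Z‖
    · have e : ∀ Z, ∫ X, ‖‖(f : LInfty k d A) Z‖ * ‖wigner Ψ θ X Y Z‖‖
          = ‖(f : LInfty k d A) Z‖ * ‖θ‖ ^ d := fun Z => by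
        simp_rw [norm_mul, norm_norm]
        rw [integral_const_mul, (integrable_wigner_left h hθ0 Y Z).2]
      simp_rw [e]
      exact hf.norm.mul_const _
  have hint : Integrable (fun P : Phase k d × Phase k d =>
      π (wigner Ψ θ P.2 Y P.1 • (f : LInfty k d A) P.1) (coeff Ψ θ Φ P.2))
      (volume.prod volume) := by
    refine (j.mul_const ‖Φ‖).mono' (aestronglyMeasurable_rep_apply π
      (hm.aestronglyMeasurable.smul hf.aestronglyMeasurable.comp_fst) hb.comp_snd)
      (ae_of_all _ fun P => ?_)
    refine (norm_rep_apply_le π _ _).trans ?_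
    rw [norm_smul, mul_comm ‖wigner Ψ θ P.2 Y P.1‖]
    exact mul_le_mul_of_nonneg_left (norm_coeff_le h θ Φ P.2) (by positivity)
  have e1 : ∀ Z, π ((f : LInfty k d A) Z) (coeff Ψ θ (quantizer Ψ θ Z Φ) Y)
      = (((‖θ‖ ^ d)⁻¹ : ℝ) : ℂ) •
        ∫ X, π (wigner Ψ θ X Y Z • (f : LInfty k d A) Z) (coeff Ψ θ Φ X) := fun Z => by
    rw [e, map_smul, ← ContinuousLinearMap.integral_comp_comm _
      (integrable_wigner_smul_coeff h hθ0 Y Z Φ)]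
    simp only [map_smul, smul_apply]
  simp_rw [e1]
  refine ⟨hint.integral_prod_left.smul _, ?_⟩
  rw [integral_smul, integral_integral_swap hint, coeff_weylOp, smul_comm, ← integral_smul]
  congr 1
  refine integral_congr_ae (ae_of_all _ fun X => ?_)
  dsimp only
  rw [integral_rep_apply π (integrable_wigner_smul h hθ0 _ X Y), wignerSymbol, map_smul, smul_apply]

/-- Parseval converts each pairing over t into one of coefficients; after Fubini in Z and Y, the
previous lemma identifies the inner integral with the coefficients of W(f)Φ₂. -/
theorem isQuantization_weylOp (h : LocalChar Ψ ϖ) {θ : k} (hθ0 : θ ≠ 0) (hθ : ‖θ‖ ≤ 1)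
    (π : A →⋆ₙₐ[ℂ] (H →L[ℂ] H)) (f : symbolSpace d A Ψ) (hf : Integrable (f : LInfty k d A)) :
    IsQuantization Ψ θ π (f : LInfty k d A) (weylOp h hθ0 hθ π f) := by
  intro Φ₁ Φ₂
  have hθ' : 0 < ‖θ‖ ^ d := pow_pos (norm_pos_iff.2 hθ0) d
  have hint := integrable_rep_coeff_quantizer h hθ0 π hf Φ₁ Φ₂
  have e1 : ∀ Z, ∫ t, inner ℂ (Φ₁ t) (((‖2 / θ‖ ^ d : ℝ) : ℂ) •
      π ((f : LInfty k d A) Z) (quantizer Ψ θ Z Φ₂ t))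
      = (((‖θ‖ ^ d)⁻¹ : ℝ) : ℂ) * (((‖2 / θ‖ ^ d : ℝ) : ℂ) *
        ∫ Y, inner ℂ (coeff Ψ θ Φ₁ Y)
          (π ((f : LInfty k d A) Z) (coeff Ψ θ (quantizer Ψ θ Z Φ₂) Y))) := by
    intro Z
    have hq := memLp_quantizer h θ Z (Lp.memLp Φ₂)
    have hπq : MemLp (fun t => π ((f : LInfty k d A) Z) (quantizer Ψ θ Z Φ₂ t)) 2 :=
      (π ((f : LInfty k d A) Z)).comp_memLp' hq
    have e := (parseval h hθ0 (Lp.memLp Φ₁) hπq).2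
    simp_rw [coeff_clm h θ _ hq] at e
    rw [e]
    simp only [inner_smul_right]
    rw [integral_const_mul, mul_left_comm, ← mul_assoc (((‖θ‖ ^ d)⁻¹ : ℝ) : ℂ),
      ← Complex.ofReal_mul, inv_mul_cancel₀ hθ'.ne', Complex.ofReal_one, one_mul]
  simp_rw [e1]
  have i1 : Integrable fun Z => ∫ Y, inner ℂ (coeff Ψ θ Φ₁ Y)
      (π ((f : LInfty k d A) Z) (coeff Ψ θ (quantizer Ψ θ Z Φ₂) Y)) := hint.integral_prod_left
  refine ⟨(i1.const_mul _).const_mul _, ?_⟩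
  have e2 : ∀ Y, inner ℂ (coeff Ψ θ Φ₁ Y) (coeff Ψ θ (weylOp h hθ0 hθ π f Φ₂) Y)
      = ((‖2 / θ‖ ^ d : ℝ) : ℂ) * ∫ Z, inner ℂ (coeff Ψ θ Φ₁ Y)
          (π ((f : LInfty k d A) Z) (coeff Ψ θ (quantizer Ψ θ Z Φ₂) Y)) := by
    intro Y
    obtain ⟨i2, e3⟩ := integral_rep_coeff_quantizer h hθ0 hθ π f hf Φ₂ Y
    rw [← e3, inner_smul_right, integral_inner i2]
  rw [integral_const_mul, integral_const_mul, integral_integral_swap hint,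
    inner_eq_integral_coeff h hθ0]
  simp_rw [e2]
  rw [integral_const_mul]

end Quantization

end PadicWeyl

end

theorem mainTheorem3 {k : Type*} [NontriviallyNormedField k] [IsUltrametricDist k]
    [LocallyCompactSpace k] [MeasureSpace k] [BorelSpace k]
    [(volume : Measure k).IsAddHaarMeasure]
    (hchar : (2 : k) ≠ 0)
    (hmod : ∀ (a : k) (s : Set k),
      volume ((fun x => a * x) '' s) = ENNReal.ofReal ‖a‖ * volume s)
    (Ψ : AddChar k Circle) (hΨcont : Continuous Ψ) (hΨ : Ψ ≠ 1)
    (hdual : volume (Metric.closedBall (0 : k) 1) * volume (PadicWeyl.conductor Ψ) = 1)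
    (d : ℕ) {A : Type*} [NonUnitalCStarAlgebra A]
    {H : Type*} [NormedAddCommGroup H] [InnerProductSpace ℂ H] [CompleteSpace H]
    (π : A →⋆ₙₐ[ℂ] (H →L[ℂ] H)) (hπ : Function.Injective π)
    (θ : k) (hθ0 : θ ≠ 0) (hθ : ‖θ‖ ≤ 1) :
    Integrable (fun X : PadicWeyl.Phase k d => (PadicWeyl.mu0 Ψ X ^ (2 * d + 1))⁻¹) ∧
    ∃ W : PadicWeyl.symbolSpace d A Ψ →ₗ[ℂ]
        (PadicWeyl.L2Space k d H →L[ℂ] PadicWeyl.L2Space k d H),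
      (∀ F : PadicWeyl.symbolSpace d A Ψ, PadicWeyl.IsWeylOp Ψ θ π (F : PadicWeyl.LInfty k d A) (W F)) ∧
      (∀ F : PadicWeyl.symbolSpace d A Ψ, ‖W F‖ ≤ (∫ X : PadicWeyl.Phase k d, (PadicWeyl.mu0 Ψ X ^ (2 * d + 1))⁻¹) *
        PadicWeyl.seminormP Ψ (2 * d + 1) (F : PadicWeyl.LInfty k d A)) ∧
      (∀ F : PadicWeyl.symbolSpace d A Ψ, ∃ F' : PadicWeyl.symbolSpace d A Ψ,
        (∀ᵐ X, (F' : PadicWeyl.LInfty k d A) X = star ((F : PadicWeyl.LInfty k d A) X)) ∧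
        ContinuousLinearMap.adjoint (W F) = W F') ∧
      (∀ F₁ F₂ : PadicWeyl.symbolSpace d A Ψ, ∃ F₃ : PadicWeyl.symbolSpace d A Ψ,
        (∀ᵐ X, (F₃ : PadicWeyl.LInfty k d A) X = PadicWeyl.starProd Ψ θ F₁ F₂ X) ∧
        W F₁ ∘L W F₂ = W F₃) ∧
      @Continuous _ _ (PadicWeyl.symbolTopology d A Ψ) _ W ∧
      (∀ f : PadicWeyl.symbolSpace d A Ψ,
        PadicWeyl.IsSchwartzSymbol Ψ (f : PadicWeyl.LInfty k d A) →
          Integrable (f : PadicWeyl.LInfty k d A) ∧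
          PadicWeyl.IsQuantization Ψ θ π (f : PadicWeyl.LInfty k d A) (W f)) := by
  haveI : ProperSpace k := .of_locallyCompactSpace k
  obtain ⟨ϖ, h⟩ := PadicWeyl.exists_localChar hchar hmod Ψ hΨcont hΨ hdual
  obtain ⟨r, hr⟩ := PadicWeyl.exists_norm_eq_pow h hθ0 hθ
  refine ⟨PadicWeyl.integrable_mu0_inv h, PadicWeyl.weylMap h hθ0 hθ π,
    PadicWeyl.isWeylOp_weylOp h hθ0 hθ π, PadicWeyl.norm_weylOp_le h hθ0 hθ π, fun F => ?_,
    fun F₁ F₂ => ?_, PadicWeyl.continuous_weylMap h hθ0 hθ π, fun f hf => ?_⟩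
  · obtain ⟨F', hF', hstar⟩ := PadicWeyl.exists_star h F.2
    exact ⟨⟨F', hF'⟩, hstar, PadicWeyl.adjoint_weylOp h hθ0 hθ π hstar⟩
  -- The symbol of the product is built as the sum of block products, which is the form in which it
  -- is composed; only then is it identified with the integral defining the deformed product.
  · obtain ⟨F₃, hF₃, hprod⟩ := PadicWeyl.exists_symbol_tsum_starBlk h θ r F₁.2 F₂.2
    refine ⟨⟨F₃, hF₃⟩, ?_, PadicWeyl.weylOp_comp h hθ0 hθ π hr hprod⟩
    filter_upwards [hprod] with X hX
    exact hX.trans (PadicWeyl.starProd_eq_tsum h hθ0 hr F₁.2 F₂.2 X).symm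
  · have hint := hf.integrable h
    exact ⟨hint, PadicWeyl.isQuantization_weylOp h hθ0 hθ π f hint⟩
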